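/- Let $K$ be an algebraically closed field of characteristic $0$. Let $\Phi,\Psi:\mathbb P^2\dashrightarrow\mathbb P^2$ be the birational maps over $K$ given by $$\Phi[x,y,z]=\big[\,9x^5-10x^3y^2+xy^4+10x^3yz-2xy^3z,\;\; 9x^4y-10x^2y^3+y^5+9x^4z-y^4z,\;\; 9x^4z-10x^2y^2z+y^4z\,\big],$$ $$\Psi[x,y,z]=\big[\,9x^5-10x^3y^2+xy^4-10x^3yz+2xy^3z,\;\; 9x^4y-10x^2y^3+y^5-9x^4z+y^4z,\;\; 9x^4z-10x^2y^2z+y^4z\,\big].$$ Put $p=[0,0,1]$, $p'=[0,1,1]$, $p''=[0,-1,1]$, $p_1=[1,1,0]$, $p_2=[1,-1,0]$, $p_3=[1,3,0]$, $p_4=[1,-3,0]$, and $R=\{p,p',p'',p_1,p_2,p_3,p_4\}$. On the exceptional curve over $p_i$ in $\mathrm{Bl}_R\mathbb P^2$ let $p_i'$ (resp. $p_i''$) be the point given by the tangent direction at $p_i$ of the $i$-th of the lines $2x-2y+z=0$, $2x+2y-z=0$, $6x-2y+z=0$, $6x+2y-z=0$ (resp. $2x-2y-z=0$, $2x+2y+z=0$,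 $6x-2y-z=0$, $6x+2y+z=0$), and let $R'=\{p_1',\dots,p_4',p_1'',\dots,p_4''\}$. Let $S=\mathrm{Bl}_{R'}\mathrm{Bl}_R\mathbb P^2$ and let $\widetilde\Phi,\widetilde\Psi:S\dashrightarrow S$ be the lifts of $\Phi,\Psi$. Let $N^1(S)$ be the group of divisors on $S$ modulo numerical equivalence, tensored with $\mathbb R$. A birational map $f:S\dashrightarrow S$ acts on $N^1(S)$ by $f^*$ and by $f_*=(f^{-1})^*$, and $f$ is called algebraically stable if $(f^n)^*=(f^*)^n$ on $N^1(S)$ for all integers $n\ge 0$. Let $\mathrm{Ind}(f)$ be the set of points at which $f$ is not defined. Then: 1. $\widetilde\Psi\circ\widetilde\Phi$ is algebraically stable on $S$. 2. If $\widetilde\Phi$ contracts a curve $C\subset S$ to a point, then that point is not in $\mathrm{Ind}(\widetilde\Psi)$; moreover $(\widetilde\Psi\circ\widetilde\Phi)_*=\widetilde\Psi_*\circ\widetilde\Phi_*$ on $N^1(S)$. 3. Let $h$ be the class of the pull-back of a line and let $e_a$ be the class of the strict transform of the exceptional curve over the blown-up point $a$. Then $$h,\ e_p,\ e_{p_1},\dots,e_{p_4},\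 e_{p'},\ e_{p_1'},\dots,e_{p_4'},\ e_{p''},\ e_{p_1''},\dots,e_{p_4''}$$ is a basis of $N^1(S)$. In this ordered basis $\widetilde\Phi_*$ and $\widetilde\Psi_*$ are represented by the $16\times16$ matrices $M_\Phi$ and $M_\Psi$ whose columns are given by (sums over $j=1,\dots,4$; $i=1,\dots,4$) $$\begin{aligned} M_\Phi:\quad & h\mapsto 5h-4e_{p'}-\textstyle\sum_j(e_{p_j}+2e_{p_j'}+e_{p_j''}), & e_p&\mapsto 4h-3e_{p'}-\textstyle\sum_j(e_{p_j}+2e_{p_j'}+e_{p_j''}),\\ & e_{p_i}\mapsto e_{p_i}+e_{p_i''},\quad e_{p'}\mapsto e_p, & e_{p_i'}&\mapsto h-e_{p'}-e_{p_i}-e_{p_i'}-e_{p_i''},\quad e_{p''}\mapsto 0,\quad e_{p_i''}\mapsto 0,\\ M_\Psi:\quad & h\mapsto 5h-4e_{p''}-\textstyle\sum_j(e_{p_j}+e_{p_j'}+2e_{p_j''}), & e_p&\mapsto 4h-3e_{p''}-\textstyle\sum_j(e_{p_j}+e_{p_j'}+2e_{p_j''}),\\ & e_{p_i}\mapsto e_{p_i}+e_{p_i'},\quad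 e_{p''}\mapsto e_p, & e_{p_i''}&\mapsto h-e_{p''}-e_{p_i}-e_{p_i'}-e_{p_i''},\quad e_{p'}\mapsto 0,\quad e_{p_i'}\mapsto 0, \end{aligned}$$ and consequently $(\widetilde\Psi\circ\widetilde\Phi)_*$ is represented by the product $M_\Psi M_\Phi$. -/

import Mathlib

noncomputable section

open scoped TensorProduct

/-! ## The function field of the plane and birational self-maps -/

/-- The function field `K(x, y)` of the projective plane over `K`. -/
abbrev FunField (K : Type*) [Field K] : Type _ := FractionRing (MvPolynomial (Fin 2) K)

namespace FunField

/-- The affine coordinate `x = X₀ / X₂` of the plane with homogeneous coordinates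
`[X₀, X₁, X₂]`. -/
def x (K : Type*) [Field K] : FunField K :=
  algebraMap (MvPolynomial (Fin 2) K) (FunField K) (MvPolynomial.X 0)

/-- The affine coordinate `y = X₁ / X₂`. -/
def y (K : Type*) [Field K] : FunField K :=
  algebraMap (MvPolynomial (Fin 2) K) (FunField K) (MvPolynomial.X 1)

/-- The rational function `P(x, y, 1)` attached to a form `P` in three variables. -/
def dehom {K : Type*} [Field K] (P : MvPolynomial (Fin 3) K) : FunField K :=
  MvPolynomial.aeval ![x K, y K, 1] P

theorem adjoin_xy (K : Type*) [Field K] :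
    IntermediateField.adjoin K {x K, y K} = (⊤ : IntermediateField K (FunField K)) := by
  rw [eq_top_iff]
  intro z _
  have hpoly : ∀ P : MvPolynomial (Fin 2) K,
      algebraMap (MvPolynomial (Fin 2) K) (FunField K) P ∈
        IntermediateField.adjoin K {x K, y K} := by
    intro P
    induction P using MvPolynomial.induction_on with
    | C a =>
      have : algebraMap (MvPolynomial (Fin 2) K) (FunField K) (MvPolynomial.C a) =
          algebraMap K (FunField K) a := by
        rw [← MvPolynomial.algebraMap_eq, ← IsScalarTower.algebraMap_apply]
      rw [this]
      exact IntermediateField.algebraMap_mem _ a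
    | add p q hp hq => rw [map_add]; exact add_mem hp hq
    | mul_X p i hp =>
      rw [map_mul]
      refine mul_mem hp (IntermediateField.subset_adjoin K _ ?_)
      fin_cases i
      · exact Or.inl rfl
      · exact Or.inr rfl
  obtain ⟨a, b, _, rfl⟩ := IsFractionRing.div_surjective (A := MvPolynomial (Fin 2) K) z
  exact div_mem (hpoly a) (hpoly b)

theorem aeval_ne_zero {K : Type*} [Field K] (P : MvPolynomial (Fin 2) K) (a : Fin 2 → K)
    (h : MvPolynomial.eval a P ≠ 0) : MvPolynomial.aeval ![x K, y K] P ≠ 0 := by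
  have h1 : MvPolynomial.aeval ![x K, y K] P =
      algebraMap (MvPolynomial (Fin 2) K) (FunField K) P := by
    have h2 : (MvPolynomial.aeval ![x K, y K] : MvPolynomial (Fin 2) K →ₐ[K] FunField K) =
        IsScalarTower.toAlgHom K (MvPolynomial (Fin 2) K) (FunField K) := by
      apply MvPolynomial.algHom_ext
      intro i
      fin_cases i <;> simp [x, y]
    rw [h2]; rfl
  rw [h1]
  intro h0
  have h3 : P = 0 := (IsFractionRing.injective (MvPolynomial (Fin 2) K) (FunField K))
    (by rw [h0, map_zero])
  exact h (by rw [h3, map_zero])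

theorem aeval_injective {K : Type*} [Field K] (u v : FunField K)
    (h : IntermediateField.adjoin K {u, v} = ⊤) :
    Function.Injective (MvPolynomial.aeval (R := K) ![u, v]) := by
  have alg : Algebra.IsAlgebraic (Algebra.adjoin K (Set.range ![u, v])) (FunField K) := by
    refine ⟨fun z => ?_⟩
    have hz : z ∈ IntermediateField.adjoin K ({u, v} : Set (FunField K)) := by rw [h]; trivial
    rw [IntermediateField.mem_adjoin_iff_div] at hz
    obtain ⟨r, hr, s, hs, rfl⟩ := hz
    have hset : ({u, v} : Set (FunField K)) = Set.range ![u, v] := by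
      simp [Set.pair_comm]
    rw [hset] at hr hs
    rw [div_eq_mul_inv]
    exact (isAlgebraic_algebraMap (⟨r, hr⟩ : Algebra.adjoin K (Set.range ![u, v]))).mul
      (isAlgebraic_algebraMap (⟨s, hs⟩ : Algebra.adjoin K (Set.range ![u, v]))).inv
  have hle : Cardinal.lift (Cardinal.mk (Fin 2)) ≤
      Cardinal.lift (Algebra.trdeg K (FunField K)) := by
    have hx : AlgebraicIndependent K
        (fun i => algebraMap (MvPolynomial (Fin 2) K) (FunField K) (MvPolynomial.X i)) :=
      (MvPolynomial.algebraicIndependent_X (Fin 2) K).map'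
        (f := IsScalarTower.toAlgHom K (MvPolynomial (Fin 2) K) (FunField K))
        (IsFractionRing.injective (MvPolynomial (Fin 2) K) (FunField K))
    exact hx.lift_cardinalMk_le_trdeg
  exact (Algebra.IsAlgebraic.isTranscendenceBasis_of_lift_le_trdeg_of_finite K ![u, v] hle).1

end FunField

/-- A birational self-map of the plane, equivalently of any projective surface with function
field `K(x, y)`. It is represented by its comorphism `g ↦ g ∘ f`, a `K`-automorphism of the
function field. In particular a birational map and its lifts to blow-ups of the plane are given by
one and the same automorphism. -/
structure BirMap (K : Type*) [Field K] where
  comorphism : FunField K ≃ₐ[K] FunField K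

namespace BirMap

/-- The identity map. -/
def id (K : Type*) [Field K] : BirMap K := ⟨AlgEquiv.refl⟩

/-- The composition `g ∘ f` (first `f`, then `g`). Its comorphism is first that of `g`, then that
of `f`. -/
def comp {K : Type*} [Field K] (g f : BirMap K) : BirMap K :=
  ⟨g.comorphism.trans f.comorphism⟩

/-- The inverse map. -/
def inv {K : Type*} [Field K] (f : BirMap K) : BirMap K := ⟨f.comorphism.symm⟩

/-- The `n`-th iterate. -/
def iter {K : Type*} [Field K] (f : BirMap K) : ℕ → BirMap K
  | 0 => id K
  | n + 1 => comp f (iter f n)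

/-- The birational map `(x, y) ↦ (u, v)` attached to two rational functions `u, v` that generate
the function field. -/
def ofGens {K : Type*} [Field K] (u v : FunField K)
    (h : IntermediateField.adjoin K {u, v} = ⊤) : BirMap K where
  comorphism := AlgEquiv.ofBijective
    (IsFractionRing.liftAlgHom (K := FunField K) (FunField.aeval_injective u v h))
    ⟨RingHom.injective _, by
      have hr : ∀ P : MvPolynomial (Fin 2) K,
          MvPolynomial.aeval (R := K) ![u, v] P ∈ AlgHom.fieldRange
            (IsFractionRing.liftAlgHom (K := FunField K) (FunField.aeval_injective u v h)) :=
        fun P => ⟨algebraMap _ _ P, by simp⟩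
      have hu := hr (MvPolynomial.X 0)
      have hv := hr (MvPolynomial.X 1)
      simp only [MvPolynomial.aeval_X, Matrix.cons_val_zero, Matrix.cons_val_one] at hu hv
      have htop : (⊤ : IntermediateField K (FunField K)) ≤ AlgHom.fieldRange
          (IsFractionRing.liftAlgHom (K := FunField K) (FunField.aeval_injective u v h)) := by
        rw [← h, IntermediateField.adjoin_le_iff]
        rintro z (rfl | rfl)
        · exact hu
        · exact hv
      intro z
      exact htop (IntermediateField.mem_top (x := z))⟩

theorem ofGens_x {K : Type*} [Field K] (u v : FunField K)
    (h : IntermediateField.adjoin K {u, v} = ⊤) :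
    (ofGens u v h).comorphism (FunField.x K) = u :=
  (IsFractionRing.lift_algebraMap (K := FunField K)
    (FunField.aeval_injective u v h) (MvPolynomial.X 0)).trans (by simp)

theorem ofGens_y {K : Type*} [Field K] (u v : FunField K)
    (h : IntermediateField.adjoin K {u, v} = ⊤) :
    (ofGens u v h).comorphism (FunField.y K) = v :=
  (IsFractionRing.lift_algebraMap (K := FunField K)
    (FunField.aeval_injective u v h) (MvPolynomial.X 1)).trans (by simp)

/-- The rational map `[X₀, X₁, X₂] ↦ [P₀, P₁, P₂]` given by three forms of the same degree, when
it is birational, i.e. when `P₀ / P₂` and `P₁ / P₂` generate the function field. -/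
def ofForms {K : Type*} [Field K] (P : Fin 3 → MvPolynomial (Fin 3) K)
    (h : IntermediateField.adjoin K
      {FunField.dehom (P 0) / FunField.dehom (P 2), FunField.dehom (P 1) / FunField.dehom (P 2)} =
        ⊤) : BirMap K :=
  ofGens _ _ h

end BirMap

/-! ## The maps `Φ` and `Ψ` -/

open MvPolynomial in
/-- The three quintic forms that define `Φ`. -/
def phiForms (K : Type*) [Field K] : Fin 3 → MvPolynomial (Fin 3) K :=
  let x : MvPolynomial (Fin 3) K := X 0
  let y : MvPolynomial (Fin 3) K := X 1
  let z : MvPolynomial (Fin 3) K := X 2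
  ![9 * x ^ 5 - 10 * x ^ 3 * y ^ 2 + x * y ^ 4 + 10 * x ^ 3 * y * z - 2 * x * y ^ 3 * z,
    9 * x ^ 4 * y - 10 * x ^ 2 * y ^ 3 + y ^ 5 + 9 * x ^ 4 * z - y ^ 4 * z,
    9 * x ^ 4 * z - 10 * x ^ 2 * y ^ 2 * z + y ^ 4 * z]

open MvPolynomial in
/-- The three quintic forms that define `Ψ`. -/
def psiForms (K : Type*) [Field K] : Fin 3 → MvPolynomial (Fin 3) K :=
  let x : MvPolynomial (Fin 3) K := X 0
  let y : MvPolynomial (Fin 3) K := X 1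
  let z : MvPolynomial (Fin 3) K := X 2
  ![9 * x ^ 5 - 10 * x ^ 3 * y ^ 2 + x * y ^ 4 - 10 * x ^ 3 * y * z + 2 * x * y ^ 3 * z,
    9 * x ^ 4 * y - 10 * x ^ 2 * y ^ 3 + y ^ 5 - 9 * x ^ 4 * z + y ^ 4 * z,
    9 * x ^ 4 * z - 10 * x ^ 2 * y ^ 2 * z + y ^ 4 * z]

theorem adjoin_aux {K : Type*} [Field K] [CharZero K] (e : K) (u v : FunField K)
    (hu : u = (9 * FunField.x K ^ 5 - 10 * FunField.x K ^ 3 * FunField.y K ^ 2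
        + FunField.x K * FunField.y K ^ 4 + algebraMap K _ e *
          (10 * FunField.x K ^ 3 * FunField.y K - 2 * FunField.x K * FunField.y K ^ 3)) /
      (9 * FunField.x K ^ 4 - 10 * FunField.x K ^ 2 * FunField.y K ^ 2 + FunField.y K ^ 4))
    (hv : v = (9 * FunField.x K ^ 4 * FunField.y K - 10 * FunField.x K ^ 2 * FunField.y K ^ 3
        + FunField.y K ^ 5 + algebraMap K _ e * (9 * FunField.x K ^ 4 - FunField.y K ^ 4)) /
      (9 * FunField.x K ^ 4 - 10 * FunField.x K ^ 2 * FunField.y K ^ 2 + FunField.y K ^ 4)) :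
    IntermediateField.adjoin K {u, v} = ⊤ := by
  have hx0 : FunField.x K ≠ 0 := by
    simpa using FunField.aeval_ne_zero (K := K) (MvPolynomial.X 0) ![1, 0] (by simp)
  have e9 : algebraMap K (FunField K) 9 = 9 := map_ofNat _ 9
  have e10 : algebraMap K (FunField K) 10 = 10 := map_ofNat _ 10
  have e2 : algebraMap K (FunField K) 2 = 2 := map_ofNat _ 2
  obtain ⟨A, hAd⟩ : ∃ A, A = 9 * FunField.x K ^ 4
      - 10 * FunField.x K ^ 2 * FunField.y K ^ 2 + FunField.y K ^ 4 := ⟨_, rfl⟩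
  obtain ⟨B, hBd⟩ : ∃ B, B = 9 * FunField.x K ^ 4
      - 10 * FunField.x K ^ 2 * FunField.y K ^ 2 + FunField.y K ^ 4 + algebraMap K _ e *
        (10 * FunField.x K ^ 2 * FunField.y K - 2 * FunField.y K ^ 3) := ⟨_, rfl⟩
  have hA : A ≠ 0 := by
    have := FunField.aeval_ne_zero (K := K)
      (MvPolynomial.C 9 * MvPolynomial.X 0 ^ 4
        - MvPolynomial.C 10 * MvPolynomial.X 0 ^ 2 * MvPolynomial.X 1 ^ 2
        + MvPolynomial.X 1 ^ 4) ![1, 0] (by simp)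
    rw [hAd]
    simpa [e9, e10] using this
  have hB : B ≠ 0 := by
    have := FunField.aeval_ne_zero (K := K)
      (MvPolynomial.C 9 * MvPolynomial.X 0 ^ 4
        - MvPolynomial.C 10 * MvPolynomial.X 0 ^ 2 * MvPolynomial.X 1 ^ 2
        + MvPolynomial.X 1 ^ 4 + MvPolynomial.C e *
        (MvPolynomial.C 10 * MvPolynomial.X 0 ^ 2 * MvPolynomial.X 1
          - MvPolynomial.C 2 * MvPolynomial.X 1 ^ 3))
        ![1, 0] (by simp)
    rw [hBd]
    simpa [e9, e10, e2] using this
  rw [← hAd] at hu hv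
  set X := FunField.x K with hX
  set Y := FunField.y K with hY
  set E := algebraMap K (FunField K) e with hE
  have hu' : u = X * B / A := by
    rw [hu, hBd]; ring
  have hv' : v - E = Y * B / A := by
    rw [hv, eq_div_iff hA, sub_mul, div_mul_cancel₀ _ hA, hBd, hAd]; ring
  have hu0 : u ≠ 0 := by
    rw [hu']; exact div_ne_zero (mul_ne_zero hx0 hB) hA
  have hm : (v - E) / u = Y / X := by
    rw [div_eq_div_iff hu0 hx0, hu', hv']
    ring
  have hfac : (1 - (Y / X) ^ 2) * (9 - (Y / X) ^ 2) = A / X ^ 4 := by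
    rw [hAd]
    field_simp
    ring
  have hxu : X = u - 2 * E * (((v - E) / u) * (5 - ((v - E) / u) ^ 2) /
      ((1 - ((v - E) / u) ^ 2) * (9 - ((v - E) / u) ^ 2))) := by
    rw [hm, hfac, hu', eq_sub_iff_add_eq, eq_div_iff hA]
    field_simp
    rw [hBd, hAd]
    ring
  have hyu : Y = ((v - E) / u) * X := by
    rw [hm]; field_simp
  have mu : u ∈ IntermediateField.adjoin K {u, v} :=
    IntermediateField.subset_adjoin K _ (Or.inl rfl)
  have mv : v ∈ IntermediateField.adjoin K {u, v} :=
    IntermediateField.subset_adjoin K _ (Or.inr rfl)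
  have mE : E ∈ IntermediateField.adjoin K {u, v} := IntermediateField.algebraMap_mem _ e
  have mnat : ∀ n : ℕ, (n : FunField K) ∈ IntermediateField.adjoin K {u, v} :=
    fun n => natCast_mem _ n
  have mm : (v - E) / u ∈ IntermediateField.adjoin K {u, v} := div_mem (sub_mem mv mE) mu
  have mX : X ∈ IntermediateField.adjoin K {u, v} := by
    rw [hxu]
    refine sub_mem mu (mul_mem (mul_mem (mnat 2) mE) (div_mem (mul_mem mm
      (sub_mem (mnat 5) (pow_mem mm 2))) (mul_mem (sub_mem (one_mem _) (pow_mem mm 2))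
        (sub_mem (mnat 9) (pow_mem mm 2)))))
  have mY : Y ∈ IntermediateField.adjoin K {u, v} := by
    rw [hyu]; exact mul_mem mm mX
  rw [eq_top_iff, ← FunField.adjoin_xy K, IntermediateField.adjoin_le_iff]
  rintro z (rfl | rfl)
  · exact mX
  · exact mY

theorem phiForms_birational (K : Type*) [Field K] [CharZero K] :
    IntermediateField.adjoin K
      {FunField.dehom (phiForms K 0) / FunField.dehom (phiForms K 2),
        FunField.dehom (phiForms K 1) / FunField.dehom (phiForms K 2)} = ⊤ := by
  refine adjoin_aux 1 _ _ ?_ ?_ <;>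
  · simp only [FunField.dehom, phiForms, map_add, map_sub, map_mul, map_pow, MvPolynomial.aeval_X,
      map_ofNat, map_one, Matrix.cons_val_zero, Matrix.cons_val_one, Matrix.cons_val]
    ring

theorem psiForms_birational (K : Type*) [Field K] [CharZero K] :
    IntermediateField.adjoin K
      {FunField.dehom (psiForms K 0) / FunField.dehom (psiForms K 2),
        FunField.dehom (psiForms K 1) / FunField.dehom (psiForms K 2)} = ⊤ := by
  refine adjoin_aux (-1) _ _ ?_ ?_ <;>
  · simp only [FunField.dehom, psiForms, map_add, map_sub, map_mul, map_pow, MvPolynomial.aeval_X,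
      map_ofNat, map_neg, map_one, Matrix.cons_val_zero, Matrix.cons_val_one, Matrix.cons_val]
    ring

/-- The birational map `Φ` of the plane. -/
def Phi (K : Type*) [Field K] [CharZero K] : BirMap K :=
  BirMap.ofForms (phiForms K) (phiForms_birational K)

/-- The birational map `Ψ` of the plane. -/
def Psi (K : Type*) [Field K] [CharZero K] : BirMap K :=
  BirMap.ofForms (psiForms K) (psiForms_birational K)

/-! ## Surfaces as sets of local rings

A projective surface with function field `K(x, y)` is identified with the set of the local rings,
inside `K(x, y)`, of its closed points. A curve on the surface (a reduced irreducible one) is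
identified with its local ring, a discrete valuation ring of `K(x, y)`. A curve and its strict
transforms on blow-ups then have the same local ring. -/

/-- The local ring at the origin of the affine plane with coordinates `u, v`, that is, the
localization of `K[u, v]` at the ideal `(u, v)`. -/
def planePoint {K : Type*} [Field K] (u v : FunField K) : LocalSubring (FunField K) where
  toSubring :=
    { carrier := {f | ∃ P Q : MvPolynomial (Fin 2) K, MvPolynomial.eval ![0, 0] Q ≠ 0 ∧
        MvPolynomial.aeval ![u, v] Q ≠ 0 ∧
        f = MvPolynomial.aeval ![u, v] P / MvPolynomial.aeval ![u, v] Q}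
      mul_mem' := by
        rintro _ _ ⟨P, Q, h, h', rfl⟩ ⟨P₁, Q₁, h₁, h₁', rfl⟩
        exact ⟨P * P₁, Q * Q₁, by rw [map_mul]; exact mul_ne_zero h h₁,
          by rw [map_mul]; exact mul_ne_zero h' h₁',
          by rw [map_mul, map_mul, div_mul_div_comm]⟩
      one_mem' := ⟨1, 1, by simp, by simp, by simp⟩
      add_mem' := by
        rintro _ _ ⟨P, Q, h, h', rfl⟩ ⟨P₁, Q₁, h₁, h₁', rfl⟩
        exact ⟨P * Q₁ + Q * P₁, Q * Q₁, by rw [map_mul]; exact mul_ne_zero h h₁,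
          by rw [map_mul]; exact mul_ne_zero h' h₁',
          by rw [map_mul, map_add, map_mul, map_mul, div_add_div _ _ h' h₁']⟩
      zero_mem' := ⟨0, 1, by simp, by simp, by simp⟩
      neg_mem' := by
        rintro _ ⟨P, Q, h, h', rfl⟩
        exact ⟨-P, Q, h, h', by rw [map_neg, neg_div]⟩ }
  isLocalRing := by
    refine IsLocalRing.of_isUnit_or_isUnit_one_sub_self ?_
    rintro ⟨_, P, Q, h, h', rfl⟩
    by_cases hP : MvPolynomial.aeval ![u, v] P = 0
    · right
      convert isUnit_one using 1
      apply Subtype.ext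
      change 1 - _ / _ = (1 : FunField K)
      rw [hP, zero_div, sub_zero]
    by_cases hQ : MvPolynomial.aeval ![u, v] (Q - P) = 0
    · left
      convert isUnit_one using 1
      apply Subtype.ext
      change _ / _ = (1 : FunField K)
      rw [map_sub, sub_eq_zero] at hQ
      rw [hQ, div_self hP]
    by_cases h0 : MvPolynomial.eval ![0, 0] P = 0
    · right
      refine IsUnit.of_mul_eq_one ⟨_, Q, Q - P, by rw [map_sub, h0, sub_zero]; exact h,
        hQ, rfl⟩ ?_
      apply Subtype.ext
      change (1 - _ / _) * (_ / _) = (1 : FunField K)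
      rw [one_sub_div h', ← map_sub, div_mul_div_comm, mul_comm, div_self (mul_ne_zero h' hQ)]
    · left
      refine IsUnit.of_mul_eq_one ⟨_, Q, P, h0, hP, rfl⟩ ?_
      apply Subtype.ext
      change (_ / _) * (_ / _) = (1 : FunField K)
      rw [div_mul_div_comm, mul_comm, div_self (mul_ne_zero h' hP)]

/-- The closed points of the projective plane, lying in its three standard affine charts. -/
def plane (K : Type*) [Field K] : Set (LocalSubring (FunField K)) :=
  let x := FunField.x K
  let y := FunField.y K
  let c : K → FunField K := algebraMap K (FunField K)
  {O | ∃ a b : K, O = planePoint (x - c a) (y - c b) ∨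
    O = planePoint (y / x - c a) (1 / x - c b) ∨ O = planePoint (x / y - c a) (1 / y - c b)}

/-- `O'` is a point of the exceptional curve of the blow-up of the point `O`: if `u, v` are
coordinates at `O`, then the blow-up is covered by the planes with coordinates `u, v / u` and
`v, u / v`, in which the exceptional curve is `u = 0` and `v = 0` respectively. -/
def IsOver {K : Type*} [Field K] (O O' : LocalSubring (FunField K)) : Prop :=
  ∃ u v : FunField K, O = planePoint u v ∧
    ((∃ c : K, O' = planePoint u (v / u - algebraMap K (FunField K) c)) ∨
      O' = planePoint v (u / v))

/-- The closed points of the blow-up of the surface `S` at a finite set `Z` of closed points. -/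
def blowUp {K : Type*} [Field K] (S Z : Set (LocalSubring (FunField K))) :
    Set (LocalSubring (FunField K)) :=
  (S \ Z) ∪ {O' | ∃ O ∈ Z, IsOver O O'}

/-- A reduced irreducible curve on the surface `S`, given by its local ring in the function field:
a discrete valuation ring that is the localization of the local ring of some closed point of `S`
at a prime ideal. -/
@[ext]
structure Curve {F : Type*} [Field F] (S : Set (LocalSubring F)) where
  ring : ValuationSubring F
  dvr : IsDiscreteValuationRing ring
  isLocalization : ∃ O ∈ S, O.toSubring ≤ ring.toSubring ∧
    ∀ f ∈ ring, ∃ a ∈ O.toSubring, ∃ b ∈ O.toSubring, b ≠ 0 ∧ b⁻¹ ∈ ring ∧ f = a / b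

attribute [instance] Curve.dvr

/-- The order of vanishing along a discrete valuation ring of a field, with value `0` at `0`. -/
def ord {F : Type*} [Field F] (V : ValuationSubring F) [IsDiscreteValuationRing V] (f : F) : ℤ :=
  -WithZero.log ((IsDiscreteValuationRing.maximalIdeal V).valuation F f)

/-! ## Divisors, intersection numbers, numerical equivalence -/

/-- Divisors on the surface `S`. -/
abbrev Divisor {F : Type*} [Field F] (S : Set (LocalSubring F)) : Type _ := Curve S →₀ ℤ

/-- `φ` is a local equation of the divisor `D` at the point `O`. The curves through the point are
those whose local ring contains `O`. -/
def IsLocalEquation {F : Type*} [Field F] {S : Set (LocalSubring F)} (D : Divisor S)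
    (O : LocalSubring F) (φ : F) : Prop :=
  φ ≠ 0 ∧ ∀ C : Curve S, O.toSubring ≤ C.ring.toSubring → ord C.ring φ = D C

/-- A closed point of the normalization of the curve `C`, given by its local ring: a discrete
valuation ring of the function field of `C` (the residue field of the local ring of `C`) that
contains the constants. -/
structure Place (K : Type*) {F : Type*} [Field K] [Field F] [Algebra K F]
    {S : Set (LocalSubring F)} (C : Curve S) where
  ring : ValuationSubring (IsLocalRing.ResidueField C.ring)
  dvr : IsDiscreteValuationRing ring
  const_mem : ∀ (a : K) (h : algebraMap K F a ∈ C.ring),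
    IsLocalRing.residue C.ring ⟨algebraMap K F a, h⟩ ∈ ring

attribute [instance] Place.dvr

/-- The normalization map of the curve `C` sends the point `w` to the point `O` of the surface:
restriction of functions to `C` maps `O` into the local ring of `w`, and the maximal ideal into
the maximal ideal. -/
def Place.LiesOver {K F : Type*} [Field K] [Field F] [Algebra K F]
    {S : Set (LocalSubring F)} {C : Curve S} (w : Place K C) (O : LocalSubring F) : Prop :=
  ∃ h : O.toSubring ≤ C.ring.toSubring,
    (∀ f : O.toSubring, IsLocalRing.residue C.ring ⟨f, h f.2⟩ ∈ w.ring) ∧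
    ∀ f ∈ IsLocalRing.maximalIdeal O.toSubring,
      w.ring.valuation (IsLocalRing.residue C.ring ⟨f, h f.2⟩) < 1

/-- The intersection number `D · C` is `n`. That is, `n` is the degree of the restriction of the
line bundle of `D` to (the normalization of) `C`: one moves `D` to `D - div g` with `g` chosen such
that `C` is not a component of `D - div g`, restricts local equations to `C`, and adds up their
orders at the points of the normalization. -/
def HasIntersectionNumber (K : Type*) {F : Type*} [Field K] [Field F] [Algebra K F]
    {S : Set (LocalSubring F)} (D : Divisor S) (C : Curve S) (n : ℤ) : Prop :=
  ∃ g : F, g ≠ 0 ∧ ord C.ring g = D C ∧ ∃ d : Place K C →₀ ℤ,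
    (∀ w : Place K C, ∃ O ∈ S, w.LiesOver O ∧ ∃ φ : F, IsLocalEquation D O φ ∧
      ∃ h : φ / g ∈ C.ring, ord w.ring (IsLocalRing.residue C.ring ⟨φ / g, h⟩) = d w) ∧
    n = d.sum fun _ k => k

/-- The group of numerically trivial divisors: those with `D · C = 0` for all curves `C`. -/
def numTrivial (K : Type*) {F : Type*} [Field K] [Field F] [Algebra K F]
    (S : Set (LocalSubring F)) : AddSubgroup (Divisor S) :=
  AddSubgroup.closure {D | ∀ C : Curve S, HasIntersectionNumber K D C 0}

/-- The real Néron-Severi space `N¹(S)`: divisors modulo numerical equivalence, tensored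
with `ℝ`. -/
abbrev N1 (K : Type*) {F : Type*} [Field K] [Field F] [Algebra K F]
    (S : Set (LocalSubring F)) : Type _ :=
  TensorProduct ℤ ℝ (Divisor S ⧸ numTrivial K S)

/-- The class of a divisor in `N¹(S)`. -/
def cls (K : Type*) {F : Type*} [Field K] [Field F] [Algebra K F]
    {S : Set (LocalSubring F)} (D : Divisor S) : N1 K S :=
  (1 : ℝ) ⊗ₜ[ℤ] (QuotientAddGroup.mk D : Divisor S ⧸ numTrivial K S)

/-! ## Action of birational maps -/

/-- `D'` is the pull-back `f^* D` of the divisor `D` on `T` under `f : S ⇢ T`: for each curve `C`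
on `S`, the coefficient of `C` in `D'` is the order along `C` of the pull-back of a local equation
of `D` at a point of `T` in (the closure of) the image of `C`. -/
def IsPullback {K : Type*} [Field K] {S T : Set (LocalSubring (FunField K))} (f : BirMap K)
    (D : Divisor T) (D' : Divisor S) : Prop :=
  ∀ C : Curve S, ∃ O ∈ T, (∀ g ∈ O.toSubring, f.comorphism g ∈ C.ring) ∧
    ∃ φ, IsLocalEquation D O φ ∧ ord C.ring (f.comorphism φ) = D' C

/-- The linear map `L` is the pull-back `f^*` on `N¹(S)` for `f : S ⇢ S`. -/
def IsPullbackN1 {K : Type*} [Field K] (S : Set (LocalSubring (FunField K))) (f : BirMap K)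
    (L : N1 K S →ₗ[ℝ] N1 K S) : Prop :=
  ∀ D : Divisor S, ∃ D' : Divisor S, IsPullback f D D' ∧ L (cls K D) = cls K D'

/-- The linear map `L` is the push-forward `f_* = (f⁻¹)^*` on `N¹(S)`, for a birational
map `f : S ⇢ S`. -/
def IsPushforwardN1 {K : Type*} [Field K] (S : Set (LocalSubring (FunField K))) (f : BirMap K)
    (L : N1 K S →ₗ[ℝ] N1 K S) : Prop :=
  IsPullbackN1 S f.inv L

/-- Algebraic stability of `f : S ⇢ S`: `(f ^ n)^* = (f^*) ^ n` on `N¹(S)` for all `n ≥ 0`. -/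
def AlgebraicallyStable {K : Type*} [Field K] (S : Set (LocalSubring (FunField K)))
    (f : BirMap K) : Prop :=
  ∃ L : N1 K S →ₗ[ℝ] N1 K S, IsPullbackN1 S f L ∧ ∀ n : ℕ, IsPullbackN1 S (f.iter n) (L ^ n)

/-- The map `f` is defined at the point `O` and sends it to the point `O'`: its comorphism maps
the local ring `O'` into `O`, and the maximal ideal into the maximal ideal. -/
def MapsPoint {K : Type*} [Field K] (f : BirMap K) (O O' : LocalSubring (FunField K)) : Prop :=
  O'.map (f.comorphism : FunField K →+* FunField K) ≤ O

/-- The indeterminacy locus of `f : S ⇢ S`. -/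
def indeterminacy {K : Type*} [Field K] (S : Set (LocalSubring (FunField K))) (f : BirMap K) :
    Set (LocalSubring (FunField K)) :=
  {O | O ∈ S ∧ ¬ ∃ O' ∈ S, MapsPoint f O O'}

/-- The map `f : S ⇢ S` contracts the curve `C` to the closed point `O` of `S`. -/
def ContractsTo {K : Type*} [Field K] {S : Set (LocalSubring (FunField K))} (f : BirMap K)
    (C : Curve S) (O : LocalSubring (FunField K)) : Prop :=
  O ∈ S ∧ MapsPoint f C.ring.toLocalSubring O

/-! ## The blow-up and the basis of `N¹` -/

/-- The `15` blown-up points, in the order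
`p, p₁, p₂, p₃, p₄, p', p₁', p₂', p₃', p₄', p'', p₁'', p₂'', p₃'', p₄''`. Here
`p = [0, 0, 1]`, `p' = [0, 1, 1]`, `p'' = [0, -1, 1]` and `pᵢ = [1, m, 0]` with
`m = 1, -1, 3, -3`. With the coordinates `ξ = y / x - m` and `ζ = 1 / x` at `pᵢ`, the points
`pᵢ'` and `pᵢ''` are the points of the exceptional curve over `pᵢ` that belong to the tangent
directions `ζ = 2 ξ` and `ζ = -2 ξ`, that is, they are the points `ξ = 0, ζ / ξ = ± 2`. -/
def center (K : Type*) [Field K] : Fin 15 → LocalSubring (FunField K) :=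
  let x := FunField.x K
  let y := FunField.y K
  let ξ : ℤ → FunField K := fun m => y / x - (m : FunField K)
  let ζ : FunField K := 1 / x
  ![planePoint x y,
    planePoint (ξ 1) ζ, planePoint (ξ (-1)) ζ, planePoint (ξ 3) ζ, planePoint (ξ (-3)) ζ,
    planePoint x (y - 1),
    planePoint (ξ 1) (ζ / ξ 1 - 2), planePoint (ξ (-1)) (ζ / ξ (-1) - 2),
    planePoint (ξ 3) (ζ / ξ 3 - 2), planePoint (ξ (-3)) (ζ / ξ (-3) - 2),
    planePoint x (y + 1),
    planePoint (ξ 1) (ζ / ξ 1 + 2), planePoint (ξ (-1)) (ζ / ξ (-1) + 2),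
    planePoint (ξ 3) (ζ / ξ 3 + 2), planePoint (ξ (-3)) (ζ / ξ (-3) + 2)]

/-- The seven points `R = {p, p', p'', p₁, p₂, p₃, p₄}` of the plane. -/
def centersR (K : Type*) [Field K] : Set (LocalSubring (FunField K)) :=
  center K '' {0, 1, 2, 3, 4, 5, 10}

/-- The eight infinitely near points `R' = {p₁', …, p₄', p₁'', …, p₄''}`. -/
def centersR' (K : Type*) [Field K] : Set (LocalSubring (FunField K)) :=
  center K '' {6, 7, 8, 9, 11, 12, 13, 14}

/-- The blow-up of the plane at `R`. -/
def surface1 (K : Type*) [Field K] : Set (LocalSubring (FunField K)) :=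
  blowUp (plane K) (centersR K)

/-- The blow-up of the plane at `R` and then at `R'`. -/
def surface2 (K : Type*) [Field K] : Set (LocalSubring (FunField K)) :=
  blowUp (surface1 K) (centersR' K)

/-- `C` is (the strict transform of) the exceptional curve over the `i`-th blown-up point. The
exceptional curve of a blow-up over a point `O` is the only curve on the blow-up whose local ring
dominates `O`. -/
def IsExceptionalCurve {K : Type*} [Field K] (i : Fin 15) (C : Curve (surface2 K)) : Prop :=
  center K i ≤ C.ring.toLocalSubring ∧
    (center K i ∈ centersR K → ∃ C₁ : Curve (surface1 K), C₁.ring = C.ring)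

/-- `L` is a line in the plane, the closure of the affine line `a x + b y + c = 0`. -/
def IsLine {K : Type*} [Field K] (L : Curve (plane K)) : Prop :=
  ∃ a b c : K, (a ≠ 0 ∨ b ≠ 0) ∧
    0 < ord L.ring (algebraMap K (FunField K) a * FunField.x K +
      algebraMap K (FunField K) b * FunField.y K + algebraMap K (FunField K) c)

/-- `e` is the basis
`h, e_p, e_{p₁}, …, e_{p₄}, e_{p'}, e_{p₁'}, …, e_{p₄'}, e_{p''}, e_{p₁''}, …, e_{p₄''}` of `N¹` of
the twofold blow-up: `h` is the class of the pull-back of a line under the blow-up map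
(whose comorphism is the identity), and the others are the classes of the exceptional curves. -/
def IsGeometricBasis {K : Type*} [Field K]
    (e : Module.Basis (Fin 16) ℝ (N1 K (surface2 K))) : Prop :=
  (∃ (L : Curve (plane K)) (H : Divisor (surface2 K)), IsLine L ∧
    IsPullback (BirMap.id K) (Finsupp.single L 1) H ∧ e 0 = cls K H) ∧
  ∀ i : Fin 15, ∃ C : Curve (surface2 K), IsExceptionalCurve i C ∧
    e i.succ = cls K (Finsupp.single C 1)

/-- The matrix `M_Φ`. -/
def matPhi : Matrix (Fin 16) (Fin 16) ℝ :=
  !![5,  4,  0,  0,  0,  0,  0,  1,  1,  1,  1,  0,  0,  0,  0,  0;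
      0,  0,  0,  0,  0,  0,  1,  0,  0,  0,  0,  0,  0,  0,  0,  0;
     -1, -1,  1,  0,  0,  0,  0, -1,  0,  0,  0,  0,  0,  0,  0,  0;
     -1, -1,  0,  1,  0,  0,  0,  0, -1,  0,  0,  0,  0,  0,  0,  0;
     -1, -1,  0,  0,  1,  0,  0,  0,  0, -1,  0,  0,  0,  0,  0,  0;
     -1, -1,  0,  0,  0,  1,  0,  0,  0,  0, -1,  0,  0,  0,  0,  0;
     -4, -3,  0,  0,  0,  0,  0, -1, -1, -1, -1,  0,  0,  0,  0,  0;
     -2, -2,  0,  0,  0,  0,  0, -1,  0,  0,  0,  0,  0,  0,  0,  0;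
     -2, -2,  0,  0,  0,  0,  0,  0, -1,  0,  0,  0,  0,  0,  0,  0;
     -2, -2,  0,  0,  0,  0,  0,  0,  0, -1,  0,  0,  0,  0,  0,  0;
     -2, -2,  0,  0,  0,  0,  0,  0,  0,  0, -1,  0,  0,  0,  0,  0;
      0,  0,  0,  0,  0,  0,  0,  0,  0,  0,  0,  0,  0,  0,  0,  0;
     -1, -1,  1,  0,  0,  0,  0, -1,  0,  0,  0,  0,  0,  0,  0,  0;
     -1, -1,  0,  1,  0,  0,  0,  0, -1,  0,  0,  0,  0,  0,  0,  0;
     -1, -1,  0,  0,  1,  0,  0,  0,  0, -1,  0,  0,  0,  0,  0,  0;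
     -1, -1,  0,  0,  0,  1,  0,  0,  0,  0, -1,  0,  0,  0,  0,  0]

/-- The matrix `M_Ψ`. -/
def matPsi : Matrix (Fin 16) (Fin 16) ℝ :=
  !![5,  4,  0,  0,  0,  0,  0,  0,  0,  0,  0,  0,  1,  1,  1,  1;
      0,  0,  0,  0,  0,  0,  0,  0,  0,  0,  0,  1,  0,  0,  0,  0;
     -1, -1,  1,  0,  0,  0,  0,  0,  0,  0,  0,  0, -1,  0,  0,  0;
     -1, -1,  0,  1,  0,  0,  0,  0,  0,  0,  0,  0,  0, -1,  0,  0;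
     -1, -1,  0,  0,  1,  0,  0,  0,  0,  0,  0,  0,  0,  0, -1,  0;
     -1, -1,  0,  0,  0,  1,  0,  0,  0,  0,  0,  0,  0,  0,  0, -1;
      0,  0,  0,  0,  0,  0,  0,  0,  0,  0,  0,  0,  0,  0,  0,  0;
     -1, -1,  1,  0,  0,  0,  0,  0,  0,  0,  0,  0, -1,  0,  0,  0;
     -1, -1,  0,  1,  0,  0,  0,  0,  0,  0,  0,  0,  0, -1,  0,  0;
     -1, -1,  0,  0,  1,  0,  0,  0,  0,  0,  0,  0,  0,  0, -1,  0;
     -1, -1,  0,  0,  0,  1,  0,  0,  0,  0,  0,  0,  0,  0,  0, -1;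
     -4, -3,  0,  0,  0,  0,  0,  0,  0,  0,  0,  0, -1, -1, -1, -1;
     -2, -2,  0,  0,  0,  0,  0,  0,  0,  0,  0,  0, -1,  0,  0,  0;
     -2, -2,  0,  0,  0,  0,  0,  0,  0,  0,  0,  0,  0, -1,  0,  0;
     -2, -2,  0,  0,  0,  0,  0,  0,  0,  0,  0,  0,  0,  0, -1,  0;
     -2, -2,  0,  0,  0,  0,  0,  0,  0,  0,  0,  0,  0,  0,  0, -1]

end

/-! In the affine plane, Φ and Ψ are shears of a pencil of lines. Such a map carries the line of
slope m through (0, α) to the parallel line through (0, β) and displaces the abscissa by (β - α)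
disp(m), where disp(m) = 2m(5 - m²) / ((1 - m²)(9 - m²)). Here (α, β) is (0, 1) for Φ and (0, -1)
for Ψ, and inversion exchanges α and β (`IsShear`, `IsShear.of_forms`, `IsShear.inv`). Everything
else follows from the expansion of disp: simple poles at the slopes 1, -1, 3, -3, all with residue
-1/2, and disp(m) = -2/m + O(1/m³) at infinity.

On the exceptional curve over the point at infinity of slope μ the function s = y - μx is a
coordinate, and the blown-up directions are s = ±1/2. By the residue, a shear acts there as the
translation s ↦ s + (β - α)/2. The pole of disp sends the line of slope μ through (0, α) onto the
second exceptional curve at s = (α + β)/2, and that curve onto the line through (0, β). The second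
exceptional curve at s = -(α + β)/2 is contracted to the point s = -α. On x = 0 the shear is y ↦ y -
(β - α). The exceptional curve over (0, β) goes to the one over (0, α), and the one over (0, -(α +
β)) is contracted to a point of height -2β. In the coordinates (x, m) the shear is a regular
automorphism away from the four slopes, which settles all other curves (`IsShear.image_cases`).

Contracted points are then followed by arithmetic on s and y. Those of Φ lie outside the
indeterminacy locus of Ψ, and those of Ψ ∘ Φ lie in a set of ten points, each fixed by Ψ ∘ Φ
(`exists_mapsPoint_of_orbitPoints`). Pull-back is functorial as long as no contracted point is
indeterminate for the next map (`IsSurface.isPullback_comp`), which gives algebraic stability and,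
applied to the inverses, the formula for push-forwards.

For the Néron-Severi space, factoriality of K[x, y] makes every divisor linearly equivalent to a
combination of the line at infinity and the exceptional curves (`exists_special_add`). Intersection
numbers with these rational curves show that they are numerically independent
(`specialDiv_independent`). The matrices come from pulling back these sixteen curves. The one curve
whose pull-back is not a combination of named curves, the exceptional curve over (0, β), is
eliminated by means of the divisor of x (`IsShear.exists_pullback`).

Points and curves are local rings, and statements about them are reduced to values of functions. A
local ring lies over a point as soon as two coordinates vanish in it (`planePoint_le`), and a curve
is determined by one coordinate that vanishes on it and another that is nonconstant on it
(`IsDiv.unique`). -/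

namespace BirSurf

/-! ## Membership and values in local subrings -/

section Calculus

variable {K F : Type*} [Field K] [Field F] [Algebra K F]

/-- `f` lies in the maximal ideal of the local subring `O`. -/
def InMax (O : LocalSubring F) (f : F) : Prop :=
  ∃ h : f ∈ O.toSubring, (⟨f, h⟩ : O.toSubring) ∈ IsLocalRing.maximalIdeal O.toSubring

/-- `O` contains the constants. -/
def HasConst (K : Type*) {F : Type*} [Field K] [Field F] [Algebra K F]
    (O : LocalSubring F) : Prop :=
  ∀ a : K, algebraMap K F a ∈ O.toSubring

/-- `O` contains the constants and `f` has the constant value `c` at the closed point of `O`. -/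
def HasVal (O : LocalSubring F) (f : F) (c : K) : Prop :=
  HasConst K O ∧ InMax O (f - algebraMap K F c)

/-- `f` lies in `O` and does not have a constant value in `K`. -/
def NoVal (K : Type*) {F : Type*} [Field K] [Field F] [Algebra K F]
    (O : LocalSubring F) (f : F) : Prop :=
  HasConst K O ∧ f ∈ O.toSubring ∧ ∀ c : K, ¬ InMax O (f - algebraMap K F c)

variable {O O' : LocalSubring F} {f g : F} {a b c d : K}

theorem InMax.mem (h : InMax O f) : f ∈ O.toSubring := h.1

theorem InMax.zero : InMax O (0 : F) := ⟨O.toSubring.zero_mem, Ideal.zero_mem _⟩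

theorem InMax.add (hf : InMax O f) (hg : InMax O g) : InMax O (f + g) :=
  ⟨O.toSubring.add_mem hf.1 hg.1, Ideal.add_mem _ hf.2 hg.2⟩

theorem InMax.mul_left (hf : f ∈ O.toSubring) (hg : InMax O g) : InMax O (f * g) :=
  ⟨O.toSubring.mul_mem hf hg.1, Ideal.mul_mem_left _ ⟨f, hf⟩ hg.2⟩

theorem InMax.mul_right (hf : InMax O f) (hg : g ∈ O.toSubring) : InMax O (f * g) := by
  rw [mul_comm]; exact InMax.mul_left hg hf

theorem InMax.neg (hf : InMax O f) : InMax O (-f) := by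
  have := InMax.mul_left (O := O) (O.toSubring.neg_mem O.toSubring.one_mem) hf
  simpa using this

theorem InMax.sub (hf : InMax O f) (hg : InMax O g) : InMax O (f - g) := by
  rw [sub_eq_add_neg]; exact hf.add hg.neg

theorem not_inMax_one : ¬ InMax O (1 : F) := fun h =>
  (IsLocalRing.mem_maximalIdeal _).1 h.2 isUnit_one

theorem inv_mem_of_not_inMax (hf : f ∈ O.toSubring) (h : ¬ InMax O f) : f⁻¹ ∈ O.toSubring := by
  have hu : IsUnit (⟨f, hf⟩ : O.toSubring) := by
    by_contra hu
    exact h ⟨hf, (IsLocalRing.mem_maximalIdeal _).2 hu⟩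
  obtain ⟨⟨w, hw⟩, hw'⟩ := hu.exists_right_inv
  have h1 : f * w = 1 := congrArg Subtype.val hw'
  have : f⁻¹ = w := inv_eq_of_mul_eq_one_right h1
  rwa [this]

theorem ne_zero_of_not_inMax (h : ¬ InMax O f) : f ≠ 0 := fun h0 => h (h0 ▸ InMax.zero)

theorem not_inMax_of_inv_mem (h0 : f ≠ 0) (h : f⁻¹ ∈ O.toSubring) : ¬ InMax O f := fun hf =>
  not_inMax_one (O := O) (by have := InMax.mul_left h hf; rwa [inv_mul_cancel₀ h0] at this)

/-- Expresses the maximal ideal through membership in the ring alone, so that it can be transported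
along field automorphisms and compared for valuation rings. -/
theorem inMax_iff : InMax O f ↔ f ∈ O.toSubring ∧ (f = 0 ∨ f⁻¹ ∉ O.toSubring) := by
  constructor
  · intro h
    refine ⟨h.1, ?_⟩
    by_cases h0 : f = 0
    · exact Or.inl h0
    · exact Or.inr fun h' => not_inMax_of_inv_mem h0 h' h
  · rintro ⟨h, h0 | h'⟩
    · exact h0 ▸ InMax.zero
    · by_contra hn
      exact h' (inv_mem_of_not_inMax h hn)

theorem InMax.of_mul (hf : f ∈ O.toSubring) (hg : g ∈ O.toSubring) (h : InMax O (f * g)) :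
    InMax O f ∨ InMax O g := by
  by_contra hn
  rw [not_or] at hn
  refine not_inMax_of_inv_mem (mul_ne_zero (ne_zero_of_not_inMax hn.1)
    (ne_zero_of_not_inMax hn.2)) ?_ h
  rw [mul_inv]
  exact O.toSubring.mul_mem (inv_mem_of_not_inMax hf hn.1) (inv_mem_of_not_inMax hg hn.2)

/-- The order on local subrings is domination. An inclusion is a local homomorphism exactly when
nonunits stay nonunits, which is the form in which domination can be checked on values. -/
theorem localSubring_le_iff :
    O ≤ O' ↔ O.toSubring ≤ O'.toSubring ∧ ∀ f, InMax O f → InMax O' f := by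
  rw [LocalSubring.le_def]
  constructor
  · rintro ⟨h, hl⟩
    refine ⟨h, fun f hf => ?_⟩
    by_contra hn
    have h1 := inv_mem_of_not_inMax (h hf.1) hn
    have h0 := ne_zero_of_not_inMax hn
    have hu : IsUnit (Subring.inclusion h ⟨f, hf.1⟩) :=
      IsUnit.of_mul_eq_one ⟨f⁻¹, h1⟩ (Subtype.ext (mul_inv_cancel₀ h0))
    exact (IsLocalRing.mem_maximalIdeal _).1 hf.2 (hl.map_nonunit _ hu)
  · rintro ⟨h, hm⟩
    refine ⟨h, ⟨fun w hw => ?_⟩⟩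
    by_contra hn
    have h1 : InMax O' (w : F) := hm _ ⟨w.2, (IsLocalRing.mem_maximalIdeal _).2 hn⟩
    exact (IsLocalRing.mem_maximalIdeal _).1 h1.2 hw

theorem InMax.mono (h : O ≤ O') (hf : InMax O f) : InMax O' f := (localSubring_le_iff.1 h).2 f hf

theorem HasConst.mono (h : O.toSubring ≤ O'.toSubring) (hO : HasConst K O) : HasConst K O' :=
  fun a => h (hO a)

theorem HasVal.mono (h : O ≤ O') (hf : HasVal O f c) : HasVal O' f c :=
  ⟨hf.1.mono h.1, hf.2.mono h⟩

theorem HasVal.const (h : HasConst K O) (a : K) : HasVal O (algebraMap K F a) a :=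
  ⟨h, by rw [sub_self]; exact InMax.zero⟩

theorem HasVal.mem (h : HasVal O f c) : f ∈ O.toSubring := by
  have := O.toSubring.add_mem h.2.1 (h.1 c)
  rwa [sub_add_cancel] at this

theorem hasVal_zero_iff : HasVal O f (0 : K) ↔ HasConst K O ∧ InMax O f := by
  simp [HasVal]

theorem HasVal.inMax (h : HasVal O f (0 : K)) : InMax O f := (hasVal_zero_iff.1 h).2

theorem InMax.hasVal (hO : HasConst K O) (h : InMax O f) : HasVal O f (0 : K) :=
  hasVal_zero_iff.2 ⟨hO, h⟩

theorem HasVal.sub_const (h : HasVal O f c) : HasVal O (f - algebraMap K F c) (0 : K) :=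
  hasVal_zero_iff.2 h

theorem HasVal.add (hf : HasVal O f c) (hg : HasVal O g d) : HasVal O (f + g) (c + d) :=
  ⟨hf.1, by
    have := hf.2.add hg.2
    rw [map_add]; convert this using 1; ring⟩

theorem HasVal.neg (hf : HasVal O f c) : HasVal O (-f) (-c) :=
  ⟨hf.1, by
    have := hf.2.neg
    rw [map_neg]; convert this using 1; ring⟩

theorem HasVal.sub (hf : HasVal O f c) (hg : HasVal O g d) : HasVal O (f - g) (c - d) := by
  rw [sub_eq_add_neg, sub_eq_add_neg]; exact hf.add hg.neg

theorem HasVal.mul (hf : HasVal O f c) (hg : HasVal O g d) : HasVal O (f * g) (c * d) :=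
  ⟨hf.1, by
    have := (hf.2.mul_right hg.mem).add (InMax.mul_left (hf.1 c) hg.2)
    rw [map_mul]; convert this using 1; ring⟩

theorem HasVal.one (h : HasConst K O) : HasVal O (1 : F) (1 : K) := by
  have := HasVal.const (F := F) h 1
  rwa [map_one] at this

theorem HasVal.ofNat (h : HasConst K O) (n : ℕ) [n.AtLeastTwo] :
    HasVal O (OfNat.ofNat n : F) (OfNat.ofNat n : K) := by
  have := HasVal.const (F := F) h (OfNat.ofNat n)
  rwa [map_ofNat] at this

theorem HasVal.pow (hf : HasVal O f c) (n : ℕ) : HasVal O (f ^ n) (c ^ n) := by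
  induction n with
  | zero => simpa using HasVal.one hf.1
  | succ k ih => rw [pow_succ, pow_succ]; exact ih.mul hf

theorem HasVal.congr (hf : HasVal O f c) (h1 : f = g) (h2 : c = d) : HasVal O g d := h1 ▸ h2 ▸ hf

/-- The difference of two distinct values is a nonzero constant, hence a unit, and it would lie in
the maximal ideal. -/
theorem HasVal.unique (hf : HasVal O f c) (hf' : HasVal O f d) : c = d := by
  by_contra hn
  have h1 := hf'.sub hf
  rw [sub_self] at h1
  have h0 : (d - c) ≠ 0 := sub_ne_zero.2 (Ne.symm hn)
  have h2 := (HasVal.const (F := F) hf.1 (d - c)⁻¹).mul h1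
  rw [mul_zero, inv_mul_cancel₀ h0] at h2
  have h3 := h2.2.neg
  rw [map_one, zero_sub, neg_neg] at h3
  exact not_inMax_one h3

theorem HasVal.not_inMax (hf : HasVal O f c) (h : c ≠ 0) : ¬ InMax O f := fun h' =>
  h (hf.unique (h'.hasVal hf.1))

theorem HasVal.ne_zero (hf : HasVal O f c) (h : c ≠ 0) : f ≠ 0 :=
  ne_zero_of_not_inMax (hf.not_inMax h)

theorem HasVal.inv_mem (hf : HasVal O f c) (h : c ≠ 0) : f⁻¹ ∈ O.toSubring :=
  inv_mem_of_not_inMax hf.mem (hf.not_inMax h)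

theorem HasVal.inv (hf : HasVal O f c) (h : c ≠ 0) : HasVal O f⁻¹ c⁻¹ := by
  refine ⟨hf.1, ?_⟩
  have h0 : f ≠ 0 := hf.ne_zero h
  -- This is f⁻¹ - c⁻¹ = -(f - c) / (f c).
  have h1 : InMax O (-(f⁻¹ * algebraMap K F c⁻¹) * (f - algebraMap K F c)) :=
    InMax.mul_left (O.toSubring.neg_mem (O.toSubring.mul_mem (hf.inv_mem h) (hf.1 _))) hf.2
  convert h1 using 1
  have hc : algebraMap K F c ≠ 0 := by simpa using h
  rw [map_inv₀]
  field_simp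
  ring

theorem HasVal.div (hf : HasVal O f c) (hg : HasVal O g d) (h : d ≠ 0) :
    HasVal O (f / g) (c / d) := by
  rw [div_eq_mul_inv, div_eq_mul_inv]; exact hf.mul (hg.inv h)

theorem NoVal.mem (h : NoVal K O f) : f ∈ O.toSubring := h.2.1

theorem NoVal.not_hasVal (h : NoVal K O f) (c : K) : ¬ HasVal O f c := fun h' => h.2.2 c h'.2

theorem NoVal.not_inMax (h : NoVal K O f) : ¬ InMax O f := fun h' =>
  h.2.2 0 (by rwa [map_zero, sub_zero])

theorem NoVal.ne_zero (h : NoVal K O f) : f ≠ 0 := ne_zero_of_not_inMax h.not_inMax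

theorem NoVal.inv_mem (h : NoVal K O f) : f⁻¹ ∈ O.toSubring :=
  inv_mem_of_not_inMax h.mem h.not_inMax

theorem noVal_iff (hO : HasConst K O) :
    NoVal K O f ↔ f ∈ O.toSubring ∧ ∀ c : K, ¬ HasVal O f c :=
  ⟨fun h => ⟨h.2.1, h.not_hasVal⟩, fun h => ⟨hO, h.1, fun c hc => h.2 c ⟨hO, hc⟩⟩⟩

/-- For the local ring of a curve, `NoVal` means that the restriction is a nonconstant function. It
survives operations with functions whose restriction is constant, but not operations between two
nonconstant ones. -/
theorem NoVal.add (hf : NoVal K O f) (hg : HasVal O g c) : NoVal K O (f + g) := by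
  rw [noVal_iff hf.1]
  refine ⟨O.toSubring.add_mem hf.mem hg.mem, fun d hd => hf.not_hasVal (d - c) ?_⟩
  have := hd.sub hg
  rwa [add_sub_cancel_right] at this

theorem NoVal.sub (hf : NoVal K O f) (hg : HasVal O g c) : NoVal K O (f - g) := by
  rw [sub_eq_add_neg]; exact hf.add hg.neg

theorem NoVal.sub_const (hf : NoVal K O f) (c : K) : NoVal K O (f - algebraMap K F c) :=
  hf.sub (HasVal.const hf.1 c)

theorem NoVal.mul (hf : NoVal K O f) (hg : HasVal O g c) (h : c ≠ 0) : NoVal K O (f * g) := by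
  rw [noVal_iff hf.1]
  refine ⟨O.toSubring.mul_mem hf.mem hg.mem, fun d hd => hf.not_hasVal (d / c) ?_⟩
  have := hd.div hg h
  rwa [mul_div_cancel_right₀ _ (hg.ne_zero h)] at this

theorem NoVal.inv (hf : NoVal K O f) : NoVal K O f⁻¹ := by
  rw [noVal_iff hf.1]
  refine ⟨hf.inv_mem, fun d hd => ?_⟩
  by_cases h : d = 0
  · subst h
    have := InMax.mul_left hf.mem hd.inMax
    rw [mul_inv_cancel₀ hf.ne_zero] at this
    exact not_inMax_one this
  · exact hf.not_hasVal d⁻¹ (by simpa using hd.inv h)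

theorem NoVal.div (hf : NoVal K O f) (hg : HasVal O g c) (h : c ≠ 0) : NoVal K O (f / g) := by
  rw [div_eq_mul_inv]; exact hf.mul (hg.inv h) (inv_ne_zero h)

theorem HasVal.zero_mul_mem (hf : HasVal O f (0 : K)) (hg : g ∈ O.toSubring) :
    HasVal O (f * g) (0 : K) := (hf.inMax.mul_right hg).hasVal hf.1

theorem HasVal.zero_div_noVal (hf : HasVal O f (0 : K)) (hg : NoVal K O g) :
    HasVal O (f / g) (0 : K) := by
  rw [div_eq_mul_inv]; exact hf.zero_mul_mem hg.inv_mem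

end Calculus

end BirSurf

namespace BirSurf

/-! ## Orders along discrete valuation rings -/

section Ord

variable {F : Type*} [Field F] {V : ValuationSubring F}

theorem inMax_valuationSubring_iff {f : F} :
    InMax V.toLocalSubring f ↔ f ∈ V ∧ (f = 0 ∨ f⁻¹ ∉ V) := inMax_iff

theorem inv_mem_of_not_mem {f : F} (h : f ∉ V) : InMax V.toLocalSubring f⁻¹ := by
  rw [inMax_valuationSubring_iff]
  refine ⟨(V.mem_or_inv_mem f).resolve_left h, Or.inr ?_⟩
  rwa [inv_inv]

variable [IsDiscreteValuationRing V]

theorem ord_zero : ord V 0 = 0 := by simp [ord]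

theorem ord_one : ord V 1 = 0 := by simp [ord]

theorem ord_mul {f g : F} (hf : f ≠ 0) (hg : g ≠ 0) : ord V (f * g) = ord V f + ord V g := by
  simp only [ord, map_mul]
  rw [WithZero.log_mul (by simpa using hf) (by simpa using hg)]
  ring

theorem ord_inv (f : F) : ord V f⁻¹ = -ord V f := by
  simp only [ord, map_inv₀, WithZero.log_inv]

theorem ord_div {f g : F} (hf : f ≠ 0) (hg : g ≠ 0) : ord V (f / g) = ord V f - ord V g := by
  rw [div_eq_mul_inv, ord_mul hf (inv_ne_zero hg), ord_inv, sub_eq_add_neg]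

theorem ord_zpow (f : F) (n : ℤ) : ord V (f ^ n) = n * ord V f := by
  simp only [ord, map_zpow₀, WithZero.log_zpow, smul_eq_mul]
  ring

theorem ord_nonneg_iff {f : F} (hf : f ≠ 0) : 0 ≤ ord V f ↔ f ∈ V := by
  have h0 : ((IsDiscreteValuationRing.maximalIdeal V).valuation F f) ≠ 0 := by simpa using hf
  have h1 : 0 ≤ ord V f ↔ (IsDiscreteValuationRing.maximalIdeal V).valuation F f ≤ 1 := by
    rw [ord, neg_nonneg, WithZero.log_le_iff_le_exp h0, WithZero.exp_zero]
  rw [h1]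
  constructor
  · intro h
    obtain ⟨a, rfl⟩ := IsDiscreteValuationRing.exists_lift_of_le_one h
    exact a.2
  · intro h
    exact IsDedekindDomain.HeightOneSpectrum.valuation_le_one (K := F) _ (⟨f, h⟩ : V)

theorem ord_nonneg_of_mem {f : F} (h : f ∈ V) : 0 ≤ ord V f := by
  by_cases hf : f = 0
  · rw [hf, ord_zero]
  · exact (ord_nonneg_iff hf).2 h

theorem ord_pos_iff {f : F} (hf : f ≠ 0) : 0 < ord V f ↔ InMax V.toLocalSubring f := by
  rw [inMax_valuationSubring_iff, ← ord_nonneg_iff hf, ← ord_nonneg_iff (inv_ne_zero hf), ord_inv]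
  simp only [hf, false_or]
  omega

theorem ord_eq_zero {f : F} (h : f ∈ V) (hn : ¬ InMax V.toLocalSubring f) : ord V f = 0 := by
  have hf := ne_zero_of_not_inMax hn
  have h1 := ord_nonneg_of_mem h
  rw [← ord_pos_iff hf] at hn
  omega

theorem not_inMax_of_ord_eq_zero {f : F} (hf : f ≠ 0) (h : ord V f = 0) :
    f ∈ V ∧ ¬ InMax V.toLocalSubring f := by
  rw [← ord_pos_iff hf, ← ord_nonneg_iff hf]
  omega

theorem exists_ord_eq_one (V : ValuationSubring F) [IsDiscreteValuationRing V] :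
    ∃ f : F, f ≠ 0 ∧ ord V f = 1 := by
  obtain ⟨p, hp⟩ := (IsDiscreteValuationRing.maximalIdeal V).valuation_exists_uniformizer F
  refine ⟨p, ?_, ?_⟩
  · rintro rfl
    rw [map_zero] at hp
    exact WithZero.exp_ne_zero hp.symm
  · rw [ord, hp, WithZero.log_exp]
    norm_num

/-- Some element has order 1. Writing it as a power of p times a unit exhibits 1 as a multiple of
the positive integer ord p. -/
theorem ord_eq_one_of_generates {p : F} (hp : InMax V.toLocalSubring p)
    (h : ∀ f : F, f ≠ 0 → ∃ n : ℤ, ∃ w : F, w ∈ V ∧ ¬ InMax V.toLocalSubring w ∧ f = p ^ n * w) :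
    ord V p = 1 := by
  obtain ⟨f, hf, hf1⟩ := exists_ord_eq_one V
  obtain ⟨n, w, hw, hw', rfl⟩ := h f hf
  -- If p = 0, only the exponent 0 gives a nonzero element, and that element is then a unit of order
  -- 0 rather than 1.
  have hp0 : p ≠ 0 := by
    rintro rfl
    by_cases hn : n = 0
    · subst hn
      rw [zpow_zero, one_mul, ord_eq_zero hw hw'] at hf1
      norm_num at hf1
    · rw [zero_zpow n hn, zero_mul] at hf
      exact hf rfl
  rw [ord_mul (zpow_ne_zero n hp0) (ne_zero_of_not_inMax hw'), ord_zpow, ord_eq_zero hw hw',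
    add_zero] at hf1
  have := (ord_pos_iff hp0).2 hp
  exact Int.eq_one_or_neg_one_of_mul_eq_one' hf1 |>.elim (fun h => h.2) (fun h => by omega)

/-- Transport along σ preserves units, so it multiplies orders by the constant ord(σ p) for a
uniformizer p. Since both orders attain 1 and ord(σ p) is positive, the constant is 1. -/
theorem ord_map {F' : Type*} [Field F'] {V' : ValuationSubring F'} [IsDiscreteValuationRing V']
    (σ : F ≃+* F') (h : ∀ f, f ∈ V ↔ σ f ∈ V') (f : F) : ord V' (σ f) = ord V f := by
  have hmax : ∀ f, InMax V.toLocalSubring f ↔ InMax V'.toLocalSubring (σ f) := by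
    intro f
    rw [inMax_valuationSubring_iff, inMax_valuationSubring_iff, ← map_inv₀, ← h, ← h]
    simp
  obtain ⟨p, hp, hp1⟩ := exists_ord_eq_one V
  have key : ∀ f, f ≠ 0 → ord V' (σ f) = ord V f * ord V' (σ p) := by
    intro f hf
    have h1 : ord V (f / p ^ (ord V f)) = 0 := by
      rw [ord_div hf (zpow_ne_zero _ hp), ord_zpow, hp1]; ring
    have h2 := not_inMax_of_ord_eq_zero (div_ne_zero hf (zpow_ne_zero _ hp)) h1
    have h3 : ord V' (σ (f / p ^ (ord V f))) = 0 :=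
      ord_eq_zero ((h _).1 h2.1) (fun h' => h2.2 ((hmax _).2 h'))
    rw [map_div₀, map_zpow₀, ord_div (by simpa using hf)
      (zpow_ne_zero _ (by simpa using hp)), ord_zpow] at h3
    linarith
  have hone : ord V' (σ p) = 1 := by
    obtain ⟨g, hg, hg1⟩ := exists_ord_eq_one V'
    have := key (σ.symm g) (by simpa using hg)
    rw [RingEquiv.apply_symm_apply, hg1] at this
    have hpos : 0 < ord V' (σ p) :=
      (ord_pos_iff (by simpa using hp)).2 ((hmax p).1 ((ord_pos_iff hp).1 (by omega)))
    exact Int.eq_one_or_neg_one_of_mul_eq_one' this.symm |>.elim (fun h => h.2)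
      (fun h => by omega)
  by_cases hf : f = 0
  · rw [hf, map_zero, ord_zero, ord_zero]
  · rw [key f hf, hone, mul_one]

theorem valuationSubring_ne_top (V : ValuationSubring F) [IsDiscreteValuationRing V] : V ≠ ⊤ := by
  rintro rfl
  obtain ⟨f, hf, hf1⟩ := exists_ord_eq_one (⊤ : ValuationSubring F)
  have := (ord_nonneg_iff (V := ⊤) (inv_ne_zero hf)).2 (ValuationSubring.mem_top _)
  rw [ord_inv] at this
  omega

end Ord

/-! ## Localization of a factorial ring at a prime element -/

section PrimeVal

variable {R F : Type*} [CommRing R] [IsDomain R] [UniqueFactorizationMonoid R] [Field F]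

/-- The injective ring homomorphism `ι : R → F` makes `F` the fraction field of `R`. -/
structure FracHom (ι : R →+* F) : Prop where
  inj : Function.Injective ι
  frac : ∀ f : F, ∃ a b : R, b ≠ 0 ∧ f = ι a / ι b

variable {ι : R →+* F} (hι : FracHom ι) {p : R} (hp : Prime p)

include hι in
omit [IsDomain R] [UniqueFactorizationMonoid R] in
theorem FracHom.ne_zero {a : R} (h : a ≠ 0) : ι a ≠ 0 := (map_ne_zero_iff _ hι.inj).2 h

include hι hp in
theorem FracHom.exists_zpow {f : F} (hf : f ≠ 0) :
    ∃ n : ℤ, ∃ a b : R, ¬ p ∣ a ∧ ¬ p ∣ b ∧ f = ι p ^ n * (ι a / ι b) := by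
  obtain ⟨a, b, hb, rfl⟩ := hι.frac f
  have ha : a ≠ 0 := by
    rintro rfl
    simp at hf
  obtain ⟨i, a', ha', rfl⟩ := WfDvdMonoid.max_power_factor ha hp.irreducible
  obtain ⟨j, b', hb', rfl⟩ := WfDvdMonoid.max_power_factor hb hp.irreducible
  refine ⟨i - j, a', b', ha', hb', ?_⟩
  rw [zpow_sub₀ (hι.ne_zero hp.ne_zero), map_mul, map_mul, map_pow, map_pow, zpow_natCast,
    zpow_natCast, mul_div_mul_comm]

/-- The localization of `R` at the prime element `p`, inside the fraction field. -/
def primeVal : ValuationSubring F where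
  carrier := {f | ∃ a b : R, ¬ p ∣ b ∧ f = ι a / ι b}
  mul_mem' := by
    rintro _ _ ⟨a, b, hb, rfl⟩ ⟨c, d, hd, rfl⟩
    exact ⟨a * c, b * d, hp.not_dvd_mul hb hd, by rw [map_mul, map_mul, div_mul_div_comm]⟩
  one_mem' := ⟨1, 1, hp.not_dvd_one, by simp⟩
  add_mem' := by
    rintro _ _ ⟨a, b, hb, rfl⟩ ⟨c, d, hd, rfl⟩
    refine ⟨a * d + b * c, b * d, hp.not_dvd_mul hb hd, ?_⟩
    have h1 : ι b ≠ 0 := hι.ne_zero (fun h => hb (h ▸ dvd_zero p))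
    have h2 : ι d ≠ 0 := hι.ne_zero (fun h => hd (h ▸ dvd_zero p))
    rw [map_add, map_mul, map_mul, map_mul, div_add_div _ _ h1 h2]
  zero_mem' := ⟨0, 1, hp.not_dvd_one, by simp⟩
  neg_mem' := by
    rintro _ ⟨a, b, hb, rfl⟩
    exact ⟨-a, b, hb, by rw [map_neg, neg_div]⟩
  mem_or_inv_mem' := by
    intro f
    by_cases hf : f = 0
    · exact Or.inl ⟨0, 1, hp.not_dvd_one, by simp [hf]⟩
    obtain ⟨n, a, b, ha, hb, rfl⟩ := hι.exists_zpow hp hf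
    rcases le_total 0 n with hn | hn
    · obtain ⟨k, rfl⟩ := Int.eq_ofNat_of_zero_le hn
      exact Or.inl ⟨p ^ k * a, b, hb, by rw [map_mul, map_pow]; simp [mul_div_assoc]⟩
    · obtain ⟨k, hk⟩ := Int.eq_ofNat_of_zero_le (neg_nonneg.2 hn)
      refine Or.inr ⟨p ^ k * b, a, ha, ?_⟩
      have : n = -(k : ℤ) := by omega
      rw [map_mul, map_pow, this, mul_inv, ← zpow_neg, neg_neg, zpow_natCast, inv_div,
        mul_div_assoc]

theorem mem_primeVal (a : R) : ι a ∈ primeVal hι hp := ⟨a, 1, hp.not_dvd_one, by simp⟩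

theorem inMax_primeVal_iff (a : R) : InMax (primeVal hι hp).toLocalSubring (ι a) ↔ p ∣ a := by
  rw [inMax_valuationSubring_iff]
  constructor
  · rintro ⟨-, h | h⟩
    · rw [(map_eq_zero_iff _ hι.inj).1 h]; exact dvd_zero p
    · by_contra hn
      exact h ⟨1, a, hn, by simp⟩
  · intro h
    refine ⟨mem_primeVal hι hp a, or_iff_not_imp_left.2 ?_⟩
    rintro h0 ⟨c, d, hd, hcd⟩
    have hd0 : ι d ≠ 0 := hι.ne_zero (fun h => hd (h ▸ dvd_zero p))
    rw [eq_div_iff hd0, inv_mul_eq_iff_eq_mul₀ h0, ← map_mul] at hcd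
    exact hd (by rw [hι.inj hcd]; exact h.mul_right c)

theorem exists_zpow_unit {f : F} (hf : f ≠ 0) : ∃ n : ℤ, ∃ w : F, w ∈ primeVal hι hp ∧
    ¬ InMax (primeVal hι hp).toLocalSubring w ∧ f = ι p ^ n * w := by
  obtain ⟨n, a, b, ha, hb, rfl⟩ := hι.exists_zpow hp hf
  have ha0 : a ≠ 0 := fun h => ha (h ▸ dvd_zero p)
  have hb0 : b ≠ 0 := fun h => hb (h ▸ dvd_zero p)
  refine ⟨n, _, ⟨a, b, hb, rfl⟩, ?_, rfl⟩
  rw [inMax_valuationSubring_iff]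
  rintro ⟨-, h | h⟩
  · exact div_ne_zero (hι.ne_zero ha0) (hι.ne_zero hb0) h
  · exact h ⟨b, a, ha, by rw [inv_div]⟩

instance isDiscreteValuationRing_primeVal : IsDiscreteValuationRing (primeVal hι hp) := by
  set V := primeVal hι hp
  have hpm : InMax V.toLocalSubring (ι p) := (inMax_primeVal_iff hι hp p).2 dvd_rfl
  let P : V := ⟨ι p, hpm.1⟩
  have hP0 : P ≠ 0 := fun h => hι.ne_zero hp.ne_zero (congrArg Subtype.val h)
  have hform : ∀ z : V, z ≠ 0 → ∃ n : ℕ, ∃ w : V, IsUnit w ∧ z = P ^ n * w := by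
    intro z hz
    obtain ⟨n, w, hw, hw', hzw⟩ := exists_zpow_unit hι hp (f := (z : F)) (by simpa using hz)
    have hwi : w⁻¹ ∈ V := inv_mem_of_not_inMax hw hw'
    have hw0 := ne_zero_of_not_inMax hw'
    have hun : IsUnit (⟨w, hw⟩ : V) :=
      IsUnit.of_mul_eq_one ⟨w⁻¹, hwi⟩ (Subtype.ext (mul_inv_cancel₀ hw0))
    rcases le_or_gt 0 n with hn | hn
    · obtain ⟨k, rfl⟩ := Int.eq_ofNat_of_zero_le hn
      exact ⟨k, ⟨w, hw⟩, hun, Subtype.ext (by simpa [P] using hzw)⟩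
    · exfalso
      obtain ⟨k, hk⟩ := Int.eq_ofNat_of_zero_le (show 0 ≤ -n - 1 by omega)
      have hnk : n = -((k : ℤ) + 1) := by omega
      refine not_inMax_of_inv_mem (hι.ne_zero hp.ne_zero) ?_ hpm
      have h1 : (ι p)⁻¹ = ι p ^ k * ((z : F) * w⁻¹) := by
        rw [hzw, hnk, mul_inv_cancel_right₀ hw0, zpow_neg, zpow_add₀ (hι.ne_zero hp.ne_zero),
          zpow_natCast, zpow_one]
        have := hι.ne_zero hp.ne_zero
        field_simp
      rw [h1]
      exact V.mul_mem _ _ (pow_mem hpm.1 k) (V.mul_mem _ _ z.2 hwi)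
  refine IsDiscreteValuationRing.ofHasUnitMulPowIrreducibleFactorization ⟨P, ?_, ?_⟩
  · refine IsDiscreteValuationRing.irreducible_of_span_eq_maximalIdeal P hP0 ?_
    ext z
    rw [Ideal.mem_span_singleton]
    constructor
    · intro hz
      by_cases hz0 : z = 0
      · rw [hz0]; exact dvd_zero P
      obtain ⟨n, w, hw, rfl⟩ := hform z hz0
      cases n with
      | zero => rw [pow_zero, one_mul] at hz; exact absurd hw ((IsLocalRing.mem_maximalIdeal _).1 hz)
      | succ k => exact (dvd_pow_self P k.succ_ne_zero).mul_right w
    · rintro ⟨w, rfl⟩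
      exact Ideal.mul_mem_right _ _ hpm.2
  · intro z hz
    obtain ⟨n, w, hw, rfl⟩ := hform z hz
    exact ⟨n, hw.unit, rfl⟩

theorem ord_primeVal_self : ord (primeVal hι hp) (ι p) = 1 :=
  ord_eq_one_of_generates ((inMax_primeVal_iff hι hp p).2 dvd_rfl)
    (fun _ hf => exists_zpow_unit hι hp hf)

/-- A discrete valuation ring has rank one, so its only proper overring in the field is the field
itself. -/
theorem primeVal_eq_of_le {V : ValuationSubring F} (h : primeVal hι hp ≤ V) (hV : V ≠ ⊤) :
    primeVal hι hp = V :=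
  (primeVal hι hp).eq_of_le_of_ne_top h hV

include hp in
-- The hypotheses make every element of R prime to p a unit of V. Hence V contains the localization
-- at p, and maximality of that ring gives equality.
theorem eq_primeVal {V : ValuationSubring F} (hV : V ≠ ⊤)
    (h : ∀ a, ι a ∈ V) (hn : ∀ a, InMax V.toLocalSubring (ι a) → p ∣ a) :
    V = primeVal hι hp := by
  refine (primeVal_eq_of_le hι hp ?_ hV).symm
  rintro f ⟨a, b, hb, rfl⟩
  rw [div_eq_mul_inv]
  exact V.mul_mem _ _ (h a) (inv_mem_of_not_inMax (O := V.toLocalSubring) (h b)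
    fun h' => hb (hn b h'))

end PrimeVal

end BirSurf

namespace BirSurf

/-! ## Local rings of points of planes -/

section PlanePoint

variable {K : Type*} [Field K]

/-- The functions `u, v` generate the function field. -/
def Gen (u v : FunField K) : Prop := IntermediateField.adjoin K {u, v} = ⊤

/-- The substitution of `u, v` into polynomials in two variables. -/
noncomputable abbrev polyHom (u v : FunField K) : MvPolynomial (Fin 2) K →+* FunField K :=
  (MvPolynomial.aeval (R := K) ![u, v] : MvPolynomial (Fin 2) K →ₐ[K] FunField K)

theorem polyHom_X0 (u v : FunField K) : polyHom u v (MvPolynomial.X 0) = u := by simp [polyHom]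

theorem polyHom_X1 (u v : FunField K) : polyHom u v (MvPolynomial.X 1) = v := by simp [polyHom]

theorem polyHom_C (u v : FunField K) (a : K) :
    polyHom u v (MvPolynomial.C a) = algebraMap K (FunField K) a := by simp [polyHom]

variable {u v u' v' : FunField K}

theorem gen_xy : Gen (FunField.x K) (FunField.y K) := FunField.adjoin_xy K

theorem Gen.of_mem (h : Gen u v) (hu : u ∈ IntermediateField.adjoin K {u', v'})
    (hv : v ∈ IntermediateField.adjoin K {u', v'}) : Gen u' v' := by
  rw [Gen, eq_top_iff, ← h, IntermediateField.adjoin_le_iff]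
  rintro z (rfl | rfl)
  · exact hu
  · exact hv

theorem mem_adjoin_left : u ∈ IntermediateField.adjoin K {u, v} :=
  IntermediateField.subset_adjoin K _ (Or.inl rfl)

theorem mem_adjoin_right : v ∈ IntermediateField.adjoin K {u, v} :=
  IntermediateField.subset_adjoin K _ (Or.inr rfl)

theorem const_mem_adjoin (a : K) :
    algebraMap K (FunField K) a ∈ IntermediateField.adjoin K {u, v} :=
  IntermediateField.algebraMap_mem _ a

theorem Gen.swap (h : Gen u v) : Gen v u := h.of_mem mem_adjoin_right mem_adjoin_left

theorem Gen.sub_const (h : Gen u v) (a b : K) :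
    Gen (u - algebraMap K _ a) (v - algebraMap K _ b) := by
  refine h.of_mem ?_ ?_
  · have := add_mem (mem_adjoin_left (u := u - algebraMap K _ a) (v := v - algebraMap K _ b))
      (const_mem_adjoin a)
    rwa [sub_add_cancel] at this
  · have := add_mem (mem_adjoin_right (u := u - algebraMap K _ a) (v := v - algebraMap K _ b))
      (const_mem_adjoin b)
    rwa [sub_add_cancel] at this

theorem Gen.injective (h : Gen u v) : Function.Injective (polyHom u v) :=
  FunField.aeval_injective u v h

theorem Gen.fracHom (h : Gen u v) : FracHom (polyHom u v) where
  inj := h.injective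
  frac := by
    intro f
    have hf : f ∈ IntermediateField.adjoin K ({u, v} : Set (FunField K)) := by
      rw [h]; exact IntermediateField.mem_top
    rw [IntermediateField.mem_adjoin_iff_div] at hf
    obtain ⟨r, hr, s, hs, rfl⟩ := hf
    have hset : ({u, v} : Set (FunField K)) = Set.range ![u, v] := by simp [Set.pair_comm]
    rw [hset, Algebra.adjoin_range_eq_range_aeval] at hr hs
    obtain ⟨a, rfl⟩ := hr
    obtain ⟨b, rfl⟩ := hs
    by_cases hb : b = 0
    · exact ⟨0, 1, one_ne_zero, by simp [hb]⟩
    · exact ⟨a, b, hb, rfl⟩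

theorem Gen.left_ne_const (h : Gen u v) (a : K) : u ≠ algebraMap K _ a := by
  intro h0
  have h1 : polyHom u v (MvPolynomial.X 0) = polyHom u v (MvPolynomial.C a) := by
    rw [polyHom_X0, polyHom_C, h0]
  have h2 := congrArg (MvPolynomial.eval ![a + 1, 0]) (h.injective h1)
  simp at h2

theorem Gen.left_ne_zero (h : Gen u v) : u ≠ 0 := by simpa using h.left_ne_const 0

theorem Gen.right_ne_zero (h : Gen u v) : v ≠ 0 := h.swap.left_ne_zero

theorem Gen.div_left (h : Gen u v) : Gen u (v / u) := by
  refine h.of_mem mem_adjoin_left ?_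
  have := mul_mem (mem_adjoin_right (u := u) (v := v / u)) (mem_adjoin_left (u := u) (v := v / u))
  rwa [div_mul_cancel₀ _ h.left_ne_zero] at this

theorem Gen.blow_left (h : Gen u v) (c : K) : Gen u (v / u - algebraMap K _ c) := by
  simpa using h.div_left.sub_const 0 c

theorem Gen.blow_right (h : Gen u v) : Gen v (u / v) := h.swap.div_left

variable {O : LocalSubring (FunField K)} {f : FunField K} {a b c : K}

theorem HasVal.polyHom (hu : HasVal O u a) (hv : HasVal O v b) (P : MvPolynomial (Fin 2) K) :
    HasVal O (polyHom u v P) (MvPolynomial.eval ![a, b] P) := by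
  induction P using MvPolynomial.induction_on with
  | C c =>
    rw [polyHom_C, MvPolynomial.eval_C]
    exact HasVal.const hu.1 c
  | add p q hp hq =>
    rw [map_add, map_add]; exact hp.add hq
  | mul_X p i hp =>
    rw [map_mul, map_mul]
    refine hp.mul ?_
    fin_cases i
    · simpa using hu
    · simpa using hv

theorem mem_planePoint_iff : f ∈ (planePoint u v).toSubring ↔
    ∃ P Q : MvPolynomial (Fin 2) K, MvPolynomial.eval ![0, 0] Q ≠ 0 ∧
      polyHom u v Q ≠ 0 ∧ f = polyHom u v P / polyHom u v Q := Iff.rfl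

theorem hasConst_planePoint (u v : FunField K) : HasConst K (planePoint u v) := fun a =>
  ⟨MvPolynomial.C a, 1, by simp, by simp, by simp⟩

theorem Gen.inMax_planePoint (h : Gen u v) {P Q : MvPolynomial (Fin 2) K}
    (hP : MvPolynomial.eval ![0, 0] P = 0) (hQ : MvPolynomial.eval ![0, 0] Q ≠ 0) :
    InMax (planePoint u v) (polyHom u v P / polyHom u v Q) := by
  have hQ0 : polyHom u v Q ≠ 0 :=
    h.fracHom.ne_zero (fun h0 => hQ (by rw [h0, map_zero]))
  rw [inMax_iff]
  refine ⟨⟨P, Q, hQ, hQ0, rfl⟩, or_iff_not_imp_left.2 ?_⟩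
  rintro h0 ⟨A, B, hB, hB0, hAB⟩
  change polyHom u v B ≠ 0 at hB0
  rw [inv_div] at hAB
  have hP0 : polyHom u v P ≠ 0 := fun h' => h0 (by rw [h', zero_div])
  change _ = polyHom u v A / polyHom u v B at hAB
  rw [div_eq_div_iff hP0 hB0, ← map_mul, ← map_mul] at hAB
  have := congrArg (MvPolynomial.eval ![0, 0]) (h.injective hAB)
  rw [map_mul, map_mul, hP, mul_zero] at this
  exact mul_ne_zero hQ hB this

theorem Gen.hasVal_left (h : Gen u v) : HasVal (planePoint u v) u (0 : K) := by
  refine InMax.hasVal (hasConst_planePoint u v) ?_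
  have := h.inMax_planePoint (P := MvPolynomial.X 0) (Q := 1) (by simp) (by simp)
  simpa using this

theorem Gen.hasVal_right (h : Gen u v) : HasVal (planePoint u v) v (0 : K) := by
  refine InMax.hasVal (hasConst_planePoint u v) ?_
  have := h.inMax_planePoint (P := MvPolynomial.X 1) (Q := 1) (by simp) (by simp)
  simpa using this

/-- The residue field of such a point is K: the value is read off from numerator and denominator at
the origin. -/
theorem Gen.exists_hasVal (h : Gen u v) (hf : f ∈ (planePoint u v).toSubring) :
    ∃ c : K, HasVal (planePoint u v) f c := by
  obtain ⟨P, Q, hQ, -, rfl⟩ := hf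
  exact ⟨_, (HasVal.polyHom h.hasVal_left h.hasVal_right P).div
    (HasVal.polyHom h.hasVal_left h.hasVal_right Q) hQ⟩

/-- The basic tool of the whole argument. Once u and v vanish in O, a quotient P/Q with Q(0, 0) ≠ 0
has the value P(0, 0)/Q(0, 0) there, so both membership and vanishing are inherited. Every later
claim about the centre of a valuation or the image of a point is thereby reduced to two values. -/
theorem planePoint_le (hu : HasVal O u (0 : K)) (hv : HasVal O v (0 : K)) : planePoint u v ≤ O := by
  have hval : ∀ P Q : MvPolynomial (Fin 2) K, MvPolynomial.eval ![0, 0] Q ≠ 0 →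
      HasVal O (polyHom u v P / polyHom u v Q)
        (MvPolynomial.eval ![0, 0] P / MvPolynomial.eval ![0, 0] Q) :=
    fun P Q hQ => (hu.polyHom hv P).div (hu.polyHom hv Q) hQ
  rw [localSubring_le_iff]
  refine ⟨?_, ?_⟩
  · rintro _ ⟨P, Q, hQ, -, rfl⟩
    exact (hval P Q hQ).mem
  · rintro _ hf
    obtain ⟨P, Q, hQ, hQ0, rfl⟩ := hf.1
    by_cases hP : MvPolynomial.eval ![0, 0] P = 0
    · have := hval P Q hQ
      rw [hP, zero_div] at this
      exact this.inMax
    · exfalso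
      have hP0 : polyHom u v P ≠ 0 := (hu.polyHom hv P).ne_zero hP
      exact not_inMax_of_inv_mem (O := planePoint u v) (div_ne_zero hP0 hQ0)
        (mem_planePoint_iff.2 ⟨Q, P, hP, hP0, inv_div _ _⟩) hf

theorem planePoint_eq (hu : HasVal (planePoint u v) u' (0 : K))
    (hv : HasVal (planePoint u v) v' (0 : K)) (hu' : HasVal (planePoint u' v') u (0 : K))
    (hv' : HasVal (planePoint u' v') v (0 : K)) : planePoint u v = planePoint u' v' :=
  le_antisymm (planePoint_le hu' hv') (planePoint_le hu hv)

theorem Gen.hasVal_of_le (h : Gen u v) (hO : planePoint u v ≤ O) :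
    HasVal O u (0 : K) ∧ HasVal O v (0 : K) := ⟨h.hasVal_left.mono hO, h.hasVal_right.mono hO⟩

theorem exists_eq_X_mul_add (P : MvPolynomial (Fin 2) K) :
    ∃ A B : MvPolynomial (Fin 2) K, P = MvPolynomial.C (MvPolynomial.eval ![0, 0] P) +
      (MvPolynomial.X 0 * A + MvPolynomial.X 1 * B) := by
  induction P using MvPolynomial.induction_on with
  | C c => exact ⟨0, 0, by simp⟩
  | add p q hp hq =>
    obtain ⟨A, B, h⟩ := hp
    obtain ⟨A', B', h'⟩ := hq
    refine ⟨A + A', B + B', ?_⟩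
    rw [map_add, map_add]
    linear_combination h + h'
  | mul_X p i hp =>
    fin_cases i
    · exact ⟨p, 0, by simp [mul_comm]⟩
    · exact ⟨0, p, by simp [mul_comm]⟩

/-- The maximal ideal of the point is generated by u and v; the numerator of f has no constant term.
-/
theorem Gen.exists_eq_of_inMax (h : Gen u v) (hf : InMax (planePoint u v) f) :
    ∃ a ∈ (planePoint u v).toSubring, ∃ b ∈ (planePoint u v).toSubring, f = a * u + b * v := by
  obtain ⟨P, Q, hQ, hQ0, rfl⟩ := hf.1
  change polyHom u v Q ≠ 0 at hQ0
  change InMax (planePoint u v) (polyHom u v P / polyHom u v Q) at hf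
  have hP : MvPolynomial.eval ![0, 0] P = 0 := by
    have h1 := ((HasVal.polyHom h.hasVal_left h.hasVal_right P).div
      (HasVal.polyHom h.hasVal_left h.hasVal_right Q) hQ).unique
      (hf.hasVal (hasConst_planePoint u v))
    exact (div_eq_zero_iff.1 h1).resolve_right hQ
  obtain ⟨A, B, h⟩ := exists_eq_X_mul_add P
  rw [hP, map_zero, zero_add] at h
  refine ⟨_, ⟨A, Q, hQ, hQ0, rfl⟩, _, ⟨B, Q, hQ, hQ0, rfl⟩, ?_⟩
  change polyHom u v P / polyHom u v Q =
    polyHom u v A / polyHom u v Q * u + polyHom u v B / polyHom u v Q * v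
  have h2 : polyHom u v P = u * polyHom u v A + v * polyHom u v B := by
    conv_lhs => rw [h]
    rw [map_add, map_mul, map_mul, polyHom_X0, polyHom_X1]
  rw [h2]
  field_simp

end PlanePoint

end BirSurf

namespace BirSurf

/-! ## Models: the plane and its blow-ups -/

section Model

variable {K : Type*} [Field K]

/-- The elements of the local ring are rational expressions in u' and v', and they include u and v.
So being a system of generators depends only on the local ring. -/
theorem Gen.of_planePoint_eq {u v u' v' : FunField K} (h : Gen u v)
    (he : planePoint u v = planePoint u' v') : Gen u' v' := by
  have key : ∀ f ∈ (planePoint u' v').toSubring, f ∈ IntermediateField.adjoin K {u', v'} := by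
    have hp : ∀ P : MvPolynomial (Fin 2) K,
        polyHom u' v' P ∈ IntermediateField.adjoin K {u', v'} := by
      intro P
      induction P using MvPolynomial.induction_on with
      | C c => rw [polyHom_C]; exact const_mem_adjoin c
      | add p q hp hq => rw [map_add]; exact add_mem hp hq
      | mul_X p i hp =>
        rw [map_mul]
        refine mul_mem hp ?_
        fin_cases i
        · simpa using mem_adjoin_left
        · simpa using mem_adjoin_right
    rintro _ ⟨P, Q, -, -, rfl⟩
    exact div_mem (hp P) (hp Q)
  rw [← he] at key
  exact h.of_mem (key _ h.hasVal_left.mem) (key _ h.hasVal_right.mem)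

/-- The points of the exceptional curve over the point with coordinates `u, v`. -/
def StdOver (u v : FunField K) (O' : LocalSubring (FunField K)) : Prop :=
  (∃ c : K, O' = planePoint u (v / u - algebraMap K (FunField K) c)) ∨ O' = planePoint v (u / v)

theorem le_of_stdOver {u v : FunField K} (h : Gen u v) {O' : LocalSubring (FunField K)}
    (hO : StdOver u v O') : planePoint u v ≤ O' := by
  rcases hO with ⟨c, rfl⟩ | rfl
  · have h1 := (h.blow_left c).hasVal_left
    have h2 := (h.blow_left c).hasVal_right
    refine planePoint_le h1 ?_
    have := h1.mul (h2.add (HasVal.const h1.1 c))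
    exact this.congr (by have := h.left_ne_zero; field_simp; ring) (by ring)
  · have h1 := h.blow_right.hasVal_left
    have h2 := h.blow_right.hasVal_right
    refine planePoint_le ?_ h1
    exact (h1.mul h2).congr (by have := h.right_ne_zero; field_simp) (by ring)

/-- Here u is u' times a unit of O', so u is also an equation of the exceptional curve near O' and
v/u = q/p is regular there, with some value c. The chart point A with coordinates u, v/u - c is
dominated by O'. Conversely u'/u is a unit of A, as otherwise its image p⁻¹ would vanish in O', so
v'/u' is regular on A with the right value and A dominates O'. -/
theorem eq_blow_of_unit {u v u' v' p q : FunField K} (h : Gen u v)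
    (he : planePoint u v = planePoint u' v') (c' : K) {O' : LocalSubring (FunField K)}
    (hO' : O' = planePoint u' (v' / u' - algebraMap K (FunField K) c'))
    (hp : u = u' * p) (hq : v = u' * q) (hqO : q ∈ O'.toSubring) (hpO : p ∈ O'.toSubring)
    (hpu : ¬ InMax O' p) : ∃ c : K, O' = planePoint u (v / u - algebraMap K (FunField K) c) ∧
      HasVal O' (q / p) c := by
  have h' : Gen u' v' := h.of_planePoint_eq he
  have hb := h'.blow_left c'
  have hu'0 := h'.left_ne_zero
  have hu0 := h.left_ne_zero
  have hp0 := ne_zero_of_not_inMax hpu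
  have hle : planePoint u' v' ≤ O' := hO' ▸ le_of_stdOver h' (Or.inl ⟨c', rfl⟩)
  have hqp : q / p ∈ O'.toSubring := by
    rw [div_eq_mul_inv]; exact O'.toSubring.mul_mem hqO (inv_mem_of_not_inMax hpO hpu)
  obtain ⟨c, hc⟩ := hb.exists_hasVal (hO' ▸ hqp)
  rw [← hO'] at hc
  have hvu : v / u = q / p := by rw [hp, hq]; field_simp
  have hle1 : planePoint u v ≤ O' := he ▸ hle
  have hA := h.blow_left c
  set A := planePoint u (v / u - algebraMap K (FunField K) c) with hAdef
  have hAO : A ≤ O' := by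
    refine planePoint_le (h.hasVal_of_le hle1).1 ?_
    rw [hvu]; exact hc.sub_const
  have hOA : planePoint u v ≤ A := le_of_stdOver h (Or.inl ⟨c, rfl⟩)
  have hvuA : v / u ∈ A.toSubring := by
    have := (hA.hasVal_right.add (HasVal.const hA.hasVal_right.1 c)).mem
    rwa [sub_add_cancel] at this
  have hmul : ∀ f, InMax (planePoint u v) f → f / u ∈ A.toSubring := by
    intro f hf
    obtain ⟨a, ha, b, hb, rfl⟩ := h.exists_eq_of_inMax hf
    have : (a * u + b * v) / u = a + b * (v / u) := by field_simp
    rw [this]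
    exact A.toSubring.add_mem (hOA.1 ha) (A.toSubring.mul_mem (hOA.1 hb) hvuA)
  have hu'm : InMax (planePoint u v) u' := he ▸ h'.hasVal_left.inMax
  have hv'm : InMax (planePoint u v) v' := he ▸ h'.hasVal_right.inMax
  have hinv : (u' / u)⁻¹ ∈ A.toSubring := by
    refine inv_mem_of_not_inMax (hmul u' hu'm) fun hn => ?_
    have h1 := hn.mono hAO
    have h2 : u' / u = p⁻¹ := by rw [hp]; field_simp
    rw [h2] at h1
    exact not_inMax_one (by simpa [hp0] using InMax.mul_left hpO h1)
  have hvA : v' / u' ∈ A.toSubring := by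
    have : v' / u' = (v' / u) * (u' / u)⁻¹ := by field_simp
    rw [this]
    exact A.toSubring.mul_mem (hmul v' hv'm) hinv
  obtain ⟨e, hev⟩ := hA.exists_hasVal hvA
  have hec : e = c' := by
    refine (hev.mono hAO).unique ?_
    rw [hO']
    exact (hb.hasVal_right.add (HasVal.const hb.hasVal_right.1 c')).congr (by ring) (by ring)
  refine ⟨c, le_antisymm ?_ hAO, hc⟩
  rw [hO']
  refine planePoint_le ((hu'm.hasVal (hasConst_planePoint u v)).mono hOA) ?_
  rw [← hec]
  exact hev.sub_const

/-- The set of points infinitely near to a given point does not depend on the coordinates. Both u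
and v are multiples u'p, u'q of u' in O', and at least one of p, q is a unit, which selects the
chart. -/
theorem stdOver_of_blow {u v u' v' : FunField K} (h : Gen u v)
    (he : planePoint u v = planePoint u' v') (c' : K) {O' : LocalSubring (FunField K)}
    (hO' : O' = planePoint u' (v' / u' - algebraMap K (FunField K) c')) : StdOver u v O' := by
  have h' : Gen u' v' := h.of_planePoint_eq he
  have hb := h'.blow_left c'
  have hu'0 := h'.left_ne_zero
  have hle : planePoint u' v' ≤ O' := hO' ▸ le_of_stdOver h' (Or.inl ⟨c', rfl⟩)
  have hle1 : planePoint u v ≤ O' := he ▸ hle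
  have hw : v' / u' ∈ O'.toSubring := by
    have := (hb.hasVal_right.add (HasVal.const hb.hasVal_right.1 c')).mem
    rw [sub_add_cancel] at this
    exact hO' ▸ this
  have hmul : ∀ f, InMax (planePoint u' v') f → ∃ g ∈ O'.toSubring, f = u' * g := by
    intro f hf
    obtain ⟨a, ha, b, hb, rfl⟩ := h'.exists_eq_of_inMax hf
    exact ⟨a + b * (v' / u'), O'.toSubring.add_mem (hle.1 ha) (O'.toSubring.mul_mem (hle.1 hb) hw),
      by field_simp⟩
  obtain ⟨p, hp, hup⟩ := hmul u (he ▸ h.hasVal_left.inMax)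
  obtain ⟨q, hq, hvq⟩ := hmul v (he ▸ h.hasVal_right.inMax)
  by_cases hpu : InMax O' p
  · have hqu : ¬ InMax O' q := by
      intro hqu
      obtain ⟨a, ha, b, hb, hab⟩ := h.exists_eq_of_inMax (he ▸ h'.hasVal_left.inMax)
      -- u' lies in the ideal (u, v) = (u'p, u'q); dividing its expression by u' shows that p and q
      -- generate the unit ideal.
      have h1 : a * p + b * q = 1 := by
        rw [hup, hvq] at hab
        have : u' * (a * p + b * q) = u' * 1 := by linear_combination -hab
        exact mul_left_cancel₀ hu'0 this
      exact not_inMax_one (h1 ▸ (InMax.mul_left (hle1.1 ha) hpu).add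
        (InMax.mul_left (hle1.1 hb) hqu))
    have hswap : planePoint v u = planePoint u' v' := by
      rw [← he]
      exact planePoint_eq h.swap.hasVal_right h.swap.hasVal_left h.hasVal_right h.hasVal_left
    obtain ⟨c, hc, hcv⟩ := eq_blow_of_unit h.swap hswap c' hO' hvq hup hp hq hqu
    right
    have hc0 : c = 0 := by
      refine hcv.unique ?_
      have := (hpu.mul_right (inv_mem_of_not_inMax hq hqu)).hasVal hcv.1
      rwa [← div_eq_mul_inv] at this
    rw [hc, hc0, map_zero, sub_zero]
  · obtain ⟨c, hc, -⟩ := eq_blow_of_unit h he c' hO' hup hvq hq hp hpu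
    exact Or.inl ⟨c, hc⟩

theorem stdOver_of_isOver {u v : FunField K} (h : Gen u v) {O' : LocalSubring (FunField K)}
    (hO : IsOver (planePoint u v) O') : StdOver u v O' := by
  obtain ⟨u', v', he, ⟨c', hc⟩ | hc⟩ := hO
  · exact stdOver_of_blow h he c' hc
  · have h' := h.of_planePoint_eq he
    have he' : planePoint u v = planePoint v' u' := by
      rw [he]
      exact planePoint_eq h'.hasVal_right h'.hasVal_left h'.swap.hasVal_right h'.swap.hasVal_left
    refine stdOver_of_blow h he' 0 ?_
    rw [hc, map_zero, sub_zero]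

/-- Replaces the existential choice of coordinates in `IsOver` by any coordinates one likes. -/
theorem isOver_iff {u v : FunField K} (h : Gen u v) {O' : LocalSubring (FunField K)} :
    IsOver (planePoint u v) O' ↔ StdOver u v O' :=
  ⟨stdOver_of_isOver h, fun hO => ⟨u, v, rfl, hO⟩⟩

theorem StdOver.gen {u v : FunField K} (h : Gen u v) {O' : LocalSubring (FunField K)}
    (hO : StdOver u v O') : ∃ u' v', Gen u' v' ∧ O' = planePoint u' v' := by
  rcases hO with ⟨c, rfl⟩ | rfl
  · exact ⟨_, _, h.blow_left c, rfl⟩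
  · exact ⟨_, _, h.blow_right, rfl⟩

theorem HasVal.not_zero_of_inv {O : LocalSubring (FunField K)} {f : FunField K} {a : K}
    (h : HasVal O f a) (h' : HasVal O f⁻¹ (0 : K)) (h0 : f ≠ 0) : False := by
  have := (h.mul h').unique ((mul_inv_cancel₀ h0).symm ▸ HasVal.one h.1)
  simp at this

/-- Points of the exceptional curve are told apart by the value of v/u, with u/v = 0 for the last
one, and V can see only one value. -/
theorem StdOver.eq_of_le {u v : FunField K} (h : Gen u v) {O₁ O₂ V : LocalSubring (FunField K)}
    (h1 : StdOver u v O₁) (h2 : StdOver u v O₂) (hV1 : O₁ ≤ V) (hV2 : O₂ ≤ V) : O₁ = O₂ := by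
  have hval : ∀ c : K, planePoint u (v / u - algebraMap K (FunField K) c) ≤ V →
      HasVal V (v / u) c := by
    intro c hc
    have := ((h.blow_left c).hasVal_of_le hc).2
    exact ⟨this.1, by simpa using this.2⟩
  have hval' : planePoint v (u / v) ≤ V → HasVal V (v / u)⁻¹ (0 : K) := by
    intro hc
    rw [inv_div]
    exact (h.blow_right.hasVal_of_le hc).2
  have hne : v / u ≠ 0 := div_ne_zero h.right_ne_zero h.left_ne_zero
  rcases h1 with ⟨c, rfl⟩ | rfl <;> rcases h2 with ⟨d, rfl⟩ | rfl
  · rw [(hval c hV1).unique (hval d hV2)]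
  · exact ((hval c hV1).not_zero_of_inv (hval' hV2) hne).elim
  · exact ((hval d hV2).not_zero_of_inv (hval' hV1) hne).elim
  · rfl

/-- A set of local rings of points that behaves like a smooth complete surface: the points have
coordinates, they are separated, and every valuation ring centred at a closed point has a centre. -/
structure IsModel (S : Set (LocalSubring (FunField K))) : Prop where
  gen : ∀ O ∈ S, ∃ u v, Gen u v ∧ O = planePoint u v
  sep : ∀ O₁ ∈ S, ∀ O₂ ∈ S, ∀ V, O₁ ≤ V → O₂ ≤ V → O₁ = O₂
  centre : ∀ W : ValuationSubring (FunField K),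
    (∀ u v, Gen u v → u ∈ W → v ∈ W →
      ∃ a b : K, HasVal W.toLocalSubring u a ∧ HasVal W.toLocalSubring v b) →
    ∃ O ∈ S, O ≤ W.toLocalSubring

theorem IsModel.exists_base {S Z : Set (LocalSubring (FunField K))} (hS : IsModel S) (hZ : Z ⊆ S)
    {O : LocalSubring (FunField K)} (hO : O ∈ blowUp S Z) :
    ∃ B ∈ S, B ≤ O ∧ (B ∉ Z ∧ O = B ∨ B ∈ Z ∧ IsOver B O) := by
  rcases hO with ⟨h1, h2⟩ | ⟨B, hB, hBO⟩
  · exact ⟨O, h1, le_rfl, Or.inl ⟨h2, rfl⟩⟩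
  · obtain ⟨u, v, hg, rfl⟩ := hS.gen B (hZ hB)
    exact ⟨_, hZ hB, le_of_stdOver hg ((isOver_iff hg).1 hBO), Or.inr ⟨hB, hBO⟩⟩

/-- For centres, a valuation ring contains v/u or u/v. The assumption on W, which says that W is
centred at a closed point of every plane containing its centre, supplies a value for this quotient
and hence a point of the exceptional curve. -/
theorem IsModel.blowUp {S Z : Set (LocalSubring (FunField K))} (hS : IsModel S) (hZ : Z ⊆ S) :
    IsModel (blowUp S Z) where
  gen O hO := by
    rcases hO with ⟨h1, -⟩ | ⟨B, hB, hBO⟩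
    · exact hS.gen O h1
    · obtain ⟨u, v, hg, rfl⟩ := hS.gen B (hZ hB)
      exact ((isOver_iff hg).1 hBO).gen hg
  sep O₁ h1 O₂ h2 V hV1 hV2 := by
    obtain ⟨B₁, hB1, hB1', hc1⟩ := hS.exists_base hZ h1
    obtain ⟨B₂, hB2, hB2', hc2⟩ := hS.exists_base hZ h2
    obtain rfl := hS.sep B₁ hB1 B₂ hB2 V (hB1'.trans hV1) (hB2'.trans hV2)
    rcases hc1 with ⟨hn, rfl⟩ | ⟨hm, ho1⟩ <;> rcases hc2 with ⟨hn', rfl⟩ | ⟨hm', ho2⟩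
    · rfl
    · exact absurd hm' hn
    · exact absurd hm hn'
    · obtain ⟨u, v, hg, rfl⟩ := hS.gen B₁ hB1
      exact ((isOver_iff hg).1 ho1).eq_of_le hg ((isOver_iff hg).1 ho2) hV1 hV2
  centre W hW := by
    obtain ⟨O, hO, hOW⟩ := hS.centre W hW
    by_cases hOZ : O ∈ Z
    · obtain ⟨u, v, hg, rfl⟩ := hS.gen O hO
      obtain ⟨hu, hv⟩ := hg.hasVal_of_le hOW
      have first : v / u ∈ W → ∃ O ∈ _root_.blowUp S Z, O ≤ W.toLocalSubring := by
        intro hm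
        obtain ⟨-, c, -, hc⟩ := hW _ _ hg.div_left hu.mem hm
        exact ⟨_, Or.inr ⟨_, hOZ, u, v, rfl, Or.inl ⟨c, rfl⟩⟩, planePoint_le hu hc.sub_const⟩
      rcases W.mem_or_inv_mem (v / u) with hm | hm
      · exact first hm
      · rw [inv_div] at hm
        obtain ⟨-, c, -, hc⟩ := hW _ _ hg.blow_right hv.mem hm
        -- A nonzero value of u/v makes v/u regular as well, so the first chart applies; only the
        -- value 0 needs the second chart.
        by_cases hc0 : c = 0
        · subst hc0
          exact ⟨_, Or.inr ⟨_, hOZ, u, v, rfl, Or.inr rfl⟩, planePoint_le hv hc⟩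
        · exact first (by rw [← inv_div]; exact hc.inv_mem hc0)
    · exact ⟨O, Or.inl ⟨hO, hOZ⟩, hOW⟩

end Model

/-! ### The projective plane as a model. -/

section Plane

variable {K : Type*} [Field K]

theorem x_ne_zero : FunField.x K ≠ 0 := gen_xy.left_ne_zero

theorem y_ne_zero : FunField.y K ≠ 0 := gen_xy.right_ne_zero

theorem Gen.infinity {u v : FunField K} (h : Gen u v) : Gen (v / u) (1 / u) := by
  have hu := h.left_ne_zero
  have h1 : (1 / u)⁻¹ ∈ IntermediateField.adjoin K {v / u, 1 / u} := inv_mem mem_adjoin_right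
  rw [one_div, inv_inv, ← one_div] at h1
  refine h.of_mem h1 ?_
  have := mul_mem (mem_adjoin_left (u := v / u) (v := 1 / u)) h1
  rwa [div_mul_cancel₀ _ hu] at this

/-- The points of the plane: affine points, points `[1, a, 0]`, and `[0, 1, 0]`. -/
theorem mem_plane_cases {O : LocalSubring (FunField K)} (hO : O ∈ plane K) :
    (∃ a b : K, O = planePoint (FunField.x K - algebraMap K _ a) (FunField.y K - algebraMap K _ b)) ∨
    (∃ a : K, O = planePoint (FunField.y K / FunField.x K - algebraMap K _ a) (1 / FunField.x K)) ∨
    O = planePoint (FunField.x K / FunField.y K) (1 / FunField.y K) := by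
  have hx := x_ne_zero (K := K)
  have hy := y_ne_zero (K := K)
  have haff : ∀ a b : K, ∀ u v : FunField K, Gen u v → HasVal (planePoint u v) (FunField.x K) a →
      HasVal (planePoint u v) (FunField.y K) b →
      (∀ O : LocalSubring (FunField K), HasVal O (FunField.x K) a → HasVal O (FunField.y K) b →
        HasVal O u (0 : K) ∧ HasVal O v (0 : K)) →
      planePoint u v = planePoint (FunField.x K - algebraMap K _ a)
        (FunField.y K - algebraMap K _ b) := by
    intro a b u v _ h1 h2 h3
    have hg := (gen_xy (K := K)).sub_const a b
    have h4 := h3 (planePoint (FunField.x K - algebraMap K _ a)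
        (FunField.y K - algebraMap K _ b))
      ⟨hg.hasVal_left.1, hg.hasVal_left.inMax⟩ ⟨hg.hasVal_left.1, hg.hasVal_right.inMax⟩
    exact planePoint_eq h1.sub_const h2.sub_const h4.1 h4.2
  have cancel : ∀ {O : LocalSubring (FunField K)} {f : FunField K} {c : K},
      HasVal O (f - algebraMap K _ c) (0 : K) → HasVal O f c := fun h => ⟨h.1, by simpa using h.2⟩
  obtain ⟨a, b, rfl | rfl | rfl⟩ := hO
  · exact Or.inl ⟨a, b, rfl⟩
  · have hg := (gen_xy (K := K)).infinity.sub_const a b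
    have h1 := cancel hg.hasVal_left
    have h2 := cancel hg.hasVal_right
    by_cases hb : b = 0
    · subst hb
      exact Or.inr (Or.inl ⟨a, by rw [map_zero, sub_zero]⟩)
    · refine Or.inl ⟨1 / b, a / b, haff _ _ _ _ hg ?_ ?_ ?_⟩
      · exact ((HasVal.one h2.1).div h2 hb).congr (by field_simp) rfl
      · exact (h1.div h2 hb).congr (by field_simp) rfl
      · intro O hX hY
        have hb' : 1 / b ≠ 0 := one_div_ne_zero hb
        exact ⟨((hY.div hX hb').congr rfl (by field_simp)).sub_const,
          (((HasVal.one hX.1).div hX hb').congr rfl (by field_simp)).sub_const⟩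
  · have hg := (gen_xy (K := K)).swap.infinity.sub_const a b
    have h1 := cancel hg.hasVal_left
    have h2 := cancel hg.hasVal_right
    by_cases hb : b = 0
    · subst hb
      by_cases ha : a = 0
      · subst ha
        exact Or.inr (Or.inr (by rw [map_zero, sub_zero, sub_zero]))
      · refine Or.inr (Or.inl ⟨1 / a, ?_⟩)
        have hg' := (gen_xy (K := K)).infinity.sub_const (1 / a) 0
        have h1' := cancel hg'.hasVal_left
        have h2' := hg'.hasVal_right
        have ha' : 1 / a ≠ 0 := one_div_ne_zero ha
        rw [map_zero, sub_zero] at h1' h2'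
        rw [map_zero, sub_zero] at h1 h2 ⊢
        refine planePoint_eq ?_ ?_ ?_ ?_
        · exact (((HasVal.one h1.1).div h1 ha).congr (by field_simp) rfl).sub_const
        · exact (h2.div h1 ha).congr (by field_simp) (by simp)
        · exact (((HasVal.one h1'.1).div h1' ha').congr (by field_simp) (by field_simp)).sub_const
        · exact (h2'.div h1' ha').congr (by field_simp) (by simp)
    · refine Or.inl ⟨a / b, 1 / b, haff _ _ _ _ hg ?_ ?_ ?_⟩
      · exact (h1.div h2 hb).congr (by field_simp) rfl
      · exact ((HasVal.one h2.1).div h2 hb).congr (by field_simp) rfl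
      · intro O hX hY
        have hb' : 1 / b ≠ 0 := one_div_ne_zero hb
        exact ⟨((hX.div hY hb').congr rfl (by field_simp)).sub_const,
          (((HasVal.one hX.1).div hY hb').congr rfl (by field_simp)).sub_const⟩

theorem HasVal.of_sub_const {F : Type*} [Field F] [Algebra K F] {O : LocalSubring F} {f : F} {c : K}
    (h : HasVal O (f - algebraMap K F c) (0 : K)) : HasVal O f c := ⟨h.1, by simpa using h.2⟩

/-- Separation compares the values of x, y and y/x; a function cannot have a finite value while its
inverse vanishes. For the centre, the chart is chosen according to which of x, y, y/x lie in the
valuation ring. -/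
theorem isModel_plane : IsModel (plane K) where
  gen O hO := by
    obtain ⟨a, b, rfl | rfl | rfl⟩ := hO
    · exact ⟨_, _, gen_xy.sub_const a b, rfl⟩
    · exact ⟨_, _, gen_xy.infinity.sub_const a b, rfl⟩
    · exact ⟨_, _, gen_xy.swap.infinity.sub_const a b, rfl⟩
  sep O₁ h1 O₂ h2 V hV1 hV2 := by
    have hx := x_ne_zero (K := K)
    have hy := y_ne_zero (K := K)
    have hA : ∀ a b : K, planePoint (FunField.x K - algebraMap K _ a)
        (FunField.y K - algebraMap K _ b) ≤ V → HasVal V (FunField.x K) a ∧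
        HasVal V (FunField.y K) b := fun a b h =>
      ⟨((gen_xy.sub_const a b).hasVal_of_le h).1.of_sub_const,
        ((gen_xy.sub_const a b).hasVal_of_le h).2.of_sub_const⟩
    have hB : ∀ a : K, planePoint (FunField.y K / FunField.x K - algebraMap K _ a)
        (1 / FunField.x K) ≤ V → HasVal V (FunField.y K / FunField.x K) a ∧
        HasVal V (FunField.x K)⁻¹ (0 : K) := by
      intro a h
      have hg := gen_xy.infinity.sub_const a (0 : K)
      rw [map_zero, sub_zero] at hg
      have := hg.hasVal_of_le h
      exact ⟨this.1.of_sub_const, by rw [← one_div]; exact this.2⟩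
    have hC : planePoint (FunField.x K / FunField.y K) (1 / FunField.y K) ≤ V →
        HasVal V (FunField.y K / FunField.x K)⁻¹ (0 : K) ∧ HasVal V (FunField.y K)⁻¹ (0 : K) := by
      intro h
      have := gen_xy.swap.infinity.hasVal_of_le h
      exact ⟨by rw [inv_div]; exact this.1, by rw [← one_div]; exact this.2⟩
    have hne : FunField.y K / FunField.x K ≠ 0 := div_ne_zero hy hx
    rcases mem_plane_cases h1 with ⟨a, b, rfl⟩ | ⟨a, rfl⟩ | rfl <;>
      rcases mem_plane_cases h2 with ⟨c, d, rfl⟩ | ⟨c, rfl⟩ | rfl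
    · rw [(hA a b hV1).1.unique (hA c d hV2).1, (hA a b hV1).2.unique (hA c d hV2).2]
    · exact ((hA a b hV1).1.not_zero_of_inv (hB c hV2).2 hx).elim
    · exact ((hA a b hV1).2.not_zero_of_inv (hC hV2).2 hy).elim
    · exact ((hA c d hV2).1.not_zero_of_inv (hB a hV1).2 hx).elim
    · rw [(hB a hV1).1.unique (hB c hV2).1]
    · exact ((hB a hV1).1.not_zero_of_inv (hC hV2).1 hne).elim
    · exact ((hA c d hV2).2.not_zero_of_inv (hC hV1).2 hy).elim
    · exact ((hB c hV2).1.not_zero_of_inv (hC hV1).1 hne).elim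
    · rfl
  centre W hW := by
    have hx := x_ne_zero (K := K)
    have hy := y_ne_zero (K := K)
    have h3 : FunField.x K / FunField.y K ∈ W → 1 / FunField.y K ∈ W →
        ∃ O ∈ plane K, O ≤ W.toLocalSubring := by
      intro h1 h2
      obtain ⟨a, b, ha, hb⟩ := hW _ _ gen_xy.swap.infinity h1 h2
      exact ⟨_, ⟨a, b, Or.inr (Or.inr rfl)⟩, planePoint_le ha.sub_const hb.sub_const⟩
    by_cases hxW : FunField.x K ∈ W
    · by_cases hyW : FunField.y K ∈ W
      · obtain ⟨a, b, ha, hb⟩ := hW _ _ gen_xy hxW hyW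
        exact ⟨_, ⟨a, b, Or.inl rfl⟩, planePoint_le ha.sub_const hb.sub_const⟩
      · have h1 := (W.mem_or_inv_mem _).resolve_left hyW
        refine h3 ?_ (by rwa [one_div])
        rw [div_eq_mul_inv]; exact W.mul_mem _ _ hxW h1
    · have h1 := (W.mem_or_inv_mem _).resolve_left hxW
      rcases W.mem_or_inv_mem (FunField.y K / FunField.x K) with h2 | h2
      · obtain ⟨a, b, ha, hb⟩ := hW _ _ gen_xy.infinity h2
          (show 1 / FunField.x K ∈ W by rwa [one_div])
        exact ⟨_, ⟨a, b, Or.inr (Or.inl rfl)⟩, planePoint_le ha.sub_const hb.sub_const⟩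
      · rw [inv_div] at h2
        refine h3 h2 ?_
        have : 1 / FunField.y K = FunField.x K / FunField.y K * (FunField.x K)⁻¹ := by field_simp
        rw [this]; exact W.mul_mem _ _ h2 h1

end Plane

end BirSurf

namespace BirSurf

/-! ## Valuation rings whose centre on a plane is a curve -/

section Loc

variable {K : Type*} [Field K]

/-- The centre of `V` on the affine plane with coordinates `u, v` is a curve. -/
structure Loc (V : ValuationSubring (FunField K)) (u v : FunField K) : Prop where
  ne_top : V ≠ ⊤
  const : HasConst K V.toLocalSubring
  left : u ∈ V
  right : v ∈ V
  not_both : ∀ a b : K, ¬ (HasVal V.toLocalSubring u a ∧ HasVal V.toLocalSubring v b)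

/-- The centre of `V` on the affine plane with coordinates `u, t` is the line `u = 0`. -/
structure IsDiv (V : ValuationSubring (FunField K)) (u t : FunField K) : Prop where
  left : HasVal V.toLocalSubring u (0 : K)
  right : NoVal K V.toLocalSubring t

/-- The point `(a, b)` lies on the centre of `V` on the plane with coordinates `u, v`. -/
def OnCentre (V : ValuationSubring (FunField K)) (u v : FunField K) (a b : K) : Prop :=
  ∀ P : MvPolynomial (Fin 2) K, InMax V.toLocalSubring (polyHom u v P) →
    MvPolynomial.eval ![a, b] P = 0

variable {V W : ValuationSubring (FunField K)} {u v t : FunField K} {a b : K}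

theorem IsDiv.const (h : IsDiv V u t) : HasConst K V.toLocalSubring := h.left.1

theorem IsDiv.ne_top (h : IsDiv V u t) (hg : Gen u t) : V ≠ ⊤ := by
  rintro rfl
  exact not_inMax_of_inv_mem (O := (⊤ : ValuationSubring (FunField K)).toLocalSubring)
    hg.left_ne_zero (ValuationSubring.mem_top _) h.left.inMax

theorem IsDiv.loc (h : IsDiv V u t) (hg : Gen u t) : Loc V u t where
  ne_top := h.ne_top hg
  const := h.const
  left := h.left.mem
  right := h.right.mem
  not_both _ b hab := h.right.not_hasVal b hab.2

theorem Loc.swap (h : Loc V u v) : Loc V v u where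
  ne_top := h.ne_top
  const := h.const
  left := h.right
  right := h.left
  not_both a b hab := h.not_both b a hab.symm

theorem polyHom_mem (hc : HasConst K V.toLocalSubring) (hu : u ∈ V) (hv : v ∈ V)
    (P : MvPolynomial (Fin 2) K) : polyHom u v P ∈ V := by
  induction P using MvPolynomial.induction_on with
  | C c => rw [polyHom_C]; exact hc c
  | add p q hp hq => rw [map_add]; exact V.add_mem _ _ hp hq
  | mul_X p i hp =>
    rw [map_mul]
    refine V.mul_mem _ _ hp ?_
    fin_cases i
    · simpa using hu
    · simpa using hv

theorem Loc.polyHom_mem (h : Loc V u v) (P : MvPolynomial (Fin 2) K) : polyHom u v P ∈ V :=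
  BirSurf.polyHom_mem h.const h.left h.right P

/-- The prime ideal of the centre of `V` on the plane with coordinates `u, v`. -/
noncomputable def centreIdeal (h : Loc V u v) : Ideal (MvPolynomial (Fin 2) K) where
  carrier := {P | InMax V.toLocalSubring (polyHom u v P)}
  add_mem' := by
    intro P Q hP hQ
    change InMax _ _
    rw [map_add]; exact InMax.add hP hQ
  zero_mem' := by
    change InMax _ _
    rw [map_zero]; exact InMax.zero
  smul_mem' := by
    intro P Q hQ
    change InMax _ _
    rw [smul_eq_mul, map_mul]
    exact InMax.mul_left (h.polyHom_mem P) hQ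

theorem mem_centreIdeal (h : Loc V u v) {P : MvPolynomial (Fin 2) K} :
    P ∈ centreIdeal h ↔ InMax V.toLocalSubring (polyHom u v P) := Iff.rfl

instance isPrime_centreIdeal (h : Loc V u v) : (centreIdeal h).IsPrime where
  ne_top' := by
    rw [Ideal.ne_top_iff_one, mem_centreIdeal, map_one]
    exact not_inMax_one
  mem_or_mem' := by
    intro P Q hPQ
    rw [mem_centreIdeal, map_mul] at hPQ
    exact hPQ.of_mul (h.polyHom_mem P) (h.polyHom_mem Q)

/-- With zero centre all nonzero polynomials would be units of V, and V would be the whole field. -/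
theorem centreIdeal_ne_bot (hg : Gen u v) (h : Loc V u v) : centreIdeal h ≠ ⊥ := by
  intro hb
  refine h.ne_top (eq_top_iff.2 fun f _ => ?_)
  obtain ⟨P, Q, hQ, rfl⟩ := hg.fracHom.frac f
  rw [div_eq_mul_inv]
  refine V.mul_mem _ _ (h.polyHom_mem P) ?_
  refine inv_mem_of_not_inMax (O := V.toLocalSubring) (h.polyHom_mem Q) fun hm => hQ ?_
  have : Q ∈ centreIdeal h := hm
  rwa [hb] at this

/-- K[X, Y] has Krull dimension 2, so there is no chain 0 < P < Q < M of primes. -/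
theorem isMaximal_of_lt_of_lt {P Q : Ideal (MvPolynomial (Fin 2) K)} [hP : P.IsPrime]
    [hQ : Q.IsPrime] (h0 : P ≠ ⊥) (h1 : P < Q) : Q.IsMaximal := by
  by_contra hn
  obtain ⟨M, hM, hQM⟩ := Ideal.exists_le_maximal Q hQ.ne_top
  have hlt : Q < M := lt_of_le_of_ne hQM (fun he => hn (he ▸ hM))
  let s : LTSeries (PrimeSpectrum (MvPolynomial (Fin 2) K)) :=
    { length := 3
      toFun := ![⊥, ⟨P, hP⟩, ⟨Q, hQ⟩, ⟨M, hM.isPrime⟩]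
      step := by
        intro i
        fin_cases i
        · exact bot_lt_iff_ne_bot.2 (fun h => h0 (congrArg PrimeSpectrum.asIdeal h))
        · exact h1
        · exact hlt }
  have h2 := Order.LTSeries.length_le_krullDim s
  have h3 : ringKrullDim (MvPolynomial (Fin 2) K) = ((2 : ℕ) : WithBot ℕ∞) := by
    rw [MvPolynomial.ringKrullDim_of_isNoetherianRing, ringKrullDim_eq_zero_of_field]
    simp
  change ((3 : ℕ) : WithBot ℕ∞) ≤ ringKrullDim (MvPolynomial (Fin 2) K) at h2
  rw [h3] at h2
  have := (Nat.cast_le (α := WithBot ℕ∞)).1 h2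
  omega

variable [IsAlgClosed K]

/-- The centre ideal contains a prime element p by factoriality. If it were larger than (p) it would
be maximal, hence by the Nullstellensatz the ideal of a point, at which both coordinates have
values; `Loc.not_both` excludes this. So V is the localization at p, in particular discrete. -/
theorem Loc.exists_prime (hg : Gen u v) (h : Loc V u v) :
    ∃ p : MvPolynomial (Fin 2) K, ∃ hp : Prime p, V = primeVal hg.fracHom hp ∧
      centreIdeal h = Ideal.span {p} := by
  obtain ⟨p, hpm, hp⟩ := Ideal.IsPrime.exists_mem_prime_of_ne_bot
    (isPrime_centreIdeal h) (centreIdeal_ne_bot hg h)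
  have hspan : Ideal.span {p} ≤ centreIdeal h := by
    rw [Ideal.span_le]; rintro _ rfl; exact hpm
  have heq : centreIdeal h = Ideal.span {p} := by
    by_contra hn
    have : (Ideal.span {p}).IsPrime := (Ideal.span_singleton_prime hp.ne_zero).2 hp
    have hmax := isMaximal_of_lt_of_lt (K := K) (P := Ideal.span {p}) (Q := centreIdeal h)
      (by simpa using hp.ne_zero) (lt_of_le_of_ne hspan (Ne.symm hn))
    obtain ⟨z, hz⟩ := MvPolynomial.isMaximal_iff_eq_vanishingIdeal_singleton.1 hmax
    have hmem : ∀ i, MvPolynomial.X i - MvPolynomial.C (z i) ∈ centreIdeal h := by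
      intro i
      rw [hz, MvPolynomial.mem_vanishingIdeal_singleton_iff]
      simp
    refine h.not_both (z 0) (z 1) ⟨⟨h.const, ?_⟩, ⟨h.const, ?_⟩⟩
    · have := hmem 0
      rwa [mem_centreIdeal, map_sub, polyHom_X0, polyHom_C] at this
    · have := hmem 1
      rwa [mem_centreIdeal, map_sub, polyHom_X1, polyHom_C] at this
  refine ⟨p, hp, eq_primeVal hg.fracHom hp h.ne_top h.polyHom_mem fun P hP => ?_, heq⟩
  have : P ∈ centreIdeal h := hP
  rwa [heq, Ideal.mem_span_singleton] at this

theorem Loc.isDiscreteValuationRing (hg : Gen u v) (h : Loc V u v) :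
    IsDiscreteValuationRing V := by
  obtain ⟨p, hp, rfl, -⟩ := h.exists_prime hg
  infer_instance

/-- The centre of `V` contains a point at which a given function not in the ideal of the centre
does not vanish. -/
theorem Loc.exists_onCentre (h : Loc V u v) {Q : MvPolynomial (Fin 2) K}
    (hQ : ¬ InMax V.toLocalSubring (polyHom u v Q)) :
    ∃ a b : K, OnCentre V u v a b ∧ MvPolynomial.eval ![a, b] Q ≠ 0 := by
  have h1 : Q ∉ MvPolynomial.vanishingIdeal K (MvPolynomial.zeroLocus K (centreIdeal h)) := by
    rw [MvPolynomial.vanishingIdeal_zeroLocus_eq_radical,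
      (isPrime_centreIdeal h).isRadical.radical]
    exact hQ
  rw [MvPolynomial.mem_vanishingIdeal_iff] at h1
  push Not at h1
  obtain ⟨z, hz, hzQ⟩ := h1
  have hz2 : ![z 0, z 1] = z := by
    ext i; fin_cases i <;> rfl
  refine ⟨z 0, z 1, fun P hP => ?_, ?_⟩
  · rw [hz2]
    have := (MvPolynomial.mem_zeroLocus_iff.1 hz) P hP
    simpa [MvPolynomial.aeval_eq_eval] using this
  · rw [hz2]
    simpa [MvPolynomial.aeval_eq_eval] using hzQ

omit [IsAlgClosed K] in
theorem polyHom_shift (a b : K) (P : MvPolynomial (Fin 2) K) :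
    ∃ Q : MvPolynomial (Fin 2) K, polyHom (u - algebraMap K _ a) (v - algebraMap K _ b) P =
      polyHom u v Q ∧ MvPolynomial.eval ![a, b] Q = MvPolynomial.eval ![0, 0] P := by
  induction P using MvPolynomial.induction_on with
  | C c => exact ⟨MvPolynomial.C c, by rw [polyHom_C, polyHom_C], by simp⟩
  | add p q hp hq =>
    obtain ⟨A, hA, hA'⟩ := hp
    obtain ⟨B, hB, hB'⟩ := hq
    exact ⟨A + B, by rw [map_add, map_add, hA, hB], by rw [map_add, map_add, hA', hB']⟩
  | mul_X p i hp =>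
    obtain ⟨A, hA, hA'⟩ := hp
    fin_cases i
    · refine ⟨A * (MvPolynomial.X 0 - MvPolynomial.C a), ?_, by simp⟩
      change polyHom _ _ (p * MvPolynomial.X 0) = _
      rw [map_mul, hA, polyHom_X0, map_mul, map_sub, polyHom_X0, polyHom_C]
    · refine ⟨A * (MvPolynomial.X 1 - MvPolynomial.C b), ?_, by simp⟩
      change polyHom _ _ (p * MvPolynomial.X 1) = _
      rw [map_mul, hA, polyHom_X1, map_mul, map_sub, polyHom_X1, polyHom_C]

omit [IsAlgClosed K] in
theorem Loc.planePoint_le (h : Loc V u v) (hab : OnCentre V u v a b) :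
    (planePoint (u - algebraMap K _ a) (v - algebraMap K _ b)).toSubring ≤ V.toSubring := by
  rintro _ ⟨P, Q, hQ, -, rfl⟩
  change polyHom _ _ P / polyHom _ _ Q ∈ V
  obtain ⟨P', hP', -⟩ := polyHom_shift (u := u) (v := v) a b P
  obtain ⟨Q', hQ', hQ0⟩ := polyHom_shift (u := u) (v := v) a b Q
  rw [hP', hQ', div_eq_mul_inv]
  refine V.mul_mem _ _ (h.polyHom_mem P') ?_
  refine inv_mem_of_not_inMax (O := V.toLocalSubring) (h.polyHom_mem Q') fun hm => hQ ?_
  rw [← hQ0]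
  exact hab Q' hm

/-- A valuation ring centred at a curve through a point of `S` is the local ring of a curve
on `S`. -/
theorem Loc.exists_curve (hg : Gen u v) (h : Loc V u v) (hab : OnCentre V u v a b)
    {S : Set (LocalSubring (FunField K))}
    (hS : planePoint (u - algebraMap K _ a) (v - algebraMap K _ b) ∈ S) :
    ∃ C : Curve S, C.ring = V := by
  refine ⟨⟨V, h.isDiscreteValuationRing hg, _, hS, h.planePoint_le hab, ?_⟩, rfl⟩
  intro f hf
  obtain ⟨p, hp, hV, hI⟩ := h.exists_prime hg
  have hg' := hg.sub_const a b
  set O := planePoint (u - algebraMap K _ a) (v - algebraMap K _ b)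
  have hmem : ∀ P, polyHom u v P ∈ O.toSubring := fun P =>
    (HasVal.polyHom hg'.hasVal_left.of_sub_const hg'.hasVal_right.of_sub_const P).mem
  rw [hV] at hf
  obtain ⟨A, B, hB, rfl⟩ := hf
  have hB' : ¬ InMax V.toLocalSubring (polyHom u v B) := by
    rw [hV, inMax_primeVal_iff]; exact hB
  exact ⟨_, hmem A, _, hmem B, ne_zero_of_not_inMax hB',
    inv_mem_of_not_inMax (O := V.toLocalSubring) (h.polyHom_mem B) hB', rfl⟩

omit [IsAlgClosed K] in
theorem prime_X (i : Fin 2) : Prime (MvPolynomial.X i : MvPolynomial (Fin 2) K) :=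
  MvPolynomial.X_prime

/-- The prime of the centre divides the first variable, hence is associated to it. Thus V is
determined by u and t, which is how all special curves are recognised later. -/
theorem IsDiv.eq_primeVal (hg : Gen u t) (h : IsDiv V u t) :
    V = primeVal hg.fracHom (prime_X (K := K) 0) := by
  obtain ⟨p, hp, hV, hI⟩ := (h.loc hg).exists_prime hg
  have h1 : p ∣ MvPolynomial.X 0 := by
    rw [← Ideal.mem_span_singleton, ← hI, mem_centreIdeal, polyHom_X0]
    exact h.left.inMax
  have h2 : Associated p (MvPolynomial.X 0) := hp.associated_of_dvd (prime_X 0) h1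
  refine BirSurf.eq_primeVal _ _ (h.ne_top hg) (h.loc hg).polyHom_mem fun P hP => ?_
  have h3 : P ∈ centreIdeal (h.loc hg) := hP
  rw [hI, Ideal.mem_span_singleton] at h3
  exact h2.symm.dvd.trans h3

theorem IsDiv.unique (hg : Gen u t) (h : IsDiv V u t) (h' : IsDiv W u t) : V = W := by
  rw [h.eq_primeVal hg, h'.eq_primeVal hg]

omit [IsAlgClosed K] in
theorem exists_isDiv (hg : Gen u t) : IsDiv (primeVal hg.fracHom (prime_X (K := K) 0)) u t := by
  set V := primeVal hg.fracHom (prime_X (K := K) 0)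
  have hc : HasConst K V.toLocalSubring := fun a => by
    have := mem_primeVal hg.fracHom (prime_X (K := K) 0) (MvPolynomial.C a)
    rwa [polyHom_C] at this
  have ht : t ∈ V := by
    have := mem_primeVal hg.fracHom (prime_X (K := K) 0) (MvPolynomial.X 1)
    rwa [polyHom_X1] at this
  refine ⟨InMax.hasVal hc ?_, hc, ht, fun c hm => ?_⟩
  · have := (inMax_primeVal_iff hg.fracHom (prime_X (K := K) 0) (MvPolynomial.X 0)).2 dvd_rfl
    rwa [polyHom_X0] at this
  · have h1 : t - algebraMap K _ c = polyHom u t (MvPolynomial.X 1 - MvPolynomial.C c) := by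
      rw [map_sub, polyHom_X1, polyHom_C]
    rw [h1, inMax_primeVal_iff] at hm
    obtain ⟨q, hq⟩ := hm
    have := congrArg (MvPolynomial.eval ![0, c + 1]) hq
    simp at this

theorem IsDiv.onCentre (hg : Gen u t) (h : IsDiv V u t) (c : K) : OnCentre V u t 0 c := by
  intro P hP
  rw [h.eq_primeVal hg, inMax_primeVal_iff] at hP
  obtain ⟨q, rfl⟩ := hP
  simp

theorem IsDiv.exists_curve (hg : Gen u t) (h : IsDiv V u t) (c : K)
    {S : Set (LocalSubring (FunField K))} (hS : planePoint u (t - algebraMap K _ c) ∈ S) :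
    ∃ C : Curve S, C.ring = V := by
  refine (h.loc hg).exists_curve hg (h.onCentre hg c) ?_
  rwa [map_zero, sub_zero]

theorem IsDiv.planePoint_le (hg : Gen u t) (h : IsDiv V u t) (c : K) :
    (planePoint u (t - algebraMap K _ c)).toSubring ≤ V.toSubring := by
  have := (h.loc hg).planePoint_le (h.onCentre hg c)
  rwa [map_zero, sub_zero] at this

omit [IsAlgClosed K] in
theorem Gen.div_not_mem (hg : Gen u v) : v / u ∉ (planePoint u v).toSubring := by
  rintro ⟨P, Q, hQ, hQ0, h⟩
  change polyHom u v Q ≠ 0 at hQ0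
  change v / u = polyHom u v P / polyHom u v Q at h
  rw [div_eq_div_iff hg.left_ne_zero hQ0] at h
  have h1 : polyHom u v (MvPolynomial.X 1 * Q) = polyHom u v (P * MvPolynomial.X 0) := by
    rw [map_mul, map_mul, polyHom_X0, polyHom_X1, h]
  have h2 : (MvPolynomial.X 0 : MvPolynomial (Fin 2) K) ∣ MvPolynomial.X 1 * Q :=
    ⟨P, by rw [hg.injective h1, mul_comm]⟩
  rcases (prime_X 0).dvd_or_dvd h2 with ⟨q, hq⟩ | ⟨q, rfl⟩
  · have := congrArg (MvPolynomial.eval ![0, 1]) hq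
    simp at this
  · simp at hQ

omit [IsAlgClosed K] in
-- The local ring of a point of a plane contains neither v/u nor u/v.
theorem Gen.not_valuation (hg : Gen u v) (h : V.toSubring = (planePoint u v).toSubring) :
    False := by
  rcases V.mem_or_inv_mem (v / u) with h1 | h1
  · exact hg.div_not_mem (h ▸ h1)
  · rw [inv_div] at h1
    refine hg.swap.div_not_mem ?_
    have : planePoint u v = planePoint v u :=
      planePoint_eq hg.hasVal_right hg.hasVal_left hg.swap.hasVal_right hg.swap.hasVal_left
    rw [← this]
    exact h ▸ h1

omit [IsAlgClosed K] in
/-- The local ring of a curve is not centred at a point of the plane it is a localization of. -/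
theorem loc_of_isLocalization (hg : Gen u v) (hV : V ≠ ⊤)
    (h : (planePoint u v).toSubring ≤ V.toSubring)
    (hf : ∀ f ∈ V, ∃ a ∈ (planePoint u v).toSubring, ∃ b ∈ (planePoint u v).toSubring,
      b ≠ 0 ∧ b⁻¹ ∈ V ∧ f = a / b) : Loc V u v := by
  have hc : HasConst K V.toLocalSubring := (hasConst_planePoint u v).mono h
  refine ⟨hV, hc, h hg.hasVal_left.mem, h hg.hasVal_right.mem, ?_⟩
  rintro a b ⟨ha, hb⟩
  have hg' := hg.sub_const a b
  -- If u and v had values a and b, every denominator allowed by the localization would be nonzero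
  -- at (a, b). Then V would coincide with the local ring of the point (a, b).
  refine hg'.not_valuation (V := V) (le_antisymm ?_ ?_)
  · intro f hfV
    obtain ⟨_, ⟨P, Q, hQ, hQ0, rfl⟩, _, ⟨P', Q', hQ', hQ0', rfl⟩, hb0, hbi, rfl⟩ := hf f hfV
    change polyHom u v Q ≠ 0 at hQ0
    change polyHom u v Q' ≠ 0 at hQ0'
    change polyHom u v P' / polyHom u v Q' ≠ 0 at hb0
    change (polyHom u v P' / polyHom u v Q')⁻¹ ∈ V at hbi
    change polyHom u v P / polyHom u v Q / (polyHom u v P' / polyHom u v Q') ∈ _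
    have hval := fun R : MvPolynomial (Fin 2) K =>
      HasVal.polyHom (O := V.toLocalSubring) ha hb R
    have hval' := fun R : MvPolynomial (Fin 2) K => HasVal.polyHom
      hg'.hasVal_left.of_sub_const hg'.hasVal_right.of_sub_const R
    have hP0' : polyHom u v P' ≠ 0 := fun h0 => hb0 (by rw [h0, zero_div])
    have hQi : (polyHom u v Q)⁻¹ ∈ V :=
      h (mem_planePoint_iff.2 ⟨1, Q, hQ, hQ0, by simp⟩)
    have hPi : (polyHom u v P')⁻¹ ∈ V := by
      have h1 : (polyHom u v Q')⁻¹ ∈ V :=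
        h (mem_planePoint_iff.2 ⟨1, Q', hQ', hQ0', by simp⟩)
      have := V.mul_mem _ _ hbi h1
      rw [inv_div] at this
      convert this using 1
      field_simp
    have he1 : MvPolynomial.eval ![a, b] Q ≠ 0 := fun h0 => by
      have := hval Q
      rw [h0] at this
      exact not_inMax_of_inv_mem (O := V.toLocalSubring) hQ0 hQi this.inMax
    have he2 : MvPolynomial.eval ![a, b] P' ≠ 0 := fun h0 => by
      have := hval P'
      rw [h0] at this
      exact not_inMax_of_inv_mem (O := V.toLocalSubring) hP0' hPi this.inMax
    have := (((hval' P).mul (hval' Q')).div ((hval' Q).mul (hval' P')) (mul_ne_zero he1 he2)).mem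
    convert this using 1
    field_simp
  · exact (planePoint_le (O := V.toLocalSubring) ha.sub_const hb.sub_const).1

omit [IsAlgClosed K] in
theorem Loc.of_sub_const {c : K} (h : Loc V u (v - algebraMap K _ c)) : Loc V u v where
  ne_top := h.ne_top
  const := h.const
  left := h.left
  right := by
    have := V.add_mem _ _ h.right (h.const c)
    rwa [sub_add_cancel] at this
  not_both a b hab := h.not_both a (b - c) ⟨hab.1, hab.2.sub (HasVal.const hab.2.1 c)⟩

omit [IsAlgClosed K] in
-- Away from u = 0 the chart is isomorphic to the original plane, so a curve of the chart is either
-- exceptional or the transform of a curve.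
theorem Loc.blow_left (hg : Gen u v) (h : Loc V u (v / u)) : IsDiv V u (v / u) ∨ Loc V u v := by
  by_cases hu : InMax V.toLocalSubring u
  · refine Or.inl ⟨hu.hasVal h.const, (noVal_iff h.const).2 ⟨h.right, fun c hc => ?_⟩⟩
    exact h.not_both 0 c ⟨hu.hasVal h.const, hc⟩
  · refine Or.inr ⟨h.ne_top, h.const, h.left, ?_, fun a b hab => ?_⟩
    · have := V.mul_mem _ _ h.left h.right
      rwa [mul_div_cancel₀ _ hg.left_ne_zero] at this
    · have ha : a ≠ 0 := by
        rintro rfl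
        exact hu hab.1.inMax
      exact h.not_both a (b / a) ⟨hab.1, hab.2.div hab.1 ha⟩

omit [IsAlgClosed K] in
theorem IsDiv.flip (hg : Gen u v) (h : IsDiv V v (u / v)) : IsDiv V u (v / u) := by
  refine ⟨?_, ?_⟩
  · exact (h.left.zero_mul_mem h.right.mem).congr (by have := hg.right_ne_zero; field_simp) rfl
  · have := h.right.inv
    rwa [inv_div] at this

omit [IsAlgClosed K] in
theorem Loc.of_stdOver (hg : Gen u v)
    (h : (∃ c : K, Loc V u (v / u - algebraMap K _ c)) ∨ Loc V v (u / v)) :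
    IsDiv V u (v / u) ∨ Loc V u v := by
  rcases h with ⟨c, h⟩ | h
  · exact h.of_sub_const.blow_left hg
  · exact (h.blow_left hg.swap).imp (fun h => h.flip hg) (fun h => h.swap)

omit [IsAlgClosed K] in
theorem onCentre_of_le (hg : Gen u v) (h : (planePoint u v).toSubring ≤ V.toSubring) :
    OnCentre V u v 0 0 := by
  intro P hP
  by_contra h0
  have hP0 : polyHom u v P ≠ 0 :=
    (HasVal.polyHom hg.hasVal_left hg.hasVal_right P).ne_zero h0
  exact not_inMax_of_inv_mem (O := V.toLocalSubring) hP0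
    (h (mem_planePoint_iff.2 ⟨1, P, h0, hP0, by simp⟩)) hP

variable {S Z : Set (LocalSubring (FunField K))}

omit [IsAlgClosed K] in
theorem Curve.exists_loc (hS : IsModel S) (C : Curve S) : ∃ u v, Gen u v ∧ planePoint u v ∈ S ∧
    (planePoint u v).toSubring ≤ C.ring.toSubring ∧ Loc C.ring u v := by
  obtain ⟨O, hO, hle, hf⟩ := C.isLocalization
  obtain ⟨u, v, hg, rfl⟩ := hS.gen O hO
  exact ⟨u, v, hg, hO, hle, loc_of_isLocalization hg (valuationSubring_ne_top C.ring) hle hf⟩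

/-- A curve on a blow-up is the strict transform of a curve or an exceptional curve. -/
theorem Curve.blowUp_cases (hZ : Z ⊆ S) (C : Curve (blowUp S Z)) :
    (∃ C₀ : Curve S, C₀.ring = C.ring) ∨
    ∃ B ∈ Z, ∀ u v, Gen u v → B = planePoint u v → IsDiv C.ring u (v / u) := by
  obtain ⟨O, hO, hle, hf⟩ := C.isLocalization
  rcases hO with ⟨hO, -⟩ | ⟨B, hB, hBO⟩
  · exact Or.inl ⟨⟨C.ring, C.dvr, O, hO, hle, hf⟩, rfl⟩
  by_cases hcase : ∃ u v, Gen u v ∧ B = planePoint u v ∧ Loc C.ring u v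
  · obtain ⟨u, v, hg, rfl, hl⟩ := hcase
    left
    refine hl.exists_curve (a := 0) (b := 0) hg (onCentre_of_le hg ?_) ?_
    · exact (le_of_stdOver hg ((isOver_iff hg).1 hBO)).1.trans hle
    · rw [map_zero, sub_zero, sub_zero]; exact hZ hB
  · refine Or.inr ⟨B, hB, fun u v hg he => ?_⟩
    subst he
    have hV := valuationSubring_ne_top C.ring
    have : IsDiv C.ring u (v / u) ∨ Loc C.ring u v := by
      refine Loc.of_stdOver hg ?_
      rcases (isOver_iff hg).1 hBO with ⟨c, rfl⟩ | rfl
      · exact Or.inl ⟨c, loc_of_isLocalization (hg.blow_left c) hV hle hf⟩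
      · exact Or.inr (loc_of_isLocalization hg.blow_right hV hle hf)
    rcases this with h | h
    · exact h
    · exact absurd ⟨u, v, hg, rfl, h⟩ hcase

omit [IsAlgClosed K] in
-- The same dichotomy at infinity: either 1/u vanishes along V, which is then the line at infinity,
-- or u is a unit and V lives on the affine plane.
theorem Loc.of_infinity (hg : Gen u v) {a b : K}
    (h : Loc V (v / u - algebraMap K _ a) (1 / u - algebraMap K _ b)) :
    Loc V u v ∨ IsDiv V (1 / u) (v / u) := by
  have h1 : Loc V (v / u) (1 / u) := h.of_sub_const.swap.of_sub_const.swap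
  have hu := hg.left_ne_zero
  by_cases hm : InMax V.toLocalSubring (1 / u)
  · right
    refine ⟨hm.hasVal h1.const, (noVal_iff h1.const).2 ⟨h1.left, fun c hc => ?_⟩⟩
    exact h1.not_both c 0 ⟨hc, hm.hasVal h1.const⟩
  · left
    have huV : u ∈ V := by
      have := inv_mem_of_not_inMax (O := V.toLocalSubring) h1.right hm
      rwa [one_div, inv_inv] at this
    have hui : u⁻¹ ∈ V := by rw [← one_div]; exact h1.right
    refine ⟨h1.ne_top, h1.const, huV, ?_, fun c d hcd => ?_⟩
    · have := V.mul_mem _ _ h1.left huV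
      rwa [div_mul_cancel₀ _ hu] at this
    · have hc : c ≠ 0 := by
        rintro rfl
        exact not_inMax_of_inv_mem (O := V.toLocalSubring) hu hui hcd.1.inMax
      exact h1.not_both (d / c) (1 / c)
        ⟨hcd.2.div hcd.1 hc, (HasVal.one hcd.1.1).div hcd.1 hc⟩

omit [IsAlgClosed K] in
theorem Curve.plane_cases (C : Curve (plane K)) :
    Loc C.ring (FunField.x K) (FunField.y K) ∨
      IsDiv C.ring (1 / FunField.x K) (FunField.y K / FunField.x K) := by
  obtain ⟨O, hO, hle, hf⟩ := C.isLocalization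
  have hV := valuationSubring_ne_top C.ring
  have hx := x_ne_zero (K := K)
  have hy := y_ne_zero (K := K)
  obtain ⟨a, b, rfl | rfl | rfl⟩ := hO
  · exact Or.inl (loc_of_isLocalization (gen_xy.sub_const a b) hV
      hle hf).of_sub_const.swap.of_sub_const.swap
  · exact (loc_of_isLocalization (gen_xy.infinity.sub_const a b) hV hle hf).of_infinity gen_xy
  · rcases (loc_of_isLocalization (gen_xy.swap.infinity.sub_const a b) hV
      hle hf).of_infinity gen_xy.swap with h | h
    · exact Or.inl h.swap
    · right
      refine ⟨?_, ?_⟩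
      · exact (h.left.zero_div_noVal h.right).congr (by field_simp) rfl
      · have := h.right.inv
        rwa [inv_div] at this

end Loc

end BirSurf

namespace BirSurf

/-! ## Surfaces, local equations and pull-backs -/

section Surface

variable {K : Type*} [Field K]

/-- A model on which no local ring of a curve dominates the local ring of a point. -/
structure IsSurface (S : Set (LocalSubring (FunField K))) : Prop extends IsModel S where
  nonDom : ∀ C : Curve S, ∀ O ∈ S, ¬ O ≤ C.ring.toLocalSubring

variable {S Z : Set (LocalSubring (FunField K))} {V : ValuationSubring (FunField K)}
  {u v t φ ψ : FunField K} {O : LocalSubring (FunField K)}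

theorem isSurface_plane : IsSurface (plane K) where
  toIsModel := isModel_plane
  nonDom C O hO hle := by
    have hx := x_ne_zero (K := K)
    have hy := y_ne_zero (K := K)
    rcases mem_plane_cases hO with ⟨a, b, rfl⟩ | ⟨a, rfl⟩ | rfl
    · have h := (gen_xy.sub_const a b).hasVal_of_le hle
      rcases Curve.plane_cases C with hC | hC
      · exact hC.not_both a b ⟨h.1.of_sub_const, h.2.of_sub_const⟩
      · exact h.1.of_sub_const.not_zero_of_inv (by rw [← one_div]; exact hC.left) hx
    · have hg := gen_xy.infinity.sub_const a (0 : K)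
      rw [map_zero, sub_zero] at hg
      have h := hg.hasVal_of_le hle
      rcases Curve.plane_cases C with hC | hC
      · have h1 := h.2.zero_mul_mem hC.left
        rw [one_div, inv_mul_cancel₀ hx] at h1
        exact not_inMax_one h1.inMax
      · exact hC.right.not_hasVal a h.1.of_sub_const
    · have h := gen_xy.swap.infinity.hasVal_of_le hle
      rcases Curve.plane_cases C with hC | hC
      · have h1 := h.2.zero_mul_mem hC.right
        rw [one_div, inv_mul_cancel₀ hy] at h1
        exact not_inMax_one h1.inMax
      · have h1 := hC.right.inv
        rw [inv_div] at h1
        exact h1.not_hasVal 0 h.1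

theorem IsDiv.planePoint_le_blow (hg : Gen u v) (h : IsDiv V u (v / u)) :
    planePoint u v ≤ V.toLocalSubring := by
  refine BirSurf.planePoint_le h.left ?_
  exact (h.left.zero_mul_mem h.right.mem).congr (mul_div_cancel₀ _ hg.left_ne_zero) rfl

/-- The exceptional curve dominates the blown-up point, which is no longer a point of the surface.
Each point that replaces it would fix the value of v/u or of u/v, and neither is constant on the
curve. -/
theorem IsModel.nonDom_of_isDiv (hS : IsModel S) (hZ : Z ⊆ S) (hg : Gen u v)
    (huv : planePoint u v ∈ Z) (h : IsDiv V u (v / u)) :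
    ∀ O ∈ _root_.blowUp S Z, ¬ O ≤ V.toLocalSubring := by
  intro O hO hle
  obtain ⟨B, hB, hBO, hc⟩ := hS.exists_base hZ hO
  obtain rfl := hS.sep B hB _ (hZ huv) V.toLocalSubring (hBO.trans hle) (h.planePoint_le_blow hg)
  rcases hc with ⟨hn, -⟩ | ⟨-, hov⟩
  · exact hn huv
  · rcases (isOver_iff hg).1 hov with ⟨c, rfl⟩ | rfl
    · exact h.right.not_hasVal c ((hg.blow_left c).hasVal_of_le hle).2.of_sub_const
    · have := h.right.inv
      rw [inv_div] at this
      exact this.not_hasVal 0 (hg.blow_right.hasVal_of_le hle).2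

theorem IsSurface.blowUp [IsAlgClosed K] (hS : IsSurface S) (hZ : Z ⊆ S) :
    IsSurface (blowUp S Z) where
  toIsModel := hS.toIsModel.blowUp hZ
  nonDom C := by
    rcases Curve.blowUp_cases hZ C with ⟨C₀, hC₀⟩ | ⟨B, hB, h⟩
    · intro O hO hle
      obtain ⟨B, hB, hBO, -⟩ := hS.exists_base hZ hO
      exact hS.nonDom C₀ B hB (hC₀ ▸ hBO.trans hle)
    · obtain ⟨u, v, hg, rfl⟩ := hS.gen B (hZ hB)
      exact hS.toIsModel.nonDom_of_isDiv hZ hg hB (h u v hg rfl)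

/-- If `O ⊆ V`, then values in `V` of elements of `O` agree with the values in `O`, or vanish. -/
theorem HasVal.eq_of_le {a b : K} (hle : O.toSubring ≤ V.toSubring) (h : HasVal O φ a)
    (h' : HasVal V.toLocalSubring φ b) : a = b := by
  by_contra hn
  have h1 : HasVal O (φ - algebraMap K _ b) (a - b) := h.sub (HasVal.const h.1 b)
  have h2 := h1.inv_mem (sub_ne_zero.2 hn)
  exact not_inMax_of_inv_mem (O := V.toLocalSubring) (h1.ne_zero (sub_ne_zero.2 hn)) (hle h2) h'.2

/-- If u and v both have values in V, these are their values at the point, namely 0, and V is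
centred at the point. Otherwise its centre is a curve through the point. -/
theorem loc_or_le (hg : Gen u v) (hV : V ≠ ⊤) (hle : (planePoint u v).toSubring ≤ V.toSubring) :
    Loc V u v ∨ planePoint u v ≤ V.toLocalSubring := by
  by_cases hab : ∃ a b : K, HasVal V.toLocalSubring u a ∧ HasVal V.toLocalSubring v b
  · obtain ⟨a, b, ha, hb⟩ := hab
    obtain rfl := hg.hasVal_left.eq_of_le hle ha
    obtain rfl := hg.hasVal_right.eq_of_le hle hb
    exact Or.inr (planePoint_le ha hb)
  · push Not at hab
    exact Or.inl ⟨hV, (hasConst_planePoint u v).mono hle, hle hg.hasVal_left.mem,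
      hle hg.hasVal_right.mem, fun a b h => hab a b h.1 h.2⟩

theorem IsSurface.loc_curve (hS : IsSurface S) (hg : Gen u v) (hO : planePoint u v ∈ S) (C : Curve S)
    (hle : (planePoint u v).toSubring ≤ C.ring.toSubring) : Loc C.ring u v :=
  (loc_or_le hg (valuationSubring_ne_top C.ring) hle).resolve_right (hS.nonDom C _ hO)

/-- A curve through the point with coordinates `u, v` on which `u` vanishes is the curve
`u = 0`. -/
theorem IsSurface.isDiv_of_inMax (hS : IsSurface S) (hg : Gen u v) (hO : planePoint u v ∈ S)
    (C : Curve S) (hle : (planePoint u v).toSubring ≤ C.ring.toSubring)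
    (hu : InMax C.ring.toLocalSubring u) : IsDiv C.ring u v := by
  have hl := hS.loc_curve hg hO C hle
  exact ⟨hu.hasVal hl.const, (noVal_iff hl.const).2 ⟨hl.right, fun c hc =>
    hl.not_both 0 c ⟨hu.hasVal hl.const, hc⟩⟩⟩

theorem IsDiv.ord_left [IsAlgClosed K] (hg : Gen u t) (h : IsDiv V u t)
    [IsDiscreteValuationRing V] : ord V u = 1 := by
  have h1 := h.eq_primeVal hg
  subst h1
  have := ord_primeVal_self hg.fracHom (prime_X (K := K) 0)
  rwa [polyHom_X0] at this

theorem ord_eq_zero_of_noVal [IsDiscreteValuationRing V] (h : NoVal K V.toLocalSubring t) :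
    ord V t = 0 := ord_eq_zero h.mem h.not_inMax

theorem ord_eq_zero_of_hasVal [IsDiscreteValuationRing V] {c : K}
    (h : HasVal V.toLocalSubring t c) (hc : c ≠ 0) : ord V t = 0 :=
  ord_eq_zero h.mem (h.not_inMax hc)

/-- The normal crossings case: at the point only the two coordinate lines can be components of D,
and each coordinate has order 1 on its line and 0 on every other curve through the point. -/
theorem IsSurface.isLocalEquation [IsAlgClosed K] (hS : IsSurface S) (hg : Gen u v)
    (hO : planePoint u v ∈ S) {D : Divisor S} {m n : ℤ}
    (h0 : ∀ C : Curve S, (planePoint u v).toSubring ≤ C.ring.toSubring → ¬ IsDiv C.ring u v →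
      ¬ IsDiv C.ring v u → D C = 0)
    (hm : ∀ C : Curve S, IsDiv C.ring u v → D C = m)
    (hn : ∀ C : Curve S, IsDiv C.ring v u → D C = n) :
    IsLocalEquation D (planePoint u v) (u ^ m * v ^ n) := by
  have hu0 := hg.left_ne_zero
  have hv0 := hg.right_ne_zero
  refine ⟨mul_ne_zero (zpow_ne_zero _ hu0) (zpow_ne_zero _ hv0), fun C hC => ?_⟩
  rw [ord_mul (zpow_ne_zero _ hu0) (zpow_ne_zero _ hv0), ord_zpow, ord_zpow]
  have hsw : planePoint u v = planePoint v u :=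
    planePoint_eq hg.hasVal_right hg.hasVal_left hg.swap.hasVal_right hg.swap.hasVal_left
  by_cases h1 : IsDiv C.ring u v
  · rw [h1.ord_left hg, ord_eq_zero_of_noVal h1.right, hm C h1]; ring
  have h1' : ord C.ring u = 0 := ord_eq_zero (hC hg.hasVal_left.mem)
    fun h => h1 (hS.isDiv_of_inMax hg hO C hC h)
  by_cases h2 : IsDiv C.ring v u
  · rw [h2.ord_left hg.swap, h1', hn C h2]; ring
  have h2' : ord C.ring v = 0 := ord_eq_zero (hC hg.hasVal_right.mem)
    fun h => h2 (hS.isDiv_of_inMax hg.swap (hsw ▸ hO) C (hsw ▸ hC) h)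
  rw [h1', h2', h0 C hC h1 h2]; ring

/-- The curve through a point given by an irreducible local equation. -/
theorem exists_curve_primeVal (hg : Gen u v) (hO : planePoint u v ∈ S)
    {p : MvPolynomial (Fin 2) K} (hp : Prime p) (hp0 : MvPolynomial.eval ![0, 0] p = 0) :
    ∃ C : Curve S, C.ring = primeVal hg.fracHom hp ∧
      (planePoint u v).toSubring ≤ C.ring.toSubring := by
  have hle : (planePoint u v).toSubring ≤ (primeVal hg.fracHom hp).toSubring := by
    rintro _ ⟨P, Q, hQ, -, rfl⟩
    exact ⟨P, Q, fun ⟨q, hq⟩ => hQ (by rw [hq, map_mul, hp0, zero_mul]), rfl⟩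
  refine ⟨⟨primeVal hg.fracHom hp, inferInstance, _, hO, hle, ?_⟩, rfl, hle⟩
  rintro _ ⟨P, Q, hQ, rfl⟩
  have hmem : ∀ P, polyHom u v P ∈ (planePoint u v).toSubring := fun P =>
    mem_planePoint_iff.2 ⟨P, 1, by simp, by simp, by simp⟩
  refine ⟨_, hmem P, _, hmem Q, hg.fracHom.ne_zero (fun h => hQ (h ▸ dvd_zero p)), ?_, rfl⟩
  exact ⟨1, Q, hQ, by simp⟩

/-- A function without poles along the curves through a point is regular at the point. -/
theorem mem_of_ord_nonneg (hg : Gen u v) (hO : planePoint u v ∈ S)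
    (h : ∀ C : Curve S, (planePoint u v).toSubring ≤ C.ring.toSubring → 0 ≤ ord C.ring φ) :
    φ ∈ (planePoint u v).toSubring := by
  obtain ⟨A, B, hB, rfl⟩ := hg.fracHom.frac φ
  by_cases hA : A = 0
  · rw [hA, map_zero, zero_div]; exact Subring.zero_mem _
  obtain ⟨P, Q, c, hrel, hcP, hcQ⟩ := UniqueFactorizationMonoid.exists_reduced_factors A hA B
  have hc0 : c ≠ 0 := by rintro rfl; exact hA (by rw [← hcP, zero_mul])
  have hP0 : P ≠ 0 := by rintro rfl; exact hA (by rw [← hcP, mul_zero])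
  have hQ0 : Q ≠ 0 := by rintro rfl; exact hB (by rw [← hcQ, mul_zero])
  have hφ : polyHom u v A / polyHom u v B = polyHom u v P / polyHom u v Q := by
    rw [← hcP, ← hcQ, map_mul, map_mul, mul_div_mul_left _ _ (hg.fracHom.ne_zero hc0)]
  rw [hφ] at h ⊢
  refine mem_planePoint_iff.2 ⟨P, Q, ?_, hg.fracHom.ne_zero hQ0, rfl⟩
  intro hQe
  -- If the reduced denominator vanished at the point, one of its prime factors would too. It would
  -- define a curve through the point along which the function has a pole, as the numerator is prime
  -- to it.
  obtain ⟨f, hf, hfQ⟩ := UniqueFactorizationMonoid.exists_prime_factors Q hQ0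
  have h1 : MvPolynomial.eval ![0, 0] f.prod = 0 := by
    obtain ⟨w, hw⟩ := hfQ
    have h2 := congrArg (MvPolynomial.eval ![(0 : K), 0]) hw
    rw [map_mul, hQe] at h2
    exact (mul_eq_zero.1 h2).resolve_right
      ((w.isUnit.map (MvPolynomial.eval ![(0 : K), 0])).ne_zero)
  rw [map_multiset_prod, Multiset.prod_eq_zero_iff, Multiset.mem_map] at h1
  obtain ⟨p, hpf, hp0⟩ := h1
  have hp := hf p hpf
  have hpQ : p ∣ Q := (Multiset.dvd_prod hpf).trans hfQ.dvd
  obtain ⟨C, hC, hle⟩ := exists_curve_primeVal hg hO hp hp0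
  have h2 := h C hle
  have hpP : ¬ p ∣ P := fun hd => hp.not_isUnit (hrel hd hpQ)
  have h3 : ord C.ring (polyHom u v P) = 0 := by
    refine ord_eq_zero ?_ ?_
    · rw [hC]; exact mem_primeVal _ _ P
    · rw [hC, inMax_primeVal_iff]; exact hpP
  have h4 : 0 < ord C.ring (polyHom u v Q) := by
    rw [ord_pos_iff (hg.fracHom.ne_zero hQ0), hC, inMax_primeVal_iff]; exact hpQ
  rw [ord_div (hg.fracHom.ne_zero hP0) (hg.fracHom.ne_zero hQ0)] at h2
  omega

theorem IsModel.unit_of_ord_eq_zero (hS : IsModel S) (hO : O ∈ S)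
    (h : ∀ C : Curve S, O.toSubring ≤ C.ring.toSubring → ord C.ring φ = 0) :
    φ ∈ O.toSubring ∧ φ⁻¹ ∈ O.toSubring := by
  obtain ⟨u, v, hg, rfl⟩ := hS.gen O hO
  exact ⟨mem_of_ord_nonneg hg hO fun C hC => (h C hC).ge,
    mem_of_ord_nonneg hg hO fun C hC => by rw [ord_inv, h C hC, neg_zero]⟩

theorem _root_.IsLocalEquation.unit (hS : IsModel S) (hO : O ∈ S) {D : Divisor S}
    (h : IsLocalEquation D O φ) (h' : IsLocalEquation D O ψ) :
    φ / ψ ∈ O.toSubring ∧ (φ / ψ)⁻¹ ∈ O.toSubring := by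
  refine hS.unit_of_ord_eq_zero hO fun C hC => ?_
  rw [ord_div h.1 h'.1, h.2 C hC, h'.2 C hC, sub_self]

theorem _root_.IsLocalEquation.mul {D E : Divisor S} (h : IsLocalEquation D O φ)
    (h' : IsLocalEquation E O ψ) : IsLocalEquation (D + E) O (φ * ψ) :=
  ⟨mul_ne_zero h.1 h'.1, fun C hC => by
    rw [ord_mul h.1 h'.1, h.2 C hC, h'.2 C hC, Finsupp.add_apply]⟩

theorem _root_.IsLocalEquation.zpow {D : Divisor S} (h : IsLocalEquation D O φ) (n : ℤ) :
    IsLocalEquation (n • D) O (φ ^ n) :=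
  ⟨zpow_ne_zero _ h.1, fun C hC => by
    rw [ord_zpow, h.2 C hC, Finsupp.smul_apply, smul_eq_mul]⟩

theorem isLocalEquation_zero (O : LocalSubring (FunField K)) :
    IsLocalEquation (0 : Divisor S) O 1 :=
  ⟨one_ne_zero, fun C _ => by rw [ord_one, Finsupp.zero_apply]⟩

/-- Weil divisors are Cartier: a curve through the point has the prime generating its centre ideal
as equation, and a curve not through the point has the equation 1. -/
theorem IsSurface.exists_localEquation [IsAlgClosed K] (hS : IsSurface S) (hO : O ∈ S)
    (D : Divisor S) : ∃ φ, IsLocalEquation D O φ := by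
  classical
  obtain ⟨u, v, hg, rfl⟩ := hS.gen O hO
  induction D using Finsupp.induction_linear with
  | zero => exact ⟨1, isLocalEquation_zero _⟩
  | add D E hD hE =>
    obtain ⟨φ, hφ⟩ := hD
    obtain ⟨ψ, hψ⟩ := hE
    exact ⟨_, hφ.mul hψ⟩
  | single C n =>
    have h1 : ∃ φ, IsLocalEquation (Finsupp.single C 1) (planePoint u v) φ := by
      by_cases hC : (planePoint u v).toSubring ≤ C.ring.toSubring
      · obtain ⟨p, hp, hV, -⟩ := (hS.loc_curve hg hO C hC).exists_prime hg
        refine ⟨polyHom u v p, hg.fracHom.ne_zero hp.ne_zero, fun C' hC' => ?_⟩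
        obtain ⟨p', hp', hV', -⟩ := (hS.loc_curve hg hO C' hC').exists_prime hg
        by_cases he : C = C'
        · subst he
          rw [Finsupp.single_eq_same]
          have := ord_primeVal_self hg.fracHom hp
          simp only [hV]
          exact this
        · rw [Finsupp.single_eq_of_ne (Ne.symm he)]
          refine ord_eq_zero ?_ fun hm => ?_
          · rw [hV']; exact mem_primeVal _ _ p
          · rw [hV', inMax_primeVal_iff] at hm
            have hass := hp'.associated_of_dvd hp hm
            refine he (Curve.ext ?_)
            rw [hV, hV']
            refine BirSurf.eq_primeVal _ _ ?_ (fun a => mem_primeVal _ _ a) fun a ha => ?_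
            · exact valuationSubring_ne_top _
            · rw [inMax_primeVal_iff] at ha
              exact hass.dvd.trans ha
      · refine ⟨1, one_ne_zero, fun C' hC' => ?_⟩
        rw [ord_one, Finsupp.single_eq_of_ne]
        rintro rfl
        exact hC hC'
    obtain ⟨φ, hφ⟩ := h1
    refine ⟨φ ^ n, ?_⟩
    have := hφ.zpow n
    rwa [Finsupp.smul_single, smul_eq_mul, mul_one] at this

theorem IsSurface.curve_or_le [IsAlgClosed K] (hS : IsSurface S) (hO : O ∈ S) (hV : V ≠ ⊤)
    (hle : O.toSubring ≤ V.toSubring) :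
    (∃ C : Curve S, C.ring = V) ∨ O ≤ V.toLocalSubring := by
  obtain ⟨u, v, hg, rfl⟩ := hS.gen O hO
  refine (loc_or_le hg hV hle).imp (fun hl => ?_) id
  refine hl.exists_curve hg (onCentre_of_le hg hle) ?_
  rwa [map_zero, sub_zero, sub_zero]

/-- The order of a divisor along a valuation is independent of the point and of the local equation
used to define it. -/
theorem IsSurface.ord_localEquation [IsAlgClosed K] (hS : IsSurface S) [IsDiscreteValuationRing V]
    {O₁ O₂ : LocalSubring (FunField K)} (h1 : O₁ ∈ S) (h2 : O₂ ∈ S)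
    (hV1 : O₁.toSubring ≤ V.toSubring) (hV2 : O₂.toSubring ≤ V.toSubring) {D : Divisor S}
    (hφ : IsLocalEquation D O₁ φ) (hψ : IsLocalEquation D O₂ ψ) : ord V φ = ord V ψ := by
  by_cases hC : ∃ C : Curve S, C.ring = V
  · obtain ⟨C, rfl⟩ := hC
    rw [hφ.2 C hV1, hψ.2 C hV2]
  · have hV := valuationSubring_ne_top V
    have hd1 := (hS.curve_or_le h1 hV hV1).resolve_left hC
    have hd2 := (hS.curve_or_le h2 hV hV2).resolve_left hC
    obtain rfl := hS.sep _ h1 _ h2 _ hd1 hd2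
    obtain ⟨hm, hm'⟩ := hφ.unit hS.toIsModel h1 hψ
    have h0 : φ / ψ ≠ 0 := div_ne_zero hφ.1 hψ.1
    have := ord_eq_zero (V := V) (hV1 hm)
      (not_inMax_of_inv_mem (O := V.toLocalSubring) h0 (hV1 hm'))
    rw [ord_div hφ.1 hψ.1] at this
    omega

/-- The image of a valuation ring under a birational map. -/
noncomputable def push (f : BirMap K) (V : ValuationSubring (FunField K)) : ValuationSubring (FunField K) :=
  V.comap (f.comorphism : FunField K →+* FunField K)

theorem mem_push {f : BirMap K} {g : FunField K} : g ∈ push f V ↔ f.comorphism g ∈ V := Iff.rfl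

theorem inMax_push {f : BirMap K} {g : FunField K} :
    InMax (push f V).toLocalSubring g ↔ InMax V.toLocalSubring (f.comorphism g) := by
  rw [inMax_valuationSubring_iff, inMax_valuationSubring_iff, mem_push, mem_push, map_inv₀]
  simp

theorem hasConst_push {f : BirMap K} :
    HasConst K (push f V).toLocalSubring ↔ HasConst K V.toLocalSubring := by
  refine forall_congr' fun a => ?_
  change f.comorphism (algebraMap K _ a) ∈ V ↔ _
  rw [AlgEquiv.commutes]; rfl

theorem hasVal_push {f : BirMap K} {g : FunField K} {c : K} :
    HasVal (push f V).toLocalSubring g c ↔ HasVal V.toLocalSubring (f.comorphism g) c := by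
  unfold HasVal
  rw [hasConst_push, inMax_push, map_sub, AlgEquiv.commutes]

theorem noVal_push {f : BirMap K} {g : FunField K} :
    NoVal K (push f V).toLocalSubring g ↔ NoVal K V.toLocalSubring (f.comorphism g) := by
  refine and_congr hasConst_push (and_congr Iff.rfl (forall_congr' fun c => ?_))
  rw [inMax_push, map_sub, AlgEquiv.commutes]

instance isDiscreteValuationRing_push (f : BirMap K) [IsDiscreteValuationRing V] :
    IsDiscreteValuationRing (push f V) := by
  let e : V ≃+* push f V :=
    { toFun := fun z => ⟨f.comorphism.symm z, by rw [mem_push]; simp⟩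
      invFun := fun z => ⟨f.comorphism z, z.2⟩
      left_inv := fun z => by simp
      right_inv := fun z => by simp
      map_mul' := fun a b => Subtype.ext (by simp)
      map_add' := fun a b => Subtype.ext (by simp) }
  exact IsDiscreteValuationRing.RingEquivClass.isDiscreteValuationRing e

theorem ord_push (f : BirMap K) [IsDiscreteValuationRing V] (g : FunField K) :
    ord V (f.comorphism g) = ord (push f V) g :=
  ord_map (V := push f V) (V' := V) (f.comorphism : FunField K ≃+* FunField K)
    (fun _ => Iff.rfl) g

theorem push_comp (f g : BirMap K) : push (g.comp f) V = push g (push f V) := rfl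

theorem planePoint_map (f : BirMap K) (u v : FunField K) :
    (planePoint u v).map (f.comorphism : FunField K →+* FunField K) =
      planePoint (f.comorphism u) (f.comorphism v) := by
  have key : ∀ P : MvPolynomial (Fin 2) K, f.comorphism (polyHom u v P) =
      polyHom (f.comorphism u) (f.comorphism v) P := by
    intro P
    induction P using MvPolynomial.induction_on with
    | C c => rw [polyHom_C, polyHom_C, AlgEquiv.commutes]
    | add p q hp hq => rw [map_add, map_add, hp, hq, map_add]
    | mul_X p i hp =>
      rw [map_mul, map_mul, hp, map_mul]
      congr 1
      fin_cases i <;> simp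
  apply LocalSubring.toSubring_injective
  ext g
  constructor
  · rintro ⟨_, ⟨P, Q, hQ, hQ0, rfl⟩, rfl⟩
    refine mem_planePoint_iff.2 ⟨P, Q, hQ, ?_, ?_⟩
    · rw [← key]
      exact (map_ne_zero_iff _ f.comorphism.injective).2 hQ0
    · change f.comorphism (polyHom u v P / polyHom u v Q) = _
      rw [map_div₀, key, key]
  · intro hg
    obtain ⟨P, Q, hQ, hQ0, rfl⟩ := mem_planePoint_iff.1 hg
    rw [← key] at hQ0
    refine ⟨_, mem_planePoint_iff.2 ⟨P, Q, hQ, fun h => hQ0 (by rw [h, map_zero]), rfl⟩, ?_⟩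
    change f.comorphism _ = _
    rw [map_div₀, key, key]

/-- By `planePoint_le`, computing the image of a point amounts to evaluating the pulled-back
coordinates of the target. -/
theorem mapsPoint_planePoint {f : BirMap K} (hu : HasVal O (f.comorphism u) (0 : K))
    (hv : HasVal O (f.comorphism v) (0 : K)) : MapsPoint f O (planePoint u v) := by
  rw [MapsPoint, planePoint_map]
  exact planePoint_le hu hv

theorem mapsPoint_iff {f : BirMap K} {O O' : LocalSubring (FunField K)} : MapsPoint f O O' ↔
    (∀ z ∈ O'.toSubring, f.comorphism z ∈ O.toSubring) ∧
      ∀ z, InMax O' z → InMax O (f.comorphism z) := by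
  rw [MapsPoint, localSubring_le_iff]
  have hmax : ∀ z, InMax (O'.map (f.comorphism : FunField K →+* FunField K))
      (f.comorphism z) ↔ InMax O' z := by
    intro z
    have hmem : ∀ w, f.comorphism w ∈
        (O'.map (f.comorphism : FunField K →+* FunField K)).toSubring ↔ w ∈ O'.toSubring := by
      intro w
      constructor
      · rintro ⟨w', hw', he⟩
        obtain rfl := f.comorphism.injective he
        exact hw'
      · exact fun hw => ⟨w, hw, rfl⟩
    rw [inMax_iff, inMax_iff, hmem, ← map_inv₀, hmem]
    simp
  refine and_congr ⟨fun hle z hz => hle ⟨z, hz, rfl⟩, ?_⟩ ⟨fun hm z hz => hm _ ((hmax z).2 hz), ?_⟩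
  · rintro hle _ ⟨z, hz, rfl⟩
    exact hle z hz
  · intro hm w hw
    obtain ⟨z, rfl⟩ := f.comorphism.surjective w
    exact hm z ((hmax z).1 hw)

theorem mapsPoint_valuationSubring_iff {f : BirMap K} {O : LocalSubring (FunField K)} :
    MapsPoint f V.toLocalSubring O ↔ O ≤ (push f V).toLocalSubring := by
  rw [mapsPoint_iff, localSubring_le_iff]
  exact and_congr Iff.rfl (forall_congr' fun z => by rw [inMax_push])

theorem _root_.MapsPoint.mem {f : BirMap K} {O₁ O₂ : LocalSubring (FunField K)}
    (hf : MapsPoint f O₁ O₂) {g : FunField K} (hg : g ∈ O₂.toSubring) :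
    f.comorphism g ∈ O₁.toSubring := hf.1 ⟨g, hg, rfl⟩

theorem _root_.MapsPoint.mono {f : BirMap K} {O₁ O₂ O₃ : LocalSubring (FunField K)}
    (hf : MapsPoint f O₁ O₂) (h : O₁ ≤ O₃) : MapsPoint f O₃ O₂ := le_trans hf h

theorem isPullback_iff {T : Set (LocalSubring (FunField K))} {f : BirMap K} {D : Divisor T}
    {D' : Divisor S} : IsPullback f D D' ↔ ∀ C : Curve S, ∃ O ∈ T,
      O.toSubring ≤ (push f C.ring).toSubring ∧ ∃ φ, IsLocalEquation D O φ ∧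
      ord (push f C.ring) φ = D' C := by
  refine forall_congr' fun C => exists_congr fun O => and_congr_right fun _ =>
    and_congr Iff.rfl (exists_congr fun φ => and_congr_right fun _ => ?_)
  rw [ord_push]

/-- `(g ∘ f)^* = f^* ∘ g^*` if no curve is contracted by `f` to a point of indeterminacy
of `g`. -/
theorem IsSurface.isPullback_comp [IsAlgClosed K] (hS : IsSurface S) {f g : BirMap K}
    (H : ∀ C : Curve S, (∃ C' : Curve S, C'.ring = push f C.ring) ∨
      ∃ O ∈ S, O.toSubring ≤ (push f C.ring).toSubring ∧ ∃ O' ∈ S, MapsPoint g O O')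
    {D D' D'' : Divisor S} (hg : IsPullback g D D') (hf : IsPullback f D' D'') :
    IsPullback (g.comp f) D D'' := by
  rw [isPullback_iff] at hg hf ⊢
  intro C
  obtain ⟨O₁, hO₁, hle₁, φ₁, hφ₁, hord₁⟩ := hf C
  rcases H C with ⟨C', hC'⟩ | ⟨O, hO, hle, O', hO', hm⟩
  · obtain ⟨O₂, hO₂, hle₂, φ₂, hφ₂, hord₂⟩ := hg C'
    have hr : push (g.comp f) C.ring = push g C'.ring := by rw [push_comp, hC']
    refine ⟨O₂, hO₂, hr ▸ hle₂, φ₂, hφ₂, ?_⟩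
    have h1 : ord C'.ring φ₁ = D' C' := hφ₁.2 C' (hC' ▸ hle₁)
    have h2 : ord C'.ring φ₁ = D'' C := by
      rw [← hord₁]; simp only [hC']
    have h3 : ord (push (g.comp f) C.ring) φ₂ = ord (push g C'.ring) φ₂ := by simp only [hr]
    rw [h3, hord₂, ← h1, h2]
  · obtain ⟨φ, hφ⟩ := hS.exists_localEquation hO' D
    have hle' : O'.toSubring ≤ (push (g.comp f) C.ring).toSubring := fun z hz =>
      hle (hm.mem hz)
    refine ⟨O', hO', hle', φ, hφ, ?_⟩
    -- Since g is defined at O, a local equation of D at the image pulls back to a local equation of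
    -- D' at O. This is the only place where absence of indeterminacy enters.
    have hloc : IsLocalEquation D' O (g.comorphism φ) := by
      refine ⟨(map_ne_zero_iff _ g.comorphism.injective).2 hφ.1, fun C₁ hC₁ => ?_⟩
      obtain ⟨O₂, hO₂, hle₂, φ₂, hφ₂, hord₂⟩ := hg C₁
      rw [ord_push, ← hord₂]
      exact hS.ord_localEquation hO' hO₂ (fun z hz => hC₁ (hm.mem hz)) hle₂ hφ hφ₂
    have hr : ord (push (g.comp f) C.ring) φ = ord (push g (push f C.ring)) φ := rfl
    rw [← hord₁, hr, ← ord_push g]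
    exact hS.ord_localEquation hO hO₁ hle hle₁ hloc hφ₁

/-- Every image under `f` of a curve on `S` has a centre on `S`. -/
def Centred (S : Set (LocalSubring (FunField K))) (f : BirMap K) : Prop :=
  ∀ C : Curve S, ∃ O ∈ S, O.toSubring ≤ (push f C.ring).toSubring

theorem IsSurface.isPullback_add [IsAlgClosed K] (hS : IsSurface S) {f : BirMap K}
    {D D' E E' : Divisor S} (hD : IsPullback f D D') (hE : IsPullback f E E') :
    IsPullback f (D + E) (D' + E') := by
  rw [isPullback_iff] at hD hE ⊢
  intro C
  obtain ⟨O₁, hO₁, hle₁, φ₁, hφ₁, hord₁⟩ := hD C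
  obtain ⟨O₂, hO₂, hle₂, φ₂, hφ₂, hord₂⟩ := hE C
  -- The pull-back of E may have been computed at a different point. The order does not depend on
  -- this choice, so E is recomputed at the point used for D.
  obtain ⟨ψ, hψ⟩ := hS.exists_localEquation hO₁ E
  refine ⟨O₁, hO₁, hle₁, _, hφ₁.mul hψ, ?_⟩
  rw [ord_mul hφ₁.1 hψ.1, hord₁, hS.ord_localEquation hO₁ hO₂ hle₁ hle₂ hψ hφ₂, hord₂,
    Finsupp.add_apply]

theorem _root_.IsPullback.zsmul {f : BirMap K} {D D' : Divisor S} (hD : IsPullback f D D') (n : ℤ) :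
    IsPullback f (n • D) (n • D') := by
  rw [isPullback_iff] at hD ⊢
  intro C
  obtain ⟨O₁, hO₁, hle₁, φ₁, hφ₁, hord₁⟩ := hD C
  exact ⟨O₁, hO₁, hle₁, _, hφ₁.zpow n, by
    rw [ord_zpow, hord₁, Finsupp.smul_apply, smul_eq_mul]⟩

theorem isPullback_zero {f : BirMap K} (hf : Centred S f) :
    IsPullback f (0 : Divisor S) (0 : Divisor S) := by
  rw [isPullback_iff]
  intro C
  obtain ⟨O, hO, hle⟩ := hf C
  exact ⟨O, hO, hle, 1, isLocalEquation_zero O, by rw [ord_one, Finsupp.zero_apply]⟩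

theorem IsSurface.isPullback_sum [IsAlgClosed K] (hS : IsSurface S) {f : BirMap K}
    (hf : Centred S f) {ι : Type*} (s : Finset ι) {D D' : ι → Divisor S}
    (h : ∀ i ∈ s, IsPullback f (D i) (D' i)) :
    IsPullback f (∑ i ∈ s, D i) (∑ i ∈ s, D' i) := by
  classical
  induction s using Finset.induction_on with
  | empty => simpa using isPullback_zero hf
  | insert i s hi ih =>
    rw [Finset.sum_insert hi, Finset.sum_insert hi]
    exact hS.isPullback_add (h i (Finset.mem_insert_self i s))
      (ih fun j hj => h j (Finset.mem_insert_of_mem hj))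

/-- `D` is the divisor of the function `g`. -/
def IsDivisorOf (g : FunField K) (D : Divisor S) : Prop :=
  g ≠ 0 ∧ ∀ C : Curve S, D C = ord C.ring g

theorem IsDivisorOf.isLocalEquation {g : FunField K} {D : Divisor S} (h : IsDivisorOf g D)
    (O : LocalSubring (FunField K)) : IsLocalEquation D O g :=
  ⟨h.1, fun C _ => (h.2 C).symm⟩

/-- A global equation serves as local equation at every point, so principal divisors pull back to
principal divisors. -/
theorem IsDivisorOf.isPullback {f : BirMap K} (hf : Centred S f) {g : FunField K}
    {D D' : Divisor S} (h : IsDivisorOf g D) (h' : IsDivisorOf (f.comorphism g) D') :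
    IsPullback f D D' := by
  rw [isPullback_iff]
  intro C
  obtain ⟨O, hO, hle⟩ := hf C
  exact ⟨O, hO, hle, g, h.isLocalEquation O, by rw [← ord_push, h'.2 C]⟩

end Surface

end BirSurf

namespace BirSurf

open FunField

set_option linter.unusedSectionVars false

/-! ## The surface -/

section Points

variable {K : Type*} [Field K]

/-- The constant function `a`. -/
noncomputable abbrev co (a : K) : FunField K := algebraMap K (FunField K) a

/-- The coordinate `y / x - μ` at the point at infinity of slope `μ`. -/
noncomputable abbrev xi (μ : K) : FunField K := y K / x K - co μ

/-- The coordinate on the exceptional curve over the point at infinity of slope `μ`. -/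
noncomputable abbrev tt (μ : K) : FunField K := 1 / x K / xi μ

/-- The function whose levels are the lines of slope `μ`. -/
noncomputable abbrev sl (μ : K) : FunField K := y K - co μ * x K

theorem co_ne_zero {a : K} (h : a ≠ 0) : co a ≠ 0 := by simpa using h

theorem co_two : co (2 : K) = 2 := map_ofNat _ 2

theorem planePoint_swap {u v : FunField K} (h : Gen u v) : planePoint u v = planePoint v u :=
  planePoint_eq h.hasVal_right h.hasVal_left h.swap.hasVal_right h.swap.hasVal_left

/-- The slopes of the four points at infinity that are blown up. -/
def mu : Fin 4 → ℤ := ![1, -1, 3, -3]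

/-- The ordinates of the three affine points that are blown up. -/
def sg : Fin 3 → ℤ := ![0, 1, -1]

theorem mu_injective : Function.Injective mu := by decide

theorem sg_injective : Function.Injective sg := by decide

theorem mu_ne_zero (i : Fin 4) : mu i ≠ 0 := by revert i; decide

theorem mu_quartic (i : Fin 4) : mu i ^ 4 - 10 * mu i ^ 2 + 9 = 0 := by revert i; decide

theorem sg_sq {k : Fin 3} (h : k ≠ 0) : sg k ^ 2 = 1 := by revert k; decide

theorem sg_eq_zero {k : Fin 3} : sg k = 0 ↔ k = 0 := by revert k; decide

theorem gen_affine (a : K) : Gen (x K) (y K - co a) := by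
  have := (gen_xy (K := K)).sub_const 0 a
  rwa [map_zero, sub_zero] at this

theorem gen_infinity (μ : K) : Gen (xi μ) (1 / x K) := by
  have := (gen_xy (K := K)).infinity.sub_const μ 0
  rwa [map_zero, sub_zero] at this

theorem gen_inf (μ : K) : Gen (xi μ) (tt μ) :=
  (gen_infinity μ).div_left

theorem gen_inf_sub (μ c : K) :
    Gen (xi μ) (tt μ - co c) := (gen_infinity μ).blow_left c

theorem gen_inf_blow (μ c : K) : Gen (xi μ)
    ((tt μ - co c) / (xi μ)) :=
  (gen_inf_sub μ c).div_left

theorem gen_line (μ : K) : Gen (1 / x K) (sl μ) := by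
  have hx := x_ne_zero (K := K)
  have := (gen_infinity μ).blow_right
  convert this using 1
  field_simp

theorem gen_line_sub (μ c : K) : Gen (1 / x K) (sl μ - co c) := by
  have := (gen_line μ).sub_const 0 c
  rwa [map_zero, sub_zero] at this

theorem gen_line_blow (μ c : K) : Gen (1 / x K) (x K * (sl μ - co c)) := by
  have := (gen_line_sub μ c).div_left
  convert this using 1
  have hx := x_ne_zero (K := K)
  field_simp

theorem gen_line_affine (μ c : K) : Gen (sl μ - co c) (x K) := by
  have h1 : Gen (sl μ) (x K) := by
    refine (gen_xy (K := K)).of_mem mem_adjoin_right ?_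
    have := add_mem (mem_adjoin_left (u := sl μ) (v := x K))
      (mul_mem (const_mem_adjoin μ) (mem_adjoin_right (u := sl μ) (v := x K)))
    rwa [sub_add_cancel] at this
  have := h1.sub_const c 0
  rwa [map_zero, sub_zero] at this

theorem mem_centersR {O : LocalSubring (FunField K)} : O ∈ centersR K ↔
    (∃ k, O = planePoint (x K) (y K - co ((sg k : ℤ) : K))) ∨
    ∃ i, O = planePoint (xi ((mu i : ℤ) : K)) (1 / x K) := by
  simp only [centersR, center, Set.image_insert_eq, Set.image_singleton, Set.mem_insert_iff,
    Set.mem_singleton_iff, Fin.exists_fin_succ, sg, mu, xi, map_intCast]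
  simp [sub_eq_add_neg]
  tauto

theorem mem_centersR' {O : LocalSubring (FunField K)} : O ∈ centersR' K ↔
    ∃ i k, k ≠ 0 ∧ O = planePoint (xi ((mu i : ℤ) : K))
      (tt ((mu i : ℤ) : K) - co (2 * ((sg k : ℤ) : K))) := by
  simp only [centersR', center, Set.image_insert_eq, Set.image_singleton, Set.mem_insert_iff,
    Set.mem_singleton_iff, Fin.exists_fin_succ, sg, mu, xi, tt, map_intCast, map_mul, co_two]
  simp [sub_eq_add_neg]
  tauto


theorem sl_ne_zero (μ : K) : sl μ ≠ 0 := (gen_line μ).right_ne_zero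

theorem xi_ne_zero (μ : K) : xi μ ≠ 0 := (gen_infinity μ).left_ne_zero

theorem xi_eq (μ : K) : xi μ = sl μ * (1 / x K) := by
  have hx := x_ne_zero (K := K)
  simp only [xi, sl]; field_simp

/-- The affine intercept y - μx is the inverse of the direction coordinate on the exceptional curve:
parallel lines of slope μ meet that curve in distinct points. The directions ±2 correspond to the
intercepts ±1/2. -/
theorem tt_eq (μ : K) : tt μ = (sl μ)⁻¹ := by
  have hx := x_ne_zero (K := K)
  have hs := sl_ne_zero μ
  rw [tt, xi_eq]; field_simp

theorem inv_x_eq (μ : K) : 1 / x K = xi μ * tt μ := by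
  have := xi_ne_zero μ
  rw [tt]; field_simp

theorem hasVal_slope {O : LocalSubring (FunField K)} {μ : K} (h : HasVal O (xi μ) (0 : K)) :
    HasVal O (y K / x K) μ := h.of_sub_const

theorem HasVal.not_inv_x {O : LocalSubring (FunField K)} {a : K} (h : HasVal O (x K) a)
    (h' : HasVal O (1 / x K) (0 : K)) : False :=
  h.not_zero_of_inv (by rwa [← one_div]) x_ne_zero

variable [CharZero K]

theorem cast_inj {m n : ℤ} (h : ((m : ℤ) : K) = n) : m = n := Int.cast_injective h

theorem cast_sq {k : Fin 3} (h : k ≠ 0) : ((sg k : ℤ) : K) ^ 2 = 1 := by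
  have := congrArg (Int.cast (R := K)) (sg_sq h)
  simpa using this

theorem affine_mem_plane (a b : K) : planePoint (x K - co a) (y K - co b) ∈ plane K :=
  ⟨a, b, Or.inl rfl⟩

theorem affine_mem_plane' (b : K) : planePoint (x K) (y K - co b) ∈ plane K := by
  have := affine_mem_plane (0 : K) b
  rwa [co, map_zero, sub_zero] at this

theorem infinity_mem_plane (μ : K) : planePoint (xi μ) (1 / x K) ∈ plane K :=
  ⟨μ, 0, Or.inr (Or.inl (by rw [map_zero, sub_zero]))⟩

theorem vertical_mem_plane : planePoint (x K / y K) (1 / y K) ∈ plane K :=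
  ⟨0, 0, Or.inr (Or.inr (by rw [map_zero, sub_zero, sub_zero]))⟩

theorem centersR_subset : centersR K ⊆ plane K := by
  intro O hO
  rcases mem_centersR.1 hO with ⟨k, rfl⟩ | ⟨i, rfl⟩
  · exact affine_mem_plane' _
  · exact infinity_mem_plane _

theorem aff_mem_centersR (k : Fin 3) : planePoint (x K) (y K - co ((sg k : ℤ) : K)) ∈ centersR K :=
  mem_centersR.2 (Or.inl ⟨k, rfl⟩)

theorem inf_mem_centersR (i : Fin 4) : planePoint (xi ((mu i : ℤ) : K)) (1 / x K) ∈ centersR K :=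
  mem_centersR.2 (Or.inr ⟨i, rfl⟩)

theorem centersR'_subset : centersR' K ⊆ surface1 K := by
  intro O hO
  obtain ⟨i, k, -, rfl⟩ := mem_centersR'.1 hO
  exact Or.inr ⟨_, inf_mem_centersR i, _, _, rfl, Or.inl ⟨_, rfl⟩⟩

theorem centersR'_le {O : LocalSubring (FunField K)} (hO : O ∈ centersR' K) :
    ∃ i k, k ≠ 0 ∧ planePoint (xi ((mu i : ℤ) : K)) (1 / x K) ≤ O ∧
      HasVal O (tt ((mu i : ℤ) : K)) (2 * ((sg k : ℤ) : K)) := by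
  obtain ⟨i, k, hk, rfl⟩ := mem_centersR'.1 hO
  exact ⟨i, k, hk, le_of_stdOver (gen_infinity _) (Or.inl ⟨_, rfl⟩),
    (gen_inf_sub _ _).hasVal_right.of_sub_const⟩

/-- A point of R' dominates a point of R. A point of the plane that did so would equal that point by
separation. -/
theorem mem_surface_of_plane {O : LocalSubring (FunField K)} (hO : O ∈ plane K)
    (h : O ∉ centersR K) : O ∈ surface2 K := by
  refine Or.inl ⟨Or.inl ⟨hO, h⟩, fun h' => ?_⟩
  obtain ⟨i, k, -, hle, -⟩ := centersR'_le h'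
  have := isModel_plane.sep _ (infinity_mem_plane _) _ hO O hle le_rfl
  exact h (this ▸ inf_mem_centersR i)

theorem mem_surface_of_over_aff {O : LocalSubring (FunField K)} {k : Fin 3}
    (hO : StdOver (x K) (y K - co ((sg k : ℤ) : K)) O) : O ∈ surface2 K := by
  have hg := gen_affine ((sg k : ℤ) : K)
  refine Or.inl ⟨Or.inr ⟨_, aff_mem_centersR k, (isOver_iff hg).2 hO⟩, fun h' => ?_⟩
  obtain ⟨i, l, -, hle, -⟩ := centersR'_le h'
  have h1 := (hg.hasVal_of_le (le_of_stdOver hg hO)).1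
  exact h1.not_inv_x ((gen_infinity _).hasVal_of_le hle).2

theorem mem_surface_of_over_inf {O : LocalSubring (FunField K)} {i : Fin 4}
    (hO : StdOver (xi ((mu i : ℤ) : K)) (1 / x K) O)
    (h : ∀ k, k ≠ 0 → ¬ HasVal O (tt ((mu i : ℤ) : K)) (2 * ((sg k : ℤ) : K))) :
    O ∈ surface2 K := by
  have hg := gen_infinity ((mu i : ℤ) : K)
  refine Or.inl ⟨Or.inr ⟨_, inf_mem_centersR i, (isOver_iff hg).2 hO⟩, fun h' => ?_⟩
  obtain ⟨j, k, hk, hle, hv⟩ := centersR'_le h'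
  have h1 := hasVal_slope (hg.hasVal_of_le (le_of_stdOver hg hO)).1
  have h2 := hasVal_slope ((gen_infinity _).hasVal_of_le hle).1
  obtain rfl := mu_injective (cast_inj (h1.unique h2))
  exact h k hk hv

theorem mem_surface_of_over_over {O : LocalSubring (FunField K)} {i : Fin 4} {k : Fin 3}
    (hk : k ≠ 0) (hO : StdOver (xi ((mu i : ℤ) : K))
      (tt ((mu i : ℤ) : K) - co (2 * ((sg k : ℤ) : K))) O) : O ∈ surface2 K :=
  Or.inr ⟨_, mem_centersR'.2 ⟨i, k, hk, rfl⟩, (isOver_iff (gen_inf_sub _ _)).2 hO⟩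

theorem affine_mem {a b : K} (h : a = 0 → ∀ k, b ≠ ((sg k : ℤ) : K)) :
    planePoint (x K - co a) (y K - co b) ∈ surface2 K := by
  have hg := (gen_xy (K := K)).sub_const a b
  have h1 := hg.hasVal_left.of_sub_const
  have h2 := hg.hasVal_right.of_sub_const
  refine mem_surface_of_plane (affine_mem_plane a b) fun hR => ?_
  rcases mem_centersR.1 hR with ⟨k, hk⟩ | ⟨i, hi⟩
  · have hg' := gen_affine ((sg k : ℤ) : K)
    have h3 := hg'.hasVal_left
    have h4 := hg'.hasVal_right.of_sub_const
    rw [← hk] at h3 h4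
    exact h (h1.unique h3) k (h2.unique h4)
  · have h3 := (gen_infinity ((mu i : ℤ) : K)).hasVal_right
    rw [← hi] at h3
    exact h1.not_inv_x h3

theorem infinity_mem {c : K} (h : ∀ i, c ≠ ((mu i : ℤ) : K)) :
    planePoint (xi c) (1 / x K) ∈ surface2 K := by
  have hg := gen_infinity c
  refine mem_surface_of_plane (infinity_mem_plane c) fun hR => ?_
  rcases mem_centersR.1 hR with ⟨k, hk⟩ | ⟨i, hi⟩
  · have h3 := (gen_affine ((sg k : ℤ) : K)).hasVal_left
    rw [← hk] at h3
    exact h3.not_inv_x hg.hasVal_right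
  · have h3 := (gen_infinity ((mu i : ℤ) : K)).hasVal_left
    rw [← hi] at h3
    exact h i ((hasVal_slope hg.hasVal_left).unique (hasVal_slope h3))

theorem vertical_mem : planePoint (x K / y K) (1 / y K) ∈ surface2 K := by
  have hg := (gen_xy (K := K)).swap.infinity
  refine mem_surface_of_plane vertical_mem_plane fun hR => ?_
  rcases mem_centersR.1 hR with ⟨k, hk⟩ | ⟨i, hi⟩
  · have h3 := (gen_affine ((sg k : ℤ) : K)).hasVal_right.of_sub_const
    rw [← hk] at h3
    exact h3.not_zero_of_inv (by rw [← one_div]; exact hg.hasVal_right) y_ne_zero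
  · have h3 := hasVal_slope (gen_infinity ((mu i : ℤ) : K)).hasVal_left
    rw [← hi] at h3
    exact h3.not_zero_of_inv (by rw [inv_div]; exact hg.hasVal_left)
      (div_ne_zero y_ne_zero x_ne_zero)

theorem over_aff_mem (k : Fin 3) (c : K) :
    planePoint (x K) ((y K - co ((sg k : ℤ) : K)) / x K - co c) ∈ surface2 K :=
  mem_surface_of_over_aff (k := k) (Or.inl ⟨c, rfl⟩)

theorem over_aff_mem' (k : Fin 3) : planePoint (y K - co ((sg k : ℤ) : K))
    (x K / (y K - co ((sg k : ℤ) : K))) ∈ surface2 K :=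
  mem_surface_of_over_aff (k := k) (Or.inr rfl)

theorem over_inf_mem (i : Fin 4) {c : K} (h : ∀ k, k ≠ 0 → c ≠ 2 * ((sg k : ℤ) : K)) :
    planePoint (xi ((mu i : ℤ) : K)) (tt ((mu i : ℤ) : K) - co c) ∈ surface2 K :=
  mem_surface_of_over_inf (i := i) (Or.inl ⟨c, rfl⟩) fun k hk hv =>
    h k hk ((gen_inf_sub _ _).hasVal_right.of_sub_const.unique hv)

theorem two_sg_ne_zero {k : Fin 3} (h : k ≠ 0) : (2 : K) * ((sg k : ℤ) : K) ≠ 0 := by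
  intro h0
  have := cast_sq (K := K) h
  rcases mul_eq_zero.1 h0 with h1 | h1
  · exact two_ne_zero h1
  · rw [h1] at this; simp at this

theorem over_inf_mem' (i : Fin 4) :
    planePoint (1 / x K) (sl ((mu i : ℤ) : K)) ∈ surface2 K := by
  have he : xi ((mu i : ℤ) : K) / (1 / x K) = sl ((mu i : ℤ) : K) := by
    have hx := x_ne_zero (K := K)
    rw [xi_eq]; field_simp
  refine mem_surface_of_over_inf (i := i) (Or.inr (by rw [he])) fun k hk hv => ?_
  have h1 := (gen_line ((mu i : ℤ) : K)).hasVal_right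
  have h2 := hv.inv (two_sg_ne_zero hk)
  rw [tt_eq, inv_inv] at h2
  exact inv_ne_zero (two_sg_ne_zero hk) (h2.unique h1)

/-- The points of the exceptional curve over a point at infinity. -/
theorem line_mem (i : Fin 4) {c : K} (h : ∀ k, k ≠ 0 → 2 * c ≠ ((sg k : ℤ) : K)) :
    planePoint (1 / x K) (sl ((mu i : ℤ) : K) - co c) ∈ surface2 K := by
  by_cases hc : c = 0
  · rw [hc, co, map_zero, sub_zero]; exact over_inf_mem' i
  set μ := ((mu i : ℤ) : K)
  have hg := gen_line_sub μ c
  have hg' := gen_inf_sub μ c⁻¹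
  have h1 := hg.hasVal_right.of_sub_const
  have h2 := hg'.hasVal_right.of_sub_const
  have he : planePoint (xi μ) (tt μ - co c⁻¹) =
      planePoint (1 / x K) (sl μ - co c) := by
    refine planePoint_eq ?_ ?_ ?_ ?_
    · rw [inv_x_eq μ]; exact hg'.hasVal_left.zero_mul_mem h2.mem
    · have h3 := h2.inv (inv_ne_zero hc)
      rw [show (tt μ)⁻¹ = sl μ by rw [tt_eq, inv_inv], inv_inv] at h3
      exact h3.sub_const
    · rw [xi_eq, mul_comm]; exact hg.hasVal_left.zero_mul_mem h1.mem
    · rw [tt_eq]; exact (h1.inv hc).sub_const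
  rw [← he]
  refine over_inf_mem i fun k hk hk' => h k hk ?_
  have := cast_sq (K := K) hk
  have h3 : 1 = 2 * ((sg k : ℤ) : K) * c := by rw [← hk', inv_mul_cancel₀ hc]
  linear_combination (-(sg k : K)) * h3 - 2 * c * this

theorem over_over_mem (i : Fin 4) {k : Fin 3} (hk : k ≠ 0) (c : K) :
    planePoint (xi ((mu i : ℤ) : K)) ((tt ((mu i : ℤ) : K) - co (2 * ((sg k : ℤ) : K))) /
      xi ((mu i : ℤ) : K) - co c) ∈ surface2 K :=
  mem_surface_of_over_over hk (Or.inl ⟨c, rfl⟩)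

theorem over_over_mem' (i : Fin 4) {k : Fin 3} (hk : k ≠ 0) :
    planePoint (tt ((mu i : ℤ) : K) - co (2 * ((sg k : ℤ) : K)))
      (xi ((mu i : ℤ) : K) / (tt ((mu i : ℤ) : K) - co (2 * ((sg k : ℤ) : K)))) ∈ surface2 K :=
  mem_surface_of_over_over hk (Or.inr rfl)

/-! ## The special curves -/

variable {V : ValuationSubring (FunField K)} {μ δ : K}

/-- `V` is the local ring of the line at infinity. -/
abbrev IsInf (V : ValuationSubring (FunField K)) : Prop := IsDiv V (1 / x K) (y K / x K)

/-- `V` is the local ring of the exceptional curve over `(0, a)`. -/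
abbrev IsAff (V : ValuationSubring (FunField K)) (a : K) : Prop :=
  IsDiv V (x K) ((y K - co a) / x K)

/-- `V` is the local ring of the exceptional curve over the point at infinity of slope `μ`. -/
abbrev IsEm (V : ValuationSubring (FunField K)) (μ : K) : Prop := IsDiv V (1 / x K) (sl μ)

/-- `V` is the local ring of the exceptional curve over the infinitely near point of slope `μ` and
direction given by `δ`. -/
abbrev IsEd (V : ValuationSubring (FunField K)) (μ δ : K) : Prop :=
  IsDiv V (1 / x K) (x K * (sl μ - co (δ / 2)))

omit [CharZero K] in
theorem isEm_iff : IsEm V μ ↔ IsDiv V (xi μ) (tt μ) := by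
  refine ⟨fun h => ⟨?_, ?_⟩, fun h => ⟨?_, ?_⟩⟩
  · rw [xi_eq, mul_comm]; exact h.left.zero_mul_mem h.right.mem
  · rw [tt_eq]; exact h.right.inv
  · rw [inv_x_eq μ]; exact h.left.zero_mul_mem h.right.mem
  · have := h.right.inv
    rwa [tt_eq, inv_inv] at this

omit [CharZero K] in
theorem IsEd.hasVal_sl (h : IsEd V μ δ) : HasVal V.toLocalSubring (sl μ) (δ / 2) := by
  have h1 := (h.left.zero_mul_mem h.right.mem).add (HasVal.const h.const (δ / 2))
  refine h1.congr ?_ (zero_add _)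
  have hx := x_ne_zero (K := K)
  field_simp
  ring

theorem half_ne_zero (hδ : δ ^ 2 = 1) : δ / 2 ≠ 0 := by
  refine div_ne_zero ?_ two_ne_zero
  rintro rfl
  simp at hδ

theorem half_inv (hδ : δ ^ 2 = 1) : (δ / 2)⁻¹ = 2 * δ := by
  have : δ ≠ 0 := by rintro rfl; simp at hδ
  field_simp
  linear_combination -hδ

theorem IsEd.hasVal_tt (hδ : δ ^ 2 = 1) (h : IsEd V μ δ) :
    HasVal V.toLocalSubring (tt μ) (2 * δ) := by
  rw [tt_eq, ← half_inv hδ]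
  exact h.hasVal_sl.inv (half_ne_zero hδ)

/-- With s = `sl μ`, δ² = 1 gives 1/s - 2δ = -2δ(s - δ/2)/s, and `xi μ` = s/x. So the coordinate of
the second blow-up is x(s - δ/2) up to a factor that is a nonzero constant on the curve. -/
theorem dir_eq (hδ : δ ^ 2 = 1) : (tt μ - co (2 * δ)) / xi μ =
    x K * (sl μ - co (δ / 2)) * (co (-2 * δ) / sl μ ^ 2) := by
  have hx := x_ne_zero (K := K)
  have hs := sl_ne_zero μ
  have h2 : (2 : FunField K) ≠ 0 := by rw [← co_two]; exact co_ne_zero two_ne_zero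
  have hδ' : co δ ^ 2 = (1 : FunField K) := by rw [← map_pow, hδ, map_one]
  have e1 : co (2 * δ) = 2 * co δ := by rw [co, map_mul, map_ofNat]
  have e2 : co (δ / 2) = co δ / 2 := by rw [co, map_div₀, map_ofNat]
  have e3 : co (-2 * δ) = -2 * co δ := by rw [co, map_mul, map_neg, map_ofNat]
  rw [tt_eq, xi_eq, e1, e2, e3]
  generalize sl μ = s at *
  field_simp
  linear_combination -hδ'

/-- Near this curve s has the value δ/2, so the two coordinate systems differ by units with a value.
The form with 1/x and s suits shears, the form with `xi` and `tt` suits the definition of the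
blow-up. -/
theorem isEd_iff (hδ : δ ^ 2 = 1) :
    IsEd V μ δ ↔ IsDiv V (xi μ) ((tt μ - co (2 * δ)) / xi μ) := by
  have h2δ : -2 * δ ≠ 0 := by
    have := half_ne_zero hδ
    intro h0
    apply this
    linear_combination (-1 / 4 : K) * h0
  have hq : ∀ h : HasVal V.toLocalSubring (sl μ) (δ / 2),
      HasVal V.toLocalSubring (co (-2 * δ) / sl μ ^ 2) (-2 * δ / (δ / 2) ^ 2) := fun h =>
    (HasVal.const h.1 _).div (h.pow 2) (pow_ne_zero _ (half_ne_zero hδ))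
  have hq0 : -2 * δ / (δ / 2) ^ 2 ≠ 0 := div_ne_zero h2δ (pow_ne_zero _ (half_ne_zero hδ))
  refine ⟨fun h => ⟨?_, ?_⟩, fun h => ?_⟩
  · rw [xi_eq, mul_comm]; exact h.left.zero_mul_mem h.hasVal_sl.mem
  · rw [dir_eq hδ]
    exact h.right.mul (hq h.hasVal_sl) hq0
  · have h1 : HasVal V.toLocalSubring (tt μ) (2 * δ) := by
      have := (h.left.zero_mul_mem h.right.mem).add (HasVal.const h.const (2 * δ))
      rwa [mul_div_cancel₀ _ (xi_ne_zero μ), sub_add_cancel, zero_add] at this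
    have h3 : HasVal V.toLocalSubring (sl μ) (δ / 2) := by
      have := h1.inv (by rw [← half_inv hδ]; exact inv_ne_zero (half_ne_zero hδ))
      rwa [tt_eq, inv_inv, ← half_inv hδ, inv_inv] at this
    refine ⟨?_, ?_⟩
    · rw [inv_x_eq μ]; exact h.left.zero_mul_mem h1.mem
    · have h4 := h.right.div (hq h3) hq0
      rw [dir_eq hδ] at h4
      rwa [mul_div_cancel_right₀ _ ((hq h3).ne_zero hq0)] at h4

variable [IsAlgClosed K]

theorem isSurface_surface1 : IsSurface (surface1 K) := isSurface_plane.blowUp centersR_subset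

theorem isSurface_surface2 : IsSurface (surface2 K) := isSurface_surface1.blowUp centersR'_subset

/-- The curves on the surface are the strict transforms of affine curves, the line at infinity and
the exceptional curves. -/
theorem Curve.surface_cases (C : Curve (surface2 K)) :
    Loc C.ring (x K) (y K) ∨ IsInf C.ring ∨ (∃ k, IsAff C.ring ((sg k : ℤ) : K)) ∨
    (∃ i, IsEm C.ring ((mu i : ℤ) : K)) ∨
    ∃ i k, k ≠ 0 ∧ IsEd C.ring ((mu i : ℤ) : K) ((sg k : ℤ) : K) := by
  rcases Curve.blowUp_cases centersR'_subset C with ⟨C₁, h₁⟩ | ⟨B, hB, h⟩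
  · rw [← h₁]
    rcases Curve.blowUp_cases centersR_subset C₁ with ⟨C₀, h₀⟩ | ⟨B, hB, h⟩
    · rw [← h₀]
      exact (Curve.plane_cases C₀).imp id Or.inl
    · rcases mem_centersR.1 hB with ⟨k, rfl⟩ | ⟨i, rfl⟩
      · exact Or.inr (Or.inr (Or.inl ⟨k, h _ _ (gen_affine _) rfl⟩))
      · exact Or.inr (Or.inr (Or.inr (Or.inl ⟨i, isEm_iff.2 (h _ _ (gen_infinity _) rfl)⟩)))
  · obtain ⟨i, k, hk, rfl⟩ := mem_centersR'.1 hB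
    exact Or.inr (Or.inr (Or.inr (Or.inr
      ⟨i, k, hk, (isEd_iff (cast_sq hk)).2 (h _ _ (gen_inf_sub _ _) rfl)⟩)))

/-- It suffices to find a point of the curve that is not blown up, that is, a polynomial vanishing
at the three affine centres but not identically on the curve. -/
theorem Loc.exists_surface_curve (h : Loc V (x K) (y K)) :
    ∃ C : Curve (surface2 K), C.ring = V := by
  have key : ∃ Q : MvPolynomial (Fin 2) K, ¬ InMax V.toLocalSubring (polyHom (x K) (y K) Q) ∧
      ∀ a b : K, MvPolynomial.eval ![a, b] Q ≠ 0 → a = 0 → ∀ k, b ≠ ((sg k : ℤ) : K) := by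
    by_cases hx : InMax V.toLocalSubring (x K)
    -- The curve is x = 0, which passes through all three centres, so the polynomial is y(y - 1)(y +
    -- 1). For any other curve x itself will do.
    · refine ⟨(MvPolynomial.X 1 - MvPolynomial.C 0) * ((MvPolynomial.X 1 - MvPolynomial.C 1) *
        (MvPolynomial.X 1 - MvPolynomial.C (-1))), fun hm => ?_, fun a b hab _ k hk => hab ?_⟩
      · have hno : ∀ c : K, ¬ InMax V.toLocalSubring
            (polyHom (x K) (y K) (MvPolynomial.X 1 - MvPolynomial.C c)) := by
          intro c hc
          rw [map_sub, polyHom_X1, polyHom_C] at hc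
          exact h.not_both 0 c ⟨hx.hasVal h.const, h.const, hc⟩
        rw [map_mul, map_mul] at hm
        rcases hm.of_mul (h.polyHom_mem _) (V.mul_mem _ _ (h.polyHom_mem _) (h.polyHom_mem _))
          with h1 | h1
        · exact hno _ h1
        · rcases h1.of_mul (h.polyHom_mem _) (h.polyHom_mem _) with h1 | h1
          · exact hno _ h1
          · exact hno _ h1
      · subst hk
        fin_cases k <;> simp [sg]
    · refine ⟨MvPolynomial.X 0, by rwa [polyHom_X0], fun a b hab ha => ?_⟩
      simp [ha] at hab
  obtain ⟨Q, hQ, hQ'⟩ := key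
  obtain ⟨a, b, hab, hne⟩ := h.exists_onCentre hQ
  exact h.exists_curve gen_xy hab (affine_mem (hQ' a b hne))

theorem mu_ne_zero' (i : Fin 4) : (0 : K) ≠ ((mu i : ℤ) : K) := by
  intro h
  exact mu_ne_zero i (cast_inj (by rw [← h, Int.cast_zero]))

omit [CharZero K] [IsAlgClosed K] in
theorem gen_isInf : Gen (1 / x K) (y K / x K) := (gen_xy (K := K)).infinity.swap

omit [CharZero K] [IsAlgClosed K] in
theorem gen_isAff (a : K) : Gen (x K) ((y K - co a) / x K) := (gen_affine a).div_left

theorem IsInf.exists_surface_curve (h : IsInf V) : ∃ C : Curve (surface2 K), C.ring = V :=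
  IsDiv.exists_curve gen_isInf h 0 (by
    have := infinity_mem (K := K) (c := 0) mu_ne_zero'
    rwa [planePoint_swap (gen_infinity _)] at this)

theorem IsAff.exists_surface_curve {k : Fin 3} (h : IsAff V ((sg k : ℤ) : K)) :
    ∃ C : Curve (surface2 K), C.ring = V :=
  IsDiv.exists_curve (gen_isAff _) h 0 (over_aff_mem k 0)

theorem IsEm.exists_surface_curve {i : Fin 4} (h : IsEm V ((mu i : ℤ) : K)) :
    ∃ C : Curve (surface2 K), C.ring = V :=
  IsDiv.exists_curve (gen_inf _) (isEm_iff.1 h) 0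
    (over_inf_mem i fun _ hk => (two_sg_ne_zero hk).symm)

theorem IsEd.exists_surface_curve {i : Fin 4} {k : Fin 3} (hk : k ≠ 0)
    (h : IsEd V ((mu i : ℤ) : K) ((sg k : ℤ) : K)) : ∃ C : Curve (surface2 K), C.ring = V :=
  IsDiv.exists_curve (gen_inf_blow _ _) ((isEd_iff (cast_sq hk)).1 h) 0 (over_over_mem i hk 0)

end Points

end BirSurf

namespace BirSurf

open FunField

set_option linter.unusedSectionVars false

/-! ## Divisors on the surface -/

section Divisors

variable {K : Type*} [Field K] {V : ValuationSubring (FunField K)}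
  {O : LocalSubring (FunField K)} {u v g : FunField K} {a b c m μ ν δ : K}

theorem Loc.isDiv_of_inMax (h : Loc V u v) (hu : InMax V.toLocalSubring u) : IsDiv V u v :=
  ⟨hu.hasVal h.const, (noVal_iff h.const).2
    ⟨h.right, fun c hc => h.not_both 0 c ⟨hu.hasVal h.const, hc⟩⟩⟩

theorem Loc.line (h : Loc V (x K) (y K)) (μ c : K) : Loc V (sl μ - co c) (x K) where
  ne_top := h.ne_top
  const := h.const
  left := V.sub_mem (V.sub_mem h.right (V.mul_mem _ _ (h.const μ) h.left)) (h.const c)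
  right := h.left
  not_both p q hpq := by
    exact h.not_both q (p + c + μ * q) ⟨hpq.2, ((hpq.1.add (HasVal.const h.const c)).add
      ((HasVal.const h.const μ).mul hpq.2)).congr (by simp only [sl]; ring) rfl⟩

/-! ### Values along the special curves -/

theorem IsAff.hasVal_y (h : IsAff V a) : HasVal V.toLocalSubring (y K) a := by
  have h1 := (h.left.zero_mul_mem h.right.mem).add (HasVal.const h.const a)
  refine h1.congr ?_ (zero_add _)
  have hx := x_ne_zero (K := K)
  field_simp
  ring

theorem hasVal_ratio_of_sl (h : HasVal O (1 / x K) (0 : K)) (hs : sl μ ∈ O.toSubring) :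
    HasVal O (y K / x K) μ := by
  have h1 := (h.zero_mul_mem hs).add (HasVal.const h.1 μ)
  refine h1.congr ?_ (zero_add _)
  have hx := x_ne_zero (K := K)
  simp only [sl]
  field_simp
  ring

theorem IsEm.hasVal_ratio (h : IsEm V μ) : HasVal V.toLocalSubring (y K / x K) μ :=
  hasVal_ratio_of_sl h.left h.right.mem

theorem IsEd.hasVal_ratio (h : IsEd V μ δ) : HasVal V.toLocalSubring (y K / x K) μ :=
  hasVal_ratio_of_sl h.left h.hasVal_sl.mem

/-- `V` is the local ring of the exceptional curve over the point of slope `mu i` at infinity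
(for `k = 0`) or over the infinitely near point with direction `sg k`. -/
def IsPt (V : ValuationSubring (FunField K)) (k : Fin 3) (i : Fin 4) : Prop :=
  (k = 0 ∧ IsEm V ((mu i : ℤ) : K)) ∨ (k ≠ 0 ∧ IsEd V ((mu i : ℤ) : K) ((sg k : ℤ) : K))

theorem IsPt.left {k : Fin 3} {i : Fin 4} (h : IsPt V k i) :
    HasVal V.toLocalSubring (1 / x K) (0 : K) := by
  rcases h with ⟨-, h⟩ | ⟨-, h⟩ <;> exact h.left

theorem IsPt.hasVal_ratio {k : Fin 3} {i : Fin 4} (h : IsPt V k i) :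
    HasVal V.toLocalSubring (y K / x K) ((mu i : ℤ) : K) := by
  rcases h with ⟨-, h⟩ | ⟨-, h⟩
  · exact IsEm.hasVal_ratio h
  · exact IsEd.hasVal_ratio h

theorem isPt_zero {i : Fin 4} : IsPt V 0 i ↔ IsEm V ((mu i : ℤ) : K) := by
  simp [IsPt]

theorem isPt_of_ne {k : Fin 3} (hk : k ≠ 0) {i : Fin 4} :
    IsPt V k i ↔ IsEd V ((mu i : ℤ) : K) ((sg k : ℤ) : K) := by
  simp [IsPt, hk]

variable [CharZero K]

/-- The value of y/x recovers the slope. Then y - μx is nonconstant for k = 0 and has the value `sg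
k` / 2 otherwise, which recovers k. -/
theorem IsPt.unique {k l : Fin 3} {i j : Fin 4} (h : IsPt V k i) (h' : IsPt V l j) :
    k = l ∧ i = j := by
  obtain rfl := mu_injective (cast_inj (h.hasVal_ratio.unique h'.hasVal_ratio))
  refine ⟨?_, rfl⟩
  rcases h with ⟨rfl, h⟩ | ⟨hk, h⟩ <;> rcases h' with ⟨rfl, h'⟩ | ⟨hl, h'⟩
  · rfl
  · exact (h.right.not_hasVal _ (IsEd.hasVal_sl h')).elim
  · exact (h'.right.not_hasVal _ (IsEd.hasVal_sl h)).elim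
  · have h1 := (IsEd.hasVal_sl h).unique (IsEd.hasVal_sl h')
    exact sg_injective (cast_inj (K := K) (by linear_combination 2 * h1))

variable [IsAlgClosed K]

theorem IsPt.ord_left {k : Fin 3} {i : Fin 4} [IsDiscreteValuationRing V] (h : IsPt V k i) :
    ord V (1 / x K) = 1 := by
  rcases h with ⟨-, h⟩ | ⟨-, h⟩
  · exact h.ord_left (gen_line _)
  · exact h.ord_left (gen_line_blow _ _)

theorem IsPt.eq {k : Fin 3} {i : Fin 4} {W : ValuationSubring (FunField K)} (h : IsPt V k i)
    (h' : IsPt W k i) : V = W := by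
  by_cases hk : k = 0
  · subst hk
    exact IsDiv.unique (gen_line _) (isPt_zero.1 h) (isPt_zero.1 h')
  · exact IsDiv.unique (gen_line_blow _ _) ((isPt_of_ne hk).1 h) ((isPt_of_ne hk).1 h')

theorem exists_isInf_curve (K : Type*) [Field K] [CharZero K] [IsAlgClosed K] :
    ∃ C : Curve (surface2 K), IsInf C.ring := by
  have h := exists_isDiv (gen_isInf (K := K))
  obtain ⟨C, hC⟩ := IsInf.exists_surface_curve h
  exact ⟨C, hC ▸ h⟩

theorem exists_isAff_curve (k : Fin 3) :
    ∃ C : Curve (surface2 K), IsAff C.ring ((sg k : ℤ) : K) := by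
  have h := exists_isDiv (gen_isAff ((sg k : ℤ) : K))
  obtain ⟨C, hC⟩ := IsAff.exists_surface_curve h
  exact ⟨C, hC ▸ h⟩

theorem exists_isPt_curve (k : Fin 3) (i : Fin 4) : ∃ C : Curve (surface2 K), IsPt C.ring k i := by
  by_cases hk : k = 0
  · subst hk
    have h := exists_isDiv (gen_line ((mu i : ℤ) : K))
    obtain ⟨C, hC⟩ := IsEm.exists_surface_curve h
    exact ⟨C, isPt_zero.2 (hC ▸ h)⟩
  · have h := exists_isDiv (gen_line_blow ((mu i : ℤ) : K) (((sg k : ℤ) : K) / 2))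
    obtain ⟨C, hC⟩ := IsEd.exists_surface_curve hk h
    exact ⟨C, (isPt_of_ne hk).2 (hC ▸ h)⟩

/-- The line at infinity. -/
noncomputable def linf (K : Type*) [Field K] [CharZero K] [IsAlgClosed K] : Curve (surface2 K) :=
  (exists_isInf_curve K).choose

/-- The exceptional curves over the affine points. -/
noncomputable def eaff (K : Type*) [Field K] [CharZero K] [IsAlgClosed K] (k : Fin 3) :
    Curve (surface2 K) := (exists_isAff_curve k).choose

/-- The exceptional curves over the points at infinity and the infinitely near points. -/
noncomputable def ept (K : Type*) [Field K] [CharZero K] [IsAlgClosed K] (k : Fin 3) (i : Fin 4) :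
    Curve (surface2 K) := (exists_isPt_curve k i).choose

theorem isInf_linf : IsInf (linf K).ring := (exists_isInf_curve K).choose_spec

theorem isAff_eaff (k : Fin 3) : IsAff (eaff K k).ring ((sg k : ℤ) : K) :=
  (exists_isAff_curve k).choose_spec

theorem isPt_ept (k : Fin 3) (i : Fin 4) : IsPt (ept K k i).ring k i :=
  (exists_isPt_curve k i).choose_spec

theorem isEm_ept (i : Fin 4) : IsEm (ept K 0 i).ring ((mu i : ℤ) : K) := isPt_zero.1 (isPt_ept 0 i)

theorem isEd_ept {k : Fin 3} (hk : k ≠ 0) (i : Fin 4) :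
    IsEd (ept K k i).ring ((mu i : ℤ) : K) ((sg k : ℤ) : K) := (isPt_of_ne hk).1 (isPt_ept k i)

variable {C : Curve (surface2 K)}

theorem eq_linf (h : IsInf C.ring) : C = linf K := Curve.ext (h.unique gen_isInf isInf_linf)

theorem eq_eaff {k : Fin 3} (h : IsAff C.ring ((sg k : ℤ) : K)) : C = eaff K k :=
  Curve.ext (h.unique (gen_isAff _) (isAff_eaff k))

theorem eq_ept {k : Fin 3} {i : Fin 4} (h : IsPt C.ring k i) : C = ept K k i :=
  Curve.ext (h.eq (isPt_ept k i))

theorem Curve.special_cases (C : Curve (surface2 K)) : Loc C.ring (x K) (y K) ∨ C = linf K ∨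
    (∃ k, C = eaff K k) ∨ ∃ k i, C = ept K k i := by
  rcases Curve.surface_cases C with h | h | ⟨k, h⟩ | ⟨i, h⟩ | ⟨i, k, hk, h⟩
  · exact Or.inl h
  · exact Or.inr (Or.inl (eq_linf h))
  · exact Or.inr (Or.inr (Or.inl ⟨k, eq_eaff h⟩))
  · exact Or.inr (Or.inr (Or.inr ⟨0, i, eq_ept (isPt_zero.2 h)⟩))
  · exact Or.inr (Or.inr (Or.inr ⟨k, i, eq_ept ((isPt_of_ne hk).2 h)⟩))

theorem Loc.not_inv_x (h : Loc V (x K) (y K)) (h' : HasVal V.toLocalSubring (1 / x K) (0 : K)) :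
    False := by
  have := h'.zero_mul_mem h.left
  rw [one_div, inv_mul_cancel₀ x_ne_zero] at this
  exact not_inMax_one this.inMax

theorem Loc.ne_linf (h : Loc C.ring (x K) (y K)) : linf K ≠ C := by
  rintro rfl
  exact h.not_inv_x isInf_linf.left

theorem Loc.ne_eaff (h : Loc C.ring (x K) (y K)) (k : Fin 3) : eaff K k ≠ C := by
  rintro rfl
  exact h.not_both _ _ ⟨(isAff_eaff k).left, IsAff.hasVal_y (isAff_eaff k)⟩

theorem Loc.ne_ept (h : Loc C.ring (x K) (y K)) (k : Fin 3) (i : Fin 4) : ept K k i ≠ C := by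
  rintro rfl
  exact h.not_inv_x (isPt_ept k i).left

theorem linf_ne_eaff (k : Fin 3) : linf K ≠ eaff K k := by
  intro h
  have h1 := isAff_eaff (K := K) k
  rw [← h] at h1
  exact h1.left.not_inv_x isInf_linf.left

theorem linf_ne_ept (k : Fin 3) (i : Fin 4) : linf K ≠ ept K k i := by
  intro h
  have h1 := isPt_ept (K := K) k i
  rw [← h] at h1
  exact isInf_linf.right.not_hasVal _ h1.hasVal_ratio

theorem eaff_ne_ept (k l : Fin 3) (i : Fin 4) : eaff K k ≠ ept K l i := by
  intro h
  have h1 := isPt_ept (K := K) l i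
  rw [← h] at h1
  exact (isAff_eaff k).left.not_inv_x h1.left

theorem eaff_inj {k l : Fin 3} : eaff K k = eaff K l ↔ k = l := by
  refine ⟨fun h => ?_, fun h => h ▸ rfl⟩
  have h1 := isAff_eaff (K := K) l
  rw [← h] at h1
  exact sg_injective (cast_inj ((IsAff.hasVal_y (isAff_eaff k)).unique (IsAff.hasVal_y h1)))

theorem ept_inj {k l : Fin 3} {i j : Fin 4} : ept K k i = ept K l j ↔ k = l ∧ i = j := by
  refine ⟨fun h => ?_, fun h => by rw [h.1, h.2]⟩
  have h1 := isPt_ept (K := K) l j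
  rw [← h] at h1
  exact (isPt_ept k i).unique h1

/-- The divisor with given multiplicities along the special curves. -/
noncomputable def specialDiv (K : Type*) [Field K] [CharZero K] [IsAlgClosed K] (n : ℤ)
    (b : Fin 3 → ℤ) (e : Fin 3 → Fin 4 → ℤ) : Divisor (surface2 K) :=
  Finsupp.single (linf K) n + ∑ k, Finsupp.single (eaff K k) (b k) +
    ∑ k, ∑ i, Finsupp.single (ept K k i) (e k i)

variable {n : ℤ} {b' : Fin 3 → ℤ} {e' : Fin 3 → Fin 4 → ℤ}

theorem specialDiv_loc (h : Loc C.ring (x K) (y K)) : specialDiv K n b' e' C = 0 := by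
  classical
  simp [specialDiv, h.ne_linf, h.ne_eaff, h.ne_ept]

theorem specialDiv_linf : specialDiv K n b' e' (linf K) = n := by
  classical
  simp [specialDiv, (linf_ne_eaff _).symm, (linf_ne_ept _ _).symm]

theorem specialDiv_eaff (k : Fin 3) : specialDiv K n b' e' (eaff K k) = b' k := by
  classical
  simp [specialDiv, Finsupp.single_apply, linf_ne_eaff, (eaff_ne_ept _ _ _).symm, eaff_inj]

theorem specialDiv_ept (k : Fin 3) (i : Fin 4) : specialDiv K n b' e' (ept K k i) = e' k i := by
  classical
  simp [specialDiv, Finsupp.single_apply, linf_ne_ept, eaff_ne_ept, ept_inj, ite_and]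

theorem single_special (hC : ¬ Loc C.ring (x K) (y K)) (m : ℤ) :
    ∃ n b e, Finsupp.single C m = specialDiv K n b e := by
  classical
  refine ⟨Finsupp.single C m (linf K), fun k => Finsupp.single C m (eaff K k),
    fun k i => Finsupp.single C m (ept K k i), Finsupp.ext fun C' => ?_⟩
  rcases Curve.special_cases C' with h | rfl | ⟨k, rfl⟩ | ⟨k, i, rfl⟩
  · rw [specialDiv_loc h, Finsupp.single_eq_of_ne]
    rintro rfl
    exact hC h
  · rw [specialDiv_linf]
  · rw [specialDiv_eaff]
  · rw [specialDiv_ept]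

theorem specialDiv_add (n n' : ℤ) (b b' : Fin 3 → ℤ) (e e' : Fin 3 → Fin 4 → ℤ) :
    specialDiv K (n + n') (b + b') (e + e') = specialDiv K n b e + specialDiv K n' b' e' := by
  ext C
  rw [Finsupp.add_apply]
  rcases Curve.special_cases C with h | rfl | ⟨k, rfl⟩ | ⟨k, i, rfl⟩
  · simp only [specialDiv_loc h, add_zero]
  · simp only [specialDiv_linf]
  · simp only [specialDiv_eaff, Pi.add_apply]
  · simp only [specialDiv_ept, Pi.add_apply]

theorem specialDiv_smul (m n : ℤ) (b : Fin 3 → ℤ) (e : Fin 3 → Fin 4 → ℤ) :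
    specialDiv K (m * n) (m • b) (m • e) = m • specialDiv K n b e := by
  ext C
  rw [Finsupp.smul_apply]
  rcases Curve.special_cases C with h | rfl | ⟨k, rfl⟩ | ⟨k, i, rfl⟩
  · simp only [specialDiv_loc h, smul_zero]
  · simp only [specialDiv_linf, smul_eq_mul]
  · simp only [specialDiv_eaff, Pi.smul_apply]
  · simp only [specialDiv_ept, Pi.smul_apply]

/-! ### Divisors of functions -/

section Functions

variable {S : Set (LocalSubring (FunField K))} {D E : Divisor S} {f : FunField K}

omit [CharZero K] [IsAlgClosed K] in
theorem IsDivisorOf.mul (h : IsDivisorOf f D) (h' : IsDivisorOf g E) :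
    IsDivisorOf (f * g) (D + E) :=
  ⟨mul_ne_zero h.1 h'.1, fun C => by rw [Finsupp.add_apply, h.2, h'.2, ord_mul h.1 h'.1]⟩

omit [CharZero K] [IsAlgClosed K] in
theorem IsDivisorOf.zpow (h : IsDivisorOf f D) (n : ℤ) : IsDivisorOf (f ^ n) (n • D) :=
  ⟨zpow_ne_zero _ h.1, fun C => by rw [Finsupp.smul_apply, h.2, ord_zpow, smul_eq_mul]⟩

omit [CharZero K] [IsAlgClosed K] in
theorem IsDivisorOf.inv (h : IsDivisorOf f D) : IsDivisorOf f⁻¹ (-D) := by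
  simpa using h.zpow (-1)

omit [CharZero K] [IsAlgClosed K] in
theorem isDivisorOf_one : IsDivisorOf 1 (0 : Divisor S) :=
  ⟨one_ne_zero, fun C => by rw [Finsupp.zero_apply, ord_one]⟩

end Functions

/-- The part of the divisor of a function that is supported on the special curves. -/
noncomputable abbrev specialPart (g : FunField K) : Divisor (surface2 K) :=
  specialDiv K (ord (linf K).ring g) (fun k => ord (eaff K k).ring g)
    fun k i => ord (ept K k i).ring g

theorem isDivisorOf_special (hg : g ≠ 0) {D : Divisor (surface2 K)}
    (h : ∀ C : Curve (surface2 K), ¬ Loc C.ring (x K) (y K) → D C = 0)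
    (h' : ∀ C : Curve (surface2 K), Loc C.ring (x K) (y K) → D C = ord C.ring g) :
    IsDivisorOf g (D + specialPart g) := by
  refine ⟨hg, fun C => ?_⟩
  rw [Finsupp.add_apply]
  rcases Curve.special_cases C with hC | rfl | ⟨k, rfl⟩ | ⟨k, i, rfl⟩
  · rw [specialDiv_loc hC, h' C hC, add_zero]
  · rw [specialDiv_linf, h _ fun hl => hl.ne_linf rfl, zero_add]
  · rw [specialDiv_eaff, h _ fun hl => hl.ne_eaff k rfl, zero_add]
  · rw [specialDiv_ept, h _ fun hl => hl.ne_ept k i rfl, zero_add]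

/-- A prime polynomial vanishing on the curve is associated to the prime of the curve, so it
vanishes to order 1 on its own curve and nowhere else in the affine plane. -/
theorem Loc.ord_eq {p : MvPolynomial (Fin 2) K} (hp : Prime p) (hC : Loc C.ring (x K) (y K)) :
    (C.ring = primeVal gen_xy.fracHom hp ∧ ord C.ring (polyHom (x K) (y K) p) = 1) ∨
    (C.ring ≠ primeVal gen_xy.fracHom hp ∧ ord C.ring (polyHom (x K) (y K) p) = 0) := by
  obtain ⟨q, hq, hV, -⟩ := hC.exists_prime gen_xy
  by_cases he : C.ring = primeVal gen_xy.fracHom hp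
  · refine Or.inl ⟨he, ?_⟩
    have := ord_primeVal_self (gen_xy (K := K)).fracHom hp
    simp only [he]
    exact this
  · refine Or.inr ⟨he, ord_eq_zero (hC.polyHom_mem p) fun hm => he ?_⟩
    refine BirSurf.eq_primeVal _ _ hC.ne_top hC.polyHom_mem fun a ha => ?_
    rw [hV, inMax_primeVal_iff] at hm ha
    exact (hq.associated_of_dvd hp hm).symm.dvd.trans ha

/-- The affine plane has trivial divisor class group: the prime equation of C has divisor C up to
curves outside it. -/
theorem isDivisorOf_single (hC : Loc C.ring (x K) (y K)) :
    ∃ g, IsDivisorOf g (Finsupp.single C 1 + specialPart g) := by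
  classical
  obtain ⟨p, hp, hV, -⟩ := hC.exists_prime gen_xy
  refine ⟨polyHom (x K) (y K) p, isDivisorOf_special (gen_xy.fracHom.ne_zero hp.ne_zero)
    (fun C' h => ?_) fun C' h => ?_⟩
  · rw [Finsupp.single_eq_of_ne]
    rintro rfl
    exact h hC
  · rcases h.ord_eq hp with ⟨h1, h2⟩ | ⟨h1, h2⟩
    · rw [h2, Curve.ext (hV.trans h1.symm), Finsupp.single_eq_same]
    · rw [h2, Finsupp.single_eq_of_ne]
      rintro rfl
      exact h1 hV

/-- The content is finiteness of the set of zeros and poles. It follows by induction on prime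
factors, each contributing at most one affine curve besides the special curves. -/
theorem exists_isDivisorOf (hg : g ≠ 0) : ∃ D : Divisor (surface2 K), IsDivisorOf g D := by
  classical
  have key : ∀ P : MvPolynomial (Fin 2) K, P ≠ 0 →
      ∃ D : Divisor (surface2 K), IsDivisorOf (polyHom (x K) (y K) P) D := by
    intro P
    induction P using UniqueFactorizationMonoid.induction_on_prime with
    | h₁ => exact fun h => absurd rfl h
    | h₂ P hP =>
      intro h0
      refine ⟨_, isDivisorOf_special (D := 0) (gen_xy.fracHom.ne_zero h0) (fun _ _ => rfl)
        fun C hC => ?_⟩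
      obtain ⟨Q, hQ⟩ := hP.exists_right_inv
      rw [Finsupp.zero_apply]
      refine (ord_eq_zero (hC.polyHom_mem P) ?_).symm
      refine not_inMax_of_inv_mem (gen_xy.fracHom.ne_zero h0) ?_
      have : (polyHom (x K) (y K) P)⁻¹ = polyHom (x K) (y K) Q :=
        inv_eq_of_mul_eq_one_right (by rw [← map_mul, hQ, map_one])
      rw [this]
      exact hC.polyHom_mem Q
    | h₃ P p hP0 hp ih =>
      intro _
      obtain ⟨D, hD⟩ := ih hP0
      rw [map_mul]
      suffices h : ∃ D : Divisor (surface2 K), IsDivisorOf (polyHom (x K) (y K) p) D by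
        obtain ⟨E, hE⟩ := h
        exact ⟨_, hE.mul hD⟩
      have hp0 := (gen_xy (K := K)).fracHom.ne_zero hp.ne_zero
      by_cases he : ∃ C : Curve (surface2 K), Loc C.ring (x K) (y K) ∧
          C.ring = primeVal gen_xy.fracHom hp
      · obtain ⟨C, hC, hV⟩ := he
        refine ⟨_, isDivisorOf_special (D := Finsupp.single C 1) hp0 (fun C' h => ?_)
          fun C' h => ?_⟩
        · rw [Finsupp.single_eq_of_ne]
          rintro rfl
          exact h hC
        · rcases h.ord_eq hp with ⟨h1, h2⟩ | ⟨h1, h2⟩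
          · rw [h2, Curve.ext (hV.trans h1.symm), Finsupp.single_eq_same]
          · rw [h2, Finsupp.single_eq_of_ne]
            rintro rfl
            exact h1 hV
      · refine ⟨_, isDivisorOf_special (D := 0) hp0 (fun _ _ => rfl) fun C hC => ?_⟩
        rw [Finsupp.zero_apply]
        rcases hC.ord_eq hp with ⟨h1, -⟩ | ⟨-, h2⟩
        · exact absurd ⟨C, hC, h1⟩ he
        · exact h2.symm
  obtain ⟨P, Q, hQ, rfl⟩ := (gen_xy (K := K)).fracHom.frac g
  have hP : P ≠ 0 := by
    rintro rfl
    rw [map_zero, zero_div] at hg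
    exact hg rfl
  obtain ⟨D, hD⟩ := key P hP
  obtain ⟨E, hE⟩ := key Q hQ
  rw [div_eq_mul_inv]
  exact ⟨_, hD.mul hE.inv⟩

/-- Every divisor is linearly equivalent to a combination of the special curves. -/
theorem exists_special_add (D : Divisor (surface2 K)) : ∃ n b e g Dg, IsDivisorOf g Dg ∧
    D = specialDiv K n b e + Dg := by
  induction D using Finsupp.induction_linear with
  | zero => exact ⟨0, 0, 0, 1, 0, isDivisorOf_one, by simp [specialDiv]⟩
  | add D E hD hE =>
    obtain ⟨n, b, e, g, Dg, hg, rfl⟩ := hD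
    obtain ⟨n', b', e', g', Dg', hg', rfl⟩ := hE
    exact ⟨n + n', b + b', e + e', _, _, hg.mul hg', by rw [specialDiv_add]; abel⟩
  | single C m =>
    by_cases hC : Loc C.ring (x K) (y K)
    · obtain ⟨g, hg⟩ := isDivisorOf_single hC
      refine ⟨-m * ord (linf K).ring g, -m • fun k => ord (eaff K k).ring g,
        -m • fun k i => ord (ept K k i).ring g, _, _, hg.zpow m, ?_⟩
      rw [specialDiv_smul, smul_add, Finsupp.smul_single, smul_eq_mul, mul_one, neg_smul]
      abel
    · obtain ⟨n, b, e, h⟩ := single_special hC m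
      exact ⟨n, b, e, 1, 0, isDivisorOf_one, by rw [h, add_zero]⟩

/-- `V` is the local ring of the line `x = 0`. -/
abbrev IsV0 (V : ValuationSubring (FunField K)) : Prop := IsDiv V (x K) (y K)

/-- `V` is the local ring of the line of slope `μ` through `(0, c)`. -/
abbrev IsEll (V : ValuationSubring (FunField K)) (μ c : K) : Prop := IsDiv V (sl μ - co c) (x K)

theorem IsEll.loc (h : IsEll V μ c) : Loc V (x K) (y K) := by
  have h1 := (IsDiv.loc h (gen_line_affine μ c)).swap
  have hy : y K = (sl μ - co c) + co c + co μ * x K := by simp only [sl]; ring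
  refine ⟨h1.ne_top, h1.const, h1.left, ?_, fun a b hab => h.right.not_hasVal a hab.1⟩
  rw [hy]
  exact V.add_mem _ _ (V.add_mem _ _ h1.right (h1.const c)) (V.mul_mem _ _ (h1.const μ) h1.left)

/-- The line x = 0 passes through the three affine centres and avoids the four at infinity. On the
line at infinity and on all twelve exceptional curves over it, 1/x has order exactly 1, also after
the second blow-up. -/
theorem isDivisorOf_x {C₀ : Curve (surface2 K)} (h₀ : IsV0 C₀.ring) :
    IsDivisorOf (x K) (Finsupp.single C₀ 1 + specialDiv K (-1) 1 (-1)) := by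
  classical
  have hinv : ∀ C : Curve (surface2 K), ord C.ring (1 / x K) = 1 → ord C.ring (x K) = -1 := by
    intro C h
    rw [one_div, ord_inv] at h
    omega
  have := isDivisorOf_special (g := x K) (D := Finsupp.single C₀ 1) x_ne_zero
    (fun C h => by
      rw [Finsupp.single_eq_of_ne]
      rintro rfl
      exact h (IsDiv.loc h₀ gen_xy)) fun C h => by
      by_cases hm : InMax C.ring.toLocalSubring (x K)
      · obtain rfl := Curve.ext ((h.isDiv_of_inMax hm).unique gen_xy h₀)
        rw [Finsupp.single_eq_same, IsDiv.ord_left gen_xy h₀]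
      · rw [ord_eq_zero h.left hm, Finsupp.single_eq_of_ne]
        rintro rfl
        exact hm h₀.left.inMax
  convert this using 2
  congr 1
  · exact (hinv _ (isInf_linf.ord_left gen_isInf)).symm
  · ext k; exact ((isAff_eaff k).ord_left (gen_isAff _)).symm
  · ext k i; exact (hinv _ (isPt_ept k i).ord_left).symm

theorem sl_div (μ α : K) : sl μ - co α = (y K / x K - co μ - co α * (1 / x K)) / (1 / x K) := by
  have hx := x_ne_zero (K := K)
  simp only [sl]
  field_simp

theorem two_mul_sg_ne (k l : Fin 3) (hl : l ≠ 0) : (2 : K) * ((sg k : ℤ) : K) ≠ ((sg l : ℤ) : K) := by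
  intro h
  have h1 : 2 * sg k = sg l := by
    apply Int.cast_injective (α := K)
    push_cast
    exact h
  clear h
  revert k l; decide

/-- Over the point of its own slope, y - μx - α is nonconstant on the first exceptional curve and
has the value ±1/2 - α ≠ 0 on the second ones, because α is 0 or ±1. Over the other points at
infinity it has a simple pole, like x. -/
theorem isDivisorOf_sl {C₀ : Curve (surface2 K)} {i : Fin 4} {l : Fin 3}
    (h₀ : IsEll C₀.ring ((mu i : ℤ) : K) ((sg l : ℤ) : K)) :
    IsDivisorOf (sl ((mu i : ℤ) : K) - co ((sg l : ℤ) : K)) (Finsupp.single C₀ 1 +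
      specialDiv K (-1) (fun k => if k = l then 1 else 0) fun _ j => if j = i then 0 else -1) := by
  classical
  set μ := ((mu i : ℤ) : K)
  set α := ((sg l : ℤ) : K)
  have hg := gen_line_affine μ α
  have := isDivisorOf_special (g := sl μ - co α) (D := Finsupp.single C₀ 1) hg.left_ne_zero
    (fun C h => by
      rw [Finsupp.single_eq_of_ne]
      rintro rfl
      exact h (IsEll.loc h₀)) fun C h => by
      by_cases hm : InMax C.ring.toLocalSubring (sl μ - co α)
      · obtain rfl := Curve.ext (((h.line μ α).isDiv_of_inMax hm).unique hg h₀)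
        rw [Finsupp.single_eq_same, IsDiv.ord_left hg h₀]
      · rw [ord_eq_zero (h.line μ α).left hm, Finsupp.single_eq_of_ne]
        rintro rfl
        exact hm h₀.left.inMax
  convert this using 2
  have hx := x_ne_zero (K := K)
  have hz : (1 / x K) ≠ 0 := one_div_ne_zero hx
  congr 1
  · have h1 := isInf_linf (K := K)
    have h2 : NoVal K (linf K).ring.toLocalSubring (y K / x K - co μ - co α * (1 / x K)) :=
      (h1.right.sub_const μ).sub ((HasVal.const h1.const α).mul h1.left)
    rw [sl_div, ord_div h2.ne_zero hz, ord_eq_zero_of_noVal h2, h1.ord_left gen_isInf]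
    rfl
  · ext k
    have h1 := isAff_eaff (K := K) k
    by_cases hk : k = l
    · subst hk
      rw [if_pos rfl]
      have h2 := h1.right.sub_const μ
      have he : sl μ - co α = x K * ((y K - co α) / x K - co μ) := by
        simp only [sl]; field_simp; ring
      rw [he, ord_mul hx h2.ne_zero, IsDiv.ord_left (gen_isAff _) h1, ord_eq_zero_of_noVal h2]
      rfl
    · rw [if_neg hk]
      have h2 := ((IsAff.hasVal_y h1).sub ((HasVal.const h1.const μ).mul h1.left)).sub
        (HasVal.const h1.const α)
      refine (ord_eq_zero_of_hasVal h2 fun h0 => hk (sg_injective (cast_inj (K := K) ?_))).symm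
      linear_combination h0
  · ext k j
    have h1 := isPt_ept (K := K) k j
    by_cases hj : j = i
    · subst hj
      rw [if_pos rfl]
      rcases h1 with ⟨-, h1⟩ | ⟨hk, h1⟩
      · exact (ord_eq_zero_of_noVal (h1.right.sub_const α)).symm
      · refine (ord_eq_zero_of_hasVal ((IsEd.hasVal_sl h1).sub (HasVal.const h1.const α))
          fun h0 => two_mul_sg_ne (K := K) l k hk ?_).symm
        linear_combination -2 * h0
    · rw [if_neg hj]
      have hc := h1.left.1
      have h2 := (h1.hasVal_ratio.sub (HasVal.const hc μ)).sub
        ((HasVal.const hc α).mul h1.left)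
      have hne : ((mu j : ℤ) : K) - μ - α * 0 ≠ 0 := by
        intro h0
        exact hj (mu_injective (cast_inj (K := K) (by linear_combination h0)))
      rw [sl_div, ord_div (h2.ne_zero hne) hz, ord_eq_zero_of_hasVal h2 hne, h1.ord_left]
      rfl

end Divisors

end BirSurf

namespace BirSurf

open FunField Polynomial

set_option linter.unusedSectionVars false

/-! ## Places of curves and intersection numbers -/

section Places

variable {K : Type*} [Field K] {S : Set (LocalSubring (FunField K))} {C : Curve S}
  {O : LocalSubring (FunField K)} {u t f g φ : FunField K} {c : K}

theorem IsModel.hasConst (hS : IsModel S) (C : Curve S) : HasConst K C.ring.toLocalSubring := by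
  obtain ⟨_, _, _, _, _, h⟩ := Curve.exists_loc hS C
  exact h.const

/-- The restriction to `C` of a function that is regular along `C`. -/
noncomputable def res (C : Curve S) (f : FunField K) : IsLocalRing.ResidueField C.ring :=
  open Classical in if h : f ∈ C.ring then IsLocalRing.residue C.ring ⟨f, h⟩ else 0

theorem res_of_mem (h : f ∈ C.ring) : res C f = IsLocalRing.residue C.ring ⟨f, h⟩ := dif_pos h

theorem res_eq_zero_iff (h : f ∈ C.ring) : res C f = 0 ↔ InMax C.ring.toLocalSubring f := by
  rw [res_of_mem h, IsLocalRing.residue_eq_zero_iff]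
  exact ⟨fun hm => ⟨h, hm⟩, fun hm => hm.2⟩

theorem res_mul (hf : f ∈ C.ring) (hg : g ∈ C.ring) : res C (f * g) = res C f * res C g := by
  rw [res_of_mem hf, res_of_mem hg, res_of_mem (C.ring.mul_mem _ _ hf hg), ← map_mul]
  rfl

theorem res_add (hf : f ∈ C.ring) (hg : g ∈ C.ring) : res C (f + g) = res C f + res C g := by
  rw [res_of_mem hf, res_of_mem hg, res_of_mem (C.ring.add_mem _ _ hf hg), ← map_add]
  rfl

theorem res_one : res C 1 = 1 := by
  rw [res_of_mem C.ring.one_mem]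
  exact map_one _

theorem res_inv (hf : f ∈ C.ring) (h : ¬ InMax C.ring.toLocalSubring f) :
    res C f⁻¹ = (res C f)⁻¹ := by
  have h1 : f⁻¹ ∈ C.ring := inv_mem_of_not_inMax (O := C.ring.toLocalSubring) hf h
  refine eq_inv_of_mul_eq_one_left ?_
  rw [← res_mul h1 hf, inv_mul_cancel₀ (ne_zero_of_not_inMax h), res_one]

theorem res_zpow (hf : f ∈ C.ring) (h : ¬ InMax C.ring.toLocalSubring f) (n : ℤ) :
    f ^ n ∈ C.ring ∧ res C (f ^ n) = res C f ^ n := by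
  have hnat : ∀ m : ℕ, f ^ m ∈ C.ring ∧ res C (f ^ m) = res C f ^ m := by
    intro m
    have hm := pow_mem hf m
    refine ⟨hm, ?_⟩
    rw [res_of_mem hf, res_of_mem hm, ← map_pow]
    rfl
  obtain ⟨m, rfl | rfl⟩ := n.eq_nat_or_neg
  · simpa using hnat m
  · have h1 : f⁻¹ ∈ C.ring := inv_mem_of_not_inMax (O := C.ring.toLocalSubring) hf h
    have h2 : ¬ InMax C.ring.toLocalSubring (f ^ m) := fun h' => by
      have h3 : res C (f ^ m) = 0 := (res_eq_zero_iff (hnat m).1).2 h'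
      rw [(hnat m).2] at h3
      exact pow_ne_zero m (fun h4 => h ((res_eq_zero_iff hf).1 h4)) h3
    rw [zpow_neg, zpow_natCast, zpow_neg, zpow_natCast]
    exact ⟨by rw [← inv_pow]; exact pow_mem h1 m, by rw [res_inv (hnat m).1 h2, (hnat m).2]⟩

theorem res_ne_zero_of_ord (hf : f ≠ 0) (h : ord C.ring f = 0) : f ∈ C.ring ∧ res C f ≠ 0 := by
  obtain ⟨h1, h2⟩ := not_inMax_of_ord_eq_zero hf h
  exact ⟨h1, fun h0 => h2 ((res_eq_zero_iff h1).1 h0)⟩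

/-- The composite of the local ring of a curve and of a place of the curve. -/
noncomputable def composite (w : Place K C) : ValuationSubring (FunField K) where
  carrier := {f | f ∈ C.ring ∧ res C f ∈ w.ring}
  mul_mem' := fun ⟨ha, ha'⟩ ⟨hb, hb'⟩ =>
    ⟨C.ring.mul_mem _ _ ha hb, by rw [res_mul ha hb]; exact w.ring.mul_mem _ _ ha' hb'⟩
  one_mem' := ⟨C.ring.one_mem, by rw [res_one]; exact w.ring.one_mem⟩
  add_mem' := fun ⟨ha, ha'⟩ ⟨hb, hb'⟩ =>
    ⟨C.ring.add_mem _ _ ha hb, by rw [res_add ha hb]; exact w.ring.add_mem _ _ ha' hb'⟩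
  zero_mem' := ⟨C.ring.zero_mem, by
    rw [(res_eq_zero_iff C.ring.zero_mem).2 InMax.zero]; exact w.ring.zero_mem⟩
  neg_mem' := by
    rintro f ⟨ha, ha'⟩
    have h1 : (-1 : FunField K) ∈ C.ring := C.ring.neg_mem _ C.ring.one_mem
    have h2 : res C (-1) + 1 = 0 := by
      rw [← res_one, ← res_add h1 C.ring.one_mem, neg_add_cancel]
      exact (res_eq_zero_iff C.ring.zero_mem).2 InMax.zero
    have h3 : res C (-f) = -res C f := by
      rw [← neg_one_mul, res_mul h1 ha, eq_neg_of_add_eq_zero_left h2, neg_one_mul]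
    exact ⟨C.ring.neg_mem _ ha, by rw [h3]; exact w.ring.neg_mem _ ha'⟩
  mem_or_inv_mem' := by
    intro f
    have key : ∀ f, f ∈ C.ring → f ∈ C.ring ∧ res C f ∈ w.ring ∨
        f⁻¹ ∈ C.ring ∧ res C f⁻¹ ∈ w.ring := by
      intro f hf
      by_cases hm : InMax C.ring.toLocalSubring f
      · left
        rw [(res_eq_zero_iff hf).2 hm]
        exact ⟨hf, w.ring.zero_mem⟩
      · rw [res_inv hf hm]
        exact (w.ring.mem_or_inv_mem (res C f)).imp (fun h => ⟨hf, h⟩)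
          fun h => ⟨inv_mem_of_not_inMax (O := C.ring.toLocalSubring) hf hm, h⟩
    rcases C.ring.mem_or_inv_mem f with h | h
    · exact key f h
    · have := key _ h
      rw [inv_inv] at this
      exact this.symm

variable {w : Place K C}

theorem mem_composite : f ∈ composite w ↔ f ∈ C.ring ∧ res C f ∈ w.ring := Iff.rfl

theorem composite_le : composite w ≤ C.ring := fun _ h => h.1

theorem inMax_composite_iff : InMax (composite w).toLocalSubring f ↔
    f ∈ C.ring ∧ InMax w.ring.toLocalSubring (res C f) := by
  rw [inMax_valuationSubring_iff, inMax_valuationSubring_iff, mem_composite]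
  constructor
  · rintro ⟨⟨h1, h2⟩, h3⟩
    refine ⟨h1, h2, ?_⟩
    by_cases hm : InMax C.ring.toLocalSubring f
    · exact Or.inl ((res_eq_zero_iff h1).2 hm)
    · right
      rw [← res_inv h1 hm]
      have h0 := ne_zero_of_not_inMax hm
      exact fun h4 => (h3.resolve_left h0)
        ⟨inv_mem_of_not_inMax (O := C.ring.toLocalSubring) h1 hm, h4⟩
  · rintro ⟨h1, h2, h3⟩
    refine ⟨⟨h1, h2⟩, ?_⟩
    by_cases hm : InMax C.ring.toLocalSubring f
    · have := (inMax_valuationSubring_iff.1 hm).2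
      exact this.imp id fun h h' => h h'.1
    · refine Or.inr fun h4 => ?_
      rw [mem_composite, res_inv h1 hm] at h4
      rcases h3 with h3 | h3
      · exact hm ((res_eq_zero_iff h1).1 h3)
      · exact h3 h4.2

theorem InMax.composite (h : InMax C.ring.toLocalSubring f) :
    InMax (composite w).toLocalSubring f :=
  inMax_composite_iff.2 ⟨h.1, by rw [(res_eq_zero_iff h.1).2 h]; exact InMax.zero⟩

theorem hasConst_composite (hC : HasConst K C.ring.toLocalSubring) :
    HasConst K (composite w).toLocalSubring := fun a =>
  ⟨hC a, by rw [res_of_mem (hC a)]; exact w.const_mem a (hC a)⟩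

theorem composite_ne : composite w ≠ C.ring := by
  intro h
  refine valuationSubring_ne_top w.ring (eq_top_iff.2 fun z _ => ?_)
  obtain ⟨⟨f, hf⟩, rfl⟩ := IsLocalRing.residue_surjective z
  have h1 : f ∈ BirSurf.composite w := by rw [h]; exact hf
  have := (mem_composite.1 h1).2
  rwa [res_of_mem hf] at this

theorem valuation_lt_one_iff' {E : Type*} [Field E] (A : ValuationSubring E) (z : E) :
    A.valuation z < 1 ↔ InMax A.toLocalSubring z := by
  rw [inMax_valuationSubring_iff]
  by_cases h0 : z = 0
  · simp [h0, A.zero_mem]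
  · rw [← A.valuation_le_one_iff, ← A.valuation_le_one_iff, map_inv₀]
    have hv : A.valuation z ≠ 0 := by simpa using h0
    simp only [h0, false_or]
    rw [inv_le_one₀ (zero_lt_iff.2 hv), not_le]
    exact ⟨fun h => ⟨h.le, h⟩, fun h => h.2⟩

/-- The composite is a rank two valuation ring. Turning incidence into domination makes the
separation and centre properties of the model apply to places. -/
theorem liesOver_iff : w.LiesOver O ↔ O ≤ (composite w).toLocalSubring := by
  rw [localSubring_le_iff]
  constructor
  · rintro ⟨h, h1, h2⟩
    refine ⟨fun f hf => ⟨h hf, ?_⟩, fun f hf => inMax_composite_iff.2 ⟨h hf.1, ?_⟩⟩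
    · rw [res_of_mem (h hf)]; exact h1 ⟨f, hf⟩
    · have := h2 ⟨f, hf.1⟩ hf.2
      rwa [valuation_lt_one_iff', ← res_of_mem] at this
  · rintro ⟨h1, h2⟩
    refine ⟨fun f hf => (h1 hf).1, fun f => ?_, fun f hf => ?_⟩
    · have := (h1 f.2).2
      rwa [res_of_mem (h1 f.2).1] at this
    · have := (inMax_composite_iff.1 (h2 f ⟨f.2, hf⟩)).2
      rwa [res_of_mem (h1 f.2).1, ← valuation_lt_one_iff'] at this

/-- The composite ring has a centre unless it is centred at a curve of some plane. In that case it
would be a discrete valuation ring, hence maximal, although it is strictly contained in the local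
ring of C. -/
theorem IsModel.exists_liesOver [IsAlgClosed K] (hS : IsModel S) (w : Place K C) :
    ∃ O ∈ S, w.LiesOver O := by
  have hC := hS.hasConst C
  have hne : composite w ≠ ⊤ := fun h =>
    valuationSubring_ne_top C.ring (eq_top_iff.2 (h ▸ composite_le))
  obtain ⟨O, hO, hle⟩ := hS.centre (composite w) fun u v hg hu hv => by
    by_contra hn
    push Not at hn
    have hl : Loc (composite w) u v :=
      ⟨hne, hasConst_composite hC, hu, hv, fun a b hab => hn a b hab.1 hab.2⟩
    obtain ⟨p, hp, hV, -⟩ := hl.exists_prime hg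
    refine composite_ne (w := w) ?_
    rw [hV]
    exact primeVal_eq_of_le _ _ (hV ▸ composite_le) (valuationSubring_ne_top C.ring)
  exact ⟨O, hO, liesOver_iff.2 hle⟩

theorem IsModel.liesOver_unique (hS : IsModel S) {O₁ O₂ : LocalSubring (FunField K)} (h1 : O₁ ∈ S)
    (h2 : O₂ ∈ S) (hw1 : w.LiesOver O₁) (hw2 : w.LiesOver O₂) : O₁ = O₂ :=
  hS.sep _ h1 _ h2 _ (liesOver_iff.1 hw1) (liesOver_iff.1 hw2)

/-- φ/g has order 0 along C automatically, so its regularity need not be carried along and the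
residue can be taken by the total function `res`. -/
theorem hasIntersectionNumber_iff {D : Divisor S} {n : ℤ} : HasIntersectionNumber K D C n ↔
    ∃ g : FunField K, g ≠ 0 ∧ ord C.ring g = D C ∧ ∃ d : Place K C →₀ ℤ,
      (∀ w : Place K C, ∃ O ∈ S, w.LiesOver O ∧ ∃ φ, IsLocalEquation D O φ ∧
        ord w.ring (res C (φ / g)) = d w) ∧ n = d.sum fun _ k => k := by
  refine exists_congr fun g => and_congr_right fun hg => and_congr_right fun hgD =>
    exists_congr fun d => and_congr_left fun _ => forall_congr' fun w => exists_congr fun O =>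
    and_congr_right fun _ => and_congr_right fun hw => exists_congr fun φ =>
    and_congr_right fun hφ => ?_
  obtain ⟨hle, -⟩ := hw
  have h0 : ord C.ring (φ / g) = 0 := by rw [ord_div hφ.1 hg, hφ.2 C hle, hgD, sub_self]
  have hm := (res_ne_zero_of_ord (div_ne_zero hφ.1 hg) h0).1
  rw [res_of_mem hm]
  exact ⟨fun ⟨_, h⟩ => h, fun h => ⟨hm, h⟩⟩

/-- With g as moving function and as local equation everywhere, all quotients are 1. -/
theorem hasIntersectionNumber_zero [IsAlgClosed K] (hS : IsModel S) {D : Divisor S}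
    (hD : IsDivisorOf g D) (C : Curve S) : HasIntersectionNumber K D C 0 := by
  refine hasIntersectionNumber_iff.2 ⟨g, hD.1, (hD.2 C).symm, 0, fun w => ?_, by simp⟩
  obtain ⟨O, hO, hw⟩ := hS.exists_liesOver w
  refine ⟨O, hO, hw, g, hD.isLocalEquation O, ?_⟩
  rw [div_self hD.1, res_one, ord_one, Finsupp.zero_apply]

theorem res_div_ne_zero {D : Divisor S} (hφ : IsLocalEquation D O φ) (hg : g ≠ 0)
    (hgD : ord C.ring g = D C) (hw : w.LiesOver O) : φ / g ∈ C.ring ∧ res C (φ / g) ≠ 0 :=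
  res_ne_zero_of_ord (div_ne_zero hφ.1 hg)
    (by rw [ord_div hφ.1 hg, hφ.2 C hw.1, hgD, sub_self])

theorem _root_.HasIntersectionNumber.add (hS : IsModel S) {D E : Divisor S} {m n : ℤ}
    (hD : HasIntersectionNumber K D C m) (hE : HasIntersectionNumber K E C n) :
    HasIntersectionNumber K (D + E) C (m + n) := by
  rw [hasIntersectionNumber_iff] at *
  obtain ⟨g, hg, hgD, d, hd, rfl⟩ := hD
  obtain ⟨g', hg', hgE, d', hd', rfl⟩ := hE
  refine ⟨g * g', mul_ne_zero hg hg', by rw [ord_mul hg hg', hgD, hgE, Finsupp.add_apply],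
    d + d', fun w => ?_, by rw [Finsupp.sum_add_index'] <;> simp⟩
  obtain ⟨O, hO, hw, φ, hφ, ho⟩ := hd w
  obtain ⟨O', hO', hw', ψ, hψ, ho'⟩ := hd' w
  obtain rfl := hS.liesOver_unique hO hO' hw hw'
  obtain ⟨h1, h2⟩ := res_div_ne_zero hφ hg hgD hw
  obtain ⟨h3, h4⟩ := res_div_ne_zero hψ hg' hgE hw
  refine ⟨O, hO, hw, _, IsLocalEquation.mul hφ hψ, ?_⟩
  rw [← div_mul_div_comm, res_mul h1 h3, ord_mul h2 h4, ho, ho', Finsupp.add_apply]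

theorem _root_.HasIntersectionNumber.neg {D : Divisor S} {n : ℤ}
    (hD : HasIntersectionNumber K D C n) : HasIntersectionNumber K (-D) C (-n) := by
  rw [hasIntersectionNumber_iff] at *
  obtain ⟨g, hg, hgD, d, hd, rfl⟩ := hD
  refine ⟨g⁻¹, inv_ne_zero hg, by rw [ord_inv, hgD, Finsupp.neg_apply], -d, fun w => ?_, ?_⟩
  · obtain ⟨O, hO, hw, φ, hφ, ho⟩ := hd w
    obtain ⟨h1, h2⟩ := res_div_ne_zero hφ hg hgD hw
    refine ⟨O, hO, hw, φ ^ (-1 : ℤ), by simpa using IsLocalEquation.zpow hφ (-1), ?_⟩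
    have : φ ^ (-1 : ℤ) / g⁻¹ = (φ / g)⁻¹ := by rw [zpow_neg_one, inv_div_inv, inv_div]
    rw [this, res_inv h1 (fun h => h2 ((res_eq_zero_iff h1).2 h)), ord_inv, ho, Finsupp.neg_apply]
  · rw [Finsupp.sum_neg_index (by simp)]
    simp [Finsupp.sum]

/-- `numTrivial` is a generated subgroup; additivity of intersection numbers extends the defining
property from the generators. -/
theorem hasIntersectionNumber_of_mem [IsAlgClosed K] (hS : IsModel S) {D : Divisor S}
    (hD : D ∈ numTrivial K S) (C : Curve S) : HasIntersectionNumber K D C 0 := by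
  induction hD using AddSubgroup.closure_induction with
  | mem D hD => exact hD C
  | zero => exact hasIntersectionNumber_zero hS isDivisorOf_one C
  | add D E _ _ hD hE => simpa using hD.add hS hE
  | neg D _ hD => simpa using hD.neg

theorem IsDivisorOf.mem_numTrivial [IsAlgClosed K] (hS : IsModel S) {D : Divisor S}
    (hD : IsDivisorOf g D) : D ∈ numTrivial K S :=
  AddSubgroup.subset_closure fun C => hasIntersectionNumber_zero hS hD C

/-! ### Rational curves with a coordinate -/

theorem splits_induction [IsAlgClosed K] {p : K[X] → Prop} (hC : ∀ a, a ≠ 0 → p (Polynomial.C a))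
    (hX : ∀ c, p (X - Polynomial.C c)) (hm : ∀ P Q, p P → p Q → p (P * Q)) {P : K[X]}
    (hP : P ≠ 0) : p P := by
  rw [(IsAlgClosed.splits P).eq_prod_roots]
  refine hm _ _ (hC _ (by simpa using hP)) ?_
  refine Multiset.prod_induction p _ hm (by simpa using hC 1 one_ne_zero) ?_
  intro q hq
  obtain ⟨c, -, rfl⟩ := Multiset.mem_map.1 hq
  exact hX c

/-- The ring homomorphism from `K[T]` to the function field of `C` that maps `T` to the
restriction of `t`. -/
noncomputable def resHom (h : IsDiv C.ring u t) : K[X] →+* IsLocalRing.ResidueField C.ring :=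
  Polynomial.eval₂RingHom ((IsLocalRing.residue C.ring).comp
    ((algebraMap K (FunField K)).codRestrict C.ring h.const)) (res C t)

theorem resHom_X (h : IsDiv C.ring u t) : resHom h X = res C t := by simp [resHom]

theorem resHom_C (h : IsDiv C.ring u t) (a : K) : resHom h (Polynomial.C a) = res C (co a) := by
  rw [res_of_mem (h.const a)]
  simp only [resHom, coe_eval₂RingHom, eval₂_C, RingHom.comp_apply]
  rfl

theorem resHom_sub (h : IsDiv C.ring u t) (a : K) :
    resHom h (X - Polynomial.C a) = res C (t - co a) := by
  have h1 := res_add (C := C) (f := t - co a) (g := co a)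
    (C.ring.sub_mem h.right.mem (h.const a)) (h.const a)
  rw [sub_add_cancel] at h1
  rw [map_sub, resHom_X, resHom_C, h1, add_sub_cancel_right]

theorem resHom_ne_zero [IsAlgClosed K] (h : IsDiv C.ring u t) {P : K[X]} (hP : P ≠ 0) :
    resHom h P ≠ 0 := by
  refine splits_induction (p := fun P => resHom h P ≠ 0) ?_ ?_ ?_ hP
  · intro a ha h0
    rw [resHom_C, res_eq_zero_iff (h.const a)] at h0
    exact (HasVal.const h.const a).not_inMax ha h0
  · intro c h0
    rw [resHom_sub, res_eq_zero_iff (C.ring.sub_mem h.right.mem (h.const c))] at h0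
    exact h.right.not_hasVal c ⟨h.const, h0⟩
  · intro P Q hP hQ
    rw [map_mul]; exact mul_ne_zero hP hQ

theorem res_polyHom (h : IsDiv C.ring u t) (P : MvPolynomial (Fin 2) K) :
    polyHom u t P ∈ C.ring ∧ res C (polyHom u t P) =
      resHom h (MvPolynomial.aeval ![0, (X : K[X])] P) := by
  have hmem := fun P => BirSurf.polyHom_mem h.const h.left.mem h.right.mem P
  refine ⟨hmem P, ?_⟩
  induction P using MvPolynomial.induction_on with
  | C a => rw [polyHom_C, MvPolynomial.aeval_C, ← resHom_C h]; rfl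
  | add p q hp hq => rw [map_add, res_add (hmem p) (hmem q), hp, hq, map_add, map_add]
  | mul_X p i hp =>
    rw [map_mul, res_mul (hmem p) (hmem _), hp, map_mul, map_mul]
    congr 1
    fin_cases i
    · simpa using (res_eq_zero_iff h.left.mem).2 h.left.inMax
    · simpa using (resHom_X h).symm

/-- Setting u = 0 in rational functions of u and t shows that the function field of C is K(t). -/
theorem fracHom_resHom [IsAlgClosed K] (hg : Gen u t) (h : IsDiv C.ring u t) :
    FracHom (resHom h) where
  inj := (injective_iff_map_eq_zero _).2 fun P hP => by
    by_contra h0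
    exact resHom_ne_zero h h0 hP
  frac z := by
    obtain ⟨⟨f, hf⟩, rfl⟩ := IsLocalRing.residue_surjective z
    rw [← res_of_mem hf]
    have hf' := hf
    rw [h.eq_primeVal hg] at hf'
    obtain ⟨A, B, hB, rfl⟩ := hf'
    obtain ⟨hA1, hA2⟩ := res_polyHom h A
    obtain ⟨hB1, hB2⟩ := res_polyHom h B
    have hBm : ¬ InMax C.ring.toLocalSubring (polyHom u t B) := by
      rw [h.eq_primeVal hg, inMax_primeVal_iff]; exact hB
    have hB0 : res C (polyHom u t B) ≠ 0 := fun h0 => hBm ((res_eq_zero_iff hB1).1 h0)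
    refine ⟨MvPolynomial.aeval ![0, (X : K[X])] A, MvPolynomial.aeval ![0, (X : K[X])] B,
      fun h0 => hB0 (by rw [hB2, h0, map_zero]), ?_⟩
    rw [← hA2, ← hB2, eq_div_iff hB0, ← res_mul hf hB1,
      div_mul_cancel₀ _ (ne_zero_of_not_inMax hBm)]

theorem IsDiv.inv_right (h : IsDiv C.ring u t) : IsDiv C.ring u t⁻¹ := ⟨h.left, h.right.inv⟩

theorem Gen.inv_right (hg : Gen u t) : Gen u t⁻¹ := by
  refine hg.of_mem mem_adjoin_left ?_
  have := inv_mem (mem_adjoin_right (u := u) (v := t⁻¹))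
  rwa [inv_inv] at this

/-- The place of `C` at which `t` has the value `c`. -/
noncomputable def ratPlace [IsAlgClosed K] (hg : Gen u t) (h : IsDiv C.ring u t) (c : K) :
    Place K C where
  ring := primeVal (fracHom_resHom hg h) (prime_X_sub_C c)
  dvr := inferInstance
  const_mem a ha := by
    have := mem_primeVal (fracHom_resHom hg h) (prime_X_sub_C c) (Polynomial.C a)
    rwa [resHom_C, res_of_mem ha] at this

theorem place_ext {w w' : Place K C} (h : w.ring = w'.ring) : w = w' := by
  cases w; cases w'; congr

theorem res_const_mem (hC : HasConst K C.ring.toLocalSubring) (a : K) : res C (co a) ∈ w.ring := by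
  rw [res_of_mem (hC a)]; exact w.const_mem a (hC a)

theorem res_const_inv_mem (hC : HasConst K C.ring.toLocalSubring) {a : K} (ha : a ≠ 0) :
    (res C (co a))⁻¹ ∈ w.ring := by
  have h1 : (co a)⁻¹ = co a⁻¹ := (map_inv₀ _ _).symm
  rw [← res_inv (hC a) ((HasVal.const hC a).not_inMax ha), h1]
  exact res_const_mem hC _

theorem resHom_mem (h : IsDiv C.ring u t) (ht : res C t ∈ w.ring) (P : K[X]) :
    resHom h P ∈ w.ring := by
  induction P using Polynomial.induction_on' with
  | add p q hp hq => rw [map_add]; exact w.ring.add_mem _ _ hp hq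
  | monomial n a =>
    rw [← Polynomial.C_mul_X_pow_eq_monomial, map_mul, map_pow, resHom_X, resHom_C]
    exact w.ring.mul_mem _ _ (res_const_mem h.const a) (pow_mem ht n)

/-- Modulo t - c every polynomial is the constant P(c). So P vanishes at the place only if c is a
root, and the place is the localization at t - c. -/
theorem place_eq [IsAlgClosed K] (hg : Gen u t) (h : IsDiv C.ring u t)
    (hc : InMax w.ring.toLocalSubring (res C (t - co c))) : w = ratPlace hg h c := by
  have ht : res C t ∈ w.ring := by
    have := w.ring.add_mem _ _ hc.mem (res_const_mem h.const c)
    rwa [← res_add (C.ring.sub_mem h.right.mem (h.const c)) (h.const c), sub_add_cancel] at this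
  refine place_ext (BirSurf.eq_primeVal (fracHom_resHom hg h) (prime_X_sub_C c) (valuationSubring_ne_top _) (resHom_mem h ht) ?_)
  intro P hP
  rw [dvd_iff_isRoot]
  by_contra h0
  have h1 : X - Polynomial.C c ∣ P - Polynomial.C (P.eval c) := by
    rw [dvd_iff_isRoot]; simp
  obtain ⟨Q, hQ⟩ := h1
  have h2 : resHom h (Polynomial.C (P.eval c)) =
      resHom h P - resHom h Q * resHom h (X - Polynomial.C c) := by
    rw [← map_mul, ← map_sub]
    congr 1
    linear_combination -hQ
  have h3 : InMax w.ring.toLocalSubring (resHom h (Polynomial.C (P.eval c))) := by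
    rw [h2, resHom_sub]
    exact hP.sub (InMax.mul_left (resHom_mem h ht Q) hc)
  refine not_inMax_of_inv_mem (resHom_ne_zero h (by simpa using h0)) ?_ h3
  rw [resHom_C]
  exact res_const_inv_mem h.const h0

/-- The places of `C` as the points of the projective line. -/
noncomputable def linePlace [IsAlgClosed K] (hg : Gen u t) (h : IsDiv C.ring u t) :
    Option K → Place K C
  | some c => ratPlace hg h c
  | none => ratPlace hg.inv_right h.inv_right 0

/-- If t is regular at w but no t - c vanishes there, then all nonzero polynomials are units at w,
as they split into linear factors. The place would be the whole function field. If t is not regular,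
t⁻¹ vanishes. -/
theorem exists_linePlace [IsAlgClosed K] (hg : Gen u t) (h : IsDiv C.ring u t) (w : Place K C) :
    (∃ c, w = linePlace hg h (some c) ∧ InMax w.ring.toLocalSubring (res C (t - co c))) ∨
    (w = linePlace hg h none ∧ InMax w.ring.toLocalSubring (res C t⁻¹)) := by
  by_cases ht : res C t ∈ w.ring
  · left
    suffices hs : ∃ c, InMax w.ring.toLocalSubring (res C (t - co c)) by
      obtain ⟨c, hc⟩ := hs
      exact ⟨c, place_eq hg h hc, hc⟩
    by_contra hn
    push Not at hn
    have key : ∀ P : K[X], P ≠ 0 → ¬ InMax w.ring.toLocalSubring (resHom h P) := by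
      intro P hP
      refine splits_induction (p := fun P => ¬ InMax w.ring.toLocalSubring (resHom h P)) ?_ ?_ ?_ hP
      · intro a ha
        refine not_inMax_of_inv_mem (resHom_ne_zero h (by simpa using ha)) ?_
        rw [resHom_C]
        exact res_const_inv_mem h.const ha
      · intro c
        rw [resHom_sub]; exact hn c
      · intro P Q hP hQ hPQ
        rw [map_mul] at hPQ
        exact (hPQ.of_mul (resHom_mem h ht P) (resHom_mem h ht Q)).elim hP hQ
    refine valuationSubring_ne_top w.ring (eq_top_iff.2 fun z _ => ?_)
    obtain ⟨A, B, hB, rfl⟩ := (fracHom_resHom hg h).frac z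
    rw [div_eq_mul_inv]
    exact w.ring.mul_mem _ _ (resHom_mem h ht A)
      (inv_mem_of_not_inMax (O := w.ring.toLocalSubring) (resHom_mem h ht B) (key B hB))
  · right
    have h1 := inv_mem_of_not_mem ht
    rw [← res_inv h.right.mem h.right.not_inMax] at h1
    refine ⟨place_eq hg.inv_right h.inv_right ?_, h1⟩
    rwa [co, map_zero, sub_zero]

theorem ord_ratPlace_self [IsAlgClosed K] (hg : Gen u t) (h : IsDiv C.ring u t) (c : K) :
    ord (ratPlace hg h c).ring (res C (t - co c)) = 1 := by
  rw [← resHom_sub h]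
  exact ord_primeVal_self (fracHom_resHom hg h) (prime_X_sub_C c)

theorem ord_ratPlace_of_ne [IsAlgClosed K] (hg : Gen u t) (h : IsDiv C.ring u t) (c : K) {P : K[X]}
    (hP : P.eval c ≠ 0) : ord (ratPlace hg h c).ring (resHom h P) = 0 := by
  refine ord_eq_zero (mem_primeVal (fracHom_resHom hg h) (prime_X_sub_C c) P) fun hm => hP ?_
  have := (inMax_primeVal_iff (fracHom_resHom hg h) (prime_X_sub_C c) P).1 hm
  exact dvd_iff_isRoot.1 this

theorem ord_const [IsAlgClosed K] (hg : Gen u t) (h : IsDiv C.ring u t) (o : Option K) {a : K}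
    (ha : a ≠ 0) : ord (linePlace hg h o).ring (res C (co a)) = 0 := by
  cases o with
  | none =>
    rw [← resHom_C h.inv_right]
    exact ord_ratPlace_of_ne hg.inv_right h.inv_right 0 (by simpa using ha)
  | some c =>
    rw [← resHom_C h]
    exact ord_ratPlace_of_ne hg h c (by simpa using ha)

theorem ord_infinity [IsAlgClosed K] (hg : Gen u t) (h : IsDiv C.ring u t) (c : K) :
    ord (linePlace hg h none).ring (res C (t - co c)) = -1 := by
  have h1 : res C (t - co c) = resHom h.inv_right (1 - Polynomial.C c * X) / res C t⁻¹ := by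
    -- In the coordinate t⁻¹ at infinity the first factor is a unit and t contributes the simple
    -- pole.
    have e : t - co c = (1 - co c * t⁻¹) * t := by
      have := h.right.ne_zero
      field_simp
    have hm : 1 - co c * t⁻¹ ∈ C.ring :=
      C.ring.sub_mem C.ring.one_mem (C.ring.mul_mem _ _ (h.const c) h.right.inv_mem)
    have h2 := res_add (C := C) hm (C.ring.mul_mem _ _ (h.const c) h.right.inv_mem)
    rw [sub_add_cancel, res_one] at h2
    rw [e, res_mul hm h.right.mem, res_inv h.right.mem h.right.not_inMax, div_inv_eq_mul]
    congr 1
    rw [map_sub, map_one, map_mul, resHom_X, resHom_C,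
      ← res_mul (h.const c) h.right.inv_mem, h2, add_sub_cancel_right]
  have h3 := ord_ratPlace_self hg.inv_right h.inv_right 0
  rw [co, map_zero, sub_zero] at h3
  have h4 := ord_ratPlace_of_ne hg.inv_right h.inv_right 0 (P := 1 - Polynomial.C c * X) (by simp)
  have hne : resHom h.inv_right (1 - Polynomial.C c * X) ≠ 0 :=
    resHom_ne_zero _ fun h0 => by simpa using congrArg (Polynomial.eval 0) h0
  have hne' : res C t⁻¹ ≠ 0 := fun h0 =>
    h.right.inv.not_inMax ((res_eq_zero_iff h.right.inv_mem).1 h0)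
  rw [h1, ord_div hne hne']
  change ord (ratPlace hg.inv_right h.inv_right 0).ring _ - ord (ratPlace hg.inv_right _ 0).ring _
    = -1
  rw [h3, h4]
  rfl

theorem linePlace_injective [IsAlgClosed K] (hg : Gen u t) (h : IsDiv C.ring u t) :
    Function.Injective (linePlace hg h) := by
  have key : ∀ c (o : Option K), linePlace hg h (some c) = linePlace hg h o → some c = o := by
    intro c o ho
    have h1 : ord (linePlace hg h (some c)).ring (res C (t - co c)) = 1 := ord_ratPlace_self hg h c
    rw [ho] at h1
    cases o with
    | none => rw [ord_infinity] at h1; omega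
    | some d =>
      by_contra hn
      have h2 : ord (ratPlace hg h d).ring (resHom h (X - Polynomial.C c)) = 0 :=
        ord_ratPlace_of_ne hg h d (by
          rw [eval_sub, eval_X, eval_C, sub_ne_zero]
          rintro rfl
          exact hn rfl)
      rw [resHom_sub] at h2
      change ord (ratPlace hg h d).ring _ = 1 at h1
      omega
  rintro (_ | c) o ho
  · cases o with
    | none => rfl
    | some d => exact (key d none ho.symm).symm
  · exact key c o ho

/-- The product formula for the projective line. -/
theorem product_formula [IsAlgClosed K] (hg : Gen u t) (h : IsDiv C.ring u t)
    {r : IsLocalRing.ResidueField C.ring} (hr : r ≠ 0) : ∃ n : Option K →₀ ℤ,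
      (∀ o, ord (linePlace hg h o).ring r = n o) ∧ n.sum (fun _ k => k) = 0 := by
  classical
  have key : ∀ P : K[X], P ≠ 0 → resHom h P ≠ 0 ∧ ∃ n : Option K →₀ ℤ,
      (∀ o, ord (linePlace hg h o).ring (resHom h P) = n o) ∧ n.sum (fun _ k => k) = 0 := by
    intro P hP
    refine splits_induction (p := fun P => resHom h P ≠ 0 ∧ ∃ n : Option K →₀ ℤ,
      (∀ o, ord (linePlace hg h o).ring (resHom h P) = n o) ∧ n.sum (fun _ k => k) = 0) ?_ ?_ ?_ hP
    · intro a ha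
      refine ⟨resHom_ne_zero h (by simpa using ha), 0, fun o => ?_, by simp⟩
      rw [resHom_C, ord_const hg h o ha, Finsupp.zero_apply]
    · intro c
      refine ⟨resHom_ne_zero h (X_sub_C_ne_zero c),
        Finsupp.single (some c) 1 + Finsupp.single none (-1), fun o => ?_, ?_⟩
      · cases o with
        | none => rw [resHom_sub, ord_infinity]; simp
        | some d =>
          by_cases hd : d = c
          · subst hd
            rw [resHom_sub, show linePlace hg h (some d) = ratPlace hg h d from rfl,
              ord_ratPlace_self hg h d]
            simp
          · have h1 : ord (ratPlace hg h d).ring (resHom h (X - Polynomial.C c)) = 0 :=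
              ord_ratPlace_of_ne hg h d (by simpa [sub_eq_zero] using hd)
            rw [show linePlace hg h (some d) = ratPlace hg h d from rfl, h1]
            simp [Ne.symm hd]
      · rw [Finsupp.sum_add_index' (by simp) (by simp), Finsupp.sum_single_index rfl,
          Finsupp.sum_single_index rfl]
        rfl
    · rintro P Q ⟨hP0, n, hn, hs⟩ ⟨hQ0, m, hm, hs'⟩
      refine ⟨by rw [map_mul]; exact mul_ne_zero hP0 hQ0, n + m, fun o => ?_, ?_⟩
      · rw [map_mul, ord_mul hP0 hQ0, hn, hm, Finsupp.add_apply]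
      · rw [Finsupp.sum_add_index' (by simp) (by simp), hs, hs', add_zero]
  obtain ⟨A, B, hB, rfl⟩ := (fracHom_resHom hg h).frac r
  have hA : A ≠ 0 := by rintro rfl; simp at hr
  obtain ⟨hA0, n, hn, hs⟩ := key A hA
  obtain ⟨hB0, m, hm, hs'⟩ := key B hB
  refine ⟨n - m, fun o => by rw [ord_div hA0 hB0, hn, hm, Finsupp.sub_apply], ?_⟩
  rw [Finsupp.sum_sub_index (by simp), hs, hs', sub_zero]

theorem sum_mapDomain {n : Option K →₀ ℤ} {P : Option K → Place K C} :
    (Finsupp.mapDomain P n).sum (fun _ k => k) = n.sum fun _ k => k :=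
  Finsupp.sum_mapDomain_index (by simp) (by simp)

/-- Well-definedness in the one case needed. For D = 0 the local equations are units, so the number
is minus the degree of the divisor of the restricted moving function, which is 0 by the product
formula. -/
theorem hasIntersectionNumber_zero_unique [IsAlgClosed K] (hS : IsModel S) (hg : Gen u t)
    (h : IsDiv C.ring u t) {n : ℤ} (hn : HasIntersectionNumber K (0 : Divisor S) C n) : n = 0 := by
  obtain ⟨g, hg0, hgD, d, hd, rfl⟩ := hasIntersectionNumber_iff.1 hn
  rw [Finsupp.zero_apply] at hgD
  obtain ⟨hgm, hr⟩ := res_ne_zero_of_ord hg0 hgD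
  obtain ⟨m, hm, hs⟩ := product_formula hg h hr
  have hdm : d = Finsupp.mapDomain (linePlace hg h) (-m) := by
    ext w
    obtain ⟨o, rfl⟩ : ∃ o, w = linePlace hg h o := by
      rcases exists_linePlace hg h w with ⟨c, hc, -⟩ | ⟨hc, -⟩
      · exact ⟨_, hc⟩
      · exact ⟨_, hc⟩
    rw [Finsupp.mapDomain_apply (linePlace_injective hg h), Finsupp.neg_apply, ← hm o]
    obtain ⟨O, hO, hw, φ, hφ, ho⟩ := hd (linePlace hg h o)
    have hu := hS.unit_of_ord_eq_zero (φ := φ) hO fun C' hC' => by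
      rw [hφ.2 C' hC', Finsupp.zero_apply]
    have hle := (localSubring_le_iff.1 (liesOver_iff.1 hw)).1
    obtain ⟨h1, h2⟩ := hle hu.1
    obtain ⟨h3, h4⟩ := hle hu.2
    have hgi : ¬ InMax C.ring.toLocalSubring g := fun hi => hr ((res_eq_zero_iff hgm).2 hi)
    have hφi : ¬ InMax C.ring.toLocalSubring φ :=
      not_inMax_of_inv_mem (O := C.ring.toLocalSubring) hφ.1 h3
    have hφ0 : res C φ ≠ 0 := fun h0 => hφi ((res_eq_zero_iff h1).1 h0)
    have hgi' : g⁻¹ ∈ C.ring := inv_mem_of_not_inMax (O := C.ring.toLocalSubring) hgm hgi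
    have h5 : ord (linePlace hg h o).ring (res C φ) = 0 := by
      refine ord_eq_zero h2 (not_inMax_of_inv_mem hφ0 ?_)
      rw [← res_inv h1 hφi]; exact h4
    rw [← ho, div_eq_mul_inv, res_mul h1 hgi', res_inv hgm hgi,
      ord_mul hφ0 (inv_ne_zero hr), ord_inv, h5, zero_add]
  rw [hdm, sum_mapDomain, Finsupp.sum_neg_index (by simp)]
  simpa [Finsupp.sum] using hs

/-- Reduces an intersection number with a rational curve to explicit local equations. For each value
c of t, and for infinity, one gives a point of the surface lying below every W of that kind, and
there φ/f must be the prescribed power of t - c. At infinity t has order -1, whence the sign of the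
exponent. -/
theorem hasIntersectionNumber_of_line [IsAlgClosed K] (hg : Gen u t)
    (h : IsDiv C.ring u t) {D : Divisor S} (hf0 : f ≠ 0) (hf : ord C.ring f = D C)
    (n : Option K →₀ ℤ)
    (H : ∀ W : ValuationSubring (FunField K),
      (∀ z, InMax C.ring.toLocalSubring z → HasVal W.toLocalSubring z (0 : K)) →
      ∀ c, HasVal W.toLocalSubring t c → ∃ O ∈ S, O ≤ W.toLocalSubring ∧
        ∃ φ, IsLocalEquation D O φ ∧ φ / f = (t - co c) ^ n (some c))
    (H' : ∀ W : ValuationSubring (FunField K),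
      (∀ z, InMax C.ring.toLocalSubring z → HasVal W.toLocalSubring z (0 : K)) →
      HasVal W.toLocalSubring t⁻¹ (0 : K) → ∃ O ∈ S, O ≤ W.toLocalSubring ∧
        ∃ φ, IsLocalEquation D O φ ∧ φ / f = t ^ (-n none)) :
    HasIntersectionNumber K D C (n.sum fun _ k => k) := by
  refine hasIntersectionNumber_iff.2 ⟨f, hf0, hf, Finsupp.mapDomain (linePlace hg h) n,
    fun w => ?_, sum_mapDomain.symm⟩
  have hc := hasConst_composite (w := w) h.const
  have hmax : ∀ z, InMax C.ring.toLocalSubring z →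
      HasVal (composite w).toLocalSubring z (0 : K) := fun z hz => hz.composite.hasVal hc
  rcases exists_linePlace hg h w with ⟨c, hw, hwc⟩ | ⟨hw, hwc⟩
  · have hmem := C.ring.sub_mem h.right.mem (h.const c)
    obtain ⟨O, hO, hle, φ, hφ, he⟩ := H (composite w) hmax c
      ⟨hc, inMax_composite_iff.2 ⟨hmem, hwc⟩⟩
    refine ⟨O, hO, liesOver_iff.2 hle, φ, hφ, ?_⟩
    have hni : ¬ InMax C.ring.toLocalSubring (t - co c) := (h.right.sub_const c).not_inMax
    rw [he, (res_zpow hmem hni _).2, ord_zpow, hw,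
      Finsupp.mapDomain_apply (linePlace_injective hg h)]
    change _ * ord (ratPlace hg h c).ring _ = _
    rw [ord_ratPlace_self, mul_one]
  · obtain ⟨O, hO, hle, φ, hφ, he⟩ := H' (composite w) hmax
      ((inMax_composite_iff.2 ⟨h.right.inv_mem, hwc⟩).hasVal hc)
    refine ⟨O, hO, liesOver_iff.2 hle, φ, hφ, ?_⟩
    rw [he, (res_zpow h.right.mem h.right.not_inMax _).2, ord_zpow, hw,
      Finsupp.mapDomain_apply (linePlace_injective hg h)]
    have := ord_infinity hg h 0
    rw [co, map_zero, sub_zero] at this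
    rw [this]; ring

end Places

end BirSurf

namespace BirSurf

open FunField

set_option linter.unusedSectionVars false

/-! ## The special curves are numerically independent -/

section Independence

variable {K : Type*} [Field K] {V : ValuationSubring (FunField K)}
  {O : LocalSubring (FunField K)} {u v : FunField K} {a b c m μ δ : K}

theorem IsDiv.sub_const (h : IsDiv V u v) (c : K) : IsDiv V u (v - co c) :=
  ⟨h.left, h.right.sub_const c⟩

theorem hasVal_inv_x_of_inf (h : HasVal O (xi μ) (0 : K)) (ht : HasVal O (tt μ) c) :
    HasVal O (1 / x K) (0 : K) := by
  rw [inv_x_eq μ]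
  exact h.zero_mul_mem ht.mem

variable [CharZero K] [IsAlgClosed K] {C C₁ C₂ : Curve (surface2 K)}
  {D : Divisor (surface2 K)} {n : ℤ} {b' : Fin 3 → ℤ} {e : Fin 3 → Fin 4 → ℤ} {i : Fin 4} {k : Fin 3}

theorem aff_cases (hO : O.toSubring ≤ C.ring.toSubring) (hx : HasVal O (x K) a)
    (hy : HasVal O (y K) b) :
    Loc C.ring (x K) (y K) ∨ ∃ k, a = 0 ∧ b = ((sg k : ℤ) : K) ∧ C = eaff K k := by
  have hinf : ¬ HasVal C.ring.toLocalSubring (1 / x K) (0 : K) := fun h => by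
    have := h.zero_mul_mem (hO hx.mem)
    rw [one_div, inv_mul_cancel₀ x_ne_zero] at this
    exact not_inMax_one this.inMax
  rcases Curve.special_cases C with h | rfl | ⟨k, rfl⟩ | ⟨k, i, rfl⟩
  · exact Or.inl h
  · exact (hinf isInf_linf.left).elim
  · exact Or.inr ⟨k, hx.eq_of_le hO (isAff_eaff k).left,
      hy.eq_of_le hO (IsAff.hasVal_y (isAff_eaff k)), rfl⟩
  · exact (hinf (isPt_ept k i).left).elim

theorem inf_cases (hO : O.toSubring ≤ C.ring.toSubring) (hx : HasVal O (1 / x K) (0 : K))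
    (hm : HasVal O (y K / x K) m) : Loc C.ring (x K) (y K) ∨ C = linf K ∨
      ∃ k i, m = ((mu i : ℤ) : K) ∧ C = ept K k i := by
  rcases Curve.special_cases C with h | rfl | ⟨k, rfl⟩ | ⟨k, i, rfl⟩
  · exact Or.inl h
  · exact Or.inr (Or.inl rfl)
  · have := (isAff_eaff (K := K) k).left.zero_mul_mem (hO hx.mem)
    rw [one_div, mul_inv_cancel₀ x_ne_zero] at this
    exact (not_inMax_one this.inMax).elim
  · exact Or.inr (Or.inr ⟨k, i, hm.eq_of_le hO (isPt_ept k i).hasVal_ratio, rfl⟩)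

theorem inf_cases' (hO : O.toSubring ≤ C.ring.toSubring)
    (hx : HasVal O (1 / x K) (0 : K)) (hm : HasVal O (xi ((mu i : ℤ) : K)) (0 : K)) :
    Loc C.ring (x K) (y K) ∨ C = linf K ∨ ∃ k, C = ept K k i := by
  refine (inf_cases hO hx (hasVal_slope hm)).imp id (Or.imp id ?_)
  rintro ⟨k, j, hj, rfl⟩
  obtain rfl := mu_injective (cast_inj hj)
  exact ⟨k, rfl⟩

theorem hasVal_tt_linf (μ : K) : HasVal (linf K).ring.toLocalSubring (tt μ) (0 : K) :=
  isInf_linf.left.zero_div_noVal (isInf_linf.right.sub_const μ)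

theorem hasVal_tt_ept (hk : k ≠ 0) :
    HasVal (ept K k i).ring.toLocalSubring (tt ((mu i : ℤ) : K)) (2 * ((sg k : ℤ) : K)) :=
  IsEd.hasVal_tt (cast_sq hk) (isEd_ept hk i)

theorem two_sg_injective {k l : Fin 3} (h : (2 : K) * ((sg k : ℤ) : K) = 2 * ((sg l : ℤ) : K)) :
    k = l :=
  sg_injective (cast_inj (mul_left_cancel₀ two_ne_zero h))

theorem localEquation_two (hg : Gen u v) (hO : planePoint u v ∈ surface2 K)
    (hD : ∀ C : Curve (surface2 K), Loc C.ring (x K) (y K) → D C = 0)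
    (h1 : IsDiv C₁.ring u v) (h2 : IsDiv C₂.ring v u)
    (h : ∀ C : Curve (surface2 K), (planePoint u v).toSubring ≤ C.ring.toSubring →
      Loc C.ring (x K) (y K) ∨ C = C₁ ∨ C = C₂) :
    IsLocalEquation D (planePoint u v) (u ^ D C₁ * v ^ D C₂) := by
  refine isSurface_surface2.isLocalEquation hg hO (fun C hC hn1 hn2 => ?_) (fun C hC => ?_)
    fun C hC => ?_
  · rcases h C hC with hl | rfl | rfl
    · exact hD C hl
    · exact absurd h1 hn1
    · exact absurd h2 hn2
  · rw [Curve.ext (hC.unique hg h1)]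
  · rw [Curve.ext (hC.unique hg.swap h2)]

theorem localEquation_one (hg : Gen u v) (hO : planePoint u v ∈ surface2 K)
    (hD : ∀ C : Curve (surface2 K), Loc C.ring (x K) (y K) → D C = 0) (h1 : IsDiv C₁.ring u v)
    (h : ∀ C : Curve (surface2 K), (planePoint u v).toSubring ≤ C.ring.toSubring →
      Loc C.ring (x K) (y K) ∨ C = C₁) : IsLocalEquation D (planePoint u v) (u ^ D C₁) := by
  have := isSurface_surface2.isLocalEquation (D := D) (m := D C₁) (n := 0) hg hO
    (fun C hC hn1 hn2 => ?_) (fun C hC => by rw [Curve.ext (hC.unique hg h1)]) fun C hC => ?_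
  · rwa [zpow_zero, mul_one] at this
  · rcases h C hC with hl | rfl
    · exact hD C hl
    · exact absurd h1 hn1
  · have hle := hC.planePoint_le hg.swap 0
    rw [map_zero, sub_zero, ← planePoint_swap hg] at hle
    rcases h C hle with hl | rfl
    · exact hD C hl
    · exact (hC.right.not_inMax h1.left.inMax).elim

/-! ### Local equations -/

theorem specialDiv_loc' : ∀ C : Curve (surface2 K), Loc C.ring (x K) (y K) →
    specialDiv K n b' e C = 0 := fun _ h => specialDiv_loc h

theorem localEquation_ed (hk : k ≠ 0) (c : K) :
    IsLocalEquation (specialDiv K n b' e) (planePoint (xi ((mu i : ℤ) : K))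
      ((tt ((mu i : ℤ) : K) - co (2 * ((sg k : ℤ) : K))) / xi ((mu i : ℤ) : K) - co c))
      (xi ((mu i : ℤ) : K) ^ e k i) := by
  have hg := (gen_inf_sub ((mu i : ℤ) : K) (2 * ((sg k : ℤ) : K))).blow_left c
  have h1 := (isEd_iff (cast_sq hk)).1 (isEd_ept (K := K) hk i)
  have := localEquation_one (D := specialDiv K n b' e) hg (over_over_mem i hk c) specialDiv_loc'
    (h1.sub_const c) fun C hC => ?_
  · rwa [specialDiv_ept] at this
  · have hxi := hg.hasVal_left
    have hτ := hg.hasVal_right.of_sub_const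
    have htt : HasVal (planePoint (xi ((mu i : ℤ) : K)) ((tt ((mu i : ℤ) : K) -
        co (2 * ((sg k : ℤ) : K))) / xi ((mu i : ℤ) : K) - co c)) (tt ((mu i : ℤ) : K))
        (2 * ((sg k : ℤ) : K)) := by
      refine HasVal.of_sub_const ((hxi.zero_mul_mem hτ.mem).congr ?_ rfl)
      rw [mul_div_cancel₀ _ (xi_ne_zero _)]
    rcases inf_cases' hC (hasVal_inv_x_of_inf hxi htt) hxi with h | rfl | ⟨l, rfl⟩
    · exact Or.inl h
    · exact (two_sg_ne_zero hk (htt.eq_of_le hC (hasVal_tt_linf _))).elim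
    · right
      by_cases hl : l = 0
      · subst hl
        have h2 := isEm_iff.1 (isEm_ept (K := K) i)
        refine (h2.right.not_hasVal (2 * ((sg k : ℤ) : K)) ?_).elim
        refine HasVal.of_sub_const ((h2.left.zero_mul_mem (hC hτ.mem)).congr ?_ rfl)
        rw [mul_div_cancel₀ _ (xi_ne_zero _)]
      · rw [two_sg_injective (htt.eq_of_le hC (hasVal_tt_ept hl))]

/-- The second chart of the second blow-up: here the new exceptional curve is cut out by `tt` - 2δ
and the old one by the quotient `xi` / (`tt` - 2δ). -/
theorem localEquation_corner (hk : k ≠ 0) :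
    IsLocalEquation (specialDiv K n b' e)
      (planePoint (tt ((mu i : ℤ) : K) - co (2 * ((sg k : ℤ) : K)))
        (xi ((mu i : ℤ) : K) / (tt ((mu i : ℤ) : K) - co (2 * ((sg k : ℤ) : K)))))
      ((tt ((mu i : ℤ) : K) - co (2 * ((sg k : ℤ) : K))) ^ e k i *
        (xi ((mu i : ℤ) : K) / (tt ((mu i : ℤ) : K) - co (2 * ((sg k : ℤ) : K)))) ^ e 0 i) := by
  have hg0 := gen_inf_sub ((mu i : ℤ) : K) (2 * ((sg k : ℤ) : K))
  have hg := hg0.blow_right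
  have h1 := ((isEd_iff (cast_sq hk)).1 (isEd_ept (K := K) hk i)).flip hg0.swap
  have h2 := isEm_iff.1 (isEm_ept (K := K) i)
  have h2' := h2.right.sub_const (2 * ((sg k : ℤ) : K))
  have := localEquation_two (D := specialDiv K n b' e) hg (over_over_mem' i hk) specialDiv_loc'
    h1 ⟨h2.left.zero_div_noVal h2', h2'⟩ fun C hC => ?_
  · rwa [specialDiv_ept, specialDiv_ept] at this
  · have htt := hg.hasVal_left.of_sub_const
    have hxi := (hg.hasVal_left.zero_mul_mem hg.hasVal_right.mem)
    rw [mul_div_cancel₀ _ hg0.right_ne_zero] at hxi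
    rcases inf_cases' hC (hasVal_inv_x_of_inf hxi htt) hxi with h | rfl | ⟨l, rfl⟩
    · exact Or.inl h
    · exact (two_sg_ne_zero hk (htt.eq_of_le hC (hasVal_tt_linf _))).elim
    · right
      by_cases hl : l = 0
      · subst hl
        exact Or.inr rfl
      · left
        rw [two_sg_injective (htt.eq_of_le hC (hasVal_tt_ept hl))]

theorem localEquation_aff (k : Fin 3) (c : K) :
    IsLocalEquation (specialDiv K n b' e)
      (planePoint (x K) ((y K - co ((sg k : ℤ) : K)) / x K - co c)) (x K ^ b' k) := by
  have hg := (gen_affine ((sg k : ℤ) : K)).blow_left c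
  have := localEquation_one (D := specialDiv K n b' e) hg (over_aff_mem k c) specialDiv_loc'
    ((isAff_eaff (K := K) k).sub_const c) fun C hC => ?_
  · rwa [specialDiv_eaff] at this
  · have hy := hg.hasVal_left.zero_mul_mem hg.hasVal_right.of_sub_const.mem
    rw [mul_div_cancel₀ _ x_ne_zero] at hy
    refine (aff_cases hC hg.hasVal_left hy.of_sub_const).imp id ?_
    rintro ⟨l, -, hl, rfl⟩
    rw [sg_injective (cast_inj hl)]

theorem localEquation_aff' (k : Fin 3) :
    IsLocalEquation (specialDiv K n b' e)
      (planePoint (y K - co ((sg k : ℤ) : K)) (x K / (y K - co ((sg k : ℤ) : K))))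
      ((y K - co ((sg k : ℤ) : K)) ^ b' k) := by
  have hg0 := gen_affine ((sg k : ℤ) : K)
  have hg := hg0.blow_right
  have := localEquation_one (D := specialDiv K n b' e) hg (over_aff_mem' k) specialDiv_loc'
    ((isAff_eaff (K := K) k).flip hg0.swap) fun C hC => ?_
  · rwa [specialDiv_eaff] at this
  · have hx := hg.hasVal_left.zero_mul_mem hg.hasVal_right.mem
    rw [mul_div_cancel₀ _ hg0.right_ne_zero] at hx
    refine (aff_cases hC hx hg.hasVal_left.of_sub_const).imp id ?_
    rintro ⟨l, -, hl, rfl⟩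
    rw [sg_injective (cast_inj hl)]

theorem localEquation_em (hc : c ≠ 0) (hc' : ∀ k, k ≠ 0 → c ≠ 2 * ((sg k : ℤ) : K)) :
    IsLocalEquation (specialDiv K n b' e)
      (planePoint (xi ((mu i : ℤ) : K)) (tt ((mu i : ℤ) : K) - co c))
      (xi ((mu i : ℤ) : K) ^ e 0 i) := by
  have hg := gen_inf_sub ((mu i : ℤ) : K) c
  have h1 := isEm_iff.1 (isEm_ept (K := K) i)
  have := localEquation_one (D := specialDiv K n b' e) hg (over_inf_mem i hc') specialDiv_loc'
    (h1.sub_const c) fun C hC => ?_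
  · rwa [specialDiv_ept] at this
  · have hxi := hg.hasVal_left
    have htt := hg.hasVal_right.of_sub_const
    rcases inf_cases' hC (hasVal_inv_x_of_inf hxi htt) hxi with h | rfl | ⟨l, rfl⟩
    · exact Or.inl h
    · exact (hc (htt.eq_of_le hC (hasVal_tt_linf _))).elim
    · right
      by_cases hl : l = 0
      · rw [hl]
      · exact (hc' l hl (htt.eq_of_le hC (hasVal_tt_ept hl))).elim

theorem localEquation_em_linf :
    IsLocalEquation (specialDiv K n b' e)
      (planePoint (xi ((mu i : ℤ) : K)) (tt ((mu i : ℤ) : K)))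
      (xi ((mu i : ℤ) : K) ^ e 0 i * tt ((mu i : ℤ) : K) ^ n) := by
  have hg := gen_inf ((mu i : ℤ) : K)
  have hO := over_inf_mem (K := K) i (c := 0) fun _ hk => (two_sg_ne_zero hk).symm
  rw [co, map_zero, sub_zero] at hO
  have := localEquation_two (D := specialDiv K n b' e) (C₂ := linf K) hg hO specialDiv_loc'
    (isEm_iff.1 (isEm_ept (K := K) i))
    ⟨hasVal_tt_linf _, isInf_linf.right.sub_const _⟩ fun C hC => ?_
  · rwa [specialDiv_ept, specialDiv_linf] at this
  · have hxi := hg.hasVal_left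
    have htt := hg.hasVal_right
    rcases inf_cases' hC (hasVal_inv_x_of_inf hxi htt) hxi with h | rfl | ⟨l, rfl⟩
    · exact Or.inl h
    · exact Or.inr (Or.inr rfl)
    · right
      by_cases hl : l = 0
      · rw [hl]; exact Or.inl rfl
      · exact (two_sg_ne_zero hl (htt.eq_of_le hC (hasVal_tt_ept hl)).symm).elim

theorem localEquation_line (hc : ∀ k, k ≠ 0 → 2 * c ≠ ((sg k : ℤ) : K)) :
    IsLocalEquation (specialDiv K n b' e)
      (planePoint (1 / x K) (sl ((mu i : ℤ) : K) - co c)) ((1 / x K) ^ e 0 i) := by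
  have hg := gen_line_sub ((mu i : ℤ) : K) c
  have := localEquation_one (D := specialDiv K n b' e) hg (line_mem i hc) specialDiv_loc'
    ((isEm_ept (K := K) i).sub_const c) fun C hC => ?_
  · rwa [specialDiv_ept] at this
  · have hs := hg.hasVal_right.of_sub_const
    have hxi := hg.hasVal_left.zero_mul_mem hs.mem
    rw [mul_comm, ← xi_eq] at hxi
    rcases inf_cases' hC hg.hasVal_left hxi with h | rfl | ⟨l, rfl⟩
    · exact Or.inl h
    · have h1 := (hasVal_tt_linf ((mu i : ℤ) : K)).zero_mul_mem (hC hs.mem)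
      rw [tt_eq, inv_mul_cancel₀ (sl_ne_zero _)] at h1
      exact (not_inMax_one h1.inMax).elim
    · right
      by_cases hl : l = 0
      · rw [hl]
      · refine (hc l hl ?_).elim
        rw [hs.eq_of_le hC (IsEd.hasVal_sl (isEd_ept hl i))]
        ring

theorem localEquation_linf (hc : ∀ i, c ≠ ((mu i : ℤ) : K)) :
    IsLocalEquation (specialDiv K n b' e)
      (planePoint (1 / x K) (y K / x K - co c)) ((1 / x K) ^ n) := by
  have hg := (gen_infinity c).swap
  have hO := infinity_mem hc
  rw [planePoint_swap (gen_infinity c)] at hO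
  have := localEquation_one (D := specialDiv K n b' e) hg hO specialDiv_loc'
    (isInf_linf.sub_const c) fun C hC => ?_
  · rwa [specialDiv_linf] at this
  · rcases inf_cases hC hg.hasVal_left hg.hasVal_right.of_sub_const with h | rfl | ⟨l, i, hi, rfl⟩
    · exact Or.inl h
    · exact Or.inr rfl
    · exact (hc i hi).elim

theorem isDiv_linf_vertical : IsDiv (linf K).ring (1 / y K) (x K / y K) := by
  have hx := x_ne_zero (K := K)
  have hy := y_ne_zero (K := K)
  refine ⟨?_, ?_⟩
  · exact (isInf_linf.left.zero_div_noVal isInf_linf.right).congr (by field_simp) rfl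
  · have := isInf_linf (K := K).right.inv
    rwa [inv_div] at this

theorem localEquation_vertical :
    IsLocalEquation (specialDiv K n b' e) (planePoint (1 / y K) (x K / y K)) ((1 / y K) ^ n) := by
  have hg := (gen_xy (K := K)).swap.infinity.swap
  have hO := vertical_mem (K := K)
  rw [planePoint_swap hg.swap] at hO
  have := localEquation_one (D := specialDiv K n b' e) hg hO specialDiv_loc'
    isDiv_linf_vertical fun C hC => ?_
  · rwa [specialDiv_linf] at this
  · rcases Curve.special_cases C with h | rfl | ⟨k, rfl⟩ | ⟨k, i, rfl⟩
    · exact Or.inl h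
    · exact Or.inr rfl
    · exfalso
      have hy := IsAff.hasVal_y (isAff_eaff (K := K) k)
      have h1 := hC hg.hasVal_left.mem
      by_cases h0 : ((sg k : ℤ) : K) = 0
      · rw [h0] at hy
        have := hy.zero_mul_mem h1
        rw [mul_one_div_cancel y_ne_zero] at this
        exact not_inMax_one this.inMax
      · have h2 := hg.hasVal_left.eq_of_le hC ((one_div (y K)).symm ▸ hy.inv h0)
        exact inv_ne_zero h0 h2.symm
    · exfalso
      have h1 := (isPt_ept (K := K) k i).hasVal_ratio.inv (mu_ne_zero' i).symm
      rw [inv_div] at h1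
      exact inv_ne_zero (mu_ne_zero' i).symm (hg.hasVal_right.eq_of_le hC h1).symm

/-! ### Intersection numbers -/

theorem zpow_corner_div {F : Type*} [Field F] {r ξ : F} (hr : r ≠ 0) (hξ : ξ ≠ 0) (p q : ℤ) :
    r ^ p * (ξ / r) ^ q / ξ ^ p = (r / ξ) ^ (p - q) := by
  rw [zpow_sub₀ (div_ne_zero hr hξ), div_zpow, div_zpow, div_zpow]
  have h1 := zpow_ne_zero p hξ
  have h2 := zpow_ne_zero q hξ
  have h3 := zpow_ne_zero q hr
  field_simp

theorem zpow_corner_div' {F : Type*} [Field F] {r ξ : F} (hr : r ≠ 0) (hξ : ξ ≠ 0) (p q : ℤ) :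
    r ^ p * (ξ / r) ^ q / ξ ^ q = r ^ (p - q) := by
  rw [zpow_sub₀ hr, div_zpow]
  have h2 := zpow_ne_zero q hξ
  have h3 := zpow_ne_zero q hr
  field_simp

/-- Self-intersection -1, and a single transverse meeting with the first exceptional curve, located
at infinity of the coordinate. Both contribute to the order at that one point. -/
theorem intersection_ed (hk : k ≠ 0) :
    HasIntersectionNumber K (specialDiv K n b' e) (ept K k i) (e 0 i - e k i) := by
  have h := (isEd_iff (cast_sq hk)).1 (isEd_ept (K := K) hk i)
  have hg := gen_inf_blow ((mu i : ℤ) : K) (2 * ((sg k : ℤ) : K))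
  set ξ := xi ((mu i : ℤ) : K)
  set r := tt ((mu i : ℤ) : K) - co (2 * ((sg k : ℤ) : K)) with hr
  have hξ : ξ ≠ 0 := xi_ne_zero _
  have hr0 : r ≠ 0 := (gen_inf_sub ((mu i : ℤ) : K) (2 * ((sg k : ℤ) : K))).right_ne_zero
  have := hasIntersectionNumber_of_line (D := specialDiv K n b' e) hg h
    (f := ξ ^ e k i) (zpow_ne_zero _ hξ) (by
      rw [ord_zpow, h.ord_left hg, specialDiv_ept, mul_one])
    (Finsupp.single none (e 0 i - e k i)) (fun W hW c hc => ?_) fun W hW hc => ?_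
  · rwa [Finsupp.sum_single_index rfl] at this
  · refine ⟨_, over_over_mem i hk c, planePoint_le (hW _ h.left.inMax) hc.sub_const, _,
      localEquation_ed hk c, ?_⟩
    rw [div_self (zpow_ne_zero _ hξ)]
    simp
  · rw [inv_div] at hc
    refine ⟨_, over_over_mem' i hk, planePoint_le (hW _ ?_) hc, _, localEquation_corner hk, ?_⟩
    · have := h.left.zero_mul_mem h.right.mem
      rw [mul_div_cancel₀ _ hξ] at this
      exact this.inMax
    · rw [Finsupp.single_eq_same, neg_sub]
      exact zpow_corner_div hr0 hξ _ _

theorem intersection_aff (k : Fin 3) :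
    HasIntersectionNumber K (specialDiv K n b' e) (eaff K k) (-b' k) := by
  have h := isAff_eaff (K := K) k
  have hg := gen_isAff ((sg k : ℤ) : K)
  have hx := x_ne_zero (K := K)
  have := hasIntersectionNumber_of_line (D := specialDiv K n b' e) hg h
    (f := x K ^ b' k) (zpow_ne_zero _ hx) (by
      rw [ord_zpow, h.ord_left hg, specialDiv_eaff, mul_one])
    (Finsupp.single none (-b' k)) (fun W hW c hc => ?_) fun W hW hc => ?_
  · rwa [Finsupp.sum_single_index rfl] at this
  · refine ⟨_, over_aff_mem k c, planePoint_le (hW _ h.left.inMax) hc.sub_const, _,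
      localEquation_aff k c, ?_⟩
    rw [div_self (zpow_ne_zero _ hx)]
    simp
  · rw [inv_div] at hc
    refine ⟨_, over_aff_mem' k, planePoint_le (hW _ ?_) hc, _, localEquation_aff' k, ?_⟩
    · have := h.left.zero_mul_mem h.right.mem
      rw [mul_div_cancel₀ _ hx] at this
      exact this.inMax
    · rw [Finsupp.single_eq_same, neg_neg, div_zpow]

/-- This curve has been blown up at two of its points, so its self-intersection is -3. It meets the
line at infinity and the two second exceptional curves once each. -/
theorem intersection_em : HasIntersectionNumber K (specialDiv K n b' e) (ept K 0 i)
    (n - e 0 i + (e 1 i - e 0 i) + (e 2 i - e 0 i)) := by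
  classical
  have h := isEm_iff.1 (isEm_ept (K := K) i)
  have hg := gen_inf ((mu i : ℤ) : K)
  set ξ := xi ((mu i : ℤ) : K)
  set t := tt ((mu i : ℤ) : K) with ht
  have hξ : ξ ≠ 0 := xi_ne_zero _
  have h2 : (2 : K) ≠ 0 := two_ne_zero
  have h22 : (2 : K) ≠ -2 := by
    intro h0
    have : (4 : K) = 0 := by linear_combination h0
    exact (by norm_num : (4 : K) ≠ 0) this
  have s1 : 2 * ((sg 1 : ℤ) : K) = 2 := by simp [sg]
  have s2 : 2 * ((sg 2 : ℤ) : K) = -2 := by simp [sg]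
  -- The four places: t = 0 is the line at infinity, t = ±2 are the second exceptional curves, and t
  -- = ∞ absorbs the change of local equation from `xi` to 1/x.
  set N : Option K →₀ ℤ := Finsupp.single (some 0) n + Finsupp.single none (-e 0 i) +
      Finsupp.single (some 2) (e 1 i - e 0 i) + Finsupp.single (some (-2)) (e 2 i - e 0 i) with hN
  have hNone : N none = -e 0 i := by simp [hN]
  have hN0 : N (some 0) = n := by
    simp [hN, h2]
  have hN1 : N (some 2) = e 1 i - e 0 i := by
    simp [hN, h22.symm]
  have hN2 : N (some (-2)) = e 2 i - e 0 i := by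
    simp [hN, h22]
  have hNc : ∀ c : K, c ≠ 0 → c ≠ 2 → c ≠ -2 → N (some c) = 0 := fun c h0 h1 h2 => by
    simp [hN, h0.symm, h1.symm, h2.symm]
  have hsum : N.sum (fun _ k => k) = n - e 0 i + (e 1 i - e 0 i) + (e 2 i - e 0 i) := by
    rw [hN, Finsupp.sum_add_index' (by simp) (by simp), Finsupp.sum_add_index' (by simp) (by simp),
      Finsupp.sum_add_index' (by simp) (by simp), Finsupp.sum_single_index rfl,
      Finsupp.sum_single_index rfl, Finsupp.sum_single_index rfl, Finsupp.sum_single_index rfl]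
    rfl
  rw [← hsum]
  have hcorner : ∀ k : Fin 3, k ≠ 0 → N (some (2 * ((sg k : ℤ) : K))) = e k i - e 0 i →
      ∀ W : ValuationSubring (FunField K),
      (∀ z, InMax (ept K 0 i).ring.toLocalSubring z → HasVal W.toLocalSubring z (0 : K)) →
      HasVal W.toLocalSubring t (2 * ((sg k : ℤ) : K)) → ∃ O ∈ surface2 K, O ≤ W.toLocalSubring ∧
        ∃ φ, IsLocalEquation (specialDiv K n b' e) O φ ∧
        φ / ξ ^ e 0 i = (t - co (2 * ((sg k : ℤ) : K))) ^ N (some (2 * ((sg k : ℤ) : K))) := by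
    intro k hk hNk W hW hc
    have hr := h.right.sub_const (2 * ((sg k : ℤ) : K))
    refine ⟨_, over_over_mem' i hk, planePoint_le hc.sub_const
      (hW _ (h.left.zero_div_noVal hr).inMax), _, localEquation_corner hk, ?_⟩
    rw [hNk]
    exact zpow_corner_div' hr.ne_zero hξ _ _
  refine hasIntersectionNumber_of_line (D := specialDiv K n b' e) hg h
    (f := ξ ^ e 0 i) (zpow_ne_zero _ hξ) (by
      rw [ord_zpow, h.ord_left hg, specialDiv_ept, mul_one]) N (fun W hW c hc => ?_)
    fun W hW hc => ?_
  · by_cases hc0 : c = 0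
    · subst hc0
      rw [hN0]
      have hO := over_inf_mem (K := K) i (c := 0) fun _ hk => (two_sg_ne_zero hk).symm
      rw [co, map_zero, sub_zero] at hO ⊢
      refine ⟨_, hO, planePoint_le (hW _ h.left.inMax) hc, _, localEquation_em_linf, ?_⟩
      rw [mul_div_cancel_left₀ _ (zpow_ne_zero _ hξ)]
    · by_cases hc1 : c = 2
      · obtain rfl : c = 2 * ((sg 1 : ℤ) : K) := by rw [hc1, s1]
        exact hcorner 1 (by decide) (by rw [s1, hN1]) W hW hc
      · by_cases hc2 : c = -2
        · obtain rfl : c = 2 * ((sg 2 : ℤ) : K) := by rw [hc2, s2]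
          exact hcorner 2 (by decide) (by rw [s2, hN2]) W hW hc
        · have hcne : ∀ k, k ≠ 0 → c ≠ 2 * ((sg k : ℤ) : K) := by
            intro k hk
            fin_cases k
            · exact absurd rfl hk
            · exact fun h => hc1 (h.trans s1)
            · exact fun h => hc2 (h.trans s2)
          refine ⟨_, over_inf_mem i hcne, planePoint_le (hW _ h.left.inMax) hc.sub_const, _,
            localEquation_em hc0 hcne, ?_⟩
          rw [div_self (zpow_ne_zero _ hξ), hNc c hc0 hc1 hc2, zpow_zero]
  · rw [hNone, neg_neg]
    have hO := line_mem (K := K) i (c := 0) fun k hk h0 => two_mul_sg_ne (K := K) 0 k hk (by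
      simpa [sg] using h0)
    have hφ := localEquation_line (K := K) (n := n) (b' := b') (e := e) (i := i) (c := 0)
      fun k hk h0 => two_mul_sg_ne (K := K) 0 k hk (by simpa [sg] using h0)
    rw [co, map_zero, sub_zero] at hO hφ
    refine ⟨_, hO, planePoint_le (hW _ (isEm_ept i).left.inMax) ?_, _, hφ, ?_⟩
    · rwa [ht, tt_eq, inv_inv] at hc
    · rw [← div_zpow]

/-- A line with four of its points blown up has self-intersection 1 - 4. The places used are the
four slopes and the vertical direction, where the equation 1/x is replaced by 1/y. -/
theorem intersection_linf : HasIntersectionNumber K (specialDiv K n b' e) (linf K)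
    ((∑ i, (e 0 i - n)) + n) := by
  classical
  have h := isInf_linf (K := K)
  have hg := gen_isInf (K := K)
  have hx := x_ne_zero (K := K)
  have hz : 1 / x K ≠ 0 := one_div_ne_zero hx
  set N : Option K →₀ ℤ := (∑ i, Finsupp.single (some ((mu i : ℤ) : K)) (e 0 i - n)) +
    Finsupp.single none n with hN
  have hNone : N none = n := by simp [hN]
  have hNi : ∀ i, N (some ((mu i : ℤ) : K)) = e 0 i - n := by
    intro i
    rw [hN, Finsupp.add_apply, Finsupp.finsetSum_apply, Finset.sum_eq_single i]
    · simp
    · intro j _ hj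
      rw [Finsupp.single_eq_of_ne]
      intro h0
      exact hj (mu_injective (cast_inj (Option.some.inj h0))).symm
    · simp
  have hNc : ∀ c : K, (∀ i, c ≠ ((mu i : ℤ) : K)) → N (some c) = 0 := fun c hc => by
    rw [hN, Finsupp.add_apply, Finsupp.finsetSum_apply, Finset.sum_eq_zero]
    · simp
    · intro j _
      rw [Finsupp.single_eq_of_ne]
      intro h0
      exact hc j (Option.some.inj h0)
  have hsum : N.sum (fun _ k => k) = (∑ i, (e 0 i - n)) + n := by
    rw [hN, Finsupp.sum_add_index' (by simp) (by simp), Finsupp.sum_single_index rfl,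
      ← Finsupp.sum_finsetSum_index (by simp) (by simp)]
    exact congrArg (· + n) (Finset.sum_congr rfl fun i _ => Finsupp.sum_single_index rfl)
  rw [← hsum]
  refine hasIntersectionNumber_of_line (D := specialDiv K n b' e) hg h
    (f := (1 / x K) ^ n) (zpow_ne_zero _ hz) (by
      rw [ord_zpow, h.ord_left hg, specialDiv_linf, mul_one]) N (fun W hW c hc => ?_)
    fun W hW hc => ?_
  · by_cases hci : ∃ i, c = ((mu i : ℤ) : K)
    · obtain ⟨i, rfl⟩ := hci
      have hO := over_inf_mem (K := K) i (c := 0) fun _ hk => (two_sg_ne_zero hk).symm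
      rw [co, map_zero, sub_zero] at hO
      refine ⟨_, hO, planePoint_le hc.sub_const (hW _ (hasVal_tt_linf _).inMax), _,
        localEquation_em_linf, ?_⟩
      have hξ := xi_ne_zero ((mu i : ℤ) : K)
      have htt := (gen_inf ((mu i : ℤ) : K)).right_ne_zero
      rw [hNi, zpow_sub₀ hξ, inv_x_eq ((mu i : ℤ) : K), mul_zpow]
      have := zpow_ne_zero n htt
      have := zpow_ne_zero n hξ
      field_simp
    · push Not at hci
      have hO := infinity_mem hci
      rw [planePoint_swap (gen_infinity c)] at hO
      refine ⟨_, hO, planePoint_le (hW _ h.left.inMax) hc.sub_const, _, localEquation_linf hci, ?_⟩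
      rw [div_self (zpow_ne_zero _ hz), hNc c hci, zpow_zero]
  · rw [inv_div] at hc
    have hO := vertical_mem (K := K)
    rw [planePoint_swap (gen_xy (K := K)).swap.infinity] at hO
    refine ⟨_, hO, planePoint_le (hW _ isDiv_linf_vertical.left.inMax) hc, _,
      localEquation_vertical, ?_⟩
    have hy := y_ne_zero (K := K)
    rw [hNone, ← div_zpow, ← inv_zpow']
    congr 1
    field_simp

/-- Subtracting the intersection number 0 of a numerically trivial divisor leaves N as an
intersection number of the zero divisor, where uniqueness is known. -/
theorem eq_zero_of_mem_numTrivial {u t : FunField K} {N : ℤ} (hg : Gen u t)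
    (hC : IsDiv C.ring u t) (hD : D ∈ numTrivial K (surface2 K))
    (h : HasIntersectionNumber K D C N) : N = 0 := by
  have hS := (isSurface_surface2 (K := K)).toIsModel
  have h1 := h.add hS (hasIntersectionNumber_of_mem hS hD C).neg
  rw [add_neg_cancel, neg_zero, add_zero] at h1
  exact hasIntersectionNumber_zero_unique hS hg hC h1

/-- The equations are solved in turn. The affine exceptional curves give b' = 0, the second
exceptional curves give e k = e 0, the first ones then give e 0 = n, and finally the line at
infinity gives n = 0. -/
theorem specialDiv_independent (h : specialDiv K n b' e ∈ numTrivial K (surface2 K)) :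
    n = 0 ∧ b' = 0 ∧ e = 0 := by
  have h1 : ∀ k, -b' k = 0 := fun k =>
    eq_zero_of_mem_numTrivial (gen_isAff _) (isAff_eaff k) h (intersection_aff k)
  have h2 : ∀ i k, k ≠ 0 → e 0 i - e k i = 0 := fun i k hk =>
    eq_zero_of_mem_numTrivial (gen_line_blow _ _) (isEd_ept hk i) h (intersection_ed hk)
  have h3 : ∀ i, n - e 0 i + (e 1 i - e 0 i) + (e 2 i - e 0 i) = 0 := fun i =>
    eq_zero_of_mem_numTrivial (gen_line _) (isEm_ept i) h intersection_em
  have h4 : (∑ i, (e 0 i - n)) + n = 0 :=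
    eq_zero_of_mem_numTrivial gen_isInf isInf_linf h intersection_linf
  have h5 : ∀ i, e 0 i = n := fun i => by
    have a1 := h2 i 1 (by decide)
    have a2 := h2 i 2 (by decide)
    have a3 := h3 i
    omega
  have h6 : n = 0 := by simpa [h5] using h4
  refine ⟨h6, funext fun k => by have := h1 k; simpa using this, ?_⟩
  funext k i
  have := h5 i
  by_cases hk : k = 0
  · subst hk
    rw [this, h6]; rfl
  · have a := h2 i k hk
    rw [Pi.zero_apply, Pi.zero_apply]
    omega

end Independence

end BirSurf

namespace BirSurf

open FunField

set_option linter.unusedSectionVars false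

/-! ## The geometric basis of `N¹` -/

section Basis

variable {K : Type*} [Field K] [CharZero K] [IsAlgClosed K]

theorem specialDiv_eq (n : ℤ) (b : Fin 3 → ℤ) (e : Fin 3 → Fin 4 → ℤ) :
    specialDiv K n b e = n • Finsupp.single (linf K) 1 + ∑ k, b k • Finsupp.single (eaff K k) 1 +
      ∑ k, ∑ i, e k i • Finsupp.single (ept K k i) 1 := by
  simp [specialDiv]

variable (K) in
/-- The exceptional curves, in the order of the blown-up points. -/
noncomputable def excCurve : Fin 15 → Curve (surface2 K) :=
  ![eaff K 0, ept K 0 0, ept K 0 1, ept K 0 2, ept K 0 3,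
    eaff K 1, ept K 1 0, ept K 1 1, ept K 1 2, ept K 1 3,
    eaff K 2, ept K 2 0, ept K 2 1, ept K 2 2, ept K 2 3]

variable (K) in
/-- The pull-back of the line at infinity, followed by the exceptional curves. -/
noncomputable def basisDiv : Fin 16 → Divisor (surface2 K) :=
  Fin.cons (specialDiv K 1 0 1) fun i => Finsupp.single (excCurve K i) 1

/-- The coordinates of a combination of special curves. -/
def coords (n : ℤ) (b : Fin 3 → ℤ) (e : Fin 3 → Fin 4 → ℤ) : Fin 16 → ℤ :=
  ![n, b 0, e 0 0 - n, e 0 1 - n, e 0 2 - n, e 0 3 - n,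
    b 1, e 1 0 - n, e 1 1 - n, e 1 2 - n, e 1 3 - n,
    b 2, e 2 0 - n, e 2 1 - n, e 2 2 - n, e 2 3 - n]

/-- The line class is represented by the total transform of the line at infinity. It contains each
of the twelve exceptional curves over infinity once, which explains the corrections by n in
`coords`. -/
theorem sum_coords (n : ℤ) (b : Fin 3 → ℤ) (e : Fin 3 → Fin 4 → ℤ) :
    ∑ j, coords n b e j • basisDiv K j = specialDiv K n b e := by
  simp only [Fin.sum_univ_succ (n := 15), basisDiv, Fin.cons_zero, Fin.cons_succ, specialDiv_eq]
  simp only [coords, excCurve, Fin.sum_univ_succ, Fin.sum_univ_zero, Matrix.cons_val_zero,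
    Matrix.cons_val_succ, Pi.zero_apply, Pi.one_apply, Fin.succ_zero_eq_one, Fin.succ_one_eq_two]
  have h3 : (2 : Fin 3).succ = (3 : Fin 4) := rfl
  simp only [h3]
  module

/-- The combination of special curves with given coordinates. -/
def ofCoords (c : Fin 16 → ℤ) : ℤ × (Fin 3 → ℤ) × (Fin 3 → Fin 4 → ℤ) :=
  (c 0, ![c 1, c 6, c 11], ![![c 2 + c 0, c 3 + c 0, c 4 + c 0, c 5 + c 0],
    ![c 7 + c 0, c 8 + c 0, c 9 + c 0, c 10 + c 0],
    ![c 12 + c 0, c 13 + c 0, c 14 + c 0, c 15 + c 0]])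

theorem coords_ofCoords (c : Fin 16 → ℤ) :
    coords (ofCoords c).1 (ofCoords c).2.1 (ofCoords c).2.2 = c := by
  funext j
  fin_cases j <;> simp [coords, ofCoords]

theorem exists_coords (c : Fin 16 → ℤ) : ∃ n b e, coords n b e = c := ⟨_, _, _, coords_ofCoords c⟩

variable (K) in
noncomputable def basisClass (j : Fin 16) : Divisor (surface2 K) ⧸ numTrivial K (surface2 K) :=
  QuotientAddGroup.mk (basisDiv K j)

theorem sum_basisClass (c : Fin 16 → ℤ) : ∑ j, c j • basisClass K j =
    QuotientAddGroup.mk (∑ j, c j • basisDiv K j) := by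
  simp only [basisClass]
  exact (map_sum (QuotientAddGroup.mk' (numTrivial K (surface2 K))) _ _).symm

theorem linearIndependent_basisClass : LinearIndependent ℤ (basisClass K) := by
  rw [Fintype.linearIndependent_iff]
  intro c hc
  obtain ⟨n, b, e, rfl⟩ := exists_coords c
  rw [sum_basisClass, sum_coords, QuotientAddGroup.eq_zero_iff] at hc
  obtain ⟨rfl, rfl, rfl⟩ := specialDiv_independent hc
  intro j
  fin_cases j <;> rfl

theorem mk_mem_span (D : Divisor (surface2 K)) :
    (QuotientAddGroup.mk D : Divisor (surface2 K) ⧸ numTrivial K (surface2 K)) ∈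
      Submodule.span ℤ (Set.range (basisClass K)) := by
  obtain ⟨n, b, e, g, Dg, hg, rfl⟩ := exists_special_add D
  have h0 : (QuotientAddGroup.mk Dg : Divisor (surface2 K) ⧸ numTrivial K (surface2 K)) = 0 :=
    (QuotientAddGroup.eq_zero_iff _).2 (hg.mem_numTrivial isSurface_surface2.toIsModel)
  rw [QuotientAddGroup.mk_add, h0, add_zero, ← sum_coords, ← sum_basisClass]
  exact Submodule.sum_mem _ fun j _ => Submodule.smul_mem _ _ (Submodule.subset_span ⟨j, rfl⟩)

variable (K) in
noncomputable def intBasis :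
    Module.Basis (Fin 16) ℤ (Divisor (surface2 K) ⧸ numTrivial K (surface2 K)) :=
  Module.Basis.mk linearIndependent_basisClass fun z _ => by
    obtain ⟨D, rfl⟩ := QuotientAddGroup.mk_surjective z
    exact mk_mem_span D

variable (K) in
/-- The basis of `N¹` given by the class of a line and the exceptional curves. -/
noncomputable def geomBasis : Module.Basis (Fin 16) ℝ (N1 K (surface2 K)) :=
  Algebra.TensorProduct.basis ℝ (intBasis K)

theorem geomBasis_apply (j : Fin 16) : geomBasis K j = cls K (basisDiv K j) := by
  rw [geomBasis, Algebra.TensorProduct.basis_apply, intBasis, Module.Basis.mk_apply]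
  rfl

/-! ### Additivity of the class map. -/

section Cls

variable {F : Type*} [Field F] [Algebra K F] {S : Set (LocalSubring F)}

omit [CharZero K] [IsAlgClosed K]

theorem cls_add (D E : Divisor S) : cls K (D + E) = cls K D + cls K E :=
  (congrArg _ (QuotientAddGroup.mk_add _ D E)).trans (TensorProduct.tmul_add _ _ _)

theorem cls_zsmul (n : ℤ) (D : Divisor S) : cls K (n • D) = (n : ℝ) • cls K D := by
  rw [cls, QuotientAddGroup.mk_zsmul, TensorProduct.tmul_smul, cls, Int.cast_smul_eq_zsmul]

theorem cls_eq_zero {D : Divisor S} (h : D ∈ numTrivial K S) : cls K D = 0 := by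
  rw [cls, (QuotientAddGroup.eq_zero_iff D).2 h, TensorProduct.tmul_zero]

theorem cls_sum_zsmul {ι : Type*} (s : Finset ι) (c : ι → ℤ) (D : ι → Divisor S) :
    cls K (∑ j ∈ s, c j • D j) = ∑ j ∈ s, (c j : ℝ) • cls K (D j) := by
  classical
  induction s using Finset.induction_on with
  | empty => simp only [Finset.sum_empty]; exact cls_eq_zero (zero_mem _)
  | insert j s hj ih =>
    rw [Finset.sum_insert hj, Finset.sum_insert hj, cls_add, ih, cls_zsmul]

end Cls

theorem IsDivisorOf.cls_eq_zero {g : FunField K} {D : Divisor (surface2 K)}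
    (h : IsDivisorOf g D) : cls K D = 0 :=
  BirSurf.cls_eq_zero (h.mem_numTrivial isSurface_surface2.toIsModel)

theorem cls_specialDiv (n : ℤ) (b : Fin 3 → ℤ) (e : Fin 3 → Fin 4 → ℤ) :
    cls K (specialDiv K n b e) = ∑ j, (coords n b e j : ℝ) • geomBasis K j := by
  rw [← sum_coords, cls_sum_zsmul]
  simp only [geomBasis_apply]

/-! ### The basis is geometric -/

theorem center_aff (k : Fin 3) :
    center K (![0, 5, 10] k) = planePoint (x K) (y K - co ((sg k : ℤ) : K)) := by
  fin_cases k <;> simp [center, sg, sub_eq_add_neg]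

theorem center_inf (i : Fin 4) :
    center K (![1, 2, 3, 4] i) = planePoint (xi ((mu i : ℤ) : K)) (1 / x K) := by
  simp only [center, xi, map_intCast]
  fin_cases i <;> simp [mu]

theorem center_over {k : Fin 3} (hk : k ≠ 0) (i : Fin 4) :
    center K (![![0, 0, 0, 0], ![6, 7, 8, 9], ![11, 12, 13, 14]] k i) =
      planePoint (xi ((mu i : ℤ) : K)) (tt ((mu i : ℤ) : K) - co (2 * ((sg k : ℤ) : K))) := by
  simp only [center, xi, tt, map_intCast, map_mul, co_two]
  fin_cases k
  · exact absurd rfl hk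
  all_goals fin_cases i <;> simp [mu, sg, sub_eq_add_neg]

theorem isExceptionalCurve_aff (k : Fin 3) :
    IsExceptionalCurve (![0, 5, 10] k) (eaff K k) := by
  have h := isAff_eaff (K := K) k
  refine ⟨?_, fun _ => IsDiv.exists_curve (gen_isAff _) h 0 (Or.inr ⟨_, aff_mem_centersR k,
    (isOver_iff (gen_affine _)).2 (Or.inl ⟨0, rfl⟩)⟩)⟩
  rw [center_aff]
  exact planePoint_le h.left (IsAff.hasVal_y h).sub_const

theorem isExceptionalCurve_inf (i : Fin 4) :
    IsExceptionalCurve (![1, 2, 3, 4] i) (ept K 0 i) := by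
  have h := isEm_iff.1 (isEm_ept (K := K) i)
  refine ⟨?_, fun _ => IsDiv.exists_curve (gen_inf _) h 0 (Or.inr ⟨_, inf_mem_centersR i,
    (isOver_iff (gen_infinity _)).2 (Or.inl ⟨0, rfl⟩)⟩)⟩
  rw [center_inf]
  exact planePoint_le h.left (isEm_ept i).left

/-- Such a point dominates a point at infinity of the plane. Were it itself a point of the plane,
the two would coincide, and `tt` would have a value on an exceptional curve where it is a
coordinate. -/
theorem center_over_not_mem {k : Fin 3} (i : Fin 4) :
    planePoint (xi ((mu i : ℤ) : K)) (tt ((mu i : ℤ) : K) - co (2 * ((sg k : ℤ) : K))) ∉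
      centersR K := by
  intro hR
  have hg := gen_infinity ((mu i : ℤ) : K)
  have hle : planePoint (xi ((mu i : ℤ) : K)) (1 / x K) ≤ _ :=
    le_of_stdOver hg (Or.inl ⟨2 * ((sg k : ℤ) : K), rfl⟩)
  have he := isModel_plane.sep _ (infinity_mem_plane _) _ (centersR_subset hR) _ hle le_rfl
  have h := isEm_iff.1 (isEm_ept (K := K) i)
  have hv := (gen_inf_sub ((mu i : ℤ) : K) (2 * ((sg k : ℤ) : K))).hasVal_right.of_sub_const
  have hle' : planePoint (xi ((mu i : ℤ) : K)) (1 / x K) ≤ (ept K 0 i).ring.toLocalSubring :=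
    planePoint_le h.left (isEm_ept i).left
  rw [he] at hle'
  exact h.right.not_hasVal _ (hv.mono hle')

theorem isExceptionalCurve_over {k : Fin 3} (hk : k ≠ 0) (i : Fin 4) :
    IsExceptionalCurve (![![0, 0, 0, 0], ![6, 7, 8, 9], ![11, 12, 13, 14]] k i) (ept K k i) := by
  have h := isEd_ept (K := K) hk i
  refine ⟨?_, fun hR => ?_⟩
  · rw [center_over hk]
    exact planePoint_le ((isEd_iff (cast_sq hk)).1 h).left (IsEd.hasVal_tt (cast_sq hk) h).sub_const
  · rw [center_over hk] at hR
    exact (center_over_not_mem i hR).elim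

theorem isExceptionalCurve_excCurve (j : Fin 15) : IsExceptionalCurve j (excCurve K j) := by
  fin_cases j
  · exact isExceptionalCurve_aff 0
  · exact isExceptionalCurve_inf 0
  · exact isExceptionalCurve_inf 1
  · exact isExceptionalCurve_inf 2
  · exact isExceptionalCurve_inf 3
  · exact isExceptionalCurve_aff 1
  · exact isExceptionalCurve_over (k := 1) (by decide) 0
  · exact isExceptionalCurve_over (k := 1) (by decide) 1
  · exact isExceptionalCurve_over (k := 1) (by decide) 2
  · exact isExceptionalCurve_over (k := 1) (by decide) 3
  · exact isExceptionalCurve_aff 2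
  · exact isExceptionalCurve_over (k := 2) (by decide) 0
  · exact isExceptionalCurve_over (k := 2) (by decide) 1
  · exact isExceptionalCurve_over (k := 2) (by decide) 2
  · exact isExceptionalCurve_over (k := 2) (by decide) 3

variable (K) in
-- The admissible lines are affine, so x = 0 is used. Its local equation is x at affine points and 1
-- at the points at infinity needed here. The pull-back is therefore the divisor of x with its polar
-- part removed, hence equivalent to the total transform of the line at infinity.
theorem exists_line_pullback : ∃ (L : Curve (plane K)) (H : Divisor (surface2 K)), IsLine L ∧
    IsPullback (BirMap.id K) (Finsupp.single L 1) H ∧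
    cls K H = cls K (specialDiv K 1 0 1) := by
  classical
  have h₀ := exists_isDiv (gen_xy (K := K))
  set V := primeVal (gen_xy (K := K)).fracHom (prime_X (K := K) 0)
  have hl : Loc V (x K) (y K) := IsDiv.loc h₀ gen_xy
  obtain ⟨L, hL⟩ : ∃ L : Curve (plane K), L.ring = V :=
    IsDiv.exists_curve gen_xy h₀ 0 (affine_mem_plane' 0)
  obtain ⟨C₀, hC₀⟩ := hl.exists_surface_curve
  have hL' : IsV0 L.ring := hL ▸ h₀
  have hC₀' : IsV0 C₀.ring := hC₀ ▸ h₀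
  have hx := isDivisorOf_x hC₀'
  set Dx := Finsupp.single C₀ 1 + specialDiv K (-1) 1 (-1) with hDx
  refine ⟨L, Dx + specialDiv K 1 0 1, ⟨1, 0, 0, Or.inl one_ne_zero, ?_⟩, fun C => ?_, ?_⟩
  · rw [map_one, map_zero, one_mul, zero_mul, add_zero, add_zero, ord_pos_iff x_ne_zero]
    exact hL'.left.inMax
  · have haff : ∀ a b : K, IsLocalEquation (Finsupp.single L 1)
        (planePoint (x K - co a) (y K - co b)) (x K) := fun a b => by
      refine ⟨x_ne_zero, fun C hC => ?_⟩
      have hv := ((gen_xy (K := K)).sub_const a b).hasVal_left.of_sub_const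
      rcases Curve.plane_cases C with h | h
      · by_cases hm : InMax C.ring.toLocalSubring (x K)
        · obtain rfl : C = L := Curve.ext ((h.isDiv_of_inMax hm).unique gen_xy hL')
          rw [Finsupp.single_eq_same, IsDiv.ord_left gen_xy hL']
        · rw [ord_eq_zero h.left hm, Finsupp.single_eq_of_ne]
          rintro rfl
          exact hm hL'.left.inMax
      · have := h.left.zero_mul_mem (hC hv.mem)
        rw [one_div, inv_mul_cancel₀ x_ne_zero] at this
        exact (not_inMax_one this.inMax).elim
    have hinf : ∀ c : K, IsLocalEquation (Finsupp.single L 1)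
        (planePoint (xi c) (1 / x K)) 1 := fun c => by
      refine ⟨one_ne_zero, fun C hC => ?_⟩
      rw [ord_one, Finsupp.single_eq_of_ne]
      rintro rfl
      have := hL'.left.zero_mul_mem (hC (gen_infinity c).hasVal_right.mem)
      rw [one_div, mul_inv_cancel₀ x_ne_zero] at this
      exact not_inMax_one this.inMax
    have hDC : (Dx + specialDiv K 1 0 1) C = ord C.ring (x K) + specialDiv K 1 0 1 C := by
      rw [Finsupp.add_apply, hx.2 C]
    have h1x : ord C.ring (1 / x K) = 1 → ord C.ring (x K) = -1 := by
      intro h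
      rw [one_div, ord_inv] at h
      omega
    rw [hDC]
    rcases Curve.special_cases C with h | rfl | ⟨k, rfl⟩ | ⟨k, i, rfl⟩
    · obtain ⟨a, b, hab, -⟩ := h.exists_onCentre (Q := 1) (by rw [map_one]; exact not_inMax_one)
      refine ⟨_, affine_mem_plane a b, fun g hg => h.planePoint_le hab hg, _, haff a b, ?_⟩
      rw [specialDiv_loc h, add_zero]
      rfl
    · refine ⟨_, infinity_mem_plane 0, fun g hg => ?_, _, hinf 0, ?_⟩
      · rw [planePoint_swap (gen_infinity 0)] at hg
        exact isInf_linf.planePoint_le gen_isInf 0 hg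
      · rw [specialDiv_linf, map_one, ord_one, h1x (isInf_linf.ord_left gen_isInf)]
        rfl
    · have h := isAff_eaff (K := K) k
      refine ⟨_, affine_mem_plane' ((sg k : ℤ) : K),
        (planePoint_le h.left (IsAff.hasVal_y h).sub_const).1, x K, ?_, ?_⟩
      · have := haff 0 ((sg k : ℤ) : K)
        rwa [co, map_zero, sub_zero] at this
      · rw [specialDiv_eaff]
        exact (add_zero _).symm
    · have h := isPt_ept (K := K) k i
      refine ⟨_, infinity_mem_plane ((mu i : ℤ) : K),
        (planePoint_le h.hasVal_ratio.sub_const h.left).1, _, hinf _, ?_⟩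
      rw [specialDiv_ept, map_one, ord_one, h1x h.ord_left]
      rfl
  · rw [cls_add, hx.cls_eq_zero, zero_add]

variable (K) in
theorem isGeometricBasis_geomBasis : IsGeometricBasis (geomBasis K) := by
  obtain ⟨L, H, hL, hH, h⟩ := exists_line_pullback K
  refine ⟨⟨L, H, hL, hH, ?_⟩, fun i => ⟨_, isExceptionalCurve_excCurve i, ?_⟩⟩
  · rw [geomBasis_apply, h]
    rfl
  · rw [geomBasis_apply]
    rfl

end Basis

end BirSurf

namespace BirSurf

open FunField

set_option linter.unusedSectionVars false

/-! ## Shears -/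

section ShearFunctions

variable {K : Type*} [Field K] {O : LocalSubring (FunField K)} {m q : FunField K} {μ α β d ε c : K}

/-- The rational function by which the shears displace the first coordinate. -/
noncomputable def disp (m : FunField K) : FunField K :=
  2 * m * (5 - m ^ 2) / ((1 - m ^ 2) * (9 - m ^ 2))

/-- The quotient of m⁴ - 10m² + 9 by m - μ when μ is one of its roots. -/
noncomputable def dispDen (μ : K) (m : FunField K) : FunField K :=
  m ^ 3 + co μ * m ^ 2 + (co μ ^ 2 - 10) * m + (co μ ^ 3 - 10 * co μ)

/-- The product of `disp m` with `m - μ`. -/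
noncomputable def dispNum (μ : K) (m : FunField K) : FunField K :=
  2 * m * (5 - m ^ 2) / dispDen μ m

/-- The difference quotient of `dispNum μ` at `μ`. -/
noncomputable def dispQuot (μ : K) (m : FunField K) : FunField K :=
  (10 - co μ ^ 2 - 2 * co μ * m - 3 * m ^ 2) / (2 * dispDen μ m)

/-- `disp` in the coordinate q = 1/m at the vertical direction, with its simple zero divided out. -/
noncomputable def dispInv (q : FunField K) : FunField K :=
  2 * (5 * q ^ 2 - 1) / ((q ^ 2 - 1) * (9 * q ^ 2 - 1))

/-- The remainder in `dispInv q` = -2 + q² `dispInv' q`; the absence of a linear term comes from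
`disp` being odd. -/
noncomputable def dispInv' (q : FunField K) : FunField K :=
  (18 * q ^ 2 - 10) / ((q ^ 2 - 1) * (9 * q ^ 2 - 1))

theorem disp_eq (hμ : μ ^ 4 - 10 * μ ^ 2 + 9 = 0) : disp m = dispNum μ m / (m - co μ) := by
  have hμ' : co μ ^ 4 - 10 * co μ ^ 2 + 9 = 0 := by
    have := congrArg (algebraMap K (FunField K)) hμ
    simpa only [map_add, map_sub, map_mul, map_pow, map_ofNat, map_zero] using this
  rw [disp, dispNum, div_div]
  congr 1
  rw [dispDen]
  linear_combination hμ'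

theorem disp_inv (h1 : q ^ 2 - 1 ≠ 0) (h9 : 9 * q ^ 2 - 1 ≠ 0) (hq : q ≠ 0) :
    disp q⁻¹ = q * dispInv q := by
  have e1 : 1 - q⁻¹ ^ 2 = (q ^ 2 - 1) / q ^ 2 := by field_simp
  have e2 : 9 - q⁻¹ ^ 2 = (9 * q ^ 2 - 1) / q ^ 2 := by field_simp
  have e3 : 5 - q⁻¹ ^ 2 = (5 * q ^ 2 - 1) / q ^ 2 := by field_simp
  rw [disp, dispInv, e1, e2, e3]
  field_simp

theorem inv_mul_dispInv (h1 : q ^ 2 - 1 ≠ 0) (h9 : 9 * q ^ 2 - 1 ≠ 0) :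
    dispInv q = -2 + q ^ 2 * dispInv' q := by
  have h0 := mul_ne_zero h1 h9
  rw [dispInv, dispInv', div_eq_iff h0, add_mul, mul_assoc (q ^ 2), div_mul_cancel₀ _ h0]
  ring

/-! ### Expansion of the displacement at its four poles. -/

section Values

variable (hm : HasVal O m μ)
include hm

theorem hasVal_dispDen : HasVal O (dispDen μ m) (4 * μ ^ 3 - 20 * μ) :=
  have k := HasVal.const (F := FunField K) hm.1 μ
  have t := HasVal.ofNat (F := FunField K) hm.1 10
  ((((hm.pow 3).add (k.mul (hm.pow 2))).add (((k.pow 2).sub t).mul hm)).add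
    ((k.pow 3).sub (t.mul k))).congr rfl (by ring)

variable [CharZero K] (hμ : μ ^ 4 - 10 * μ ^ 2 + 9 = 0)
include hμ

omit hm in
theorem deriv_ne_zero : 4 * μ ^ 3 - 20 * μ ≠ 0 := by
  intro h
  have h1 : μ * (μ ^ 2 - 5) = 0 := by linear_combination (1 / 4 : K) * h
  rcases mul_eq_zero.1 h1 with h0 | h5
  · rw [h0] at hμ; norm_num at hμ
  -- μ⁴ - 10μ² + 9 = (μ² - 5)² - 16, so a multiple root other than 0 would force 16 = 0.
  · have : (16 : K) = 0 := by linear_combination -hμ + (μ ^ 2 - 5) * h5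
    norm_num at this

/-- The residue 2μ(5 - μ²)/(4μ³ - 20μ) is the same at all four poles. The numerator of `disp` is
chosen for this, and it fixes the blown-up directions s = ±1/2. -/
theorem hasVal_dispNum : HasVal O (dispNum μ m) (-1 / 2 : K) := by
  have h0 := deriv_ne_zero hμ
  refine ((((HasVal.ofNat hm.1 2).mul hm).mul ((HasVal.ofNat hm.1 5).sub (hm.pow 2))).div
    (hasVal_dispDen hm) h0).congr rfl ?_
  rw [div_eq_div_iff h0 two_ne_zero]
  ring

theorem hasVal_dispQuot : ∃ c : K, HasVal O (dispQuot μ m) c := by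
  have k := HasVal.const (F := FunField K) hm.1 μ
  exact ⟨_, ((((HasVal.ofNat hm.1 10).sub (k.pow 2)).sub (((HasVal.ofNat hm.1 2).mul k).mul hm)).sub
    ((HasVal.ofNat hm.1 3).mul (hm.pow 2))).div ((HasVal.ofNat hm.1 2).mul (hasVal_dispDen hm))
    (mul_ne_zero two_ne_zero (deriv_ne_zero hμ))⟩

theorem dispNum_eq : dispNum μ m = -1 / 2 + (m - co μ) * dispQuot μ m := by
  have h0 := (hasVal_dispDen hm).ne_zero (deriv_ne_zero hμ)
  have h2 : (2 : FunField K) ≠ 0 := by rw [← co_two]; exact co_ne_zero two_ne_zero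
  rw [dispNum, dispQuot]
  have e : dispDen μ m = m ^ 3 + co μ * m ^ 2 + (co μ ^ 2 - 10) * m + (co μ ^ 3 - 10 * co μ) := rfl
  generalize dispDen μ m = D at *
  field_simp
  rw [e]
  ring

end Values

/-! ### Expansion of the displacement at the vertical direction. -/

section Infinity

variable (hq : HasVal O q (0 : K))
include hq

theorem hasVal_sq_sub_one : HasVal O (q ^ 2 - 1) (-1 : K) :=
  ((hq.pow 2).sub (HasVal.one hq.1)).congr rfl (by ring)

theorem hasVal_nine_sq_sub_one : HasVal O (9 * q ^ 2 - 1) (-1 : K) :=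
  (((HasVal.ofNat hq.1 9).mul (hq.pow 2)).sub (HasVal.one hq.1)).congr rfl (by ring)

theorem hasVal_dispInv : HasVal O (dispInv q) (-2 : K) :=
  (((HasVal.ofNat hq.1 2).mul (((HasVal.ofNat hq.1 5).mul (hq.pow 2)).sub (HasVal.one hq.1))).div
    ((hasVal_sq_sub_one hq).mul (hasVal_nine_sq_sub_one hq)) (by norm_num)).congr rfl (by norm_num)

theorem hasVal_dispInv' : HasVal O (dispInv' q) (-10 : K) :=
  ((((HasVal.ofNat hq.1 18).mul (hq.pow 2)).sub (HasVal.ofNat hq.1 10)).div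
    ((hasVal_sq_sub_one hq).mul (hasVal_nine_sq_sub_one hq)) (by norm_num)).congr rfl (by norm_num)

theorem disp_of_inv (hq0 : q ≠ 0) : disp q⁻¹ = q * dispInv q :=
  disp_inv ((hasVal_sq_sub_one hq).ne_zero (by norm_num))
    ((hasVal_nine_sq_sub_one hq).ne_zero (by norm_num)) hq0

theorem dispInv_eq : dispInv q = -2 + q ^ 2 * dispInv' q :=
  inv_mul_dispInv ((hasVal_sq_sub_one hq).ne_zero (by norm_num))
    ((hasVal_nine_sq_sub_one hq).ne_zero (by norm_num))

end Infinity

/-- The slope of the line through `(0, α)`. -/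
noncomputable abbrev slope (α : K) : FunField K := (y K - co α) / x K

theorem slope_sub (μ α : K) : slope α - co μ = (sl μ - co α) / x K := by
  have hx := x_ne_zero (K := K)
  simp only [slope, sl]
  field_simp
  ring

/-- `f` maps the line of slope `m` through `(0, α)` to the line of slope `m` through `(0, β)`. -/
structure IsShear (f : BirMap K) (α β : K) : Prop where
  map_x : f.comorphism (x K) = x K + co (β - α) * disp (slope α)
  map_y : f.comorphism (y K) = co β + slope α * f.comorphism (x K)

namespace IsShear

variable {f : BirMap K} (h : IsShear f α β)
include h

theorem map_x_ne_zero : f.comorphism (x K) ≠ 0 := by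
  simpa using x_ne_zero (K := K)

theorem map_slope : f.comorphism (slope β) = slope α := by
  have := h.map_x_ne_zero
  rw [map_div₀, map_sub, AlgEquiv.commutes, h.map_y]
  field_simp
  ring

/-! ### A shear near a point at infinity. -/

section AtSlope

variable (hμ : μ ^ 4 - 10 * μ ^ 2 + 9 = 0)
include hμ

theorem map_x_sl : f.comorphism (x K) =
    x K * (sl μ - co α + co (β - α) * dispNum μ (slope α)) / (sl μ - co α) := by
  have hx := x_ne_zero (K := K)
  have hA : sl μ - co α ≠ 0 := (gen_line_affine μ α).left_ne_zero
  rw [h.map_x, disp_eq hμ, slope_sub]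
  generalize sl μ - co α = A at *
  field_simp

theorem map_inv_x : f.comorphism (1 / x K) =
    1 / x K * ((sl μ - co α) / (sl μ - co α + co (β - α) * dispNum μ (slope α))) := by
  rw [map_div₀, map_one, h.map_x_sl hμ, one_div_div, div_mul_div_comm, one_mul]

/-- Since `dispNum` has the value -1/2 where the slope is μ, this is the translation of s by (β -
α)/2 along the exceptional curve. -/
theorem map_sl : f.comorphism (sl μ) = sl μ + co (β - α) * (1 + dispNum μ (slope α)) := by
  have hx := x_ne_zero (K := K)
  have hA : sl μ - co α ≠ 0 := (gen_line_affine μ α).left_ne_zero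
  have h1 : f.comorphism (sl μ) = co β + (slope α - co μ) * f.comorphism (x K) := by
    rw [map_sub, map_mul, AlgEquiv.commutes, h.map_y]
    ring
  have e : co (β - α) = co β - co α := map_sub _ _ _
  rw [h1, h.map_x_sl hμ, slope_sub, e]
  generalize sl μ = s at *
  generalize dispNum μ (slope α) = N at *
  field_simp
  ring

theorem map_sl_sub : f.comorphism (sl μ) - co β =
    sl μ - co α + co (β - α) * dispNum μ (slope α) := by
  have e : co (β - α) = co β - co α := map_sub _ _ _
  rw [h.map_sl hμ, e]
  ring

/-- The image of `sl μ` near the point at infinity of slope `μ`. -/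
theorem map_sl_sub_half [CharZero K] (hm : HasVal O (slope α) μ) :
    f.comorphism (sl μ) - co ((α + β) / 2) = (sl μ - co α) *
      (1 + co (β - α) * (1 / x K) * dispQuot μ (slope α)) := by
  have e : co (β - α) = co β - co α := map_sub _ _ _
  have e' : co ((α + β) / 2) = (co α + co β) / 2 := by rw [co, map_div₀, map_add, map_ofNat]
  have h2 : (2 : FunField K) ≠ 0 := by rw [← co_two]; exact co_ne_zero two_ne_zero
  rw [h.map_sl hμ, dispNum_eq hm hμ, slope_sub, e, e']
  field_simp
  ring

end AtSlope

/-! ### A shear near the line x = 0. -/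

section AtVertical

variable (hq : HasVal O (x K / (y K - co α)) (0 : K))
include hq

theorem map_x_vertical : f.comorphism (x K) = x K * (1 + co (β - α) *
    dispInv (x K / (y K - co α)) / (y K - co α)) := by
  have hg := gen_affine α
  have hx := hg.left_ne_zero
  have hy := hg.right_ne_zero
  rw [h.map_x, slope, ← inv_div, disp_of_inv hq (div_ne_zero hx hy)]
  ring

/-- The leading term -2 of `dispInv` turns the expected translation by β - α into one by -(β - α),
with an error of second order in x/(y - α). -/
theorem map_y_vertical : f.comorphism (y K) = y K - co (β - α) + co (β - α) *
    ((x K / (y K - co α)) ^ 2 * dispInv' (x K / (y K - co α))) := by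
  have hg := gen_affine α
  have hx := hg.left_ne_zero
  have hy := hg.right_ne_zero
  have e : co (β - α) = co β - co α := map_sub _ _ _
  have h1 : slope α * (x K * (1 + co (β - α) *
      dispInv (x K / (y K - co α)) / (y K - co α))) =
      y K - co α + co (β - α) * dispInv (x K / (y K - co α)) := by
    rw [slope]
    field_simp
  rw [h.map_y, h.map_x_vertical hq, h1, dispInv_eq hq, e]
  ring

theorem map_inv_slope : f.comorphism (x K / (y K - co β)) = x K / (y K - co α) := by
  rw [← inv_div, map_inv₀, h.map_slope, slope, inv_div]

end AtVertical

end IsShear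

end ShearFunctions

end BirSurf

namespace BirSurf

open FunField

set_option linter.unusedSectionVars false

/-! ## The action of a shear on points and curves -/

section ShearAction

variable {K : Type*} [Field K] [CharZero K] {O : LocalSubring (FunField K)}
  {V : ValuationSubring (FunField K)} {f : BirMap K} {μ α β : K}

theorem hasVal_slope_of_sl (hz : HasVal O (1 / x K) (0 : K)) (hs : sl μ ∈ O.toSubring) (α : K) :
    HasVal O (slope α) μ := by
  have h1 := (hz.zero_mul_mem (O.toSubring.sub_mem hs (hz.1 α))).add (HasVal.const hz.1 μ)
  refine h1.congr ?_ (zero_add _)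
  linear_combination -slope_sub μ α

theorem disp_mem {m : FunField K} (hm : m ∈ V) (hi : ∀ i, (m - co ((mu i : ℤ) : K))⁻¹ ∈ V) :
    disp m ∈ V := by
  have e : disp m = 2 * m * (5 - m ^ 2) *
      ((m - 1)⁻¹ * (m + 1)⁻¹ * ((m - 3)⁻¹ * (m + 3)⁻¹)) := by
    rw [disp, div_eq_mul_inv, ← mul_inv, ← mul_inv, ← mul_inv]
    congr 2
    ring
  have h1 : (m - 1)⁻¹ ∈ V := by simpa [mu] using hi 0
  have h2 : (m + 1)⁻¹ ∈ V := by simpa [mu] using hi 1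
  have e3 : algebraMap K (FunField K) 3 = 3 := map_ofNat _ 3
  have h3 : (m - 3)⁻¹ ∈ V := by simpa [mu, e3] using hi 2
  have h4 : (m + 3)⁻¹ ∈ V := by simpa [mu, e3] using hi 3
  rw [e]
  exact V.mul_mem _ _ (V.mul_mem _ _ (V.mul_mem _ _ (natCast_mem V.toSubring 2) hm)
    (V.sub_mem (natCast_mem V.toSubring 5) (V.toSubring.pow_mem hm 2)))
    (V.mul_mem _ _ (V.mul_mem _ _ h1 h2) (V.mul_mem _ _ h3 h4))

/-- One of α, β is 0 and the other is ±1. All nonvanishing conditions on values met below are of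
this shape. -/
theorem lin_ne_zero (h0 : α * β = 0) (h1 : (α + β) ^ 2 = 1) {p q : K} (hp : p ≠ 0) (hq : q ≠ 0) :
    p * α + q * β ≠ 0 := by
  rcases mul_eq_zero.1 h0 with rfl | rfl
  · rw [mul_zero, zero_add]
    refine mul_ne_zero hq ?_
    rintro rfl
    norm_num at h1
  · rw [mul_zero, add_zero]
    refine mul_ne_zero hp ?_
    rintro rfl
    norm_num at h1

namespace IsShear

variable (h : IsShear f α β)
include h

/-! ### Images of points on the exceptional curves at infinity. -/

section Slope

variable (hμ : μ ^ 4 - 10 * μ ^ 2 + 9 = 0) {c : K}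
include hμ

theorem hasVal_map_sl_sub (hm : HasVal O (slope α) μ) (hs : HasVal O (sl μ) c) :
    HasVal O (sl μ - co α + co (β - α) * dispNum μ (slope α)) (c - (α + β) / 2) :=
  ((hs.sub (HasVal.const hm.1 α)).add ((HasVal.const hm.1 (β - α)).mul
    (hasVal_dispNum hm hμ))).congr rfl (by ring)

theorem hasVal_map_sl (hm : HasVal O (slope α) μ) (hs : HasVal O (sl μ) c) :
    HasVal O (f.comorphism (sl μ)) (c + (β - α) / 2) := by
  rw [h.map_sl hμ]
  exact (hs.add ((HasVal.const hm.1 (β - α)).mul ((HasVal.one hm.1).add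
    (hasVal_dispNum hm hμ)))).congr rfl (by ring)

theorem hasVal_map_inv_x (hz : HasVal O (1 / x K) (0 : K)) (hs : HasVal O (sl μ) c)
    (hc : c ≠ (α + β) / 2) : HasVal O (f.comorphism (1 / x K)) (0 : K) := by
  have hm := hasVal_slope_of_sl hz hs.mem α
  rw [h.map_inv_x hμ]
  exact hz.zero_mul_mem ((hs.sub (HasVal.const hz.1 α)).div
    (h.hasVal_map_sl_sub hμ hm hs) (sub_ne_zero.2 hc)).mem

theorem mapsPoint_line (hz : HasVal O (1 / x K) (0 : K)) (hs : HasVal O (sl μ) c)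
    (hc : c ≠ (α + β) / 2) :
    MapsPoint f O (planePoint (1 / x K) (sl μ - co (c + (β - α) / 2))) := by
  refine mapsPoint_planePoint (h.hasVal_map_inv_x hμ hz hs hc) ?_
  rw [map_sub, AlgEquiv.commutes]
  exact (h.hasVal_map_sl hμ (hasVal_slope_of_sl hz hs.mem α) hs).sub_const

/-- The point s = α goes to s = (α + β)/2, a blown-up direction, so the image must be lifted once
more. Both 1/x and s - (α + β)/2 pull back to multiples of s - α; the factor cancels in the quotient
and leaves 1/x times a unit. So the image is the corner with the first exceptional curve. -/
theorem mapsPoint_corner (h0 : α * β = 0) (h1 : (α + β) ^ 2 = 1)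
    (hz : HasVal O (1 / x K) (0 : K)) (hs : HasVal O (sl μ) α) :
    MapsPoint f O (planePoint (tt μ - co (2 * (α + β)))
      (xi μ / (tt μ - co (2 * (α + β))))) := by
  have hm := hasVal_slope_of_sl hz hs.mem α
  obtain ⟨c, hQ⟩ := hasVal_dispQuot hm hμ
  have hε : (α + β) / 2 ≠ 0 := half_ne_zero h1
  have hd : α - (α + β) / 2 ≠ 0 := fun h2 => lin_ne_zero h0 h1 (p := 1 / 2) (q := -1 / 2)
    (by norm_num) (by norm_num) (by linear_combination h2)
  have hS : HasVal O (f.comorphism (sl μ)) ((α + β) / 2) :=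
    (h.hasVal_map_sl hμ hm hs).congr rfl (by ring)
  have hT : HasVal O (f.comorphism (tt μ)) (2 * (α + β)) := by
    rw [tt_eq, map_inv₀, ← half_inv h1]
    exact hS.inv hε
  have hB := h.hasVal_map_sl_sub hμ hm hs
  have hE : HasVal O (1 + co (β - α) * (1 / x K) * dispQuot μ (slope α)) (1 : K) :=
    ((HasVal.one hz.1).add (((HasVal.const hz.1 (β - α)).mul hz).mul hQ)).congr rfl (by ring)
  refine mapsPoint_planePoint ?_ ?_
  · rw [map_sub, AlgEquiv.commutes]
    exact hT.sub_const
  · have hx := x_ne_zero (K := K)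
    have hA : sl μ - co α ≠ 0 := (gen_line_affine μ α).left_ne_zero
    have hε0 := hε
    have key := h.map_sl_sub_half hμ hm
    have hS0 := hS.ne_zero hε
    have hB0 := hB.ne_zero hd
    have hE0 := hE.ne_zero one_ne_zero
    have h2 : (2 : FunField K) ≠ 0 := by rw [← co_two]; exact co_ne_zero two_ne_zero
    have hsq : co (α + β) ^ 2 = (1 : FunField K) := by rw [← map_pow, h1, map_one]
    have hco0 : co (α + β) ≠ (0 : FunField K) := fun h3 => by rw [h3] at hsq; norm_num at hsq
    have e2 : co (2 * (α + β)) = 2 * co (α + β) := by rw [co, map_mul, map_ofNat]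
    have e3 : co ((α + β) / 2) = co (α + β) / 2 := by rw [co, map_div₀, map_ofNat]
    have hinv : (f.comorphism (sl μ))⁻¹ - co (2 * (α + β)) = -2 * co (α + β) *
        (f.comorphism (sl μ) - co ((α + β) / 2)) / f.comorphism (sl μ) := by
      rw [e2, e3]
      field_simp
      linear_combination -hsq
    have e4 : f.comorphism (tt μ - co (2 * (α + β))) =
        (f.comorphism (sl μ))⁻¹ - co (2 * (α + β)) := by
      rw [map_sub f.comorphism (tt μ), AlgEquiv.commutes, tt_eq, map_inv₀]
    have e : f.comorphism (xi μ / (tt μ - co (2 * (α + β)))) = (1 / x K) *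
        (f.comorphism (sl μ) ^ 2 / (-2 * co (α + β) *
          ((sl μ - co α + co (β - α) * dispNum μ (slope α)) *
            (1 + co (β - α) * (1 / x K) * dispQuot μ (slope α))))) := by
      rw [map_div₀, xi_eq, map_mul, h.map_inv_x hμ, e4, hinv, key]
      generalize 1 + co (β - α) * (1 / x K) * dispQuot μ (slope α) = E at *
      generalize sl μ - co α + co (β - α) * dispNum μ (slope α) = B at *
      generalize sl μ - co α = A at *
      field_simp
    rw [e]
    refine hz.zero_mul_mem ((hS.pow 2).div ((((HasVal.ofNat hz.1 2).neg).mul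
      (HasVal.const hz.1 (α + β))).mul (hB.mul hE)) ?_).mem
    refine mul_ne_zero (mul_ne_zero (neg_ne_zero.2 two_ne_zero) ?_) (mul_ne_zero hd one_ne_zero)
    intro h3
    apply hε
    rw [h3, zero_div]

end Slope

/-! ### Images of points over the line x = 0. -/

section Vertical

variable (h0 : α * β = 0) (h1 : (α + β) ^ 2 = 1)
include h0 h1

/-- The translation by -(β - α) takes height β to height α. The error term is divisible by y - β,
since x is (y - β) times the direction coordinate, so the vertical direction is kept. -/
theorem mapsPoint_base (hy : HasVal O (y K - co β) (0 : K))
    (hr : HasVal O (x K / (y K - co β)) (0 : K)) :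
    MapsPoint f O (planePoint (y K - co α) (x K / (y K - co α))) := by
  have hg := gen_affine β
  have hd : β - α ≠ 0 := fun h2 => lin_ne_zero h0 h1 (p := -1) (q := 1)
    (by norm_num) (by norm_num) (by linear_combination h2)
  have hyα : HasVal O (y K - co α) (β - α) :=
    (hy.add (HasVal.const hy.1 (β - α))).congr (by rw [map_sub]; ring) (by ring)
  have hx : HasVal O (x K) (0 : K) :=
    (hy.zero_mul_mem hr.mem).congr (mul_div_cancel₀ _ hg.right_ne_zero) rfl
  have hq : HasVal O (x K / (y K - co α)) (0 : K) := (hx.div hyα hd).congr rfl (zero_div _)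
  have hU := hasVal_dispInv' hq
  have hF : HasVal O (1 + x K / (y K - co β) * (co (β - α) * x K / (y K - co α) ^ 2 *
      dispInv' (x K / (y K - co α)))) (1 : K) :=
    ((HasVal.one hy.1).add (hr.zero_mul_mem (((((HasVal.const hy.1 (β - α)).mul hx).div
      (hyα.pow 2) (pow_ne_zero 2 hd)).mul hU).mem))).congr rfl (by ring)
  have hy0 := hg.right_ne_zero
  have hyα0 := hyα.ne_zero hd
  have ey : f.comorphism (y K) - co α = (y K - co β) *
      (1 + x K / (y K - co β) * (co (β - α) * x K / (y K - co α) ^ 2 *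
      dispInv' (x K / (y K - co α)))) := by
    have e : co (β - α) = co β - co α := map_sub _ _ _
    rw [h.map_y_vertical hq]
    generalize dispInv' (x K / (y K - co α)) = U
    field_simp
    rw [e]
    ring
  refine mapsPoint_planePoint ?_ ?_
  · rw [map_sub, AlgEquiv.commutes, ey]
    exact hy.zero_mul_mem hF.mem
  · rw [map_div₀, map_sub, AlgEquiv.commutes, ey, h.map_x_vertical hq, mul_div_mul_comm]
    exact hr.zero_mul_mem (((HasVal.one hy.1).add (((HasVal.const hy.1 (β - α)).mul
      (hasVal_dispInv hq)).div hyα hd)).div hF one_ne_zero).mem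

theorem mapsPoint_vertical (hx : HasVal O (x K) (0 : K)) (hy : HasVal O (y K) (-(α + β))) :
    HasVal O (x K / (y K - co α)) (0 : K) ∧ HasVal O (f.comorphism (x K)) (0 : K) ∧
      HasVal O (f.comorphism (y K)) (-2 * β) := by
  have hyα := hy.sub (HasVal.const hx.1 α)
  have hd : -(α + β) - α ≠ 0 := fun h2 => lin_ne_zero h0 h1 (p := -2) (q := -1)
    (by norm_num) (by norm_num) (by linear_combination h2)
  have hq : HasVal O (x K / (y K - co α)) (0 : K) := (hx.div hyα hd).congr rfl (zero_div _)
  refine ⟨hq, ?_, ?_⟩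
  · rw [h.map_x_vertical hq]
    exact hx.zero_mul_mem ((HasVal.one hx.1).add (((HasVal.const hx.1 (β - α)).mul
      (hasVal_dispInv hq)).div hyα hd)).mem
  · rw [h.map_y_vertical hq]
    exact ((hy.sub (HasVal.const hx.1 (β - α))).add ((HasVal.const hx.1 (β - α)).mul
      ((hq.pow 2).mul (hasVal_dispInv' hq)))).congr rfl (by ring)

end Vertical

/-! ### Curves -/

theorem isInf_push (hV : IsInf V) : IsInf (push f V) := by
  have hx := x_ne_zero (K := K)
  have hm : NoVal K V.toLocalSubring (slope α) := by
    have := hV.right.sub ((HasVal.const hV.const α).mul hV.left)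
    have e : y K / x K - co α * (1 / x K) = slope α := by rw [slope]; ring
    rwa [e] at this
  have hR : disp (slope α) ∈ V := disp_mem hm.mem fun i => (hm.sub_const _).inv_mem
  have hD : HasVal V.toLocalSubring (1 + 1 / x K * (co (β - α) * disp (slope α))) (1 : K) :=
    ((HasVal.one hV.const).add (hV.left.zero_mul_mem (V.mul_mem _ _ (hV.const _) hR))).congr rfl
      (add_zero _)
  have hz : HasVal V.toLocalSubring (f.comorphism (1 / x K)) (0 : K) := by
    have hD0 := hD.ne_zero one_ne_zero
    refine (hV.left.div hD one_ne_zero).congr ?_ (zero_div _)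
    rw [map_div₀, map_one, h.map_x, div_div]
    congr 1
    field_simp
  refine ⟨hasVal_push.2 hz, noVal_push.2 ?_⟩
  have hx' := h.map_x_ne_zero
  have e : f.comorphism (y K / x K) = slope α + co β * f.comorphism (1 / x K) := by
    rw [map_div₀, h.map_y, map_div₀, map_one]
    field_simp
    ring
  rw [e]
  exact hm.add ((HasVal.const hV.const β).mul hz)

theorem isV0_push (hV : IsV0 V) : IsV0 (push f V) := by
  have hq : HasVal V.toLocalSubring (x K / (y K - co α)) (0 : K) :=
    hV.left.zero_div_noVal (hV.right.sub_const α)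
  refine ⟨hasVal_push.2 ?_, noVal_push.2 ?_⟩
  · rw [h.map_x_vertical hq]
    refine hV.left.zero_mul_mem (V.add_mem _ _ V.one_mem ?_)
    rw [div_eq_mul_inv]
    exact V.mul_mem _ _ (V.mul_mem _ _ (hV.const _) (hasVal_dispInv hq).mem)
      (hV.right.sub_const α).inv_mem
  · rw [h.map_y_vertical hq]
    exact (hV.right.sub_const _).add ((HasVal.const hV.const (β - α)).mul
      ((hq.pow 2).mul (hasVal_dispInv' hq)))

/-- At (0, β) the shear is a local isomorphism onto a neighbourhood of (0, α): x is multiplied by a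
unit of value 1 - 2 = -1 and y is translated. Its differential carries directions to directions. -/
theorem isAff_push (h0 : α * β = 0) (h1 : (α + β) ^ 2 = 1) (hV : IsAff V β) :
    IsAff (push f V) α := by
  have hx := x_ne_zero (K := K)
  have hy := IsAff.hasVal_y hV
  have hyα : HasVal V.toLocalSubring (y K - co α) (β - α) := hy.sub (HasVal.const hV.const α)
  have hd : β - α ≠ 0 := fun h2 => lin_ne_zero h0 h1 (p := -1) (q := 1)
    (by norm_num) (by norm_num) (by linear_combination h2)
  have hq : HasVal V.toLocalSubring (x K / (y K - co α)) (0 : K) :=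
    (hV.left.div hyα hd).congr rfl (zero_div _)
  have hT : HasVal V.toLocalSubring (1 + co (β - α) *
      dispInv (x K / (y K - co α)) / (y K - co α)) (-1 : K) := by
    refine ((HasVal.one hV.const).add (((HasVal.const hV.const (β - α)).mul
      (hasVal_dispInv hq)).div hyα hd)).congr rfl ?_
    field_simp
    ring
  refine ⟨hasVal_push.2 ?_, noVal_push.2 ?_⟩
  · rw [h.map_x_vertical hq]
    exact hV.left.zero_mul_mem hT.mem
  · have hyα0 := hyα.ne_zero hd
    have e : f.comorphism ((y K - co α) / x K) = ((y K - co β) / x K +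
        co (β - α) * (x K / (y K - co α)) * dispInv' (x K / (y K - co α)) / (y K - co α)) /
        (1 + co (β - α) * dispInv (x K / (y K - co α)) / (y K - co α)) := by
      have e : co (β - α) = co β - co α := map_sub _ _ _
      rw [map_div₀, map_sub, AlgEquiv.commutes, h.map_y_vertical hq, h.map_x_vertical hq,
        ← div_div]
      congr 1
      generalize dispInv' (x K / (y K - co α)) = U
      field_simp
      rw [e]
      ring
    rw [e]
    exact (hV.right.add ((((HasVal.const hV.const (β - α)).mul hq).mul
      (hasVal_dispInv' hq)).div hyα hd)).div hT (by norm_num)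

section Slope

variable (hμ : μ ^ 4 - 10 * μ ^ 2 + 9 = 0)
include hμ

theorem isEm_push (hV : IsEm V μ) : IsEm (push f V) μ := by
  have hm := hasVal_slope_of_sl hV.left hV.right.mem α
  have hN := (HasVal.const hV.const (β - α)).mul (hasVal_dispNum hm hμ)
  refine ⟨hasVal_push.2 ?_, noVal_push.2 ?_⟩
  · rw [h.map_inv_x hμ, div_eq_mul_inv (sl μ - co α)]
    exact hV.left.zero_mul_mem (V.mul_mem _ _ (hV.right.sub_const α).mem
      ((hV.right.sub_const α).add hN).inv_mem)
  · rw [h.map_sl hμ]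
    exact hV.right.add ((HasVal.const hV.const (β - α)).mul ((HasVal.one hV.const).add
      (hasVal_dispNum hm hμ)))

variable (h0 : α * β = 0) (h1 : (α + β) ^ 2 = 1)
include h0 h1

/-- The pole of `disp` throws this line to infinity. With A = s - α and B its displaced numerator, x
pulls back to xB/A and s - (α + β)/2 to A times a unit. In the product A cancels, so the coordinate
of the second exceptional curve restricts to a nonconstant function of x. -/
theorem isEd_push_of_isEll (hV : IsEll V μ α) : IsEd (push f V) μ (α + β) := by
  have hx := x_ne_zero (K := K)
  have hA : sl μ - co α ≠ 0 := (gen_line_affine μ α).left_ne_zero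
  have hm : HasVal V.toLocalSubring (slope α) μ := by
    refine ((hV.left.zero_div_noVal hV.right).add (HasVal.const hV.const μ)).congr ?_ (zero_add _)
    rw [← slope_sub μ α, sub_add_cancel]
  obtain ⟨c, hQ⟩ := hasVal_dispQuot hm hμ
  have hB : HasVal V.toLocalSubring (sl μ - co α + co (β - α) * dispNum μ (slope α))
      (α - (α + β) / 2) := h.hasVal_map_sl_sub hμ hm hV.left.of_sub_const
  have hd : α - (α + β) / 2 ≠ 0 := fun h2 => lin_ne_zero h0 h1 (p := 1 / 2) (q := -1 / 2)
    (by norm_num) (by norm_num) (by linear_combination h2)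
  refine ⟨hasVal_push.2 ?_, noVal_push.2 ?_⟩
  · have := (hV.left.zero_div_noVal hV.right).div hB hd
    refine this.congr ?_ (zero_div _)
    rw [h.map_inv_x hμ]
    ring
  · have e : f.comorphism (x K * (sl μ - co ((α + β) / 2))) =
        (x K + co (β - α) * dispQuot μ (slope α)) *
          (sl μ - co α + co (β - α) * dispNum μ (slope α)) := by
      rw [map_mul, map_sub, AlgEquiv.commutes, h.map_sl_sub_half hμ hm, h.map_x_sl hμ]
      generalize sl μ - co α + co (β - α) * dispNum μ (slope α) = B
      generalize sl μ - co α = A at *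
      field_simp
    rw [e]
    exact (hV.right.add ((HasVal.const hV.const (β - α)).mul hQ)).mul hB hd

/-- The reverse phenomenon: on this curve s has exactly the value at which s - β pulls back to 0,
and x becomes an affine function of the curve's own coordinate. -/
theorem isEll_push_of_isEd (hV : IsEd V μ (α + β)) : IsEll (push f V) μ β := by
  have hx := x_ne_zero (K := K)
  have hs := IsEd.hasVal_sl hV
  have hm := hasVal_slope_of_sl hV.left hs.mem α
  obtain ⟨c, hQ⟩ := hasVal_dispQuot hm hμ
  have hA := hs.sub (HasVal.const hV.const α)
  have hd : (α + β) / 2 - α ≠ 0 := fun h2 => lin_ne_zero h0 h1 (p := -1 / 2) (q := 1 / 2)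
    (by norm_num) (by norm_num) (by linear_combination h2)
  refine ⟨hasVal_push.2 ?_, noVal_push.2 ?_⟩
  · rw [map_sub, AlgEquiv.commutes, h.map_sl_sub hμ]
    exact (h.hasVal_map_sl_sub hμ hm hs).congr rfl (sub_self _)
  · have hA0 := hA.ne_zero hd
    have e : f.comorphism (x K) = (x K * (sl μ - co ((α + β) / 2)) + co (β - α) *
        ((sl μ - co α) * dispQuot μ (slope α))) / (sl μ - co α) := by
      have e1 : co ((α + β) / 2) = (co α + co β) / 2 := by rw [co, map_div₀, map_add, map_ofNat]
      have e2 : co (β - α) = co β - co α := map_sub _ _ _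
      have h2 : (2 : FunField K) ≠ 0 := by rw [← co_two]; exact co_ne_zero two_ne_zero
      rw [h.map_x_sl hμ, dispNum_eq hm hμ, slope_sub, e1, e2]
      congr 1
      field_simp
      ring
    rw [e]
    exact (hV.right.add ((HasVal.const hV.const (β - α)).mul (hA.mul hQ))).div hA hd

end Slope

end IsShear

end ShearAction

end BirSurf

namespace BirSurf

open FunField

set_option linter.unusedSectionVars false

/-! ## Images of curves under a shear -/

section Images

variable {K : Type*} [Field K] [CharZero K] {V : ValuationSubring (FunField K)} {f : BirMap K}
  {μ α β : K}

theorem mu_quartic' (i : Fin 4) :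
    ((mu i : ℤ) : K) ^ 4 - 10 * ((mu i : ℤ) : K) ^ 2 + 9 = 0 := by
  have := congrArg (Int.cast (R := K)) (mu_quartic i)
  simpa using this

/-- A valuation centred on a curve on which the coordinates `x` and `slope α` are regular, and that
is not one of the four lines through `(0, α)` of slope `mu i`. -/
structure Generic (V : ValuationSubring (FunField K)) (α : K) : Prop where
  loc : Loc V (x K) (slope α)
  inv_mem : ∀ i, (slope α - co ((mu i : ℤ) : K))⁻¹ ∈ V

theorem y_eq_slope (α : K) : y K = slope α * x K + co α := by
  have hx := x_ne_zero (K := K)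
  rw [slope]
  field_simp
  ring

theorem Generic.cases (h : Generic V α) :
    IsAff V α ∨ (Loc V (x K) (y K) ∧ ¬ InMax V.toLocalSubring (x K)) := by
  by_cases hm : InMax V.toLocalSubring (x K)
  · exact Or.inl (h.loc.isDiv_of_inMax hm)
  · refine Or.inr ⟨⟨h.loc.ne_top, h.loc.const, h.loc.left, ?_, fun a b hab => ?_⟩, hm⟩
    · rw [y_eq_slope α]
      exact V.add_mem _ _ (V.mul_mem _ _ h.loc.right h.loc.left) (h.loc.const α)
    · have ha : a ≠ 0 := by
        rintro rfl
        exact hm hab.1.inMax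
      exact h.loc.not_both a _ ⟨hab.1, (hab.2.sub (HasVal.const h.loc.const α)).div hab.1 ha⟩

theorem Generic.not_isV0 (h : Generic V α) (h' : IsV0 V) : False := by
  have := (h'.left.zero_mul_mem h.loc.right).add (HasVal.const h.loc.const α)
  rw [mul_comm, ← y_eq_slope] at this
  exact h'.right.not_hasVal _ this

theorem IsEll.hasVal_slope (h : IsEll V μ α) : HasVal V.toLocalSubring (slope α) μ := by
  refine ((h.left.zero_div_noVal h.right).add (HasVal.const h.const μ)).congr ?_ (zero_add _)
  rw [← slope_sub μ α, sub_add_cancel]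

theorem Generic.not_isEll {i : Fin 4} (h : Generic V α) (h' : IsEll V ((mu i : ℤ) : K) α) :
    False := by
  have h1 := (IsEll.hasVal_slope h').sub_const
  have h0 : slope α - co ((mu i : ℤ) : K) ≠ 0 := by
    rw [slope_sub]
    exact div_ne_zero (gen_line_affine _ _).left_ne_zero x_ne_zero
  exact not_inMax_of_inv_mem (O := V.toLocalSubring) h0 (h.inv_mem i) h1.inMax

theorem IsAff.generic (h : IsAff V α) : Generic V α :=
  ⟨IsDiv.loc h (gen_isAff α), fun _ => (h.right.sub_const _).inv_mem⟩

theorem Loc.generic_or (h : Loc V (x K) (y K)) (α : K) :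
    Generic V α ∨ IsV0 V ∨ ∃ i, IsEll V ((mu i : ℤ) : K) α := by
  by_cases hm : InMax V.toLocalSubring (x K)
  · exact Or.inr (Or.inl (h.isDiv_of_inMax hm))
  have hx := inv_mem_of_not_inMax (O := V.toLocalSubring) h.left hm
  have hs : slope α ∈ V := by
    rw [slope, div_eq_mul_inv]
    exact V.mul_mem _ _ (V.sub_mem h.right (h.const α)) hx
  by_cases he : ∃ i, InMax V.toLocalSubring (slope α - co ((mu i : ℤ) : K))
  · obtain ⟨i, hi⟩ := he
    refine Or.inr (Or.inr ⟨i, (h.line _ α).isDiv_of_inMax ?_⟩)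
    rw [slope_sub] at hi
    have := hi.mul_right h.left
    rwa [div_mul_cancel₀ _ x_ne_zero] at this
  · push Not at he
    refine Or.inl ⟨⟨h.ne_top, h.const, h.left, hs, fun a b hab => ?_⟩, fun i =>
      inv_mem_of_not_inMax (O := V.toLocalSubring) (V.sub_mem hs (h.const _)) (he i)⟩
    have h1 := (hab.2.mul hab.1).add (HasVal.const h.const α)
    rw [← y_eq_slope] at h1
    exact h.not_both _ _ ⟨hab.1, h1⟩

/-- In the coordinates x and m the shear is (x, m) ↦ (x + (β - α) disp(m), m), an isomorphism
wherever `disp` is regular. -/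
theorem IsShear.generic_push (h : IsShear f α β) (hV : Generic V α) : Generic (push f V) β := by
  have hR : disp (slope α) ∈ V := disp_mem hV.loc.right hV.inv_mem
  have hxm : f.comorphism (x K) ∈ V := by
    rw [h.map_x]
    exact V.add_mem _ _ hV.loc.left (V.mul_mem _ _ (hV.loc.const _) hR)
  refine ⟨⟨?_, hasConst_push.2 hV.loc.const, hxm, ?_, fun a b hab => ?_⟩, fun i => ?_⟩
  · intro ht
    refine hV.loc.ne_top (SetLike.ext fun z => ⟨fun _ => trivial, fun _ => ?_⟩)
    have : f.comorphism.symm z ∈ push f V := ht ▸ trivial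
    rw [mem_push] at this
    simpa using this
  · rw [mem_push, h.map_slope]
    exact hV.loc.right
  · have h1 := hasVal_push.1 hab.1
    have h2 := hasVal_push.1 hab.2
    rw [h.map_slope] at h2
    have hd : HasVal V.toLocalSubring (disp (slope α))
        (2 * b * (5 - b ^ 2) / ((1 - b ^ 2) * (9 - b ^ 2))) := by
      have hc := h2.1
      refine ((((HasVal.ofNat hc 2).mul h2).mul ((HasVal.ofNat hc 5).sub (h2.pow 2))).div
        (((HasVal.one hc).sub (h2.pow 2)).mul ((HasVal.ofNat hc 9).sub (h2.pow 2))) ?_)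
      have hb : ∀ i, b ≠ ((mu i : ℤ) : K) := by
        rintro i rfl
        have h0 : slope α - co ((mu i : ℤ) : K) ≠ 0 := by
          rw [slope_sub]
          exact div_ne_zero (gen_line_affine _ _).left_ne_zero x_ne_zero
        exact not_inMax_of_inv_mem (O := V.toLocalSubring) h0 (hV.inv_mem i) h2.sub_const.inMax
      have e : (1 - b ^ 2) * (9 - b ^ 2) = (b - ((mu 0 : ℤ) : K)) * (b - ((mu 1 : ℤ) : K)) *
          ((b - ((mu 2 : ℤ) : K)) * (b - ((mu 3 : ℤ) : K))) := by
        simp [mu]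
        ring
      change (1 - b ^ 2) * (9 - b ^ 2) ≠ 0
      rw [e]
      exact mul_ne_zero (mul_ne_zero (sub_ne_zero.2 (hb 0)) (sub_ne_zero.2 (hb 1)))
        (mul_ne_zero (sub_ne_zero.2 (hb 2)) (sub_ne_zero.2 (hb 3)))
    have h3 := h1.sub ((HasVal.const h2.1 (β - α)).mul hd)
    rw [h.map_x, add_sub_cancel_right] at h3
    exact hV.loc.not_both _ _ ⟨h3, h2⟩
  · rw [mem_push, map_inv₀, map_sub, AlgEquiv.commutes, h.map_slope]
    exact hV.inv_mem i

variable [IsAlgClosed K]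

theorem Generic.exists_curve {k : Fin 3} (h : Generic V ((sg k : ℤ) : K)) :
    ∃ C : Curve (surface2 K), C.ring = V := by
  rcases h.cases with h | h
  · exact IsAff.exists_surface_curve h
  · exact h.1.exists_surface_curve

/-- The shear with parameters `sg a` and `sg b`, where one of `a, b` is `0` and the other is `p`,
and `q` is the remaining index. -/
def ShearIndex (a b p q : Fin 3) : Prop :=
  (a = 0 ∧ b = p ∨ b = 0 ∧ a = p) ∧ p ≠ 0 ∧ q ≠ 0 ∧ p ≠ q

instance (a b p q : Fin 3) : Decidable (ShearIndex a b p q) := by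
  unfold ShearIndex
  infer_instance

namespace ShearIndex

variable {a b p q : Fin 3}

theorem mul_eq (h : ShearIndex a b p q) : ((sg a : ℤ) : K) * ((sg b : ℤ) : K) = 0 := by
  have : sg a * sg b = 0 := by
    revert a b p q
    decide
  rw [← Int.cast_mul, this, Int.cast_zero]

theorem add_eq (h : ShearIndex a b p q) :
    ((sg a : ℤ) : K) + ((sg b : ℤ) : K) = ((sg p : ℤ) : K) := by
  have : sg a + sg b = sg p := by
    revert a b p q
    decide
  rw [← Int.cast_add, this]

theorem sq_eq (h : ShearIndex a b p q) : (((sg a : ℤ) : K) + ((sg b : ℤ) : K)) ^ 2 = 1 := by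
  rw [h.add_eq, cast_sq h.2.1]

theorem neg_eq (h : ShearIndex a b p q) :
    ((sg q : ℤ) : K) = -(((sg a : ℤ) : K) + ((sg b : ℤ) : K)) := by
  have : sg q = -(sg a + sg b) := by
    revert a b p q
    decide
  rw [← Int.cast_add, ← Int.cast_neg, this]

theorem cases_zero (h : ShearIndex a b p q) (k : Fin 3) : k = 0 ∨ k = p ∨ k = q := by
  revert a b p q k
  decide

theorem cases_aff (h : ShearIndex a b p q) (k : Fin 3) : k = a ∨ k = b ∨ k = q := by
  revert a b p q k
  decide

theorem ne (h : ShearIndex a b p q) : a ≠ b ∧ a ≠ q ∧ b ≠ q := by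
  revert a b p q
  decide

theorem neg_two_mul_eq (h : ShearIndex a b p q) {k : Fin 3}
    (hk : -2 * ((sg b : ℤ) : K) = ((sg k : ℤ) : K)) : k = b := by
  have h1 : -2 * sg b = sg k := by
    apply Int.cast_injective (α := K)
    push_cast
    exact hk
  clear hk
  revert a b p q k
  decide

end ShearIndex

variable {a b p q : Fin 3} {C : Curve (surface2 K)}

variable (K) in
/-- The point to which a shear with parameters `sg a, sg b` contracts an exceptional curve at
infinity. -/
noncomputable abbrev linePoint (a : Fin 3) (i : Fin 4) : LocalSubring (FunField K) :=
  planePoint (1 / x K) (sl ((mu i : ℤ) : K) - co (-((sg a : ℤ) : K)))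

variable (K) in
/-- The point to which a shear with parameters `sg a, sg b` contracts an exceptional curve over the
affine plane. -/
noncomputable abbrev vertPoint (b : Fin 3) : LocalSubring (FunField K) :=
  planePoint (y K - co (-2 * ((sg b : ℤ) : K))) (x K / (y K - co ((sg b : ℤ) : K)))

theorem two_mul_neg_ne (a : Fin 3) {k : Fin 3} (hk : k ≠ 0) :
    2 * (-((sg a : ℤ) : K)) ≠ ((sg k : ℤ) : K) := by
  intro h
  have h1 : 2 * (-sg a) = sg k := by
    apply Int.cast_injective (α := K)
    push_cast
    exact h
  clear h
  revert a k
  decide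

theorem linePoint_mem (a : Fin 3) (i : Fin 4) : linePoint K a i ∈ surface2 K :=
  line_mem i fun _ hk => two_mul_neg_ne a hk

theorem gen_vertPoint (b : Fin 3) : Gen (y K - co (-2 * ((sg b : ℤ) : K)))
    (x K / (y K - co ((sg b : ℤ) : K))) := by
  have := (gen_affine ((sg b : ℤ) : K)).blow_right.sub_const (-3 * ((sg b : ℤ) : K)) 0
  rw [map_zero, sub_zero, sub_sub] at this
  have e : co ((sg b : ℤ) : K) + algebraMap K (FunField K) (-3 * ((sg b : ℤ) : K)) =
      co (-2 * ((sg b : ℤ) : K)) := by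
    rw [← map_add]
    congr 1
    ring
  rwa [e] at this

theorem hasVal_vertPoint (b : Fin 3) : HasVal (vertPoint K b) (x K) (0 : K) ∧
    HasVal (vertPoint K b) (y K) (-2 * ((sg b : ℤ) : K)) := by
  have hg := gen_vertPoint (K := K) b
  have hy := hg.hasVal_left.of_sub_const
  refine ⟨?_, hy⟩
  refine (hg.hasVal_right.zero_mul_mem (hy.sub (HasVal.const hy.1 ((sg b : ℤ) : K))).mem).congr
    (div_mul_cancel₀ _ (gen_affine _).right_ne_zero) rfl

theorem vertPoint_mem (b : Fin 3) : vertPoint K b ∈ surface2 K := by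
  by_cases hb : b = 0
  · subst hb
    have := over_aff_mem' (K := K) 0
    have e : -2 * ((sg 0 : ℤ) : K) = ((sg 0 : ℤ) : K) := by simp [sg]
    rwa [vertPoint, e]
  · have hne : ∀ k, -2 * ((sg b : ℤ) : K) ≠ ((sg k : ℤ) : K) := by
      intro k h
      have h1 : -2 * sg b = sg k := by
        apply Int.cast_injective (α := K)
        push_cast
        exact h
      clear h
      revert b k
      decide
    have h1 := affine_mem (K := K) (a := 0) (b := -2 * ((sg b : ℤ) : K)) fun _ => hne
    have hg := (gen_xy (K := K)).sub_const 0 (-2 * ((sg b : ℤ) : K))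
    have hv := hasVal_vertPoint (K := K) b
    have hy := hg.hasVal_right.of_sub_const
    have hsb : ((sg b : ℤ) : K) ≠ 0 := fun h0 => by
      have := cast_sq (K := K) hb
      rw [h0] at this
      norm_num at this
    have he : planePoint (x K - co 0) (y K - co (-2 * ((sg b : ℤ) : K))) = vertPoint K b := by
      refine planePoint_eq hg.hasVal_right ?_ hv.1.sub_const hv.2.sub_const
      refine (hg.hasVal_left.of_sub_const.div (hy.sub (HasVal.const hy.1 ((sg b : ℤ) : K)))
        fun h0 => hsb ?_).congr rfl (zero_div _)
      linear_combination (-1 / 3 : K) * h0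
    rwa [← he]

namespace IsShear

variable (h : IsShear f ((sg a : ℤ) : K) ((sg b : ℤ) : K)) (hI : ShearIndex a b p q)
include h hI

/-- On this curve s is constant with value -(α + β)/2, and translation by (β - α)/2 gives -α, which
is not a blown-up direction. So nothing separates the points of the curve any more. -/
theorem linePoint_le_push (i : Fin 4) :
    linePoint K a i ≤ (push f (ept K q i).ring).toLocalSubring := by
  have hV := isEd_ept (K := K) hI.2.2.1 i
  have hs := IsEd.hasVal_sl hV
  have hne : ((sg q : ℤ) : K) / 2 ≠ (((sg a : ℤ) : K) + ((sg b : ℤ) : K)) / 2 := by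
    intro h0
    refine lin_ne_zero (K := K) hI.mul_eq hI.sq_eq one_ne_zero one_ne_zero ?_
    have := hI.neg_eq (K := K)
    linear_combination (-1 : K) * h0 + (1 / 2 : K) * this
  refine planePoint_le (hasVal_push.2 (h.hasVal_map_inv_x (mu_quartic' i) hV.left hs hne)) ?_
  refine HasVal.sub_const (hasVal_push.2 ?_)
  refine (h.hasVal_map_sl (mu_quartic' i) (hasVal_slope_of_sl hV.left hs.mem _) hs).congr rfl ?_
  have := hI.neg_eq (K := K)
  linear_combination (1 / 2 : K) * this

/-- The multiplicity of the contracted curve in the pull-back of the first exceptional curve: 1/x is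
carried to itself times a unit. -/
theorem ord_push_inv_x (i : Fin 4) : ord (push f (ept K q i).ring) (1 / x K) = 1 := by
  have hV := isEd_ept (K := K) hI.2.2.1 i
  have hs := IsEd.hasVal_sl hV
  have hm := hasVal_slope_of_sl hV.left hs.mem ((sg a : ℤ) : K)
  have hn := hI.neg_eq (K := K)
  have hA := hs.sub (HasVal.const hV.const ((sg a : ℤ) : K))
  have hB := h.hasVal_map_sl_sub (mu_quartic' i) hm hs
  have hA0 : ((sg q : ℤ) : K) / 2 - ((sg a : ℤ) : K) ≠ 0 := fun h0 =>
    lin_ne_zero (K := K) hI.mul_eq hI.sq_eq (p := -3 / 2) (q := -1 / 2) (by norm_num) (by norm_num)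
      (by linear_combination h0 - (1 / 2 : K) * hn)
  have hB0 : ((sg q : ℤ) : K) / 2 - (((sg a : ℤ) : K) + ((sg b : ℤ) : K)) / 2 ≠ 0 := fun h0 =>
    lin_ne_zero (K := K) hI.mul_eq hI.sq_eq (p := -1) (q := -1) (by norm_num) (by norm_num)
      (by linear_combination h0 - (1 / 2 : K) * hn)
  have hw := hA.div hB hB0
  have hw0 := div_ne_zero hA0 hB0
  rw [← ord_push, h.map_inv_x (mu_quartic' i), ord_mul (one_div_ne_zero x_ne_zero)
    (hw.ne_zero hw0), ord_eq_zero_of_hasVal hw hw0, (isPt_ept q i).ord_left]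
  rfl

theorem vertPoint_le_push : vertPoint K b ≤ (push f (eaff K q).ring).toLocalSubring := by
  have hV := isAff_eaff (K := K) q
  obtain ⟨h1, h2, h3⟩ := h.mapsPoint_vertical hI.mul_eq hI.sq_eq hV.left
    ((IsAff.hasVal_y hV).congr rfl hI.neg_eq)
  refine planePoint_le (hasVal_push.2 h3).sub_const (hasVal_push.2 ?_)
  rwa [h.map_inv_slope h1]

theorem ord_push_inv_slope :
    ord (push f (eaff K q).ring) (x K / (y K - co ((sg b : ℤ) : K))) = 1 := by
  have hV := isAff_eaff (K := K) q
  have hy := IsAff.hasVal_y hV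
  obtain ⟨h1, -, -⟩ := h.mapsPoint_vertical hI.mul_eq hI.sq_eq hV.left (hy.congr rfl hI.neg_eq)
  have hn := hI.neg_eq (K := K)
  have hA := hy.sub (HasVal.const hV.const ((sg a : ℤ) : K))
  have hA0 : ((sg q : ℤ) : K) - ((sg a : ℤ) : K) ≠ 0 := fun h0 =>
    lin_ne_zero (K := K) hI.mul_eq hI.sq_eq (p := -2) (q := -1) (by norm_num) (by norm_num)
      (by linear_combination h0 - hn)
  rw [← ord_push, h.map_inv_slope h1, ord_div x_ne_zero (hA.ne_zero hA0),
    ord_eq_zero_of_hasVal hA hA0, IsDiv.ord_left (gen_isAff _) hV]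
  rfl

/-- The images of the curves on the surface under a shear. -/
theorem image_cases (C : Curve (surface2 K)) :
    (∃ C' : Curve (surface2 K), C'.ring = push f C.ring ∧
      ((Generic C.ring ((sg a : ℤ) : K) ∧ Generic C'.ring ((sg b : ℤ) : K)) ∨
        (IsV0 C.ring ∧ IsV0 C'.ring) ∨
        (∃ i, IsEll C.ring ((mu i : ℤ) : K) ((sg a : ℤ) : K) ∧ C' = ept K p i) ∨
        (C = linf K ∧ C' = linf K) ∨ (C = eaff K b ∧ C' = eaff K a) ∨
        (∃ i, C = ept K 0 i ∧ C' = ept K 0 i) ∨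
        ∃ i, C = ept K p i ∧ IsEll C'.ring ((mu i : ℤ) : K) ((sg b : ℤ) : K))) ∨
    (∃ i, C = ept K q i) ∨ C = eaff K q := by
  have hp := hI.add_eq (K := K)
  have hgen : Generic C.ring ((sg a : ℤ) : K) → ∃ C' : Curve (surface2 K),
      C'.ring = push f C.ring ∧ Generic C'.ring ((sg b : ℤ) : K) := fun hC => by
    have h1 := h.generic_push hC
    obtain ⟨C', hC'⟩ := h1.exists_curve
    exact ⟨C', hC', hC' ▸ h1⟩
  rcases Curve.special_cases C with hC | rfl | ⟨k, rfl⟩ | ⟨k, i, rfl⟩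
  · rcases hC.generic_or ((sg a : ℤ) : K) with h1 | h1 | ⟨i, h1⟩
    · obtain ⟨C', h2, h3⟩ := hgen h1
      exact Or.inl ⟨C', h2, Or.inl ⟨h1, h3⟩⟩
    · have h2 := h.isV0_push h1
      obtain ⟨C', hC'⟩ := (IsDiv.loc h2 gen_xy).exists_surface_curve
      exact Or.inl ⟨C', hC', Or.inr (Or.inl ⟨h1, hC' ▸ h2⟩)⟩
    · have h2 := h.isEd_push_of_isEll (mu_quartic' i) hI.mul_eq hI.sq_eq h1
      rw [hp] at h2
      obtain ⟨C', hC'⟩ := IsEd.exists_surface_curve hI.2.1 h2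
      exact Or.inl ⟨C', hC', Or.inr (Or.inr (Or.inl ⟨i, h1,
        eq_ept ((isPt_of_ne hI.2.1).2 (hC' ▸ h2))⟩))⟩
  · have h2 := h.isInf_push isInf_linf
    obtain ⟨C', hC'⟩ := IsInf.exists_surface_curve h2
    exact Or.inl ⟨C', hC', Or.inr (Or.inr (Or.inr (Or.inl ⟨rfl, eq_linf (hC' ▸ h2)⟩)))⟩
  -- The exceptional curve over (0, α) is the line x = 0 in the plane with coordinates x and slope,
  -- hence generic. The one over (0, β) is exchanged with it, and the third is contracted.
  · rcases hI.cases_aff k with rfl | rfl | rfl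
    · have h1 := IsAff.generic (isAff_eaff (K := K) k)
      obtain ⟨C', h2, h3⟩ := hgen h1
      exact Or.inl ⟨C', h2, Or.inl ⟨h1, h3⟩⟩
    · have h2 := h.isAff_push hI.mul_eq hI.sq_eq (isAff_eaff (K := K) k)
      obtain ⟨C', hC'⟩ := IsAff.exists_surface_curve h2
      exact Or.inl ⟨C', hC', Or.inr (Or.inr (Or.inr (Or.inr (Or.inl
        ⟨rfl, eq_eaff (hC' ▸ h2)⟩))))⟩
    · exact Or.inr (Or.inr rfl)
  · rcases hI.cases_zero k with rfl | rfl | rfl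
    · have h2 := h.isEm_push (mu_quartic' i) (isEm_ept (K := K) i)
      obtain ⟨C', hC'⟩ := IsEm.exists_surface_curve h2
      exact Or.inl ⟨C', hC', Or.inr (Or.inr (Or.inr (Or.inr (Or.inr (Or.inl
        ⟨i, rfl, eq_ept (isPt_zero.2 (hC' ▸ h2))⟩)))))⟩
    · have h1 := isEd_ept (K := K) hI.2.1 i
      rw [← hp] at h1
      have h2 := h.isEll_push_of_isEd (mu_quartic' i) hI.mul_eq hI.sq_eq h1
      obtain ⟨C', hC'⟩ := (IsEll.loc h2).exists_surface_curve
      exact Or.inl ⟨C', hC', Or.inr (Or.inr (Or.inr (Or.inr (Or.inr (Or.inr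
        ⟨i, rfl, hC' ▸ h2⟩)))))⟩
    · exact Or.inr (Or.inl ⟨i, rfl⟩)

/-- A curve is mapped to a curve or contracted to one of five points. -/
theorem curve_or_point (C : Curve (surface2 K)) :
    (∃ C' : Curve (surface2 K), C'.ring = push f C.ring) ∨
    (∃ i, linePoint K a i ≤ (push f C.ring).toLocalSubring) ∨
    vertPoint K b ≤ (push f C.ring).toLocalSubring := by
  rcases h.image_cases hI C with ⟨C', hC', -⟩ | ⟨i, rfl⟩ | rfl
  · exact Or.inl ⟨C', hC'⟩
  · exact Or.inr (Or.inl ⟨i, h.linePoint_le_push hI i⟩)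
  · exact Or.inr (Or.inr (h.vertPoint_le_push hI))

theorem centred : Centred (surface2 K) f := fun C => by
  rcases h.curve_or_point hI C with ⟨C', hC'⟩ | ⟨i, hi⟩ | hi
  · obtain ⟨O, hO, hle, -⟩ := C'.isLocalization
    exact ⟨O, hO, hC' ▸ hle⟩
  · exact ⟨_, linePoint_mem a i, hi.1⟩
  · exact ⟨_, vertPoint_mem b, hi.1⟩

end IsShear

end Images

end BirSurf

namespace BirSurf

open FunField

set_option linter.unusedSectionVars false

/-! ## Pull-backs under a shear -/

section Pullbacks

variable {K : Type*} [Field K] [CharZero K] [IsAlgClosed K] {f : BirMap K} {a b p q k l : Fin 3}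
  {C : Curve (surface2 K)} {i : Fin 4}

theorem exists_isEll_curve (l : Fin 3) (i : Fin 4) :
    ∃ C : Curve (surface2 K), IsEll C.ring ((mu i : ℤ) : K) ((sg l : ℤ) : K) := by
  have h := exists_isDiv (gen_line_affine ((mu i : ℤ) : K) ((sg l : ℤ) : K))
  obtain ⟨C, hC⟩ := (IsEll.loc h).exists_surface_curve
  exact ⟨C, hC ▸ h⟩

theorem exists_isV0_curve (K : Type*) [Field K] [CharZero K] [IsAlgClosed K] :
    ∃ C : Curve (surface2 K), IsV0 C.ring := by
  have h := exists_isDiv (gen_xy (K := K))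
  obtain ⟨C, hC⟩ := (IsDiv.loc h gen_xy).exists_surface_curve
  exact ⟨C, hC ▸ h⟩

/-- The line of slope `mu i` through `(0, sg l)`. -/
noncomputable def ell (K : Type*) [Field K] [CharZero K] [IsAlgClosed K] (l : Fin 3) (i : Fin 4) :
    Curve (surface2 K) := (exists_isEll_curve l i).choose

/-- The line `x = 0`. -/
noncomputable def vline (K : Type*) [Field K] [CharZero K] [IsAlgClosed K] : Curve (surface2 K) :=
  (exists_isV0_curve K).choose

theorem isEll_ell (l : Fin 3) (i : Fin 4) :
    IsEll (ell K l i).ring ((mu i : ℤ) : K) ((sg l : ℤ) : K) :=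
  (exists_isEll_curve l i).choose_spec

theorem isV0_vline : IsV0 (vline K).ring := (exists_isV0_curve K).choose_spec

theorem eq_ell (h : IsEll C.ring ((mu i : ℤ) : K) ((sg l : ℤ) : K)) : C = ell K l i :=
  Curve.ext (IsDiv.unique (gen_line_affine _ _) h (isEll_ell l i))

theorem eq_vline (h : IsV0 C.ring) : C = vline K :=
  Curve.ext (IsDiv.unique gen_xy h isV0_vline)

theorem loc_ell (l : Fin 3) (i : Fin 4) : Loc (ell K l i).ring (x K) (y K) :=
  IsEll.loc (isEll_ell l i)

theorem loc_vline : Loc (vline K).ring (x K) (y K) := IsDiv.loc isV0_vline gen_xy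

theorem ell_inj {j : Fin 4} : ell K l i = ell K l j ↔ i = j := by
  refine ⟨fun h => ?_, fun h => h ▸ rfl⟩
  have h1 := IsEll.hasVal_slope (isEll_ell (K := K) l i)
  rw [h] at h1
  exact mu_injective (cast_inj (h1.unique (IsEll.hasVal_slope (isEll_ell l j))))

theorem ell_ne_vline : ell K l i ≠ vline K := by
  intro h
  have h1 := isEll_ell (K := K) l i
  rw [h] at h1
  exact h1.right.not_hasVal 0 isV0_vline.left

/-- A combination of the lines of slopes `mu i` through `(0, sg l)`. -/
noncomputable def ellDiv (K : Type*) [Field K] [CharZero K] [IsAlgClosed K] (l : Fin 3)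
    (c : Fin 4 → ℤ) : Divisor (surface2 K) := ∑ i, c i • Finsupp.single (ell K l i) 1

theorem ellDiv_of_ne {c : Fin 4 → ℤ} (h : ∀ i, ell K l i ≠ C) : ellDiv K l c C = 0 := by
  simp [ellDiv, h]

theorem ellDiv_ell {c : Fin 4 → ℤ} : ellDiv K l c (ell K l i) = c i := by
  classical
  simp [ellDiv, Finsupp.single_apply, ell_inj]

theorem Generic.ne_ell (h : Generic C.ring ((sg l : ℤ) : K)) (i : Fin 4) : ell K l i ≠ C := by
  rintro rfl
  exact h.not_isEll (isEll_ell l i)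

theorem Generic.ne_vline {α : K} (h : Generic C.ring α) : vline K ≠ C := by
  rintro rfl
  exact h.not_isV0 isV0_vline

theorem specialDiv_generic {n : ℤ} {c : Fin 3 → ℤ} {e : Fin 3 → Fin 4 → ℤ}
    (h : Generic C.ring ((sg k : ℤ) : K)) (hc : c k = 0) : specialDiv K n c e C = 0 := by
  rcases h.cases with h | h
  · rw [eq_eaff h, specialDiv_eaff, hc]
  · exact specialDiv_loc h.1

/-! ### Local equations at the points to which curves are contracted -/

theorem isLocalEquation_vertPoint {n : ℤ} {c : Fin 3 → ℤ} {e : Fin 3 → Fin 4 → ℤ}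
    (hI : ShearIndex a b p q) (hc : c b = 0) :
    IsLocalEquation (specialDiv K n c e) (vertPoint K b) 1 := by
  refine ⟨one_ne_zero, fun C hC => ?_⟩
  have hv := hasVal_vertPoint (K := K) b
  rw [ord_one]
  rcases aff_cases hC hv.1 hv.2 with h | ⟨k, -, hk, rfl⟩
  · rw [specialDiv_loc h]
  · rw [specialDiv_eaff, hI.neg_two_mul_eq hk, hc]

theorem isLocalEquation_vline_linePoint (i : Fin 4) :
    IsLocalEquation (Finsupp.single (vline K) 1) (linePoint K a i) 1 := by
  classical
  refine ⟨one_ne_zero, fun C hC => ?_⟩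
  rw [ord_one, Finsupp.single_eq_of_ne]
  rintro rfl
  have h1 := hC (gen_line_sub ((mu i : ℤ) : K) (-((sg a : ℤ) : K))).hasVal_left.mem
  have := (isV0_vline (K := K)).left.zero_mul_mem h1
  rw [mul_one_div_cancel x_ne_zero] at this
  exact not_inMax_one this.inMax

theorem isLocalEquation_vline_vertPoint : IsLocalEquation (Finsupp.single (vline K) 1)
    (vertPoint K b) (x K / (y K - co ((sg b : ℤ) : K))) := by
  classical
  have hg := gen_vertPoint (K := K) b
  have hv : IsDiv (vline K).ring (x K / (y K - co ((sg b : ℤ) : K)))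
      (y K - co (-2 * ((sg b : ℤ) : K))) := by
    have h := isV0_vline (K := K)
    exact ⟨h.left.zero_div_noVal (h.right.sub_const _), h.right.sub_const _⟩
  have := isSurface_surface2.isLocalEquation (D := Finsupp.single (vline K) 1) (m := 0) (n := 1)
    hg (vertPoint_mem b) (fun C _ _ h => ?_) (fun C h => ?_) fun C h => ?_
  · rwa [zpow_zero, zpow_one, one_mul] at this
  · rw [Finsupp.single_eq_of_ne]
    rintro rfl
    exact h hv
  · rw [Finsupp.single_eq_of_ne]
    rintro rfl
    exact hv.right.not_hasVal 0 h.left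
  · rw [Curve.ext (h.unique hg.swap hv), Finsupp.single_eq_same]

/-! ### Pull-backs -/

namespace IsShear

variable (h : IsShear f ((sg a : ℤ) : K) ((sg b : ℤ) : K)) (hI : ShearIndex a b p q)
include h hI

/-- One condition for each kind of curve. `h1` to `h7` compare coefficients of a curve and its
image; `h8` and `h9` evaluate a local equation at the point to which a curve is contracted. -/
theorem isPullback_of_images {D D' : Divisor (surface2 K)}
    (h1 : ∀ C C' : Curve (surface2 K), Generic C.ring ((sg a : ℤ) : K) →
      Generic C'.ring ((sg b : ℤ) : K) → D C' = D' C)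
    (h2 : D (vline K) = D' (vline K)) (h3 : ∀ i, D (ept K p i) = D' (ell K a i))
    (h4 : D (linf K) = D' (linf K)) (h5 : D (eaff K a) = D' (eaff K b))
    (h6 : ∀ i, D (ept K 0 i) = D' (ept K 0 i)) (h7 : ∀ i, D (ell K b i) = D' (ept K p i))
    (h8 : ∀ i, ∃ φ, IsLocalEquation D (linePoint K a i) φ ∧
      ord (push f (ept K q i).ring) φ = D' (ept K q i))
    (h9 : ∃ φ, IsLocalEquation D (vertPoint K b) φ ∧
      ord (push f (eaff K q).ring) φ = D' (eaff K q)) : IsPullback f D D' := by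
  rw [isPullback_iff]
  intro C
  rcases h.image_cases hI C with ⟨C', hC', hcase⟩ | ⟨i, rfl⟩ | rfl
  · obtain ⟨O, hO, hle, -⟩ := C'.isLocalization
    obtain ⟨φ, hφ⟩ := isSurface_surface2.exists_localEquation hO D
    refine ⟨O, hO, hC' ▸ hle, φ, hφ, ?_⟩
    have e : ord (push f C.ring) φ = ord C'.ring φ := by simp only [hC']
    rw [e, hφ.2 C' hle]
    rcases hcase with ⟨ha, hb⟩ | ⟨ha, hb⟩ | ⟨i, ha, rfl⟩ | ⟨rfl, rfl⟩ | ⟨rfl, rfl⟩ |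
      ⟨i, rfl, rfl⟩ | ⟨i, rfl, hb⟩
    · exact h1 C C' ha hb
    · rw [eq_vline ha, eq_vline hb, h2]
    · rw [eq_ell ha, h3]
    · exact h4
    · exact h5
    · exact h6 i
    · rw [eq_ell hb, h7]
  · obtain ⟨φ, hφ, he⟩ := h8 i
    exact ⟨_, linePoint_mem a i, (h.linePoint_le_push hI i).1, φ, hφ, he⟩
  · obtain ⟨φ, hφ, he⟩ := h9
    exact ⟨_, vertPoint_mem b, (h.vertPoint_le_push hI).1, φ, hφ, he⟩

/-- The exceptional curve over (0, β) is left out because it is the image of a generic curve that is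
not on the list, and because for β = 0 it passes through the contraction point `vertPoint`. -/
theorem isPullback_specialDiv (n : ℤ) (c : Fin 3 → ℤ) (e : Fin 3 → Fin 4 → ℤ) (hc : c b = 0) :
    IsPullback f (specialDiv K n c e) (specialDiv K n (fun k => if k = b then c a else 0)
      (fun k i => if k = p then 0 else e 0 i) + ellDiv K a (e p)) := by
  classical
  obtain ⟨hab, haq, hbq⟩ := hI.ne
  have hloc : ∀ C : Curve (surface2 K), ¬ Loc C.ring (x K) (y K) → ellDiv K a (e p) C = 0 := by
    intro C hC
    refine ellDiv_of_ne ?_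
    rintro i rfl
    exact hC (loc_ell a i)
  have hinf : ellDiv K a (e p) (linf K) = 0 := hloc _ fun h => h.ne_linf rfl
  have haff : ∀ k, ellDiv K a (e p) (eaff K k) = 0 := fun k => hloc _ fun h => h.ne_eaff k rfl
  have hpt : ∀ k i, ellDiv K a (e p) (ept K k i) = 0 := fun k i => hloc _ fun h => h.ne_ept k i rfl
  refine h.isPullback_of_images hI (fun C C' h1 h2 => ?_) ?_ (fun i => ?_) ?_ ?_ (fun i => ?_)
    (fun i => ?_) (fun i => ⟨(1 / x K) ^ e 0 i, localEquation_line fun _ hk => two_mul_neg_ne a hk,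
      ?_⟩) ⟨1, isLocalEquation_vertPoint hI hc, ?_⟩
  · rw [Finsupp.add_apply, specialDiv_generic h2 hc, specialDiv_generic h1 (if_neg hab),
      ellDiv_of_ne h1.ne_ell, add_zero]
  · rw [Finsupp.add_apply, specialDiv_loc loc_vline, specialDiv_loc loc_vline,
      ellDiv_of_ne fun _ => ell_ne_vline, add_zero]
  · rw [Finsupp.add_apply, specialDiv_ept, specialDiv_loc (loc_ell a i), ellDiv_ell, zero_add]
  · rw [Finsupp.add_apply, specialDiv_linf, specialDiv_linf, hinf, add_zero]
  · rw [Finsupp.add_apply, specialDiv_eaff, specialDiv_eaff, haff, if_pos rfl, add_zero]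
  · rw [Finsupp.add_apply, specialDiv_ept, specialDiv_ept, hpt, if_neg (Ne.symm hI.2.1), add_zero]
  · rw [Finsupp.add_apply, specialDiv_loc (loc_ell b i), specialDiv_ept, hpt, if_pos rfl, add_zero]
  · rw [Finsupp.add_apply, specialDiv_ept, hpt, if_neg (Ne.symm hI.2.2.2), ord_zpow,
      h.ord_push_inv_x hI, mul_one, add_zero]
  · rw [Finsupp.add_apply, specialDiv_eaff, haff, if_neg (Ne.symm hbq), ord_one, add_zero]

/-- The line x = 0 is mapped to itself, and the contracted affine exceptional curve lands on it with
multiplicity one. -/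
theorem isPullback_vline : IsPullback f (Finsupp.single (vline K) 1)
    (Finsupp.single (vline K) 1 + specialDiv K 0 (Pi.single q 1) 0) := by
  classical
  obtain ⟨hab, haq, hbq⟩ := hI.ne
  have hloc : ∀ C : Curve (surface2 K), ¬ Loc C.ring (x K) (y K) →
      (Finsupp.single (vline K) 1 : Divisor (surface2 K)) C = 0 := by
    intro C hC
    rw [Finsupp.single_eq_of_ne]
    rintro rfl
    exact hC loc_vline
  have hinf := hloc (linf K) fun h => h.ne_linf rfl
  have haff := fun k => hloc (eaff K k) fun h => h.ne_eaff k rfl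
  have hpt := fun k i => hloc (ept K k i) fun h => h.ne_ept k i rfl
  have hell : ∀ l i, (Finsupp.single (vline K) 1 : Divisor (surface2 K)) (ell K l i) = 0 :=
    fun l i => Finsupp.single_eq_of_ne ell_ne_vline
  refine h.isPullback_of_images hI (fun C C' h1 h2 => ?_) ?_ (fun i => ?_) ?_ ?_ (fun i => ?_)
    (fun i => ?_) (fun i => ⟨1, isLocalEquation_vline_linePoint i, ?_⟩)
      ⟨_, isLocalEquation_vline_vertPoint, ?_⟩
  · rw [Finsupp.add_apply, specialDiv_generic h1 (Pi.single_eq_of_ne haq 1),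
      Finsupp.single_eq_of_ne h1.ne_vline.symm, Finsupp.single_eq_of_ne h2.ne_vline.symm, add_zero]
  · rw [Finsupp.add_apply, specialDiv_loc loc_vline, add_zero]
  · rw [Finsupp.add_apply, specialDiv_loc (loc_ell a i), hpt, hell, add_zero]
  · rw [Finsupp.add_apply, specialDiv_linf, add_zero]
  · rw [Finsupp.add_apply, specialDiv_eaff, haff, haff, Pi.single_eq_of_ne hbq, add_zero]
  · rw [Finsupp.add_apply, specialDiv_ept, hpt]; rfl
  · rw [Finsupp.add_apply, specialDiv_ept, hpt, hell]; rfl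
  · rw [Finsupp.add_apply, specialDiv_ept, hpt, ord_one]; rfl
  · rw [Finsupp.add_apply, specialDiv_eaff, haff, Pi.single_eq_same, h.ord_push_inv_slope hI,
      zero_add]

end IsShear

/-! ### Classes -/

variable (K) in
/-- The class of a combination of special curves. -/
noncomputable def specialCls :
    (ℤ × (Fin 3 → ℤ) × (Fin 3 → Fin 4 → ℤ)) →+ N1 K (surface2 K) :=
  AddMonoidHom.mk' (fun t => cls K (specialDiv K t.1 t.2.1 t.2.2)) fun s t => by
    rw [← cls_add, ← specialDiv_add]
    rfl

theorem specialCls_apply (n : ℤ) (c : Fin 3 → ℤ) (e : Fin 3 → Fin 4 → ℤ) :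
    specialCls K (n, c, e) = cls K (specialDiv K n c e) := rfl

theorem cls_zsmul' (n : ℤ) (D : Divisor (surface2 K)) : cls K (n • D) = n • cls K D := by
  rw [cls_zsmul, Int.cast_smul_eq_zsmul]

theorem cls_vline : cls K (Finsupp.single (vline K) 1) = specialCls K (1, -1, 1) := by
  have h := (isDivisorOf_x (isV0_vline (K := K))).cls_eq_zero
  rw [cls_add, ← specialCls_apply] at h
  rw [eq_neg_of_add_eq_zero_left h, ← map_neg]
  simp

theorem cls_ell (l : Fin 3) (i : Fin 4) : cls K (Finsupp.single (ell K l i) 1) =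
    specialCls K (1, -Pi.single l 1, fun _ j => if j = i then 0 else 1) := by
  have h := (isDivisorOf_sl (isEll_ell (K := K) l i)).cls_eq_zero
  rw [cls_add, ← specialCls_apply] at h
  rw [eq_neg_of_add_eq_zero_left h, ← map_neg]
  congr 1
  refine Prod.ext rfl (Prod.ext (funext fun k => ?_) (funext fun k => funext fun j => ?_))
  · simp [Pi.single_apply]
  · simp only [Prod.snd_neg, Pi.neg_apply]
    split_ifs <;> rfl

theorem cls_ellDiv (l : Fin 3) (c : Fin 4 → ℤ) : cls K (ellDiv K l c) =
    specialCls K (∑ i, c i, -Pi.single l (∑ i, c i), fun _ j => (∑ i, c i) - c j) := by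
  rw [ellDiv, cls_sum_zsmul]
  simp only [cls_ell, Int.cast_smul_eq_zsmul, ← map_zsmul]
  rw [← map_sum]
  congr 1
  refine Prod.ext ?_ (Prod.ext (funext fun k => ?_) (funext fun k => funext fun j => ?_))
  · simp [Prod.fst_sum]
  · by_cases hk : k = l
    · subst hk
      simp [Prod.snd_sum, Prod.fst_sum]
    · simp [Prod.snd_sum, Prod.fst_sum, hk]
  · simp only [Prod.snd_sum, Prod.smul_snd, Finset.sum_apply, Pi.smul_apply, smul_eq_mul, mul_ite,
      mul_zero, mul_one]
    rw [eq_sub_iff_add_eq, ← Finset.sum_erase_add _ _ (Finset.mem_univ j), if_pos rfl, add_zero,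
      ← Finset.sum_erase_add _ c (Finset.mem_univ j)]
    congr 1
    refine Finset.sum_congr rfl fun i hi => if_neg ?_
    exact (Finset.ne_of_mem_erase hi).symm

/-- The effect of a shear on classes of combinations of special curves. -/
def shearImage (a b p : Fin 3) (n : ℤ) (c : Fin 3 → ℤ) (e : Fin 3 → Fin 4 → ℤ) :
    ℤ × (Fin 3 → ℤ) × (Fin 3 → Fin 4 → ℤ) :=
  (n + (∑ i, e p i) + 4 * c b,
    fun k => if k = b then c a else if k = a then -(∑ i, e p i) - 3 * c b else 0,
    fun k j => (if k = p then 2 * c b else e 0 j + 3 * c b) + ((∑ i, e p i) - e p j))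

/-- The pull-back of the exceptional curve over (0, β) is obtained indirectly. In the divisor of x
it occurs with multiplicity 1, the divisor of x pulls back to a principal one, and all its other
components have known pull-backs. -/
theorem IsShear.exists_pullback (h : IsShear f ((sg a : ℤ) : K) ((sg b : ℤ) : K))
    (hI : ShearIndex a b p q) (n : ℤ) (c : Fin 3 → ℤ) (e : Fin 3 → Fin 4 → ℤ) :
    ∃ D', IsPullback f (specialDiv K n c e) D' ∧ cls K D' = specialCls K (shearImage a b p n c e) := by
  classical
  have hS := isSurface_surface2 (K := K)
  obtain ⟨hab, haq, hbq⟩ := hI.ne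
  have hx := isDivisorOf_x (isV0_vline (K := K))
  obtain ⟨Dx, hDx⟩ := exists_isDivisorOf (K := K) h.map_x_ne_zero
  have p1 := hx.isPullback (h.centred hI) hDx
  have p2 := (h.isPullback_vline hI).zsmul (-1)
  have p3 := (h.isPullback_specialDiv hI (-1) (1 - Pi.single b 1) (-1) (by simp)).zsmul (-1)
  have p4 := h.isPullback_specialDiv hI n (fun k => if k = b then 0 else c k) e (if_pos rfl)
  have p5 := hS.isPullback_add p4
    ((hS.isPullback_add (hS.isPullback_add p1 p2) p3).zsmul (c b))
  have e1 : specialDiv K (-1) 1 (-1) = specialDiv K (-1) (1 - Pi.single b 1) (-1) +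
      specialDiv K 0 (Pi.single b 1) 0 := by
    rw [← specialDiv_add, sub_add_cancel, add_zero, add_zero]
  have e2 : specialDiv K n c e = specialDiv K n (fun k => if k = b then 0 else c k) e +
      c b • specialDiv K 0 (Pi.single b 1) 0 := by
    rw [← specialDiv_smul, ← specialDiv_add, mul_zero, add_zero, smul_zero, add_zero]
    congr 1
    funext k
    by_cases hk : k = b
    · subst hk; simp
    · simp [hk]
  -- The omitted curve is rewritten as the divisor of x minus the line x = 0 minus the remaining
  -- special curves.
  have e3 : specialDiv K n c e = specialDiv K n (fun k => if k = b then 0 else c k) e +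
      c b • (Finsupp.single (vline K) 1 + specialDiv K (-1) 1 (-1) +
        -1 • Finsupp.single (vline K) 1 +
        -1 • specialDiv K (-1) (1 - Pi.single b 1) (-1)) := by
    rw [e2, e1]
    module
  rw [← e3] at p5
  refine ⟨_, p5, ?_⟩
  · simp only [cls_add, cls_zsmul', hDx.cls_eq_zero, cls_vline, cls_ellDiv, ← specialCls_apply,
      zero_add, ← map_add, ← map_zsmul]
    congr 1
    refine Prod.ext ?_ (Prod.ext (funext fun k => ?_) (funext fun k => funext fun j => ?_))
    · simp [shearImage]
      ring
    · rcases hI.cases_aff k with rfl | rfl | rfl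
      · simp [shearImage, hab, haq]
        ring
      · simp [shearImage, hab, hab.symm, hbq]
      · simp [shearImage, haq.symm, hbq.symm]
    · by_cases hk : k = p
      · simp [shearImage, hk]
        ring
      · simp [shearImage, hk]
        ring

end Pullbacks

end BirSurf

namespace BirSurf

open FunField

set_option linter.unusedSectionVars false

/-! ## The action of a shear on the Néron-Severi space -/

section Action

variable {K : Type*} [Field K] [CharZero K] [IsAlgClosed K] {f : BirMap K} {a b p q : Fin 3}

theorem specialDiv_ofCoords (j : Fin 16) : specialDiv K (ofCoords (Pi.single j 1)).1
    (ofCoords (Pi.single j 1)).2.1 (ofCoords (Pi.single j 1)).2.2 = basisDiv K j := by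
  classical
  rw [← sum_coords, coords_ofCoords, Finset.sum_eq_single j, Pi.single_eq_same, one_smul]
  · intro i _ hi
    rw [Pi.single_eq_of_ne hi, zero_smul]
  · simp

/-- The matrix of the pull-back under a shear. -/
def shearMat (a b p : Fin 3) : Matrix (Fin 16) (Fin 16) ℤ := fun i j =>
  let s := shearImage a b p (ofCoords (Pi.single j 1)).1 (ofCoords (Pi.single j 1)).2.1
    (ofCoords (Pi.single j 1)).2.2
  coords s.1 s.2.1 s.2.2 i

variable (K) in
/-- The pull-back under a shear. -/
noncomputable def shearPull (a b p : Fin 3) : N1 K (surface2 K) →ₗ[ℝ] N1 K (surface2 K) :=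
  Matrix.toLin (geomBasis K) (geomBasis K) ((shearMat a b p).map Int.cast)

theorem IsShear.isPullbackN1 (h : IsShear f ((sg a : ℤ) : K) ((sg b : ℤ) : K))
    (hI : ShearIndex a b p q) : IsPullbackN1 (surface2 K) f (shearPull K a b p) := by
  intro D
  have hS := isSurface_surface2 (K := K)
  have key : ∀ j, ∃ D', IsPullback f (basisDiv K j) D' ∧
      shearPull K a b p (geomBasis K j) = cls K D' := by
    intro j
    obtain ⟨D', hD', hc⟩ := h.exists_pullback hI (ofCoords (Pi.single j 1)).1
      (ofCoords (Pi.single j 1)).2.1 (ofCoords (Pi.single j 1)).2.2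
    rw [specialDiv_ofCoords] at hD'
    refine ⟨D', hD', ?_⟩
    rw [hc, shearPull, Matrix.toLin_self]
    exact (cls_specialDiv _ _ _).symm
  choose B hB hL using key
  -- An arbitrary divisor is a combination of the sixteen basis divisors plus a principal one, and
  -- the principal part has class 0 before and after pull-back.
  obtain ⟨n, c, e, g, Dg, hg, rfl⟩ := exists_special_add D
  have hg0 : f.comorphism g ≠ 0 := by simpa using hg.1
  obtain ⟨Eg, hEg⟩ := exists_isDivisorOf (K := K) hg0
  refine ⟨∑ j, coords n c e j • B j + Eg, ?_, ?_⟩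
  · rw [← sum_coords]
    exact hS.isPullback_add (hS.isPullback_sum (h.centred hI) _ fun j _ => (hB j).zsmul _)
      (hg.isPullback (h.centred hI) hEg)
  · rw [cls_add, cls_add, hg.cls_eq_zero, hEg.cls_eq_zero, add_zero, add_zero, cls_specialDiv,
      cls_sum_zsmul, map_sum]
    exact Finset.sum_congr rfl fun j _ => by rw [map_smul, hL]

theorem toMatrix_shearPull (a b p : Fin 3) : LinearMap.toMatrix (geomBasis K) (geomBasis K)
    (shearPull K a b p) = (shearMat a b p).map Int.cast := LinearMap.toMatrix_toLin _ _ _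

/-- The slope is preserved, so undoing the displacement only reverses the sign of β - α.
Push-forwards thereby become pull-backs under shears. -/
theorem IsShear.inv {α β : K} (h : IsShear f α β) : IsShear f.inv β α := by
  have ex : f.comorphism (f.inv.comorphism (x K)) = x K := f.comorphism.apply_symm_apply _
  have ey : f.comorphism (f.inv.comorphism (y K)) = y K := f.comorphism.apply_symm_apply _
  constructor <;> apply f.comorphism.injective
  · have hd : f.comorphism (disp (slope β)) = disp (slope α) := by
      simp only [disp, map_div₀, map_mul, map_sub f.comorphism, map_pow, map_ofNat, map_one,
        ← h.map_slope]
    rw [ex, map_add, map_mul, hd, h.map_x, AlgEquiv.commutes]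
    simp only [map_sub]
    ring
  · have hx := x_ne_zero (K := K)
    rw [ey, map_add, map_mul, h.map_slope, ex, AlgEquiv.commutes, slope]
    field_simp
    ring

/-- The third form is x⁴(1 - m²)(9 - m²) for m = y/x, so dividing the other two by it gives the
displacement and the line of slope m through (0, e). -/
theorem IsShear.of_forms {e : K} {f : BirMap K}
    (hu : f.comorphism (x K) = (9 * x K ^ 5 - 10 * x K ^ 3 * y K ^ 2 + x K * y K ^ 4 +
      co e * (10 * x K ^ 3 * y K - 2 * x K * y K ^ 3)) /
      (9 * x K ^ 4 - 10 * x K ^ 2 * y K ^ 2 + y K ^ 4))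
    (hv : f.comorphism (y K) = (9 * x K ^ 4 * y K - 10 * x K ^ 2 * y K ^ 3 + y K ^ 5 +
      co e * (9 * x K ^ 4 - y K ^ 4)) / (9 * x K ^ 4 - 10 * x K ^ 2 * y K ^ 2 + y K ^ 4)) :
    IsShear f 0 e := by
  have hx := x_ne_zero (K := K)
  have e9 : co (9 : K) = 9 := map_ofNat _ 9
  have e10 : co (10 : K) = 10 := map_ofNat _ 10
  have hA : 9 * x K ^ 4 - 10 * x K ^ 2 * y K ^ 2 + y K ^ 4 ≠ 0 := by
    have := FunField.aeval_ne_zero (K := K) (MvPolynomial.C 9 * MvPolynomial.X 0 ^ 4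
      - MvPolynomial.C 10 * MvPolynomial.X 0 ^ 2 * MvPolynomial.X 1 ^ 2
      + MvPolynomial.X 1 ^ 4) ![1, 0] (by simp)
    simpa [e9, e10] using this
  have hs : slope (0 : K) = y K / x K := by simp [slope]
  have hfac : (1 - (y K / x K) ^ 2) * (9 - (y K / x K) ^ 2) =
      (9 * x K ^ 4 - 10 * x K ^ 2 * y K ^ 2 + y K ^ 4) / x K ^ 4 := by
    field_simp
    ring
  constructor
  · rw [hs, disp, hfac, sub_zero, hu]
    generalize hd : 9 * x K ^ 4 - 10 * x K ^ 2 * y K ^ 2 + y K ^ 4 = A at *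
    field_simp
    linear_combination hd
  · rw [hs, hu, hv]
    generalize hd : 9 * x K ^ 4 - 10 * x K ^ 2 * y K ^ 2 + y K ^ 4 = A at *
    field_simp
    linear_combination co e * hd

variable (K) in
theorem isShear_phi : IsShear (Phi K) ((sg 0 : ℤ) : K) ((sg 1 : ℤ) : K) := by
  have h : IsShear (Phi K) 0 1 := by
    refine .of_forms ((BirMap.ofGens_x _ _ (phiForms_birational K)).trans ?_)
      ((BirMap.ofGens_y _ _ (phiForms_birational K)).trans ?_) <;>
    · simp only [FunField.dehom, phiForms, map_add, map_sub, map_mul, map_pow,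
        MvPolynomial.aeval_X, map_ofNat, map_one, Matrix.cons_val_zero, Matrix.cons_val_one,
        Matrix.cons_val]
      ring
  simpa [sg] using h

variable (K) in
theorem isShear_psi : IsShear (Psi K) ((sg 0 : ℤ) : K) ((sg 2 : ℤ) : K) := by
  have h : IsShear (Psi K) 0 (-1) := by
    refine .of_forms ((BirMap.ofGens_x _ _ (psiForms_birational K)).trans ?_)
      ((BirMap.ofGens_y _ _ (psiForms_birational K)).trans ?_) <;>
    · simp only [FunField.dehom, psiForms, map_add, map_sub, map_mul, map_pow, map_neg,
        MvPolynomial.aeval_X, map_ofNat, map_one, Matrix.cons_val_zero, Matrix.cons_val_one,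
        Matrix.cons_val]
      ring
  simpa [sg] using h

/-- The indices are those of the inverse of Φ, which leads from α = 1 to β = 0, because Φ pushes
forward by pulling back under its inverse. -/
theorem shearMat_phi : shearMat 1 0 1 =
  !![5,  4,  0,  0,  0,  0,  0,  1,  1,  1,  1,  0,  0,  0,  0,  0;
      0,  0,  0,  0,  0,  0,  1,  0,  0,  0,  0,  0,  0,  0,  0,  0;
     -1, -1,  1,  0,  0,  0,  0, -1,  0,  0,  0,  0,  0,  0,  0,  0;
     -1, -1,  0,  1,  0,  0,  0,  0, -1,  0,  0,  0,  0,  0,  0,  0;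
     -1, -1,  0,  0,  1,  0,  0,  0,  0, -1,  0,  0,  0,  0,  0,  0;
     -1, -1,  0,  0,  0,  1,  0,  0,  0,  0, -1,  0,  0,  0,  0,  0;
     -4, -3,  0,  0,  0,  0,  0, -1, -1, -1, -1,  0,  0,  0,  0,  0;
     -2, -2,  0,  0,  0,  0,  0, -1,  0,  0,  0,  0,  0,  0,  0,  0;
     -2, -2,  0,  0,  0,  0,  0,  0, -1,  0,  0,  0,  0,  0,  0,  0;
     -2, -2,  0,  0,  0,  0,  0,  0,  0, -1,  0,  0,  0,  0,  0,  0;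
     -2, -2,  0,  0,  0,  0,  0,  0,  0,  0, -1,  0,  0,  0,  0,  0;
      0,  0,  0,  0,  0,  0,  0,  0,  0,  0,  0,  0,  0,  0,  0,  0;
     -1, -1,  1,  0,  0,  0,  0, -1,  0,  0,  0,  0,  0,  0,  0,  0;
     -1, -1,  0,  1,  0,  0,  0,  0, -1,  0,  0,  0,  0,  0,  0,  0;
     -1, -1,  0,  0,  1,  0,  0,  0,  0, -1,  0,  0,  0,  0,  0,  0;
     -1, -1,  0,  0,  0,  1,  0,  0,  0,  0, -1,  0,  0,  0,  0,  0] := by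
  decide +kernel

theorem shearMat_psi : shearMat 2 0 2 =
  !![5,  4,  0,  0,  0,  0,  0,  0,  0,  0,  0,  0,  1,  1,  1,  1;
      0,  0,  0,  0,  0,  0,  0,  0,  0,  0,  0,  1,  0,  0,  0,  0;
     -1, -1,  1,  0,  0,  0,  0,  0,  0,  0,  0,  0, -1,  0,  0,  0;
     -1, -1,  0,  1,  0,  0,  0,  0,  0,  0,  0,  0,  0, -1,  0,  0;
     -1, -1,  0,  0,  1,  0,  0,  0,  0,  0,  0,  0,  0,  0, -1,  0;
     -1, -1,  0,  0,  0,  1,  0,  0,  0,  0,  0,  0,  0,  0,  0, -1;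
      0,  0,  0,  0,  0,  0,  0,  0,  0,  0,  0,  0,  0,  0,  0,  0;
     -1, -1,  1,  0,  0,  0,  0,  0,  0,  0,  0,  0, -1,  0,  0,  0;
     -1, -1,  0,  1,  0,  0,  0,  0,  0,  0,  0,  0,  0, -1,  0,  0;
     -1, -1,  0,  0,  1,  0,  0,  0,  0,  0,  0,  0,  0,  0, -1,  0;
     -1, -1,  0,  0,  0,  1,  0,  0,  0,  0,  0,  0,  0,  0,  0, -1;
     -4, -3,  0,  0,  0,  0,  0,  0,  0,  0,  0,  0, -1, -1, -1, -1;
     -2, -2,  0,  0,  0,  0,  0,  0,  0,  0,  0,  0, -1,  0,  0,  0;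
     -2, -2,  0,  0,  0,  0,  0,  0,  0,  0,  0,  0,  0, -1,  0,  0;
     -2, -2,  0,  0,  0,  0,  0,  0,  0,  0,  0,  0,  0,  0, -1,  0;
     -2, -2,  0,  0,  0,  0,  0,  0,  0,  0,  0,  0,  0,  0,  0, -1] := by
  decide +kernel

theorem comp_vecCons {α β : Type*} {n : ℕ} (f : α → β) (a : α) (v : Fin n → α) :
    f ∘ Matrix.vecCons a v = Matrix.vecCons (f a) (f ∘ v) := by
  funext i
  exact Fin.cases rfl (fun _ => rfl) i

theorem matrix_map_eq {m n : ℕ} (f : ℤ → ℝ) (M : Fin m → Fin n → ℤ) :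
    (Matrix.of M).map f = Matrix.of ((f ∘ ·) ∘ M) := rfl

theorem map_shearMat_phi : (shearMat 1 0 1).map Int.cast = matPhi := by
  rw [shearMat_phi, matPhi, matrix_map_eq]
  simp only [comp_vecCons, Matrix.empty_eq, Int.cast_zero, Int.cast_one, Int.cast_neg,
    Int.cast_ofNat]

theorem map_shearMat_psi : (shearMat 2 0 2).map Int.cast = matPsi := by
  rw [shearMat_psi, matPsi, matrix_map_eq]
  simp only [comp_vecCons, Matrix.empty_eq, Int.cast_zero, Int.cast_one, Int.cast_neg,
    Int.cast_ofNat]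

end Action

end BirSurf

namespace BirSurf

open FunField

set_option linter.unusedSectionVars false

/-! ## Composition and iteration -/

section Iteration

variable {K : Type*} [Field K] [IsAlgClosed K] {S : Set (LocalSubring (FunField K))}

theorem IsSurface.isPullbackN1_comp (hS : IsSurface S) {f g : BirMap K}
    (H : ∀ C : Curve S, (∃ C' : Curve S, C'.ring = push f C.ring) ∨
      ∃ O ∈ S, O ≤ (push f C.ring).toLocalSubring ∧ ∃ O' ∈ S, MapsPoint g O O')
    {L M : N1 K S →ₗ[ℝ] N1 K S} (hg : IsPullbackN1 S g M) (hf : IsPullbackN1 S f L) :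
    IsPullbackN1 S (g.comp f) (L ∘ₗ M) := by
  intro D
  obtain ⟨D', hD', h1⟩ := hg D
  obtain ⟨D'', hD'', h2⟩ := hf D'
  refine ⟨D'', hS.isPullback_comp (fun C => (H C).imp_right ?_) hD' hD'', ?_⟩
  · rintro ⟨O, hO, hle, h⟩
    exact ⟨O, hO, hle.1, h⟩
  · rw [LinearMap.comp_apply, h1, h2]

theorem IsSurface.isPullbackN1_id (hS : IsSurface S) :
    IsPullbackN1 S (BirMap.id K) LinearMap.id := by
  refine fun D => ⟨D, isPullback_iff.2 fun C => ?_, rfl⟩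
  obtain ⟨O, hO, hle, -⟩ := C.isLocalization
  obtain ⟨φ, hφ⟩ := hS.exists_localEquation hO D
  exact ⟨O, hO, hle, φ, hφ, hφ.2 C hle⟩

omit [IsAlgClosed K] in
theorem _root_.MapsPoint.comp {f g : BirMap K} {O₁ O₂ O₃ : LocalSubring (FunField K)}
    (hf : MapsPoint f O₁ O₂) (hg : MapsPoint g O₂ O₃) : MapsPoint (g.comp f) O₁ O₃ := by
  rw [mapsPoint_iff] at hf hg ⊢
  exact ⟨fun z hz => hf.1 _ (hg.1 z hz), fun z hz => hf.2 _ (hg.2 z hz)⟩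

/-- A map that sends every curve to a curve or into a set `G` of points that is mapped to itself
is algebraically stable. -/
theorem IsSurface.algebraicallyStable (hS : IsSurface S) {f : BirMap K}
    {L : N1 K S →ₗ[ℝ] N1 K S} (hL : IsPullbackN1 S f L) {G : Set (LocalSubring (FunField K))}
    (hG : G ⊆ S) (hmap : ∀ O ∈ G, ∃ O' ∈ G, MapsPoint f O O')
    (hC : ∀ C : Curve S, (∃ C' : Curve S, C'.ring = push f C.ring) ∨
      ∃ O ∈ G, O ≤ (push f C.ring).toLocalSubring) : AlgebraicallyStable S f := by
  have key : ∀ (n : ℕ) (C : Curve S), (∃ C' : Curve S, C'.ring = push (f.iter n) C.ring) ∨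
      ∃ O ∈ G, O ≤ (push (f.iter n) C.ring).toLocalSubring := by
    intro n
    induction n with
    | zero => exact fun C => Or.inl ⟨C, rfl⟩
    | succ n ih =>
      intro C
      rcases ih C with ⟨C', hC'⟩ | ⟨O, hO, hle⟩
      · have := hC C'
        rwa [hC'] at this
      · obtain ⟨O', hO', hm⟩ := hmap O hO
        rw [BirMap.iter, push_comp]
        exact Or.inr ⟨O', hO', mapsPoint_valuationSubring_iff.1 (hm.mono hle)⟩
  refine ⟨L, hL, fun n => ?_⟩
  induction n with
  | zero => exact hS.isPullbackN1_id
  | succ n ih =>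
    -- The iterate n + 1 applies f last, so its pull-back applies `L` first; hence the factor `L`
    -- belongs on the right.
    rw [pow_succ]
    refine hS.isPullbackN1_comp (fun C => (key n C).imp_right ?_) hL ih
    rintro ⟨O, hO, hle⟩
    obtain ⟨O', hO', hm⟩ := hmap O hO
    exact ⟨O, hG hO, hle, O', hG hO', hm⟩

end Iteration

/-! ## Images of the points to which curves are contracted -/

section Points

variable {K : Type*} [Field K] [CharZero K] [IsAlgClosed K] {f : BirMap K} {a b p q : Fin 3}

variable (K) in
/-- The point of the exceptional curve over an infinitely near point that lies on the strict
transform of the first exceptional curve. -/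
noncomputable abbrev cornerPoint (i : Fin 4) (k : Fin 3) : LocalSubring (FunField K) :=
  planePoint (tt ((mu i : ℤ) : K) - co (2 * ((sg k : ℤ) : K)))
    (xi ((mu i : ℤ) : K) / (tt ((mu i : ℤ) : K) - co (2 * ((sg k : ℤ) : K))))

variable (K) in
/-- The point of the exceptional curve over `(0, sg k)` in the vertical direction. -/
noncomputable abbrev basePoint (k : Fin 3) : LocalSubring (FunField K) :=
  planePoint (y K - co ((sg k : ℤ) : K)) (x K / (y K - co ((sg k : ℤ) : K)))

theorem vertPoint_zero : vertPoint K 0 = basePoint K 0 := by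
  simp [vertPoint, basePoint, sg]

theorem gen_basePoint (k : Fin 3) : Gen (y K - co ((sg k : ℤ) : K))
    (x K / (y K - co ((sg k : ℤ) : K))) := (gen_affine _).blow_right

theorem hasVal_cornerPoint (i : Fin 4) {k : Fin 3} (hk : k ≠ 0) :
    HasVal (cornerPoint K i k) (1 / x K) (0 : K) ∧
      HasVal (cornerPoint K i k) (sl ((mu i : ℤ) : K)) (((sg k : ℤ) : K) / 2) := by
  have hg : Gen (tt ((mu i : ℤ) : K) - co (2 * ((sg k : ℤ) : K)))
      (xi ((mu i : ℤ) : K) / (tt ((mu i : ℤ) : K) - co (2 * ((sg k : ℤ) : K)))) :=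
    (gen_inf_sub _ _).blow_right
  have ht := hg.hasVal_left.of_sub_const
  have hxi : HasVal (cornerPoint K i k) (xi ((mu i : ℤ) : K)) (0 : K) :=
    (hg.hasVal_left.zero_mul_mem hg.hasVal_right.mem).congr
      (mul_div_cancel₀ _ hg.left_ne_zero) rfl
  refine ⟨?_, ?_⟩
  · rw [inv_x_eq ((mu i : ℤ) : K)]
    exact hxi.zero_mul_mem ht.mem
  · refine (ht.inv (two_sg_ne_zero hk)).congr ?_ ?_
    · rw [tt_eq, inv_inv]
    · rw [← half_inv (cast_sq hk), inv_inv]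

namespace IsShear

variable (h : IsShear f ((sg a : ℤ) : K) ((sg b : ℤ) : K)) (hI : ShearIndex a b p q)
include h hI

/-- The contraction point of a shear with first parameter `sg l` is s = -`sg l`. The condition
places it at s = α, which goes to the corner. -/
theorem mapsPoint_linePoint {l : Fin 3} (hl : -sg l = sg a) (i : Fin 4) :
    MapsPoint f (linePoint K l i) (cornerPoint K i p) := by
  have hg := gen_line_sub ((mu i : ℤ) : K) (-((sg l : ℤ) : K))
  have hs := hg.hasVal_right.of_sub_const.congr rfl (show _ = ((sg a : ℤ) : K) by
    rw [← hl, Int.cast_neg])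
  have := h.mapsPoint_corner (mu_quartic' i) hI.mul_eq hI.sq_eq hg.hasVal_left hs
  rwa [hI.add_eq] at this

theorem mapsPoint_cornerPoint (i : Fin 4) :
    MapsPoint f (cornerPoint K i q) (linePoint K a i) := by
  obtain ⟨hz, hs⟩ := hasVal_cornerPoint (K := K) i hI.2.2.1
  have hn := hI.neg_eq (K := K)
  have := h.mapsPoint_line (mu_quartic' i) hz hs fun h0 =>
    lin_ne_zero (K := K) hI.mul_eq hI.sq_eq one_ne_zero one_ne_zero
      (by linear_combination (-1 : K) * h0 + (1 / 2 : K) * hn)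
  have e : ((sg q : ℤ) : K) / 2 + (((sg b : ℤ) : K) - ((sg a : ℤ) : K)) / 2 =
      -((sg a : ℤ) : K) := by linear_combination (1 / 2 : K) * hn
  rwa [e] at this

theorem mapsPoint_basePoint : MapsPoint f (basePoint K b) (basePoint K a) :=
  h.mapsPoint_base hI.mul_eq hI.sq_eq (gen_basePoint b).hasVal_left (gen_basePoint b).hasVal_right

theorem mapsPoint_basePoint_vertPoint : MapsPoint f (basePoint K q) (vertPoint K b) := by
  have hg := gen_basePoint (K := K) q
  have hx : HasVal (basePoint K q) (x K) (0 : K) :=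
    (hg.hasVal_left.zero_mul_mem hg.hasVal_right.mem).congr
      (mul_div_cancel₀ _ hg.left_ne_zero) rfl
  have hy := hg.hasVal_left.of_sub_const.congr rfl hI.neg_eq
  obtain ⟨hq, -, hfy⟩ := h.mapsPoint_vertical hI.mul_eq hI.sq_eq hx hy
  refine mapsPoint_planePoint ?_ ?_
  · rw [map_sub, AlgEquiv.commutes]
    exact hfy.sub_const
  · rwa [h.map_inv_slope hq]

end IsShear

/-- With α = 0 the point of height -2 `sg q` = 2β is lowered by β to height β, where it becomes the
vertical direction over a blown-up point. -/
theorem IsShear.mapsPoint_vertPoint (h : IsShear f ((sg 0 : ℤ) : K) ((sg b : ℤ) : K))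
    (hI : ShearIndex 0 b b q) : MapsPoint f (vertPoint K q) (basePoint K b) := by
  obtain ⟨hx, hy⟩ := hasVal_vertPoint (K := K) q
  have h0 : ((sg 0 : ℤ) : K) = 0 := by simp [sg]
  have hn := hI.neg_eq (K := K)
  have hq : HasVal (vertPoint K q) (x K / (y K - co ((sg 0 : ℤ) : K))) (0 : K) := by
    refine (hx.div (hy.sub (HasVal.const hx.1 _)) ?_).congr rfl (zero_div _)
    rw [h0, sub_zero]
    exact mul_ne_zero (neg_ne_zero.2 two_ne_zero)
      (Int.cast_ne_zero.2 fun hs => hI.2.2.1 (sg_eq_zero.1 hs))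
  refine mapsPoint_planePoint ?_ ?_
  · rw [map_sub, AlgEquiv.commutes, h.map_y_vertical hq]
    refine ((hy.sub (HasVal.const hx.1 _)).add ((HasVal.const hx.1 _).mul
      ((hq.pow 2).mul (hasVal_dispInv' hq)))).sub (HasVal.const hx.1 _) |>.congr rfl ?_
    rw [hn, h0]
    ring
  · rwa [h.map_inv_slope hq]

end Points

/-! ## The maps `Φ` and `Ψ` -/

section Main

variable (K : Type*) [Field K] [CharZero K] [IsAlgClosed K]

theorem linePoint_not_mem_indeterminacy (i : Fin 4) :
    linePoint K 0 i ∉ indeterminacy (surface2 K) (Psi K) := fun h =>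
  h.2 ⟨_, over_over_mem' i (by decide),
    (isShear_psi K).mapsPoint_linePoint (p := 2) (q := 1) (by decide) (by decide) i⟩

theorem vertPoint_not_mem_indeterminacy :
    vertPoint K 1 ∉ indeterminacy (surface2 K) (Psi K) := fun h =>
  h.2 ⟨_, over_aff_mem' 2, (isShear_psi K).mapsPoint_vertPoint (by decide)⟩

/-- By separation the point of contraction is unique, so it is one of the five known points; a curve
with a curve as image dominates no point. -/
theorem not_mem_indeterminacy_of_contractsTo {C : Curve (surface2 K)}
    {O : LocalSubring (FunField K)} (h : ContractsTo (Phi K) C O) :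
    O ∉ indeterminacy (surface2 K) (Psi K) := by
  have hS := isSurface_surface2 (K := K)
  have hle := mapsPoint_valuationSubring_iff.1 h.2
  rcases (isShear_phi K).curve_or_point (p := 1) (q := 2) (by decide) C with
    ⟨C', hC'⟩ | ⟨i, hi⟩ | hv
  · exact (hS.nonDom C' O h.1 (hC' ▸ hle)).elim
  · rw [hS.sep O h.1 _ (linePoint_mem 0 i) _ hle hi]
    exact linePoint_not_mem_indeterminacy K i
  · rw [hS.sep O h.1 _ (vertPoint_mem 1) _ hle hv]
    exact vertPoint_not_mem_indeterminacy K

/-- The points to which `Ψ ∘ Φ` contracts curves. -/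
def orbitPoints : Set (LocalSubring (FunField K)) :=
  {O | (∃ i, O = linePoint K 0 i) ∨ (∃ i, O = cornerPoint K i 2) ∨ O = vertPoint K 2 ∨
    O = basePoint K 2}

theorem orbitPoints_subset : orbitPoints K ⊆ surface2 K := by
  rintro O (⟨i, rfl⟩ | ⟨i, rfl⟩ | rfl | rfl)
  · exact linePoint_mem 0 i
  · exact over_over_mem' i (by decide)
  · exact vertPoint_mem 2
  · exact over_aff_mem' 2

/-- Each point is fixed by Ψ ∘ Φ. On s the two maps translate by 1/2 and -1/2, giving 0 → 1/2 → 0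
and -1/2 → 0 → -1/2. On y they translate by -1 and 1, giving 2 → 1 → 2 and -1 → -2 → -1. -/
theorem exists_mapsPoint_of_orbitPoints {O : LocalSubring (FunField K)} (hO : O ∈ orbitPoints K) :
    ∃ O' ∈ orbitPoints K, MapsPoint ((Psi K).comp (Phi K)) O O' := by
  have hΦ := isShear_phi K
  have hΨ := isShear_psi K
  have i1 : ShearIndex 0 1 1 2 := by decide
  have i2 : ShearIndex 0 2 2 1 := by decide
  rcases hO with ⟨i, rfl⟩ | ⟨i, rfl⟩ | rfl | rfl
  · exact ⟨_, Or.inl ⟨i, rfl⟩,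
      MapsPoint.comp (hΦ.mapsPoint_linePoint i1 (l := 0) (by decide) i) (hΨ.mapsPoint_cornerPoint i2 i)⟩
  · exact ⟨_, Or.inr (Or.inl ⟨i, rfl⟩),
      MapsPoint.comp (hΦ.mapsPoint_cornerPoint i1 i) (hΨ.mapsPoint_linePoint i2 (by decide) i)⟩
  · exact ⟨_, Or.inr (Or.inr (Or.inl rfl)),
      MapsPoint.comp (hΦ.mapsPoint_vertPoint i1) (hΨ.mapsPoint_basePoint_vertPoint i2)⟩
  · exact ⟨_, Or.inr (Or.inr (Or.inr rfl)),
      MapsPoint.comp (hΦ.mapsPoint_basePoint_vertPoint i1) (hΨ.mapsPoint_vertPoint i2)⟩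

theorem curve_or_orbitPoints (C : Curve (surface2 K)) :
    (∃ C' : Curve (surface2 K), C'.ring = push ((Psi K).comp (Phi K)) C.ring) ∨
      ∃ O ∈ orbitPoints K, O ≤ (push ((Psi K).comp (Phi K)) C.ring).toLocalSubring := by
  have hΨ := isShear_psi K
  have i2 : ShearIndex 0 2 2 1 := by decide
  rw [push_comp]
  rcases (isShear_phi K).curve_or_point (p := 1) (q := 2) (by decide) C with
    ⟨C', hC'⟩ | ⟨i, hi⟩ | hv
  · rw [← hC']
    rcases hΨ.curve_or_point i2 C' with h | ⟨i, hi⟩ | hv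
    · exact Or.inl h
    · exact Or.inr ⟨_, Or.inl ⟨i, rfl⟩, hi⟩
    · exact Or.inr ⟨_, Or.inr (Or.inr (Or.inl rfl)), hv⟩
  · exact Or.inr ⟨_, Or.inr (Or.inl ⟨i, rfl⟩), mapsPoint_valuationSubring_iff.1
      ((hΨ.mapsPoint_linePoint i2 (by decide) i).mono hi)⟩
  · exact Or.inr ⟨_, Or.inr (Or.inr (Or.inr rfl)), mapsPoint_valuationSubring_iff.1
      ((hΨ.mapsPoint_vertPoint i2).mono hv)⟩

theorem isPullbackN1_psi_comp_phi : IsPullbackN1 (surface2 K) ((Psi K).comp (Phi K))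
    (shearPull K 0 1 1 ∘ₗ shearPull K 0 2 2) := by
  have hΦ := isShear_phi K
  have hΨ := isShear_psi K
  have i1 : ShearIndex 0 1 1 2 := by decide
  have i2 : ShearIndex 0 2 2 1 := by decide
  refine isSurface_surface2.isPullbackN1_comp (fun C => ?_) (hΨ.isPullbackN1 i2)
    (hΦ.isPullbackN1 i1)
  rcases hΦ.curve_or_point i1 C with h | ⟨i, hi⟩ | hv
  · exact Or.inl h
  · exact Or.inr ⟨_, linePoint_mem 0 i, hi, _, over_over_mem' i (by decide),
      hΨ.mapsPoint_linePoint i2 (by decide) i⟩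
  · exact Or.inr ⟨_, vertPoint_mem 1, hv, _, over_aff_mem' 2, hΨ.mapsPoint_vertPoint i2⟩

theorem algebraicallyStable_psi_comp_phi :
    AlgebraicallyStable (surface2 K) ((Psi K).comp (Phi K)) :=
  isSurface_surface2.algebraicallyStable (isPullbackN1_psi_comp_phi K) (orbitPoints_subset K)
    (fun _ => exists_mapsPoint_of_orbitPoints K) (curve_or_orbitPoints K)

theorem isPushforwardN1_phi : IsPushforwardN1 (surface2 K) (Phi K) (shearPull K 1 0 1) :=
  (isShear_phi K).inv.isPullbackN1 (q := 2) (by decide)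

theorem isPushforwardN1_psi : IsPushforwardN1 (surface2 K) (Psi K) (shearPull K 2 0 2) :=
  (isShear_psi K).inv.isPullbackN1 (q := 1) (by decide)

/-- Push-forward under Ψ ∘ Φ is pull-back under Φ⁻¹ ∘ Ψ⁻¹, so the points to follow are those
contracted by Ψ⁻¹. They lie at s = 1, the first parameter of Φ⁻¹, and at the vertical direction over
the origin, and Φ⁻¹ is defined at both. -/
theorem isPushforwardN1_psi_comp_phi : IsPushforwardN1 (surface2 K) ((Psi K).comp (Phi K))
    (shearPull K 2 0 2 ∘ₗ shearPull K 1 0 1) := by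
  have hΦ := (isShear_phi K).inv
  have i1 : ShearIndex 1 0 1 2 := by decide
  refine isSurface_surface2.isPullbackN1_comp (f := (Psi K).inv) (g := (Phi K).inv)
    (fun C => ?_) (isPushforwardN1_phi K) (isPushforwardN1_psi K)
  rcases (isShear_psi K).inv.curve_or_point (p := 2) (q := 1) (by decide) C with
    h | ⟨i, hi⟩ | hv
  · exact Or.inl h
  · exact Or.inr ⟨_, linePoint_mem 2 i, hi, _, over_over_mem' i (by decide),
      hΦ.mapsPoint_linePoint i1 (by decide) i⟩
  · refine Or.inr ⟨_, vertPoint_mem 0, hv, _, over_aff_mem' 1, ?_⟩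
    rw [vertPoint_zero]
    exact hΦ.mapsPoint_basePoint i1

end Main

end BirSurf

/-! ### Assembly of the three assertions. -/

theorem mainTheorem2 (K : Type*) [Field K] [IsAlgClosed K] [CharZero K] :
    AlgebraicallyStable (surface2 K) ((Psi K).comp (Phi K)) ∧
    (∀ (C : Curve (surface2 K)) (O : LocalSubring (FunField K)),
      ContractsTo (Phi K) C O → O ∉ indeterminacy (surface2 K) (Psi K)) ∧
    ∃ (e : Module.Basis (Fin 16) ℝ (N1 K (surface2 K)))
      (pushPhi pushPsi pushComp : N1 K (surface2 K) →ₗ[ℝ] N1 K (surface2 K)),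
      IsGeometricBasis e ∧
      IsPushforwardN1 (surface2 K) (Phi K) pushPhi ∧
      IsPushforwardN1 (surface2 K) (Psi K) pushPsi ∧
      IsPushforwardN1 (surface2 K) ((Psi K).comp (Phi K)) pushComp ∧
      pushComp = pushPsi ∘ₗ pushPhi ∧
      LinearMap.toMatrix e e pushPhi = matPhi ∧
      LinearMap.toMatrix e e pushPsi = matPsi ∧
      LinearMap.toMatrix e e pushComp = matPsi * matPhi := by
  have hΦ := (BirSurf.toMatrix_shearPull (K := K) 1 0 1).trans BirSurf.map_shearMat_phi
  have hΨ := (BirSurf.toMatrix_shearPull (K := K) 2 0 2).trans BirSurf.map_shearMat_psi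
  refine ⟨BirSurf.algebraicallyStable_psi_comp_phi K,
    fun C O h => BirSurf.not_mem_indeterminacy_of_contractsTo K h,
    BirSurf.geomBasis K, _, _, _, BirSurf.isGeometricBasis_geomBasis K,
    BirSurf.isPushforwardN1_phi K, BirSurf.isPushforwardN1_psi K,
    BirSurf.isPushforwardN1_psi_comp_phi K, rfl, hΦ, hΨ, ?_⟩
  rw [LinearMap.toMatrix_comp (BirSurf.geomBasis K) (BirSurf.geomBasis K) (BirSurf.geomBasis K),
    hΦ, hΨ]
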